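/- All graphs are finite and simple. A graph $G$ is $H$-saturated if $G$ contains no copy of $H$ as a (not necessarily induced) subgraph, but $G+e$ contains a copy of $H$ for every edge $e$ of the complement $\overline G$. Let $\mathrm{sat}(n,H)$ be the minimum number of edges of an $n$-vertex $H$-saturated graph, and let $\mathrm{Sat}(n,H)$ be the set (up to isomorphism) of $n$-vertex $H$-saturated graphs with exactly $\mathrm{sat}(n,H)$ edges. Let $F\vee K_1$ denote the graph obtained from $F$ by adding a new vertex adjacent to all vertices of $F$, and let $W_4=C_4\vee K_1$ be the wheel with four spokes. For a vertex set $U$ and a set $S$ of vertices disjoint from $U$, say that $U$ is *paired over* $S$ if $G[U]$ is a perfect matching of $U$ (possibly $U=\emptyset$), every vertex of $U$ is adjacent to every vertex of $S$, and vertices of $U$ have no further neighbours. The following families are defined; in each case the graph has exactly the edges described, the named vertices are distinct, and the named sets are pairwise disjoint, contain none of the named vertices and may be empty. * $\mathcal F_n^1$ ($n\ge 6$ even): $n$-vertex graphs consisting of a triangle $abc$, vertices $a',b',c'$ of degree $1$ adjacent to $a,b,c$ respectively, and sets $A,B,C$ paired over $\{a\},\{b\},\{c\}$ respectively. * $\mathcal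 F_n^2$ ($n\ge 5$ odd): $n$-vertex graphs obtained from graphs in $\mathcal F_{n+1}^1$ by deleting one vertex of degree $1$. * $\mathcal F_n^3$ ($n\ge 5$ odd): $n$-vertex graphs consisting of a 5-cycle $c_1c_2c_3c_4c_5$ and sets $P,Q$ paired over $\{c_1\},\{c_2\}$ respectively. * $\mathcal A_n^1=\{F\vee K_1:F\in\mathcal F_{n-1}^1\}$ ($n\ge 7$ odd), and $\mathcal A_n^i=\{F\vee K_1:F\in\mathcal F_{n-1}^i\}$ for $i\in\{2,3\}$ ($n\ge 6$ even). * $\mathcal B_n^1$ ($n\ge 7$ odd): $n$-vertex graphs with vertex set $\{x,y,z,x_1,x_2,u_1,u_2\}\cup U_1^1\cup U_1^2\cup U_2$ such that $x_1,x_2,u_1,u_2$ induce a $K_4$, $N(u_2)=\{x_1,x_2,u_1\}$, $N(x)=\{x_1,x_2\}$, $N(y)=\{x_1,u_1\}$, $N(z)=\{x_2,u_1\}$, and $U_1^1$, $U_1^2$, $U_2$ are paired over $\{x_1,u_1\}$, $\{x_2,u_1\}$, $\{x_1,x_2\}$ respectively. * $\mathcal B_n^2$ ($n\ge 8$ even):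 $n$-vertex graphs obtained from graphs in $\mathcal B_{n+1}^1$ with $U_1^2\ne\emptyset$ by deleting the vertex $z$. * $\mathcal B_n^3$ ($n\ge 8$ even): $n$-vertex graphs with vertex set $\{x,y,x_1,x_2,v_1,v_2,u_1,u_2\}\cup U_1\cup U_2$ such that $x_1,x_2,u_1,u_2$ induce a $K_4$, $N(u_2)=\{x_1,x_2,u_1,v_1\}$, $N(x)=\{x_1,x_2\}$, $N(y)=\{x_1,u_1\}$, $N(v_1)=\{x_1,v_2,u_2\}$, $N(v_2)=\{x_2,v_1,u_1\}$, and $U_1$, $U_2$ are paired over $\{x_1,u_1\}$, $\{x_1,x_2\}$ respectively. ($\mathcal B_6^2=\mathcal B_6^3=\emptyset$.) **Theorem.** For every $n\ge 6$, $\mathrm{sat}(n,W_4)=\left\lfloor\frac{5n-10}{2}\right\rfloor$, and $$\mathrm{Sat}(n,W_4)=\begin{cases}\mathcal A_n^1\cup\mathcal B_n^1,&n\text{ odd},\\ \mathcal A_n^2\cup\mathcal A_n^3\cup\mathcal B_n^2\cup\mathcal B_n^3,&n\text{ even}.\end{cases}$$ -/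

import Mathlib

open scoped SimpleGraph

namespace W4Sat

universe u v

/-- The join `G ∨ H`: the disjoint union of `G` and `H` together with all edges between them. -/
def join {V : Type u} {W : Type v} (G : SimpleGraph V) (H : SimpleGraph W) :
    SimpleGraph (V ⊕ W) :=
  (G ⊕g H) ⊔ completeBipartiteGraph V W

/-- The one-vertex graph `K₁`. -/
def K1 : SimpleGraph (Fin 1) := ⊤

/-- The wheel `W₄ = C₄ ∨ K₁`. -/
def W4 : SimpleGraph (Fin 4 ⊕ Fin 1) := join (SimpleGraph.cycleGraph 4) K1

/-- `G` is `H`-saturated: `G` contains no copy of `H` (as a not necessarily induced subgraph), but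
`G + st` contains one for every pair of distinct non-adjacent vertices `s, t`. -/
def IsSaturated {V : Type u} {W : Type v} (H : SimpleGraph W) (G : SimpleGraph V) : Prop :=
  H.Free G ∧ ∀ s t : V, s ≠ t → ¬ G.Adj s t → H ⊑ G ⊔ SimpleGraph.edge s t

/-- `sat(n, H)`: the minimum number of edges of an `H`-saturated graph on `n` vertices
(the infimum of a set of naturals, which is attained whenever the set is nonempty). -/
noncomputable def satNumber {W : Type v} (n : ℕ) (H : SimpleGraph W) : ℕ :=
  sInf {m | ∃ G : SimpleGraph (Fin n), IsSaturated H G ∧ G.edgeSet.ncard = m}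

/-- `Sat(n, H)`: the extremal graphs, i.e. the `H`-saturated graphs on the vertex set `Fin n` with
exactly `sat(n, H)` edges. -/
def extremalGraphs {W : Type v} (n : ℕ) (H : SimpleGraph W) : Set (SimpleGraph (Fin n)) :=
  {G | IsSaturated H G ∧ G.edgeSet.ncard = satNumber n H}

/-- The set `U` falls into adjacent pairs, each joined to all of `S` and to nothing else:
every `v ∈ U` has neighbourhood `S ∪ {v'}` for some `v' ∈ U`. When `U` and `S` are disjoint this
says that `G[U]` is a perfect matching on `U`, that every vertex of `U` is adjacent to every vertex
of `S`, and that vertices of `U` have no further neighbours. -/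
def PairsJoinedTo {V : Type u} (G : SimpleGraph V) (U S : Set V) : Prop :=
  ∀ v ∈ U, ∃ v' ∈ U, G.neighborSet v = S ∪ {v'}

/-- `G` consists of a triangle `a b c`, one vertex of degree one attached to each of `a`, `b`, `c`
(namely `a'`, `b'`, `c'`), and adjacent pairs of vertices, each pair joined to `a` (the set `A`),
to `b` (the set `B`) or to `c` (the set `C`). -/
def IsF1 {V : Type u} (G : SimpleGraph V) : Prop :=
  ∃ (a b c a' b' c' : V) (A B C : Set V),
    [a, b, c, a', b', c'].Nodup ∧
    [{a, b, c, a', b', c'}, A, B, C].Pairwise Disjoint ∧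
    {a, b, c, a', b', c'} ∪ A ∪ B ∪ C = Set.univ ∧
    G.IsClique {a, b, c} ∧
    G.neighborSet a' = {a} ∧ G.neighborSet b' = {b} ∧ G.neighborSet c' = {c} ∧
    PairsJoinedTo G A {a} ∧ PairsJoinedTo G B {b} ∧ PairsJoinedTo G C {c}

/-- The family `𝓕ₙ¹`. -/
def F1 (n : ℕ) : Set (SimpleGraph (Fin n)) := {G | IsF1 G}

/-- The family `𝓕ₙ²`: graphs obtained from those in `𝓕ₙ₊₁¹` by deleting a vertex of degree one. -/
def F2 (n : ℕ) : Set (SimpleGraph (Fin n)) :=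
  {G | ∃ F ∈ F1 (n + 1), ∃ w : Fin (n + 1), (F.neighborSet w).ncard = 1 ∧
    Nonempty (G ≃g F.induce {w}ᶜ)}

/-- `G` consists of a 5-cycle `c₁ c₂ c₃ c₄ c₅`, together with adjacent pairs of vertices, each pair
joined to `c₁` (the set `P`) or to `c₂` (the set `Q`). -/
def IsF3 {V : Type u} (G : SimpleGraph V) : Prop :=
  ∃ (c₁ c₂ c₃ c₄ c₅ : V) (P Q : Set V),
    [c₁, c₂, c₃, c₄, c₅].Nodup ∧
    [{c₁, c₂, c₃, c₄, c₅}, P, Q].Pairwise Disjoint ∧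
    {c₁, c₂, c₃, c₄, c₅} ∪ P ∪ Q = Set.univ ∧
    G.Adj c₁ c₂ ∧
    G.neighborSet c₃ = {c₂, c₄} ∧ G.neighborSet c₄ = {c₃, c₅} ∧ G.neighborSet c₅ = {c₄, c₁} ∧
    PairsJoinedTo G P {c₁} ∧ PairsJoinedTo G Q {c₂}

/-- The family `𝓕ₙ³`. -/
def F3 (n : ℕ) : Set (SimpleGraph (Fin n)) := {G | IsF3 G}

/-- The graphs on `Fin n` of the form `F ∨ K₁` with `F` in a given family of graphs on `n - 1`
vertices (up to isomorphism). -/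
def cone (n : ℕ) (𝓕 : Set (SimpleGraph (Fin (n - 1)))) : Set (SimpleGraph (Fin n)) :=
  {G | ∃ F ∈ 𝓕, Nonempty (G ≃g join F K1)}

/-- The family `𝓐ₙ¹`. -/
def A1 (n : ℕ) : Set (SimpleGraph (Fin n)) := cone n (F1 (n - 1))

/-- The family `𝓐ₙ²`. -/
def A2 (n : ℕ) : Set (SimpleGraph (Fin n)) := cone n (F2 (n - 1))

/-- The family `𝓐ₙ³`. -/
def A3 (n : ℕ) : Set (SimpleGraph (Fin n)) := cone n (F3 (n - 1))

/-- The labelled description of the graphs in `𝓑ₙ¹`. The sets `U₁¹`, `U₁²`, `U₂` are `U11`, `U12`,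
`U2`. The neighbourhood of every vertex outside the triangle `x₁ x₂ u₁` is given, so the graph has
no edges other than the listed ones. -/
structure B1Labelled {V : Type u} (G : SimpleGraph V) (x y z x₁ x₂ u₁ u₂ : V)
    (U11 U12 U2 : Set V) : Prop where
  nodup : [x, y, z, x₁, x₂, u₁, u₂].Nodup
  disjoint : [{x, y, z, x₁, x₂, u₁, u₂}, U11, U12, U2].Pairwise Disjoint
  cover : {x, y, z, x₁, x₂, u₁, u₂} ∪ U11 ∪ U12 ∪ U2 = Set.univ
  clique : G.IsClique {x₁, x₂, u₁, u₂}
  nbr_u₂ : G.neighborSet u₂ = {x₁, x₂, u₁}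
  nbr_x : G.neighborSet x = {x₁, x₂}
  nbr_y : G.neighborSet y = {x₁, u₁}
  nbr_z : G.neighborSet z = {x₂, u₁}
  pairs_U11 : PairsJoinedTo G U11 {x₁, u₁}
  pairs_U12 : PairsJoinedTo G U12 {x₂, u₁}
  pairs_U2 : PairsJoinedTo G U2 {x₁, x₂}

/-- The family `𝓑ₙ¹`. -/
def B1 (n : ℕ) : Set (SimpleGraph (Fin n)) :=
  {G | ∃ (x y z x₁ x₂ u₁ u₂ : Fin n) (U11 U12 U2 : Set (Fin n)),
    B1Labelled G x y z x₁ x₂ u₁ u₂ U11 U12 U2}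

/-- The family `𝓑ₙ²`: graphs obtained from those in `𝓑ₙ₊₁¹` with `U₁² ≠ ∅` by deleting `z`. -/
def B2 (n : ℕ) : Set (SimpleGraph (Fin n)) :=
  {G | ∃ (F : SimpleGraph (Fin (n + 1))) (x y z x₁ x₂ u₁ u₂ : Fin (n + 1))
    (U11 U12 U2 : Set (Fin (n + 1))),
    B1Labelled F x y z x₁ x₂ u₁ u₂ U11 U12 U2 ∧ U12.Nonempty ∧
    Nonempty (G ≃g F.induce {z}ᶜ)}

/-- The labelled description of the graphs in `𝓑ₙ³`; again the neighbourhood of every vertex outside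
the triangle `x₁ x₂ u₁` is given, so there are no edges other than the listed ones. -/
structure B3Labelled {V : Type u} (G : SimpleGraph V) (x y x₁ x₂ v₁ v₂ u₁ u₂ : V)
    (U1 U2 : Set V) : Prop where
  nodup : [x, y, x₁, x₂, v₁, v₂, u₁, u₂].Nodup
  disjoint : [{x, y, x₁, x₂, v₁, v₂, u₁, u₂}, U1, U2].Pairwise Disjoint
  cover : {x, y, x₁, x₂, v₁, v₂, u₁, u₂} ∪ U1 ∪ U2 = Set.univ
  clique : G.IsClique {x₁, x₂, u₁, u₂}
  nbr_u₂ : G.neighborSet u₂ = {x₁, x₂, u₁, v₁}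
  nbr_x : G.neighborSet x = {x₁, x₂}
  nbr_y : G.neighborSet y = {x₁, u₁}
  nbr_v₁ : G.neighborSet v₁ = {x₁, v₂, u₂}
  nbr_v₂ : G.neighborSet v₂ = {x₂, v₁, u₁}
  pairs_U1 : PairsJoinedTo G U1 {x₁, u₁}
  pairs_U2 : PairsJoinedTo G U2 {x₁, x₂}

/-- The family `𝓑ₙ³`. -/
def B3 (n : ℕ) : Set (SimpleGraph (Fin n)) :=
  {G | ∃ (x y x₁ x₂ v₁ v₂ u₁ u₂ : Fin n) (U1 U2 : Set (Fin n)),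
    B3Labelled G x y x₁ x₂ v₁ v₂ u₁ u₂ U1 U2}

end W4Sat

/-! A missing edge st can complete a wheel in two ways: as a rim edge (`RimLink`) or as a spoke with
hub s or t (`HubLink`). In both cases s and t have a common neighbour, so every vertex outside N(x)
∪ {x} ("far" from x) has a neighbour in N(x). This gives the count behind everything
(`two_mul_edges`): 2e = 2d(x) + τ + Σ (d(v) + |N(v) ∩ N(x)|), where τ is the degree sum inside N(x)
and v runs over the far vertices. Far vertices with one neighbour in N(x) are called thin, the
others thick; a thin vertex is adjacent to a thick "parent" (`Sat.parent`). On average a far vertex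
contributes about 5, and the proof controls the deviation.

Degree two. If N(x) = {a, b}, then ab is an edge (`Sat.twoBase`) and every far vertex has exactly
one thick neighbour, so 2e + 9 = 5n + Σ (t(v) - 1), where v runs over the thin vertices and t(v) is
its number of thin neighbours (`TwoBase.edges`). Only isolated vertices of the thin graph cause a
deficit, and there are at most two of them (`TwoBase.card_isolated`); hence 2e ≥ 5n - 11. At 5n - 11
and 5n - 10 the thin graph is a matching plus two isolated vertices or one. The missing edges then
locate all pairs (`TwoBase.classify_odd`, `TwoBase.classify_even`), which yields all families except
𝓐³.

Minimum degree at least three. Here 2e ≥ 5n - 9, with one exception (`edges_of_three_le`). Degree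
four is settled by `edges_of_minDegree_four`. In degree three the graph induced by N(x) is
independent, a single edge, a triangle or a path, and each case has its own discharging. Only the
induced path can reach 5n - 10. All estimates are then sharp (`TightPath`), the middle of the path
is adjacent to every other vertex, and in the rest of the graph any two non-adjacent vertices are
joined by a path of length three. That forces a 5-cycle with pairs at two adjacent vertices
(`ConePath.isF3`), that is, 𝓐³.

Conversely, each family consists of a small core (K₄, the cone over C₅, or one further graph on six
vertices), with vertices of degree two and adjacent pairs of vertices of degree three attached to
certain core edges. `Based.sat` reduces saturation to a finite check on the core and `Based.edges`
counts the edges. -/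

namespace W4Sat

universe u v

/-! ### Wheels and saturation in elementary terms. -/

/-- `G` contains a wheel with hub `h` and rim `a b c d`. -/
def HasW4 {V : Type u} (G : SimpleGraph V) : Prop :=
  ∃ h a b c d, a ≠ c ∧ b ≠ d ∧ G.Adj h a ∧ G.Adj h b ∧ G.Adj h c ∧ G.Adj h d ∧
    G.Adj a b ∧ G.Adj b c ∧ G.Adj c d ∧ G.Adj d a

/-- Adding `s t` creates a wheel in which `s t` is a rim edge. -/
def RimLink {V : Type u} (G : SimpleGraph V) (s t : V) : Prop :=
  ∃ h p r, G.Adj h s ∧ G.Adj h p ∧ G.Adj h r ∧ G.Adj h t ∧ G.Adj s p ∧ G.Adj p r ∧ G.Adj r t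

/-- Adding `s t` creates a wheel with hub `s` in which `s t` is a spoke. -/
def HubLink {V : Type u} (G : SimpleGraph V) (s t : V) : Prop :=
  ∃ a b r, a ≠ b ∧ G.Adj s a ∧ G.Adj s b ∧ G.Adj s r ∧ G.Adj t a ∧ G.Adj t b ∧
    G.Adj r a ∧ G.Adj r b

/-- Elementary form of being saturated with respect to the wheel `W₄`. -/
structure Sat {V : Type u} (G : SimpleGraph V) : Prop where
  free : ¬ HasW4 G
  link : ∀ s t, s ≠ t → ¬ G.Adj s t → RimLink G s t ∨ HubLink G s t ∨ HubLink G t s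

theorem W4_isContained_iff {V : Type u} (G : SimpleGraph V) : W4 ⊑ G ↔ HasW4 G := by
  constructor
  · rintro ⟨f⟩
    have hadj : ∀ {x y}, W4.Adj x y → G.Adj (f x) (f y) := fun h => f.toHom.map_adj h
    have hinj : ∀ {x y}, x ≠ y → f x ≠ f y := fun h e => h (f.injective e)
    refine ⟨f (Sum.inr 0), f (Sum.inl 0), f (Sum.inl 1), f (Sum.inl 2), f (Sum.inl 3),
      hinj (by simp), hinj (by simp), hadj ?_, hadj ?_, hadj ?_, hadj ?_, hadj ?_, hadj ?_,
      hadj ?_, hadj ?_⟩ <;> simp [W4, join, SimpleGraph.cycleGraph_adj] <;> decide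
  · rintro ⟨h, a, b, c, d, hac, hbd, ha, hb, hc, hd, hab, hbc, hcd, hda⟩
    have ha' := ha.ne
    have hb' := hb.ne
    have hc' := hc.ne
    have hd' := hd.ne
    have h1 := hab.ne
    have h2 := hbc.ne
    have h3 := hcd.ne
    have h4 := hda.ne
    refine ⟨⟨⟨Sum.elim ![a, b, c, d] (fun _ => h), ?_⟩, ?_⟩⟩
    · rintro (i | i) (j | j) hij
      · fin_cases i <;> fin_cases j <;>
          simp_all [W4, join, SimpleGraph.cycleGraph_adj, SimpleGraph.adj_comm] <;>
          exact absurd hij (by decide)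
      · fin_cases i <;> simp_all [SimpleGraph.adj_comm]
      · fin_cases j <;> simp_all [SimpleGraph.adj_comm]
      · fin_cases i
        fin_cases j
        simp [W4, join, K1] at hij
    · rintro (i | i) (j | j) hij
      · fin_cases i <;> fin_cases j <;> simp_all [eq_comm]
      · fin_cases i <;> simp_all [eq_comm]
      · fin_cases j <;> simp_all [eq_comm]
      · fin_cases i
        fin_cases j
        rfl

theorem sup_edge_adj_iff {V : Type u} (G : SimpleGraph V) {s t : V} (hst : s ≠ t) (x y : V) :
    (G ⊔ SimpleGraph.edge s t).Adj x y ↔ G.Adj x y ∨ (x = s ∧ y = t) ∨ (x = t ∧ y = s) := by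
  simp only [SimpleGraph.sup_adj, SimpleGraph.edge_adj]
  constructor
  · tauto
  · rintro (h | ⟨rfl, rfl⟩ | ⟨rfl, rfl⟩)
    · exact Or.inl h
    · exact Or.inr ⟨Or.inl ⟨rfl, rfl⟩, hst⟩
    · exact Or.inr ⟨Or.inr ⟨rfl, rfl⟩, hst.symm⟩

theorem hasW4_sup_edge_of_link {V : Type u} (G : SimpleGraph V) {s t : V} (hst : s ≠ t)
    (hn : ¬ G.Adj s t) (h : RimLink G s t ∨ HubLink G s t ∨ HubLink G t s) :
    HasW4 (G ⊔ SimpleGraph.edge s t) := by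
  have hle : ∀ {x y}, G.Adj x y → (G ⊔ SimpleGraph.edge s t).Adj x y := fun h => Or.inl h
  have hst' : (G ⊔ SimpleGraph.edge s t).Adj s t := by
    rw [sup_edge_adj_iff G hst]
    simp
  rcases h with ⟨h, p, r, h1, h2, h3, h4, h5, h6, h7⟩ | ⟨a, b, r, hab, h1, h2, h3, h4, h5, h6, h7⟩ |
    ⟨a, b, r, hab, h1, h2, h3, h4, h5, h6, h7⟩
  · refine ⟨h, s, p, r, t, ?_, ?_, hle h1, hle h2, hle h3, hle h4, hle h5, hle h6, hle h7,
      hst'.symm⟩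
    · rintro rfl
      exact hn h7
    · rintro rfl
      exact hn h5
  · refine ⟨s, a, t, b, r, hab, ?_, hle h1, hst', hle h2, hle h3, hle h4.symm, hle h5,
      hle h7.symm, hle h6⟩
    rintro rfl
    exact hn h3
  · refine ⟨t, a, s, b, r, hab, ?_, hle h1, hst'.symm, hle h2, hle h3, hle h4.symm, hle h5,
      hle h7.symm, hle h6⟩
    rintro rfl
    exact hn h3.symm

/-- Since `G` is wheel-free, the wheel uses the new edge. The four spokes and four rim edges are
tested in turn; rotating the rim brings the new edge into standard position, and reversing the rim
or exchanging `s` and `t` takes care of its two orientations. -/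
theorem link_of_hasW4_sup_edge {V : Type u} (G : SimpleGraph V) {s t : V} (hst : s ≠ t)
    (hn : ¬ G.Adj s t) (hfree : ¬ HasW4 G) (hw : HasW4 (G ⊔ SimpleGraph.edge s t)) :
    RimLink G s t ∨ HubLink G s t ∨ HubLink G t s := by
  -- a rim edge or a spoke of the wheel is the new edge
  have rim : ∀ h a b c d, a ≠ c → b ≠ d → (G ⊔ SimpleGraph.edge s t).Adj h a →
      (G ⊔ SimpleGraph.edge s t).Adj h b → (G ⊔ SimpleGraph.edge s t).Adj h c →
      (G ⊔ SimpleGraph.edge s t).Adj h d → (G ⊔ SimpleGraph.edge s t).Adj b c →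
      (G ⊔ SimpleGraph.edge s t).Adj c d → (G ⊔ SimpleGraph.edge s t).Adj d a →
      a = s → b = t → RimLink G s t := by
    rintro h a b c d hac hbd ha hb hc hd hbc hcd hda rfl rfl
    clear hw
    rw [sup_edge_adj_iff G hst] at *
    refine ⟨h, d, c, ?_⟩
    grind [SimpleGraph.adj_comm, SimpleGraph.irrefl]
  have spoke : ∀ s t h a b c d, s ≠ t → ¬ G.Adj s t → a ≠ c → b ≠ d →
      (G ⊔ SimpleGraph.edge s t).Adj h b → (G ⊔ SimpleGraph.edge s t).Adj h c →
      (G ⊔ SimpleGraph.edge s t).Adj h d → (G ⊔ SimpleGraph.edge s t).Adj a b →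
      (G ⊔ SimpleGraph.edge s t).Adj b c →
      (G ⊔ SimpleGraph.edge s t).Adj c d → (G ⊔ SimpleGraph.edge s t).Adj d a →
      h = s → a = t → HubLink G s t := by
    rintro s t h a b c d hst hn hac hbd hb hc hd hab hbc hcd hda rfl rfl
    clear hw rim
    rw [sup_edge_adj_iff G hst] at *
    refine ⟨b, d, c, ?_⟩
    grind [SimpleGraph.adj_comm, SimpleGraph.irrefl]
  obtain ⟨h, a, b, c, d, hac, hbd, ha, hb, hc, hd, hab, hbc, hcd, hda⟩ := hw
  have flip : SimpleGraph.edge s t = SimpleGraph.edge t s := SimpleGraph.edge_comm s t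
  have symmR : RimLink G t s → RimLink G s t := by
    rintro ⟨h, p, r, h1, h2, h3, h4, h5, h6, h7⟩
    exact ⟨h, r, p, h4, h3, h2, h1, h7.symm, h6.symm, h5.symm⟩
  have key : ∀ x y, (G ⊔ SimpleGraph.edge s t).Adj x y →
      G.Adj x y ∨ (x = s ∧ y = t) ∨ (x = t ∧ y = s) := fun x y => (sup_edge_adj_iff G hst x y).1
  have spk : ∀ h a b c d, a ≠ c → b ≠ d →
      (G ⊔ SimpleGraph.edge s t).Adj h b → (G ⊔ SimpleGraph.edge s t).Adj h c →
      (G ⊔ SimpleGraph.edge s t).Adj h d → (G ⊔ SimpleGraph.edge s t).Adj a b →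
      (G ⊔ SimpleGraph.edge s t).Adj b c →
      (G ⊔ SimpleGraph.edge s t).Adj c d → (G ⊔ SimpleGraph.edge s t).Adj d a →
      (h = s ∧ a = t) ∨ (h = t ∧ a = s) →
      RimLink G s t ∨ HubLink G s t ∨ HubLink G t s := by
    rintro h a b c d hac hbd hb hc hd hab hbc hcd hda (⟨e1, e2⟩ | ⟨e1, e2⟩)
    · exact Or.inr (Or.inl (spoke s t h a b c d hst hn hac hbd hb hc hd hab hbc hcd hda e1 e2))
    · rw [flip] at hb hc hd hab hbc hcd hda
      exact Or.inr (Or.inr (spoke t s h a b c d hst.symm (fun e => hn e.symm) hac hbd hb hc hd hab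
        hbc hcd hda e1 e2))
  have rm : ∀ h a b c d, a ≠ c → b ≠ d → (G ⊔ SimpleGraph.edge s t).Adj h a →
      (G ⊔ SimpleGraph.edge s t).Adj h b → (G ⊔ SimpleGraph.edge s t).Adj h c →
      (G ⊔ SimpleGraph.edge s t).Adj h d → (G ⊔ SimpleGraph.edge s t).Adj b c →
      (G ⊔ SimpleGraph.edge s t).Adj c d → (G ⊔ SimpleGraph.edge s t).Adj d a →
      (a = s ∧ b = t) ∨ (a = t ∧ b = s) →
      RimLink G s t ∨ HubLink G s t ∨ HubLink G t s := by
    rintro h a b c d hac hbd ha hb hc hd hbc hcd hda (⟨e1, e2⟩ | ⟨e1, e2⟩)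
    · exact Or.inl (rim h a b c d hac hbd ha hb hc hd hbc hcd hda e1 e2)
    · exact Or.inl (rim h b a d c hbd hac hb ha hd hc hda.symm hcd.symm hbc.symm e2 e1)
  rcases key _ _ ha with ka | ka
  swap
  · exact spk h a b c d hac hbd hb hc hd hab hbc hcd hda ka
  rcases key _ _ hb with kb | kb
  swap
  · exact spk h b c d a hbd hac.symm hc hd ha hbc hcd hda hab kb
  rcases key _ _ hc with kc | kc
  swap
  · exact spk h c d a b hac.symm hbd.symm hd ha hb hcd hda hab hbc kc
  rcases key _ _ hd with kd | kd
  swap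
  · exact spk h d a b c hbd.symm hac ha hb hc hda hab hbc hcd kd
  rcases key _ _ hab with kab | kab
  swap
  · exact rm h a b c d hac hbd ha hb hc hd hbc hcd hda kab
  rcases key _ _ hbc with kbc | kbc
  swap
  · exact rm h b c d a hbd hac.symm hb hc hd ha hcd hda hab kbc
  rcases key _ _ hcd with kcd | kcd
  swap
  · exact rm h c d a b hac.symm hbd.symm hc hd ha hb hda hab hbc kcd
  rcases key _ _ hda with kda | kda
  swap
  · exact rm h d a b c hbd.symm hac hd ha hb hc hab hbc hcd kda
  exact absurd ⟨h, a, b, c, d, hac, hbd, ka, kb, kc, kd, kab, kbc, kcd, kda⟩ hfree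

theorem isSaturated_W4_iff {V : Type u} (G : SimpleGraph V) : IsSaturated W4 G ↔ Sat G := by
  constructor
  · rintro ⟨h1, h2⟩
    have hf : ¬ HasW4 G := fun h => h1 ((W4_isContained_iff G).2 h)
    exact ⟨hf, fun s t hst hn =>
      link_of_hasW4_sup_edge G hst hn hf ((W4_isContained_iff _).1 (h2 s t hst hn))⟩
  · rintro ⟨h1, h2⟩
    exact ⟨fun h => h1 ((W4_isContained_iff G).1 h), fun s t hst hn =>
      (W4_isContained_iff _).2 (hasW4_sup_edge_of_link G hst hn (h2 s t hst hn))⟩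

theorem Sat.iso {V : Type u} {W : Type v} {G : SimpleGraph V} {H : SimpleGraph W} (e : G ≃g H)
    (hG : Sat G) : Sat H := by
  have ad : ∀ x y, G.Adj (e.symm x) (e.symm y) ↔ H.Adj x y := fun x y => e.symm.map_adj_iff
  have ad' : ∀ x y, H.Adj (e x) (e y) ↔ G.Adj x y := fun x y => e.map_adj_iff
  have rl : ∀ s t, RimLink G (e.symm s) (e.symm t) → RimLink H s t := by
    rintro s t ⟨h, p, r, h'⟩
    refine ⟨e h, e p, e r, ?_⟩
    simpa [← ad'] using h'
  have hl : ∀ s t, HubLink G (e.symm s) (e.symm t) → HubLink H s t := by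
    rintro s t ⟨a, b, r, hab, h'⟩
    refine ⟨e a, e b, e r, fun h => hab (e.injective h), ?_⟩
    simpa [← ad'] using h'
  refine ⟨?_, ?_⟩
  · rintro ⟨h, a, b, c, d, hac, hbd, h'⟩
    refine hG.free ⟨e.symm h, e.symm a, e.symm b, e.symm c, e.symm d,
      fun h => hac (e.symm.injective h), fun h => hbd (e.symm.injective h), ?_⟩
    simpa [ad] using h'
  · intro s t hst hn
    rcases hG.link (e.symm s) (e.symm t) (fun h => hst (e.symm.injective h))
      (fun h => hn ((ad s t).1 h)) with h | h | h
    · exact Or.inl (rl _ _ h)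
    · exact Or.inr (Or.inl (hl _ _ h))
    · exact Or.inr (Or.inr (hl _ _ h))

/-! ### Counting edges from the neighbourhood of a vertex. -/

section Counting

variable {V : Type u} (G : SimpleGraph V)

open Classical in
/-- The number of neighbours of `v` in `A`. -/
noncomputable def nb (A : Finset V) (v : V) : ℕ := (A.filter (G.Adj v)).card

variable {G}

theorem nb_pos {A : Finset V} {v : V} : 0 < nb G A v ↔ ∃ u ∈ A, G.Adj v u := by
  classical
  simp [nb, Finset.card_pos, Finset.Nonempty]

theorem nb_eq_zero {A : Finset V} {v : V} : nb G A v = 0 ↔ ∀ u ∈ A, ¬ G.Adj v u := by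
  classical
  simp [nb, Finset.filter_eq_empty_iff]

theorem two_le_nb {A : Finset V} {v : V} :
    2 ≤ nb G A v ↔ ∃ u ∈ A, ∃ w ∈ A, u ≠ w ∧ G.Adj v u ∧ G.Adj v w := by
  classical
  unfold nb
  constructor
  · intro h
    obtain ⟨a, ha, b, hb, hab⟩ := Finset.one_lt_card.1 h
    simp only [Finset.mem_filter] at ha hb
    exact ⟨a, ha.1, b, hb.1, hab, ha.2, hb.2⟩
  · rintro ⟨a, ha, b, hb, hab, h1, h2⟩
    exact Finset.one_lt_card.2 ⟨a, by simp [ha, h1], b, by simp [hb, h2], hab⟩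

theorem nb_eq_one {A : Finset V} {v : V} :
    nb G A v = 1 ↔ ∃ u ∈ A, G.Adj v u ∧ ∀ w ∈ A, G.Adj v w → w = u := by
  classical
  unfold nb
  rw [Finset.card_eq_one]
  constructor
  · rintro ⟨a, ha⟩
    have : ∀ w, (w ∈ A ∧ G.Adj v w) ↔ w = a := by
      intro w
      have := Finset.ext_iff.1 ha w
      simpa using this
    exact ⟨a, ((this a).2 rfl).1, ((this a).2 rfl).2, fun w h1 h2 => (this w).1 ⟨h1, h2⟩⟩
  · rintro ⟨a, h1, h2, h3⟩
    refine ⟨a, ?_⟩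
    ext w
    simp only [Finset.mem_filter, Finset.mem_singleton]
    exact ⟨fun h => h3 w h.1 h.2, fun h => h ▸ ⟨h1, h2⟩⟩

theorem nb_eq_two {A : Finset V} {v : V} :
    nb G A v = 2 ↔ ∃ a ∈ A, ∃ b ∈ A, a ≠ b ∧ G.Adj v a ∧ G.Adj v b ∧
      ∀ w ∈ A, G.Adj v w → w = a ∨ w = b := by
  classical
  unfold nb
  rw [Finset.card_eq_two]
  constructor
  · rintro ⟨a, b, hab, ha⟩
    have : ∀ w, (w ∈ A ∧ G.Adj v w) ↔ w = a ∨ w = b := by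
      intro w
      have := Finset.ext_iff.1 ha w
      simpa using this
    have h1 := (this a).2 (Or.inl rfl)
    have h2 := (this b).2 (Or.inr rfl)
    exact ⟨a, h1.1, b, h2.1, hab, h1.2, h2.2, fun w h1 h2 => (this w).1 ⟨h1, h2⟩⟩
  · rintro ⟨a, h1, b, h2, hab, h3, h4, h5⟩
    refine ⟨a, b, hab, ?_⟩
    ext w
    simp only [Finset.mem_filter, Finset.mem_singleton, Finset.mem_insert]
    constructor
    · exact fun h => h5 w h.1 h.2
    · rintro (rfl | rfl)
      · exact ⟨h1, h3⟩
      · exact ⟨h2, h4⟩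

theorem three_le_nb {A : Finset V} {v a b c : V} (ha : a ∈ A) (hb : b ∈ A) (hc : c ∈ A)
    (hab : a ≠ b) (hac : a ≠ c) (hbc : b ≠ c) (h1 : G.Adj v a) (h2 : G.Adj v b)
    (h3 : G.Adj v c) : 3 ≤ nb G A v := by
  classical
  have : ({a, b, c} : Finset V).card = 3 := Finset.card_eq_three.2 ⟨a, b, c, hab, hac, hbc, rfl⟩
  rw [← this]
  apply Finset.card_le_card
  intro w hw
  simp only [Finset.mem_insert, Finset.mem_singleton] at hw
  rcases hw with rfl | rfl | rfl <;> simp [*]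

theorem nb_mono {A B : Finset V} (h : A ⊆ B) (v : V) : nb G A v ≤ nb G B v := by
  classical
  exact Finset.card_le_card (Finset.filter_subset_filter _ h)

theorem nb_eq_sum (A : Finset V) (v : V) [DecidableRel G.Adj] :
    nb G A v = ∑ a ∈ A, if G.Adj v a then 1 else 0 := by
  classical
  rw [← Finset.card_filter]
  unfold nb
  congr

theorem nb_union [DecidableEq V] {A B : Finset V} (h : Disjoint A B) (v : V) :
    nb G (A ∪ B) v = nb G A v + nb G B v := by
  classical
  simp only [nb_eq_sum]
  exact Finset.sum_union h

theorem nb_insert [DecidableEq V] {A : Finset V} {a : V} (h : a ∉ A) (v : V) [DecidableRel G.Adj] :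
    nb G (insert a A) v = (if G.Adj v a then 1 else 0) + nb G A v := by
  classical
  simp only [nb_eq_sum]
  exact Finset.sum_insert h

theorem nb_singleton [DecidableRel G.Adj] (a v : V) :
    nb G {a} v = if G.Adj v a then 1 else 0 := by
  rw [nb_eq_sum, Finset.sum_singleton]

theorem sum_nb_comm (A B : Finset V) : ∑ a ∈ A, nb G B a = ∑ b ∈ B, nb G A b := by
  classical
  simp only [nb_eq_sum]
  rw [Finset.sum_comm]
  simp only [G.adj_comm]

variable [Fintype V] (G)

/-- The degree of `v`. -/
noncomputable def dg (v : V) : ℕ := nb G Finset.univ v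

theorem sum_dg : ∑ v, dg G v = 2 * G.edgeSet.ncard := by
  classical
  have h := G.sum_degrees_eq_twice_card_edges
  rw [← SimpleGraph.coe_edgeFinset, Set.ncard_coe_finset, ← h]
  refine Finset.sum_congr rfl fun v _ => ?_
  rw [← SimpleGraph.card_neighborFinset_eq_degree, SimpleGraph.neighborFinset_eq_filter]
  unfold dg nb
  congr

open Classical in
/-- The neighbourhood of `x`. -/
noncomputable def nbhd (x : V) : Finset V := Finset.univ.filter (G.Adj x)

open Classical in
/-- The vertices at distance at least two from `x`. -/
noncomputable def far (x : V) : Finset V := Finset.univ.filter fun v => v ≠ x ∧ ¬ G.Adj x v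

variable {G}

@[simp] theorem mem_nbhd {x v : V} : v ∈ nbhd G x ↔ G.Adj x v := by
  classical
  simp [nbhd]

@[simp] theorem mem_far {x v : V} : v ∈ far G x ↔ v ≠ x ∧ ¬ G.Adj x v := by
  classical
  simp [far]

theorem card_nbhd (x : V) : (nbhd G x).card = dg G x := rfl

theorem disjoint_nbhd_far (x : V) : Disjoint (nbhd G x) (far G x) := by
  rw [Finset.disjoint_left]
  intro v h1 h2
  simp only [mem_nbhd, mem_far] at h1 h2
  exact h2.2 h1

theorem univ_eq_nbhd_far [DecidableEq V] (x : V) :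
    (Finset.univ : Finset V) = insert x (nbhd G x ∪ far G x) := by
  ext v
  simp only [Finset.mem_univ, Finset.mem_insert, Finset.mem_union, mem_nbhd, mem_far, true_iff]
  tauto

theorem not_mem_nbhd_far [DecidableEq V] (x : V) : x ∉ nbhd G x ∪ far G x := by
  simp

theorem card_eq_nbhd_far (x : V) : Fintype.card V = 1 + dg G x + (far G x).card := by
  classical
  rw [← Finset.card_univ, univ_eq_nbhd_far (G := G) x, Finset.card_insert_of_notMem
    (not_mem_nbhd_far x), Finset.card_union_of_disjoint (disjoint_nbhd_far x), card_nbhd]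
  ring

theorem dg_eq_nb (x v : V) [DecidableRel G.Adj] : dg G v = (if G.Adj v x then 1 else 0) +
    nb G (nbhd G x) v + nb G (far G x) v := by
  classical
  rw [dg, univ_eq_nbhd_far (G := G) x, nb_insert (not_mem_nbhd_far x),
    nb_union (disjoint_nbhd_far x)]
  ring

theorem dg_of_mem_far {x v : V} (h : v ∈ far G x) :
    dg G v = nb G (nbhd G x) v + nb G (far G x) v := by
  classical
  rw [dg_eq_nb x v, if_neg]
  · ring
  · rw [mem_far] at h
    exact fun e => h.2 e.symm

theorem dg_of_adj {x v : V} (h : G.Adj x v) :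
    dg G v = 1 + nb G (nbhd G x) v + nb G (far G x) v := by
  classical
  rw [dg_eq_nb x v, if_pos h.symm]

/-- Twice the number of edges, counted from the neighbourhood of `x`. -/
theorem two_mul_edges (x : V) : 2 * G.edgeSet.ncard = 2 * dg G x +
    ∑ s ∈ nbhd G x, nb G (nbhd G x) s + ∑ v ∈ far G x, (dg G v + nb G (nbhd G x) v) := by
  classical
  rw [← sum_dg]
  have h1 : ∑ v, dg G v = dg G x + (∑ s ∈ nbhd G x, dg G s + ∑ v ∈ far G x, dg G v) := by
    conv_lhs => rw [univ_eq_nbhd_far (G := G) x]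
    rw [Finset.sum_insert (not_mem_nbhd_far x), Finset.sum_union (disjoint_nbhd_far x)]
  have h2 : ∑ s ∈ nbhd G x, dg G s = ∑ s ∈ nbhd G x,
      (1 + nb G (nbhd G x) s + nb G (far G x) s) :=
    Finset.sum_congr rfl fun s hs => dg_of_adj (mem_nbhd.1 hs)
  -- The edges between `nbhd G x` and `far G x` are counted at their far ends.
  rw [h1, h2, Finset.sum_add_distrib, Finset.sum_add_distrib, Finset.sum_add_distrib,
    sum_nb_comm (nbhd G x) (far G x), Finset.sum_const, card_nbhd]
  simp only [smul_eq_mul, mul_one]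
  ring

theorem le_dg_of_subset {A : Finset V} {v : V} (h : ∀ a ∈ A, G.Adj v a) : A.card ≤ dg G v := by
  classical
  exact Finset.card_le_card fun a ha => by simpa using h a ha

/-- A vertex of degree three with three known neighbours has no other neighbours. -/
theorem adj_iff_of_dg_three {v a b c : V} (hd : dg G v = 3) (ha : G.Adj v a) (hb : G.Adj v b)
    (hc : G.Adj v c) (hab : a ≠ b) (hac : a ≠ c) (hbc : b ≠ c) (u : V) :
    G.Adj v u ↔ u = a ∨ u = b ∨ u = c := by
  classical
  have h3 : ({a, b, c} : Finset V).card = 3 := Finset.card_eq_three.2 ⟨a, b, c, hab, hac, hbc, rfl⟩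
  have : ({a, b, c} : Finset V) = nbhd G v := by
    apply Finset.eq_of_subset_of_card_le
    · intro w hw
      simp only [Finset.mem_insert, Finset.mem_singleton] at hw
      rcases hw with rfl | rfl | rfl <;> simpa
    · rw [card_nbhd, hd, h3]
  rw [← mem_nbhd, ← this]
  simp

theorem adj_iff_of_dg_two {v a b : V} (hd : dg G v = 2) (ha : G.Adj v a) (hb : G.Adj v b)
    (hab : a ≠ b) (u : V) : G.Adj v u ↔ u = a ∨ u = b := by
  classical
  have h3 : ({a, b} : Finset V).card = 2 := Finset.card_pair hab
  have : ({a, b} : Finset V) = nbhd G v := by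
    apply Finset.eq_of_subset_of_card_le
    · intro w hw
      simp only [Finset.mem_insert, Finset.mem_singleton] at hw
      rcases hw with rfl | rfl <;> simpa
    · rw [card_nbhd, hd, h3]
  rw [← mem_nbhd, ← this]
  simp

theorem exists_of_dg_two {v : V} (hd : dg G v = 2) :
    ∃ a b, a ≠ b ∧ ∀ u, G.Adj v u ↔ u = a ∨ u = b := by
  classical
  rw [← card_nbhd, Finset.card_eq_two] at hd
  obtain ⟨a, b, hab, h⟩ := hd
  refine ⟨a, b, hab, fun u => ?_⟩
  rw [← mem_nbhd, h]
  simp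

theorem exists_of_dg_three {v : V} (hd : dg G v = 3) :
    ∃ a b c, a ≠ b ∧ a ≠ c ∧ b ≠ c ∧ ∀ u, G.Adj v u ↔ u = a ∨ u = b ∨ u = c := by
  classical
  rw [← card_nbhd, Finset.card_eq_three] at hd
  obtain ⟨a, b, c, hab, hac, hbc, h⟩ := hd
  refine ⟨a, b, c, hab, hac, hbc, fun u => ?_⟩
  rw [← mem_nbhd, h]
  simp

theorem exists_of_dg_four {v a b : V} (hd : dg G v = 4) (ha : G.Adj v a) (hb : G.Adj v b)
    (hab : a ≠ b) : ∃ c d, a ≠ c ∧ a ≠ d ∧ b ≠ c ∧ b ≠ d ∧ c ≠ d ∧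
      ∀ u, G.Adj v u ↔ u = a ∨ u = b ∨ u = c ∨ u = d := by
  classical
  have h2 : (nbhd G v \ {a, b}).card = 2 := by
    rw [Finset.card_sdiff_of_subset]
    · rw [card_nbhd, hd, Finset.card_pair hab]
    · intro w hw
      simp only [Finset.mem_insert, Finset.mem_singleton] at hw
      rcases hw with rfl | rfl <;> simpa
  obtain ⟨c, d, hcd, h⟩ := Finset.card_eq_two.1 h2
  have key : ∀ u, (G.Adj v u ∧ u ≠ a ∧ u ≠ b) ↔ u = c ∨ u = d := by
    intro u
    have := Finset.ext_iff.1 h u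
    simpa using this
  have hc := (key c).2 (Or.inl rfl)
  have hd := (key d).2 (Or.inr rfl)
  refine ⟨c, d, hc.2.1.symm, hd.2.1.symm, hc.2.2.symm, hd.2.2.symm, hcd, fun u => ?_⟩
  have := key u
  constructor
  · intro hu
    tauto
  · rintro (rfl | rfl | rfl | rfl)
    exacts [ha, hb, hc.1, hd.1]

/-- The possible reasons for a vertex at distance two from `x` to be linked to `x`. -/
theorem Sat.far_cases (hG : Sat G) {x v : V} (hv : v ∈ far G x) :
    (∃ w p r, G.Adj x w ∧ G.Adj x p ∧ G.Adj w p ∧ G.Adj v w ∧ G.Adj r w ∧ G.Adj r p ∧ G.Adj r v) ∨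
    (∃ a b r, a ≠ b ∧ G.Adj x a ∧ G.Adj x b ∧ G.Adj x r ∧ G.Adj v a ∧ G.Adj v b ∧
      G.Adj r a ∧ G.Adj r b) ∨
    (∃ a b r, a ≠ b ∧ G.Adj x a ∧ G.Adj x b ∧ G.Adj v a ∧ G.Adj v b ∧
      G.Adj r a ∧ G.Adj r b ∧ G.Adj r v) := by
  rw [mem_far] at hv
  rcases hG.link x v hv.1.symm hv.2 with ⟨h, p, r, h1, h2, h3, h4, h5, h6, h7⟩ |
    ⟨a, b, r, hab, h1, h2, h3, h4, h5, h6, h7⟩ | ⟨a, b, r, hab, h1, h2, h3, h4, h5, h6, h7⟩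
  · exact Or.inl ⟨h, p, r, h1.symm, h5, h2, h4.symm, h3.symm, h6.symm, h7⟩
  · exact Or.inr (Or.inl ⟨a, b, r, hab, h1, h2, h3, h4, h5, h6, h7⟩)
  · exact Or.inr (Or.inr ⟨a, b, r, hab, h4, h5, h1, h2, h6, h7, h3.symm⟩)

/-- Each of the three kinds of link contains a common neighbour, so a saturated graph has diameter
at most two. -/
theorem Sat.one_le_nb (hG : Sat G) {x v : V} (hv : v ∈ far G x) : 1 ≤ nb G (nbhd G x) v := by
  rcases hG.far_cases hv with ⟨w, p, r, h1, h2, h3, h4, -⟩ | ⟨a, b, r, -, h1, h2, h3, h4, -⟩ |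
    ⟨a, b, r, -, h1, h2, h3, -⟩
  · exact nb_pos.2 ⟨w, by simpa, h4⟩
  · exact nb_pos.2 ⟨a, by simpa, h4⟩
  · exact nb_pos.2 ⟨a, by simpa, h3⟩

/-- A vertex with only one neighbour `w` in the neighbourhood of `x` is attached to a common
neighbour of `w` and another neighbour of `x`. -/
theorem Sat.parent (hG : Sat G) {x v : V} (hv : v ∈ far G x) (h1 : nb G (nbhd G x) v = 1) :
    ∃ w p q, G.Adj x w ∧ G.Adj x p ∧ G.Adj w p ∧ G.Adj v w ∧ q ∈ far G x ∧ G.Adj q w ∧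
      G.Adj q p ∧ G.Adj q v ∧ 2 ≤ nb G (nbhd G x) q ∧ ∀ s, G.Adj x s → G.Adj v s → s = w := by
  obtain ⟨w0, hw0, hvw0, huniq⟩ := nb_eq_one.1 h1
  -- A hub link, in either direction, supplies two common neighbours, so only the rim link survives;
  -- its hub is the unique neighbour `w`, and its rim vertex `r` is the parent.
  rcases hG.far_cases hv with ⟨w, p, r, h1, h2, h3, h4, h5, h6, h7⟩ |
    ⟨a, b, r, hab, h1, h2, h3, h4, h5, -⟩ | ⟨a, b, r, hab, h1, h2, h3, h4, -⟩
  · have e : w = w0 := huniq w (by simpa) h4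
    subst e
    refine ⟨w, p, r, h1, h2, h3, h4, ?_, h5, h6, h7, ?_, fun s hs hvs => huniq s (by simpa) hvs⟩
    · rw [mem_far]
      constructor
      · rintro rfl
        rw [mem_far] at hv
        exact hv.2 h7
      · intro hxr
        exact h5.ne (huniq r (by simpa) h7.symm)
    · exact two_le_nb.2 ⟨w, by simpa, p, by simpa, h3.ne, h5, h6⟩
  · exact absurd ((huniq a (by simpa) h4).trans (huniq b (by simpa) h5).symm) hab
  · exact absurd ((huniq a (by simpa) h3).trans (huniq b (by simpa) h4).symm) hab

end Counting

section SumBounds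

variable {V : Type u}

theorem add_sum_le_sum [DecidableEq V] {f : V → ℕ} {A W : Finset V} {q : V} (hA : A ⊆ W)
    (hq : q ∈ W) (hqA : q ∉ A) : f q + ∑ v ∈ A, f v ≤ ∑ v ∈ W, f v := by
  rw [← Finset.sum_insert hqA]
  exact Finset.sum_le_sum_of_subset (Finset.insert_subset hq hA)

theorem card_le_sum_of_pos {f : V → ℕ} {A W : Finset V} (hA : A ⊆ W) (h : ∀ v ∈ A, 1 ≤ f v) :
    A.card ≤ ∑ v ∈ W, f v := by
  calc A.card = ∑ v ∈ A, 1 := by simp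
    _ ≤ ∑ v ∈ A, f v := Finset.sum_le_sum h
    _ ≤ _ := Finset.sum_le_sum_of_subset hA

theorem pair_le_sum {f : V → ℕ} {W : Finset V} {p q : V} (hp : p ∈ W)
    (hq : q ∈ W) (hpq : p ≠ q) : f p + f q ≤ ∑ v ∈ W, f v := by
  classical
  have := add_sum_le_sum (f := f) (A := {q}) (W := W) (q := p) (by simpa) hp (by simpa)
  simpa using this

end SumBounds

/-! ### Minimum degree four. -/

section MinDegreeFour

variable {V : Type u} [Fintype V] {G : SimpleGraph V}

/-- The excess of `v` in the count of edges around a vertex `x` of degree four. -/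
noncomputable def excess (G : SimpleGraph V) (x v : V) : ℕ := dg G v + nb G (nbhd G x) v - 5

/-- For `dg G x = 4` one has 2e = 5n - 17 + τ + Σ excess, so a surplus of 8 is what 2e ≥ 5n - 9
requires. The truncated subtraction in `excess` loses nothing, because degrees are at least 4 and a
far vertex has a neighbour in `nbhd G x`. -/
theorem edges_of_excess (hG : Sat G) {x : V} (hx : dg G x = 4) (hmin : ∀ v, 4 ≤ dg G v)
    (h : 8 ≤ ∑ s ∈ nbhd G x, nb G (nbhd G x) s + ∑ v ∈ far G x, excess G x v) :
    5 * Fintype.card V ≤ 2 * G.edgeSet.ncard + 9 := by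
  have h1 := two_mul_edges (G := G) x
  have h2 := card_eq_nbhd_far (G := G) x
  have h3 : ∑ v ∈ far G x, (dg G v + nb G (nbhd G x) v) =
      ∑ v ∈ far G x, (5 + excess G x v) := by
    refine Finset.sum_congr rfl fun v hv => ?_
    have := hG.one_le_nb hv
    have := hmin v
    unfold excess
    omega
  rw [h3, Finset.sum_add_distrib, Finset.sum_const, smul_eq_mul] at h1
  omega

theorem sum_nbhd_four {x s₁ s₂ s₃ s₄ : V} (hS : ∀ u, G.Adj x u ↔ u = s₁ ∨ u = s₂ ∨ u = s₃ ∨ u = s₄)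
    (h12 : s₁ ≠ s₂) (h13 : s₁ ≠ s₃) (h14 : s₁ ≠ s₄) (h23 : s₂ ≠ s₃) (h24 : s₂ ≠ s₄)
    (h34 : s₃ ≠ s₄) (f : V → ℕ) :
    ∑ s ∈ nbhd G x, f s = f s₁ + f s₂ + f s₃ + f s₄ := by
  classical
  have : nbhd G x = {s₁, s₂, s₃, s₄} := by
    ext u
    simp [hS]
  rw [this, Finset.sum_insert (by simp [*]), Finset.sum_insert (by simp [*]),
    Finset.sum_insert (by simp [*]), Finset.sum_singleton]
  ring

/-- The vertices far from `x` that are adjacent to `s`. -/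
noncomputable def farNbhd (G : SimpleGraph V) (x s : V) : Finset V := by
  classical exact (far G x).filter (G.Adj s)

theorem mem_farNbhd {x s v : V} : v ∈ farNbhd G x s ↔ v ∈ far G x ∧ G.Adj s v := by
  simp [farNbhd]

theorem card_farNbhd (x s : V) : (farNbhd G x s).card = nb G (far G x) s := rfl

/-- Vertices with two neighbours in `nbhd G x` have positive excess. If `s₄` is adjacent to another
neighbour of `x`, then τ ≥ 6, and an excess of 2 can fail only if a single vertex is the parent of
all others. If `s₄` is isolated there, its far neighbours all have positive excess, since a parent
would require an edge at `s₄` inside the neighbourhood. -/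
theorem four_of_path (hG : Sat G) {x s₁ s₂ s₃ s₄ : V} (hx : dg G x = 4) (hmin : ∀ v, 4 ≤ dg G v)
    (hS : ∀ u, G.Adj x u ↔ u = s₁ ∨ u = s₂ ∨ u = s₃ ∨ u = s₄)
    (h12 : s₁ ≠ s₂) (h13 : s₁ ≠ s₃) (h14 : s₁ ≠ s₄) (h23 : s₂ ≠ s₃) (h24 : s₂ ≠ s₄)
    (h34 : s₃ ≠ s₄) (a12 : G.Adj s₁ s₂) (a23 : G.Adj s₂ s₃) (hn : 10 ≤ Fintype.card V) :
    5 * Fintype.card V ≤ 2 * G.edgeSet.ncard + 9 := by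
  classical
  apply edges_of_excess hG hx hmin
  rw [sum_nbhd_four hS h12 h13 h14 h23 h24 h34]
  have hcard : 5 ≤ (far G x).card := by
    have := card_eq_nbhd_far (G := G) x
    omega
  have m1 : s₁ ∈ nbhd G x := by simp [hS]
  have m2 : s₂ ∈ nbhd G x := by simp [hS]
  have m3 : s₃ ∈ nbhd G x := by simp [hS]
  have m4 : s₄ ∈ nbhd G x := by simp [hS]
  have n1 : 1 ≤ nb G (nbhd G x) s₁ := nb_pos.2 ⟨s₂, m2, a12⟩
  have n2 : 2 ≤ nb G (nbhd G x) s₂ := two_le_nb.2 ⟨s₁, m1, s₃, m3, h13, a12.symm, a23⟩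
  have n3 : 1 ≤ nb G (nbhd G x) s₃ := nb_pos.2 ⟨s₂, m2, a23.symm⟩
  have ex1 : ∀ v, 2 ≤ nb G (nbhd G x) v → 1 ≤ excess G x v := by
    intro v hv
    have := hmin v
    unfold excess
    omega
  have ex2 : ∀ v, 3 ≤ nb G (nbhd G x) v → 2 ≤ excess G x v := by
    intro v hv
    have := hmin v
    unfold excess
    omega
  by_cases hiso : ∃ s ∈ nbhd G x, G.Adj s₄ s
  · -- at least three edges among the neighbours
    have hτ : 6 ≤ nb G (nbhd G x) s₁ + nb G (nbhd G x) s₂ + nb G (nbhd G x) s₃ +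
        nb G (nbhd G x) s₄ := by
      have n4 : 1 ≤ nb G (nbhd G x) s₄ := nb_pos.2 hiso
      obtain ⟨s, hs, hadj⟩ := hiso
      rw [mem_nbhd, hS] at hs
      rcases hs with rfl | rfl | rfl | rfl
      · have : 2 ≤ nb G (nbhd G x) s := two_le_nb.2 ⟨s₂, m2, s₄, m4, h24, a12, hadj.symm⟩
        omega
      · have : 3 ≤ nb G (nbhd G x) s :=
          three_le_nb m1 m3 m4 h13 h14 h34 a12.symm a23 hadj.symm
        omega
      · have : 2 ≤ nb G (nbhd G x) s := two_le_nb.2 ⟨s₂, m2, s₄, m4, h24, a23.symm, hadj.symm⟩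
        omega
      · exact absurd hadj G.irrefl
    suffices h : 2 ≤ ∑ v ∈ far G x, excess G x v by omega
    by_contra hlt
    have huniq : ∀ p ∈ far G x, ∀ q ∈ far G x, 2 ≤ nb G (nbhd G x) p → 2 ≤ nb G (nbhd G x) q →
        p = q := by
      intro p hp q hq h1 h2
      by_contra hpq
      have := pair_le_sum (f := excess G x) hp hq hpq
      have := ex1 p h1
      have := ex1 q h2
      omega
    have hq : ∃ q ∈ far G x, 2 ≤ nb G (nbhd G x) q := by
      obtain ⟨v, hv⟩ : (far G x).Nonempty := Finset.card_pos.1 (by omega)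
      by_cases h2 : 2 ≤ nb G (nbhd G x) v
      · exact ⟨v, hv, h2⟩
      · have := hG.one_le_nb hv
        obtain ⟨w, p, q, -, -, -, -, h1, -, -, -, h2, -⟩ := hG.parent hv (by omega)
        exact ⟨q, h1, h2⟩
    obtain ⟨q, hq, hq2⟩ := hq
    -- All other far vertices are thin and have `q` as parent; so `q` has degree at least 2 + 4 and
    -- an excess of at least 3 by itself.
    have hall : ∀ v ∈ (far G x).erase q, G.Adj q v := by
      intro v hv
      rw [Finset.mem_erase] at hv
      have h1 := hG.one_le_nb hv.2
      by_cases h2 : 2 ≤ nb G (nbhd G x) v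
      · exact absurd (huniq v hv.2 q hq h2 hq2) hv.1
      · obtain ⟨w, p, q', -, -, -, -, hq', -, -, hadj, h2', -⟩ := hG.parent hv.2 (by omega)
        rw [huniq q hq q' hq' hq2 h2']
        exact hadj
    have h1 : ((far G x).erase q).card ≤ nb G (far G x) q :=
      Finset.card_le_card fun v hv => Finset.mem_filter.2 ⟨Finset.mem_of_mem_erase hv, hall v hv⟩
    rw [Finset.card_erase_of_mem hq] at h1
    have h2 := dg_of_mem_far hq
    have h3 : excess G x q ≤ ∑ v ∈ far G x, excess G x v :=
      Finset.single_le_sum (f := excess G x) (fun _ _ => Nat.zero_le _) hq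
    unfold excess at h3 hlt
    omega
  · push Not at hiso
    have n4 : nb G (nbhd G x) s₄ = 0 := nb_eq_zero.2 hiso
    have hA2 : ∀ v ∈ farNbhd G x s₄, 2 ≤ nb G (nbhd G x) v := by
      intro v hv
      rw [mem_farNbhd] at hv
      by_contra h
      have := hG.one_le_nb hv.1
      obtain ⟨w, p, q, hw, hp, hwp, hvw, -, -, -, -, -, hu⟩ := hG.parent hv.1 (by omega)
      have := hu s₄ (mem_nbhd.1 m4) hv.2.symm
      subst this
      exact hiso p (by simpa) hwp
    have hsub : farNbhd G x s₄ ⊆ far G x := fun v hv => (mem_farNbhd.1 hv).1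
    have hA3 : 3 ≤ (farNbhd G x s₄).card := by
      rw [card_farNbhd]
      have := dg_of_adj (mem_nbhd.1 m4)
      have := hmin s₄
      omega
    have hsum := card_le_sum_of_pos (f := excess G x) hsub fun v hv => ex1 v (hA2 v hv)
    by_cases a13 : G.Adj s₁ s₃
    · have : 2 ≤ nb G (nbhd G x) s₁ := two_le_nb.2 ⟨s₂, m2, s₃, m3, h23, a12, a13⟩
      have : 2 ≤ nb G (nbhd G x) s₃ := two_le_nb.2 ⟨s₂, m2, s₁, m1, h12.symm, a23.symm, a13.symm⟩
      omega
    · suffices h : 4 ≤ ∑ v ∈ far G x, excess G x v by omega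
      by_contra hlt
      have hout : ∀ v ∈ far G x, v ∉ farNbhd G x s₄ → excess G x v = 0 := by
        intro v hv hvA
        have h1 := add_sum_le_sum (f := excess G x) hsub hv hvA
        have h2 := card_le_sum_of_pos (f := excess G x) (subset_refl (farNbhd G x s₄))
          fun v hv => ex1 v (hA2 v hv)
        omega
      have hne : ∃ v ∈ far G x, v ∉ farNbhd G x s₄ := by
        by_contra hcon
        push Not at hcon
        have : (far G x).card ≤ (farNbhd G x s₄).card := Finset.card_le_card hcon
        omega
      obtain ⟨v, hv, hvA⟩ := hne
      have h0 := hout v hv hvA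
      have h1 := hG.one_le_nb hv
      have h4 := hmin v
      unfold excess at h0
      obtain ⟨w, p, q, hw, hp, hwp, hvw, hq, hqw, hqp, hqv, hq2, -⟩ := hG.parent hv (by omega)
      have hqA : q ∈ farNbhd G x s₄ := by
        by_contra hqA
        have := hout q hq hqA
        have := ex1 q hq2
        omega
      -- The parent `q` of a vertex not adjacent to `s₄` sees `w`, `p` and `s₄`, so its excess is at
      -- least 2; the two or more other far neighbours of `s₄` bring the total to 4.
      have h3 : 3 ≤ nb G (nbhd G x) q := by
        refine three_le_nb (by simpa : w ∈ nbhd G x) (by simpa : p ∈ nbhd G x) m4 hwp.ne ?_ ?_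
          hqw hqp (mem_farNbhd.1 hqA).2.symm
        · rintro rfl
          exact hiso p (by simpa) hwp
        · rintro rfl
          exact hiso w (by simpa) hwp.symm
      have h5 := add_sum_le_sum (f := excess G x) (A := (farNbhd G x s₄).erase q)
        ((Finset.erase_subset _ _).trans hsub) hq (Finset.notMem_erase _ _)
      have h6 := card_le_sum_of_pos (f := excess G x) (subset_refl ((farNbhd G x s₄).erase q))
          fun v hv => ex1 v (hA2 v (Finset.mem_of_mem_erase hv))
      rw [Finset.card_erase_of_mem hqA] at h6
      have := ex2 q h3
      omega

/-- No vertex of degree `k` has a path on three vertices in its neighbourhood. -/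
def NoPathInNbhd (G : SimpleGraph V) (k : ℕ) : Prop :=
  ∀ y a b c, dg G y = k → G.Adj y a → G.Adj y b → G.Adj y c → a ≠ c → G.Adj b a → ¬ G.Adj b c

/-- The neighbourhood of `q` contains the path p w v, so `q` does not have degree 4, and degree 5
cancels the constant in `excess`. -/
theorem excess_of_parent (hP : NoPathInNbhd G 4) (hmin : ∀ v, 4 ≤ dg G v) {x w p q v : V}
    (hwp : G.Adj w p) (hvw : G.Adj v w) (hqw : G.Adj q w) (hqp : G.Adj q p) (hqv : G.Adj q v)
    (hvp : v ≠ p) : nb G (nbhd G x) q ≤ excess G x q := by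
  have h1 : dg G q ≠ 4 := fun h => hP q p w v h hqp hqw hqv hvp.symm hwp hvw.symm
  have := hmin q
  unfold excess
  omega

/-- For a neighbourhood consisting of two disjoint edges, with a parent `q` over `s₁ s₂` of excess
at least 2. If the total is below 4, then `q` misses `s₃` or `s₄`, there is no second parent over
`s₃ s₄`, and so all far neighbours of `s₃` and `s₄` have positive excess. -/
theorem four_of_matching_aux (hG : Sat G) {x s₁ s₂ s₃ s₄ q : V} (hmin : ∀ v, 4 ≤ dg G v)
    (hP : NoPathInNbhd G 4)
    (hS : ∀ u, G.Adj x u ↔ u = s₁ ∨ u = s₂ ∨ u = s₃ ∨ u = s₄)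
    (h12 : s₁ ≠ s₂) (h13 : s₁ ≠ s₃) (h14 : s₁ ≠ s₄) (h23 : s₂ ≠ s₃) (h24 : s₂ ≠ s₄)
    (h34 : s₃ ≠ s₄) (a34 : G.Adj s₃ s₄)
    (n13 : ¬ G.Adj s₁ s₃) (n14 : ¬ G.Adj s₁ s₄) (n23 : ¬ G.Adj s₂ s₃) (n24 : ¬ G.Adj s₂ s₄)
    (hq : q ∈ far G x) (hq1 : G.Adj q s₁) (hq2 : G.Adj q s₂)
    (hqe : nb G (nbhd G x) q ≤ excess G x q) : 4 ≤ ∑ v ∈ far G x, excess G x v := by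
  classical
  by_contra hlt
  have m1 : s₁ ∈ nbhd G x := by simp [hS]
  have m2 : s₂ ∈ nbhd G x := by simp [hS]
  have m3 : s₃ ∈ nbhd G x := by simp [hS]
  have m4 : s₄ ∈ nbhd G x := by simp [hS]
  have q2 : 2 ≤ nb G (nbhd G x) q := two_le_nb.2 ⟨s₁, m1, s₂, m2, h12, hq1, hq2⟩
  have hsingle : excess G x q ≤ ∑ v ∈ far G x, excess G x v :=
    Finset.single_le_sum (f := excess G x) (fun _ _ => Nat.zero_le _) hq
  have hfour : ¬ (G.Adj q s₃ ∧ G.Adj q s₄) := by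
    rintro ⟨h3, h4⟩
    have : ({s₁, s₂, s₃, s₄} : Finset V).card ≤ nb G (nbhd G x) q := by
      apply Finset.card_le_card
      intro u hu
      simp only [Finset.mem_insert, Finset.mem_singleton] at hu
      rcases hu with rfl | rfl | rfl | rfl <;> simp [*]
    rw [Finset.card_insert_of_notMem (by simp [*]), Finset.card_insert_of_notMem (by simp [*]),
      Finset.card_pair h34] at this
    omega
  have hside : ∀ s, s = s₃ ∨ s = s₄ → ∀ v ∈ farNbhd G x s, 2 ≤ nb G (nbhd G x) v := by
    intro s hs v hv
    rw [mem_farNbhd] at hv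
    by_contra h
    have := hG.one_le_nb hv.1
    obtain ⟨w, p, q', hw, hp, hwp, hvw, hq', hqw, hqp, hqv, hq2', hu⟩ := hG.parent hv.1 (by omega)
    have hxs : G.Adj x s := by
      rw [hS]
      tauto
    have e := hu s hxs hv.2.symm
    subst e
    have hvp : v ≠ p := by
      rintro rfl
      exact (mem_far.1 hv.1).2 hp
    have hq'e := excess_of_parent (x := x) hP hmin hwp hvw hqw hqp hqv hvp
    by_cases e : q = q'
    · subst e
      apply hfour
      rw [hS] at hp
      rcases hs with rfl | rfl <;> rcases hp with rfl | rfl | rfl | rfl <;>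
        simp_all [G.adj_comm]
    · have := pair_le_sum (f := excess G x) hq hq' e
      omega
  -- If `q` misses `s`, then the at least two far neighbours of `s`, each of positive excess, add to
  -- the 2 of `q`.
  have hadj : ∀ s, s = s₃ ∨ s = s₄ → G.Adj q s := by
    intro s hs
    by_contra hqs
    have hsub : farNbhd G x s ⊆ far G x := fun v hv => (mem_farNbhd.1 hv).1
    have hqA : q ∉ farNbhd G x s := fun h => hqs (mem_farNbhd.1 h).2.symm
    have h1 := add_sum_le_sum (f := excess G x) hsub hq hqA
    have h2 := card_le_sum_of_pos (f := excess G x) (subset_refl (farNbhd G x s)) fun v hv => by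
      have := hside s hs v hv
      have := hmin v
      unfold excess
      omega
    have hxs : G.Adj x s := by
      rw [hS]
      tauto
    have h3 := dg_of_adj hxs
    have h4 : nb G (nbhd G x) s ≤ 1 := by
      by_contra h
      obtain ⟨u, hu, w, hw, huw, h1, h2⟩ := two_le_nb.1 (by omega : 2 ≤ nb G (nbhd G x) s)
      rw [mem_nbhd, hS] at hu hw
      rcases hs with rfl | rfl <;> rcases hu with rfl | rfl | rfl | rfl <;>
        rcases hw with rfl | rfl | rfl | rfl <;> simp_all [G.adj_comm]
    have := hmin s
    rw [card_farNbhd] at h2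
    omega
  exact hfour ⟨hadj s₃ (Or.inl rfl), hadj s₄ (Or.inr rfl)⟩

/-- Without paths, `s₁ s₂` is a component of the neighbourhood. If `s₃ s₄` is an edge, then τ ≥ 4
and the other 4 come from a parent, or from five thick vertices. Otherwise τ ≥ 2, and `s₃`, `s₄`
have at least three far neighbours each, to which an excess of 6 is charged. -/
theorem four_of_edge (hG : Sat G) {x s₁ s₂ s₃ s₄ : V} (hx : dg G x = 4) (hmin : ∀ v, 4 ≤ dg G v)
    (hP : NoPathInNbhd G 4)
    (hS : ∀ u, G.Adj x u ↔ u = s₁ ∨ u = s₂ ∨ u = s₃ ∨ u = s₄)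
    (h12 : s₁ ≠ s₂) (h13 : s₁ ≠ s₃) (h14 : s₁ ≠ s₄) (h23 : s₂ ≠ s₃) (h24 : s₂ ≠ s₄)
    (h34 : s₃ ≠ s₄) (a12 : G.Adj s₁ s₂) (hn : 10 ≤ Fintype.card V) :
    5 * Fintype.card V ≤ 2 * G.edgeSet.ncard + 9 := by
  classical
  apply edges_of_excess hG hx hmin
  rw [sum_nbhd_four hS h12 h13 h14 h23 h24 h34]
  have hcard : 5 ≤ (far G x).card := by
    have := card_eq_nbhd_far (G := G) x
    omega
  have x1 : G.Adj x s₁ := by simp [hS]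
  have x2 : G.Adj x s₂ := by simp [hS]
  have x3 : G.Adj x s₃ := by simp [hS]
  have x4 : G.Adj x s₄ := by simp [hS]
  have n1 : 1 ≤ nb G (nbhd G x) s₁ := nb_pos.2 ⟨s₂, by simpa, a12⟩
  have n2 : 1 ≤ nb G (nbhd G x) s₂ := nb_pos.2 ⟨s₁, by simpa, a12.symm⟩
  have n13 : ¬ G.Adj s₁ s₃ := hP x s₂ s₁ s₃ hx x2 x1 x3 h23 a12
  have n14 : ¬ G.Adj s₁ s₄ := hP x s₂ s₁ s₄ hx x2 x1 x4 h24 a12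
  have n23 : ¬ G.Adj s₂ s₃ := hP x s₁ s₂ s₃ hx x1 x2 x3 h13 a12.symm
  have n24 : ¬ G.Adj s₂ s₄ := hP x s₁ s₂ s₄ hx x1 x2 x4 h14 a12.symm
  have ex1 : ∀ v, 2 ≤ nb G (nbhd G x) v → 1 ≤ excess G x v := by
    intro v hv
    have := hmin v
    unfold excess
    omega
  by_cases a34 : G.Adj s₃ s₄
  · have n3 : 1 ≤ nb G (nbhd G x) s₃ := nb_pos.2 ⟨s₄, by simpa, a34⟩
    have n4 : 1 ≤ nb G (nbhd G x) s₄ := nb_pos.2 ⟨s₃, by simpa, a34.symm⟩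
    suffices h : 4 ≤ ∑ v ∈ far G x, excess G x v by omega
    by_cases hT : ∀ v ∈ far G x, 2 ≤ nb G (nbhd G x) v
    · have := card_le_sum_of_pos (f := excess G x) (subset_refl (far G x))
        fun v hv => ex1 v (hT v hv)
      omega
    · push Not at hT
      obtain ⟨v, hv, hv2⟩ := hT
      have := hG.one_le_nb hv
      obtain ⟨w, p, q, hw, hp, hwp, hvw, hq, hqw, hqp, hqv, hq2, hu⟩ := hG.parent hv (by omega)
      have hvp : v ≠ p := by
        rintro rfl
        exact (mem_far.1 hv).2 hp
      have hqe := excess_of_parent (x := x) hP hmin hwp hvw hqw hqp hqv hvp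
      have hor : (G.Adj q s₁ ∧ G.Adj q s₂) ∨ (G.Adj q s₃ ∧ G.Adj q s₄) := by
        rw [hS] at hw hp
        rcases hw with rfl | rfl | rfl | rfl <;> rcases hp with rfl | rfl | rfl | rfl <;>
          simp_all [G.adj_comm]
      rcases hor with ⟨h1, h2⟩ | ⟨h1, h2⟩
      · exact four_of_matching_aux hG hmin hP hS h12 h13 h14 h23 h24 h34 a34 n13 n14 n23 n24 hq
          h1 h2 hqe
      · refine four_of_matching_aux (s₁ := s₃) (s₂ := s₄) (s₃ := s₁) (s₄ := s₂) hG hmin hP ?_ h34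
          h13.symm h23.symm h14.symm h24.symm h12 a12 (fun h => n13 h.symm) (fun h => n23 h.symm)
          (fun h => n14 h.symm) (fun h => n24 h.symm) hq h1 h2 hqe
        intro u
        rw [hS]
        tauto
  · have z3 : ∀ p ∈ nbhd G x, ¬ G.Adj s₃ p := by
      intro p hp
      rw [mem_nbhd, hS] at hp
      rcases hp with rfl | rfl | rfl | rfl
      exacts [fun h => n13 h.symm, fun h => n23 h.symm, G.irrefl, a34]
    have z4 : ∀ p ∈ nbhd G x, ¬ G.Adj s₄ p := by
      intro p hp
      rw [mem_nbhd, hS] at hp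
      rcases hp with rfl | rfl | rfl | rfl
      exacts [fun h => n14 h.symm, fun h => n24 h.symm, fun h => a34 h.symm, G.irrefl]
    have hside : ∀ s, (s = s₃ ∨ s = s₄) → ∀ v ∈ far G x, G.Adj s v → 2 ≤ nb G (nbhd G x) v := by
      intro s hs v hv hsv
      by_contra h
      have := hG.one_le_nb hv
      obtain ⟨w, p, q', hw, hp, hwp, hvw, hq', hqw, hqp, hqv, hq2', hu⟩ := hG.parent hv (by omega)
      have hxs : G.Adj x s := by
        rw [hS]
        tauto
      have e := hu s hxs hsv.symm
      subst e
      rcases hs with rfl | rfl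
      · exact z3 p (by simpa) hwp
      · exact z4 p (by simpa) hwp
    -- Each far vertex pays one unit per edge to `s₃` or `s₄`. If these two are its only neighbours
    -- next to `x`, then it is linked to `x` with itself as hub, so its neighbourhood contains a
    -- path and its degree is at least 5.
    have key : ∀ v ∈ far G x, (if G.Adj s₃ v then 1 else 0) + (if G.Adj s₄ v then 1 else 0) ≤
        excess G x v := by
      intro v hv
      by_cases h3 : G.Adj s₃ v
      · have e3 := ex1 v (hside s₃ (Or.inl rfl) v hv h3)
        by_cases h4 : G.Adj s₄ v
        · simp only [h3, h4, if_true]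
          by_cases h5 : 3 ≤ nb G (nbhd G x) v
          · have := hmin v
            unfold excess
            omega
          have nS : ∀ s, G.Adj x s → G.Adj v s → s = s₃ ∨ s = s₄ := by
            intro s hs hvs
            by_contra hne
            push Not at hne
            exact h5 (three_le_nb (mem_nbhd.2 hs) (mem_nbhd.2 x3) (mem_nbhd.2 x4) hne.1 hne.2 h34
              hvs h3.symm h4.symm)
          have zz : ∀ s p, G.Adj x s → G.Adj v s → G.Adj x p → ¬ G.Adj s p := by
            intro s p hs hvs hp
            rcases nS s hs hvs with rfl | rfl
            · exact z3 p (by simpa)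
            · exact z4 p (by simpa)
          have h6 : dg G v ≠ 4 := by
            intro h6
            rcases hG.far_cases hv with ⟨w, p, r, k1, k2, k3, k4, -⟩ |
              ⟨a, b, r, hab, k1, k2, k3, k4, k5, k6, -⟩ | ⟨a, b, r, hab, k1, k2, k3, k4, k5, k6, k7⟩
            · exact zz w p k1 k4 k2 k3
            · exact zz a r k1 k4 k3 k6.symm
            · exact hP v a r b h6 k3 k7.symm k4 hab k5 k6
          have := hmin v
          have := hside s₃ (Or.inl rfl) v hv h3
          unfold excess
          omega
        · simp only [h3, h4, if_true, if_false]
          omega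
      · by_cases h4 : G.Adj s₄ v
        · have e4 := ex1 v (hside s₄ (Or.inr rfl) v hv h4)
          simp only [h3, h4, if_true, if_false]
          omega
        · simp [h3, h4]
    have hs := Finset.sum_le_sum key
    rw [Finset.sum_add_distrib, ← nb_eq_sum, ← nb_eq_sum] at hs
    have d3 := dg_of_adj x3
    have d4 := dg_of_adj x4
    have := nb_eq_zero.2 z3
    have := nb_eq_zero.2 z4
    have := hmin s₃
    have := hmin s₄
    omega

theorem edges_of_minDegree_four (hG : Sat G) {x : V} (hx : dg G x = 4) (hmin : ∀ v, 4 ≤ dg G v) :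
    5 * Fintype.card V ≤ 2 * G.edgeSet.ncard + 9 := by
  by_cases hn : Fintype.card V < 10
  -- For n ≤ 9 the trivial bound 2e ≥ 4n suffices.
  · have h1 : ∑ v : V, 4 ≤ ∑ v, dg G v := Finset.sum_le_sum fun v _ => hmin v
    rw [sum_dg, Finset.sum_const, smul_eq_mul, Finset.card_univ] at h1
    omega
  push Not at hn
  by_cases hP : NoPathInNbhd G 4
  · by_cases hE : ∀ y a b, dg G y = 4 → G.Adj y a → G.Adj y b → ¬ G.Adj a b
    · apply edges_of_excess hG hx hmin
      -- When vertices of degree 4 have independent neighbourhoods, only the link with hub `v`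
      -- remains; it puts an edge into the neighbourhood of `v`, so `v` has degree at least 5.
      have key : ∀ v ∈ far G x, 2 ≤ excess G x v := by
        intro v hv
        rcases hG.far_cases hv with ⟨w, p, r, k1, k2, k3, -⟩ |
              ⟨a, b, r, hab, k1, k2, k3, k4, k5, k6, -⟩ | ⟨a, b, r, hab, k1, k2, k3, k4, k5, k6, k7⟩
        · exact absurd k3 (hE x w p hx k1 k2)
        · exact absurd k6 (hE x r a hx k3 k1)
        · have h6 : dg G v ≠ 4 := fun h6 => hE v r a h6 k7.symm k3 k5
          have := hmin v
          have : 2 ≤ nb G (nbhd G x) v := two_le_nb.2 ⟨a, by simpa, b, by simpa, hab, k3, k4⟩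
          unfold excess
          omega
      have h1 := Finset.sum_le_sum key
      rw [Finset.sum_const, smul_eq_mul] at h1
      have := card_eq_nbhd_far (G := G) x
      omega
    · push Not at hE
      obtain ⟨y, a, b, hy, ha, hb, hab⟩ := hE
      obtain ⟨c, d, h1, h2, h3, h4, h5, hS⟩ := exists_of_dg_four hy ha hb hab.ne
      exact four_of_edge hG hy hmin hP hS hab.ne h1 h2 h3 h4 h5 hab hn
  · unfold NoPathInNbhd at hP
    push Not at hP
    obtain ⟨y, a, b, c, hy, ha, hb, hc, hac, hba, hbc⟩ := hP
    obtain ⟨e, d, h1, h2, h3, h4, h5, hS⟩ := exists_of_dg_four hy ha hb hba.ne.symm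
    rcases (hS c).1 hc with rfl | rfl | rfl | rfl
    · exact absurd rfl hac
    · exact absurd hbc G.irrefl
    · exact four_of_path hG hy hmin hS hba.ne.symm h1 h2 h3 h4 h5 hba.symm hbc hn
    · refine four_of_path hG hy hmin (s₃ := c) (s₄ := e) ?_ hba.ne.symm h2 h1 h4 h3 h5.symm hba.symm
        hbc hn
      intro u
      rw [hS]
      tauto

end MinDegreeFour

section SumBounds

variable {V : Type u}

theorem sum_ge_of_mem {f : V → ℤ} {A : Finset V} (h : ∀ v ∈ A, 0 ≤ f v) {a : V} (ha : a ∈ A) :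
    f a ≤ ∑ v ∈ A, f v := Finset.single_le_sum (f := f) h ha

theorem sum_ge_of_pair {f : V → ℤ} {A : Finset V} (h : ∀ v ∈ A, 0 ≤ f v) {a b : V} (ha : a ∈ A)
    (hb : b ∈ A) (hab : a ≠ b) : f a + f b ≤ ∑ v ∈ A, f v := by
  classical
  rw [← Finset.sum_pair hab]
  refine Finset.sum_le_sum_of_subset_of_nonneg ?_ fun v hv _ => h v hv
  intro u hu
  simp only [Finset.mem_insert, Finset.mem_singleton] at hu
  rcases hu with rfl | rfl <;> assumption

end SumBounds

/-! ### Degree three: independent neighbourhoods and neighbourhoods with a single edge. -/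

section MinDegreeThree

variable {V : Type u} [Fintype V] {G : SimpleGraph V}

/-- The vertices far from `x` with exactly one neighbour in the neighbourhood of `x`. -/
noncomputable def thin (G : SimpleGraph V) (x : V) : Finset V :=
  (far G x).filter fun v => nb G (nbhd G x) v = 1

/-- The vertices far from `x` with at least two neighbours in the neighbourhood of `x`. -/
noncomputable def thick (G : SimpleGraph V) (x : V) : Finset V :=
  (far G x).filter fun v => ¬ nb G (nbhd G x) v = 1

theorem mem_thin {x v : V} : v ∈ thin G x ↔ v ∈ far G x ∧ nb G (nbhd G x) v = 1 := by
  simp only [thin, Finset.mem_filter]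

theorem mem_thick {x v : V} : v ∈ thick G x ↔ v ∈ far G x ∧ nb G (nbhd G x) v ≠ 1 := by
  simp only [thick, Finset.mem_filter, ne_eq]

theorem Sat.mem_thick_iff (hG : Sat G) {x v : V} :
    v ∈ thick G x ↔ v ∈ far G x ∧ 2 ≤ nb G (nbhd G x) v := by
  rw [mem_thick]
  refine and_congr_right fun hv => ?_
  have := hG.one_le_nb hv
  omega

theorem thick_union_thin [DecidableEq V] (x : V) : thick G x ∪ thin G x = far G x := by
  rw [Finset.union_comm]
  exact Finset.filter_union_filter_not_eq _ _

theorem disjoint_thick_thin (x : V) : Disjoint (thick G x) (thin G x) :=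
  (Finset.disjoint_filter_filter_not _ _ _).symm

theorem nb_far (x v : V) : nb G (far G x) v = nb G (thick G x) v + nb G (thin G x) v := by
  classical
  rw [← nb_union (disjoint_thick_thin x), thick_union_thin]

theorem sum_far {M : Type*} [AddCommMonoid M] (x : V) (f : V → M) :
    ∑ v ∈ far G x, f v = ∑ v ∈ thick G x, f v + ∑ v ∈ thin G x, f v := by
  classical
  rw [← Finset.sum_union (disjoint_thick_thin x), thick_union_thin]

theorem dg_of_mem_thick {x v : V} (h : v ∈ thick G x) :
    dg G v = nb G (nbhd G x) v + nb G (thick G x) v + nb G (thin G x) v := by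
  rw [dg_of_mem_far (mem_thick.1 h).1, nb_far, add_assoc]

theorem dg_of_mem_thin {x v : V} (h : v ∈ thin G x) :
    dg G v = 1 + nb G (thick G x) v + nb G (thin G x) v := by
  rw [dg_of_mem_far (mem_thin.1 h).1, nb_far, (mem_thin.1 h).2, add_assoc]

/-- The edge count around a vertex of degree three. -/
theorem edges_of_dg_three {x : V} (hx : dg G x = 3) :
    (2 * G.edgeSet.ncard + 14 : ℤ) = 5 * Fintype.card V +
      ∑ s ∈ nbhd G x, (nb G (nbhd G x) s : ℤ) +
      (∑ v ∈ thick G x, (2 * nb G (nbhd G x) v + nb G (thick G x) v - 5 : ℤ) +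
      ∑ v ∈ thin G x, (2 * nb G (thick G x) v + nb G (thin G x) v - 3 : ℤ)) := by
  have h1 := two_mul_edges (G := G) x
  have h2 := card_eq_nbhd_far (G := G) x
  have h3 : ((far G x).card : ℤ) = (thick G x).card + (thin G x).card := by
    have := sum_far (G := G) x (fun _ => (1 : ℤ))
    simpa using this
  -- Edges between thick and thin vertices are charged to their thin ends; hence the coefficient 2
  -- in the thin terms.
  have h4 := sum_nb_comm (G := G) (thick G x) (thin G x)
  have h5 : ∑ v ∈ far G x, (dg G v + nb G (nbhd G x) v : ℤ) =
      ∑ v ∈ thick G x, (2 * nb G (nbhd G x) v + nb G (thick G x) v + nb G (thin G x) v : ℤ) +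
      ∑ v ∈ thin G x, (2 + nb G (thick G x) v + nb G (thin G x) v : ℤ) := by
    rw [sum_far]
    congr 1
    · refine Finset.sum_congr rfl fun v hv => ?_
      rw [dg_of_mem_thick hv]
      push_cast
      ring
    · refine Finset.sum_congr rfl fun v hv => ?_
      rw [dg_of_mem_thin hv, (mem_thin.1 hv).2]
      push_cast
      ring
  zify at h1 h2 h4
  simp only [Finset.sum_add_distrib, Finset.sum_sub_distrib, Finset.sum_const, nsmul_eq_mul,
    ← Finset.mul_sum] at *
  rw [hx] at h1 h2
  push_cast at *
  linarith

theorem exists_third_of_dg_three {v a b : V} (hd : dg G v = 3) (ha : G.Adj v a) (hb : G.Adj v b)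
    (hab : a ≠ b) : ∃ c, a ≠ c ∧ b ≠ c ∧ ∀ u, G.Adj v u ↔ u = a ∨ u = b ∨ u = c := by
  obtain ⟨p, q, r, hpq, hpr, hqr, h⟩ := exists_of_dg_three hd
  rcases (h a).1 ha with rfl | rfl | rfl <;> rcases (h b).1 hb with rfl | rfl | rfl
  · exact absurd rfl hab
  · exact ⟨r, hpr, hqr, h⟩
  · exact ⟨q, hpq, hqr.symm, fun u => by rw [h]; tauto⟩
  · exact ⟨r, hqr, hpr, fun u => by rw [h]; tauto⟩
  · exact absurd rfl hab
  · exact ⟨p, hpq.symm, hpr.symm, fun u => by rw [h]; tauto⟩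
  · exact ⟨q, hqr.symm, hpq, fun u => by rw [h]; tauto⟩
  · exact ⟨p, hpr.symm, hpq.symm, fun u => by rw [h]; tauto⟩
  · exact absurd rfl hab

theorem sum_nbhd_three {x s₁ s₂ s₃ : V} (hS : ∀ u, G.Adj x u ↔ u = s₁ ∨ u = s₂ ∨ u = s₃)
    (h12 : s₁ ≠ s₂) (h13 : s₁ ≠ s₃) (h23 : s₂ ≠ s₃) {M : Type*} [AddCommMonoid M] (f : V → M) :
    ∑ s ∈ nbhd G x, f s = f s₁ + f s₂ + f s₃ := by
  classical
  have : nbhd G x = {s₁, s₂, s₃} := by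
    ext u
    simp [hS]
  rw [this, Finset.sum_insert (by simp [*]), Finset.sum_insert (by simp [*]),
    Finset.sum_singleton, add_assoc]

theorem nb_nbhd_three {x s₁ s₂ s₃ : V} (hS : ∀ u, G.Adj x u ↔ u = s₁ ∨ u = s₂ ∨ u = s₃)
    (h12 : s₁ ≠ s₂) (h13 : s₁ ≠ s₃) (h23 : s₂ ≠ s₃) [DecidableRel G.Adj] (v : V) :
    nb G (nbhd G x) v = (if G.Adj v s₁ then 1 else 0) + (if G.Adj v s₂ then 1 else 0) +
      (if G.Adj v s₃ then 1 else 0) := by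
  rw [nb_eq_sum, sum_nbhd_three hS h12 h13 h23]

/-- Every far vertex is linked to `x` with itself as hub; so it has an edge in its neighbourhood,
hence degree at least 4, and two neighbours next to `x`. A contribution of 6 from each suffices once
there are five far vertices; fewer are handled by counting from `a`, `b`, `c`. -/
theorem three_of_independent (hG : Sat G) {x : V} (hx : dg G x = 3) (hmin : ∀ v, 3 ≤ dg G v)
    (hn : 6 ≤ Fintype.card V) (hE : ∀ y a b, dg G y = 3 → G.Adj y a → G.Adj y b → ¬ G.Adj a b) :
    5 * Fintype.card V ≤ 2 * G.edgeSet.ncard + 9 := by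
  have h1 := two_mul_edges (G := G) x
  have h2 := card_eq_nbhd_far (G := G) x
  have key : ∀ v ∈ far G x, ∃ a b r, a ≠ b ∧ G.Adj x a ∧ G.Adj x b ∧ G.Adj v a ∧ G.Adj v b ∧
      G.Adj r a ∧ G.Adj r b ∧ G.Adj r v := by
    intro v hv
    rcases hG.far_cases hv with ⟨w, p, r, k1, k2, k3, -⟩ |
              ⟨a, b, r, hab, k1, k2, k3, k4, k5, k6, -⟩ | h
    · exact absurd k3 (hE x w p hx k1 k2)
    · exact absurd k6 (hE x r a hx k3 k1)
    · exact h
  have d4 : ∀ v ∈ far G x, 4 ≤ dg G v := by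
    intro v hv
    obtain ⟨a, b, r, -, -, -, k3, -, k5, -, k7⟩ := key v hv
    have := hmin v
    have : dg G v ≠ 3 := fun h => hE v r a h k7.symm k3 k5
    omega
  have n2 : ∀ v ∈ far G x, 2 ≤ nb G (nbhd G x) v := by
    intro v hv
    obtain ⟨a, b, r, hab, k1, k2, k3, k4, -⟩ := key v hv
    exact two_le_nb.2 ⟨a, by simpa, b, by simpa, hab, k3, k4⟩
  have hd := Finset.sum_le_sum d4
  have hnb := Finset.sum_le_sum n2
  rw [Finset.sum_const, smul_eq_mul] at hd hnb
  rw [Finset.sum_add_distrib] at h1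
  by_cases h5 : 5 ≤ (far G x).card
  · omega
  have hcomm := sum_nb_comm (G := G) (nbhd G x) (far G x)
  obtain ⟨v, hv⟩ : (far G x).Nonempty := Finset.card_pos.1 (by omega)
  obtain ⟨a, b, r, hab, xa, xb, va, vb, ra, rb, rv⟩ := key v hv
  obtain ⟨c, hac, hbc, hS⟩ := exists_third_of_dg_three hx xa xb hab
  have xc : G.Adj x c := by simp [hS]
  rw [sum_nbhd_three hS hab hac hbc] at hcomm
  have zS : ∀ s, G.Adj x s → nb G (nbhd G x) s = 0 := fun s hs =>
    nb_eq_zero.2 fun u hu => hE x s u hx hs (mem_nbhd.1 hu)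
  -- `r` and `v` are adjacent neighbours of `a`, so `a` does not have degree 3.
  have na : 3 ≤ nb G (far G x) a := by
    have := dg_of_adj xa
    have := zS a xa
    have := hmin a
    have : dg G a ≠ 3 := fun h => hE a r v h ra.symm va.symm rv
    omega
  have nb' : 3 ≤ nb G (far G x) b := by
    have := dg_of_adj xb
    have := zS b xb
    have := hmin b
    have : dg G b ≠ 3 := fun h => hE b r v h rb.symm vb.symm rv
    omega
  have hdc := dg_of_adj xc
  have hzc := zS c xc
  have hmc := hmin c
  by_cases h3 : (far G x).card ≤ 3
  · omega
  by_cases hc3 : 3 ≤ nb G (far G x) c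
  · omega
  -- two far neighbours of `c` are adjacent to all neighbours of `x`
  have hc : dg G c = 3 := by omega
  obtain ⟨v₁, hv₁, v₂, hv₂, hne, c1, c2⟩ := two_le_nb.1 (by omega : 2 ≤ nb G (far G x) c)
  have full : ∀ w ∈ far G x, G.Adj c w → 3 ≤ nb G (nbhd G x) w := by
    intro w hw cw
    obtain ⟨a', b', r', hab', xa', xb', wa, wb, ra', rb', rw'⟩ := key w hw
    have ha : a' ≠ c := fun h => hE c r' w hc (h ▸ ra'.symm) cw rw'
    have hb : b' ≠ c := fun h => hE c r' w hc (h ▸ rb'.symm) cw rw'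
    exact three_le_nb (mem_nbhd.2 xa') (mem_nbhd.2 xb') (mem_nbhd.2 xc) hab' ha hb wa wb cw.symm
  have e1 := full v₁ hv₁ c1
  have e2 := full v₂ hv₂ c2
  have e3 : ∑ w ∈ far G x, (nb G (nbhd G x) w - 2) + ∑ w ∈ far G x, 2 =
      ∑ w ∈ far G x, nb G (nbhd G x) w := by
    rw [← Finset.sum_add_distrib]
    exact Finset.sum_congr rfl fun w hw => Nat.sub_add_cancel (n2 w hw)
  have e4 := pair_le_sum (f := fun w => nb G (nbhd G x) w - 2) hv₁ hv₂ hne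
  rw [Finset.sum_const, smul_eq_mul] at e3
  omega

/-- Here τ ≥ 2, so the thick and thin terms of `edges_of_dg_three` must yield 3 more. They are all
nonnegative because every far vertex has a thick neighbour; the gain comes from the two or more far
neighbours of `s₃`, which are all thick. -/
theorem three_of_edge (hG : Sat G) {x s₁ s₂ s₃ : V} (hx : dg G x = 3) (hmin : ∀ v, 3 ≤ dg G v)
    (hP : NoPathInNbhd G 3)
    (hS : ∀ u, G.Adj x u ↔ u = s₁ ∨ u = s₂ ∨ u = s₃)
    (h12 : s₁ ≠ s₂) (h13 : s₁ ≠ s₃) (h23 : s₂ ≠ s₃) (a12 : G.Adj s₁ s₂) :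
    5 * Fintype.card V ≤ 2 * G.edgeSet.ncard + 9 := by
  classical
  have hid := edges_of_dg_three hx
  rw [sum_nbhd_three hS h12 h13 h23] at hid
  have x1 : G.Adj x s₁ := by simp [hS]
  have x2 : G.Adj x s₂ := by simp [hS]
  have x3 : G.Adj x s₃ := by simp [hS]
  have n13 : ¬ G.Adj s₁ s₃ := hP x s₂ s₁ s₃ hx x2 x1 x3 h23 a12
  have n23 : ¬ G.Adj s₂ s₃ := hP x s₁ s₂ s₃ hx x1 x2 x3 h13 a12.symm
  have n1 : 1 ≤ nb G (nbhd G x) s₁ := nb_pos.2 ⟨s₂, by simpa, a12⟩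
  have n2 : 1 ≤ nb G (nbhd G x) s₂ := nb_pos.2 ⟨s₁, by simpa, a12.symm⟩
  have n3 : nb G (nbhd G x) s₃ = 0 := nb_eq_zero.2 fun u hu => by
    rw [mem_nbhd, hS] at hu
    rcases hu with rfl | rfl | rfl
    exacts [fun h => n13 h.symm, fun h => n23 h.symm, G.irrefl]
  have hnbS := nb_nbhd_three (G := G) hS h12 h13 h23
  -- edges among the neighbours of `x`
  have hSS : ∀ w p, G.Adj x w → G.Adj x p → G.Adj w p →
      (w = s₁ ∧ p = s₂) ∨ (w = s₂ ∧ p = s₁) := by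
    intro w p hw hp hwp
    rw [hS] at hw hp
    rcases hw with rfl | rfl | rfl <;> rcases hp with rfl | rfl | rfl <;>
      first
      | exact Or.inl ⟨rfl, rfl⟩
      | exact Or.inr ⟨rfl, rfl⟩
      | exact absurd hwp G.irrefl
      | exact absurd hwp n13
      | exact absurd hwp n23
      | exact absurd hwp.symm n13
      | exact absurd hwp.symm n23
  have mem2 : ∀ v, v ≠ x → ¬ G.Adj x v → ∀ s t, G.Adj x s → G.Adj x t → s ≠ t → G.Adj v s →
      G.Adj v t → v ∈ thick G x := by
    intro v h1 h2 s t hs ht hst hvs hvt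
    rw [hG.mem_thick_iff, mem_far]
    exact ⟨⟨h1, h2⟩, two_le_nb.2 ⟨s, by simpa, t, by simpa, hst, hvs, hvt⟩⟩
  -- every far vertex has a thick neighbour, of one of two kinds
  have key : ∀ v ∈ far G x,
      (∃ r ∈ thick G x, (G.Adj v s₁ ∨ G.Adj v s₂) ∧ G.Adj r s₁ ∧ G.Adj r s₂ ∧ G.Adj v r) ∨
      (∃ r ∈ thick G x, ∃ a b, a ≠ b ∧ G.Adj x a ∧ G.Adj x b ∧ G.Adj v a ∧ G.Adj v b ∧
        G.Adj r a ∧ G.Adj r b ∧ G.Adj v r) := by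
    intro v hv
    have hv' := mem_far.1 hv
    rcases hG.far_cases hv with ⟨w, p, r, k1, k2, k3, k4, k5, k6, k7⟩ |
      ⟨a, b, r, hab, k1, k2, k3, k4, k5, k6, k7⟩ | ⟨a, b, r, hab, k1, k2, k3, k4, k5, k6, k7⟩
    · left
      have hrx : r ≠ x := fun h => hv'.2 (h ▸ k7)
      have hr1 : G.Adj r s₁ ∧ G.Adj r s₂ ∧ (G.Adj v s₁ ∨ G.Adj v s₂) := by
        rcases hSS w p k1 k2 k3 with ⟨rfl, rfl⟩ | ⟨rfl, rfl⟩
        · exact ⟨k5, k6, Or.inl k4⟩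
        · exact ⟨k6, k5, Or.inr k4⟩
      have hxr : ¬ G.Adj x r := by
        intro h
        rw [hS] at h
        rcases h with rfl | rfl | rfl
        exacts [G.irrefl hr1.1, G.irrefl hr1.2.1, n13 hr1.1.symm]
      exact ⟨r, mem2 r hrx hxr s₁ s₂ x1 x2 h12 hr1.1 hr1.2.1, hr1.2.2, hr1.1, hr1.2.1, k7.symm⟩
    · exfalso
      have e1 := hSS r a k3 k1 k6
      have e2 := hSS r b k3 k2 k7
      rcases e1 with ⟨rfl, rfl⟩ | ⟨rfl, rfl⟩ <;> rcases e2 with ⟨e, rfl⟩ | ⟨e, rfl⟩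
      exacts [hab rfl, h12 e, h12 e.symm, hab rfl]
    · right
      have hrx : r ≠ x := fun h => hv'.2 (h ▸ k7)
      have hxr : ¬ G.Adj x r := by
        intro h
        have e1 := hSS r a h k1 k5
        have e2 := hSS r b h k2 k6
        rcases e1 with ⟨rfl, rfl⟩ | ⟨rfl, rfl⟩ <;> rcases e2 with ⟨e, rfl⟩ | ⟨e, rfl⟩
        exacts [hab rfl, h12 e, h12 e.symm, hab rfl]
      exact ⟨r, mem2 r hrx hxr a b k1 k2 hab k5 k6, a, b, hab, k1, k2, k3, k4, k5, k6, k7.symm⟩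
  -- every thin vertex has a neighbour adjacent to both `s₁` and `s₂`, and is not adjacent to `s₃`
  have keyT : ∀ v ∈ thin G x, ∃ r ∈ thick G x, G.Adj r s₁ ∧ G.Adj r s₂ ∧ G.Adj v r := by
    intro v hv
    rw [mem_thin] at hv
    rcases key v hv.1 with ⟨r, hr, -, h1, h2, h3⟩ | ⟨r, hr, a, b, hab, k1, k2, k3, k4, -⟩
    · exact ⟨r, hr, h1, h2, h3⟩
    · exact absurd hv.2 (by
        have : 2 ≤ nb G (nbhd G x) v := two_le_nb.2 ⟨a, by simpa, b, by simpa, hab, k3, k4⟩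
        omega)
  have thin3 : ∀ v ∈ thin G x, ¬ G.Adj v s₃ := by
    intro v hv h3
    rw [mem_thin] at hv
    obtain ⟨w, p, q, hw, hp, hwp, hvw, -, -, -, -, -, hu⟩ := hG.parent hv.1 hv.2
    have := hu s₃ x3 h3
    rcases hSS w p hw hp hwp with ⟨rfl, -⟩ | ⟨rfl, -⟩
    · exact h13 this.symm
    · exact h23 this.symm
  have fT : ∀ v ∈ thin G x, (0 : ℤ) ≤ 2 * nb G (thick G x) v + nb G (thin G x) v - 3 := by
    intro v hv
    obtain ⟨r, hr, -, -, h3⟩ := keyT v hv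
    have h1 : 1 ≤ nb G (thick G x) v := nb_pos.2 ⟨r, hr, h3⟩
    have h2 := dg_of_mem_thin hv
    have h3 := hmin v
    omega
  have qQ : ∀ v ∈ thick G x, 1 ≤ nb G (thick G x) v := by
    intro v hv
    rcases key v (mem_thick.1 hv).1 with ⟨r, hr, -, -, -, h⟩ | ⟨r, hr, a, b, -, -, -, -, -, -, -, h⟩
    · exact nb_pos.2 ⟨r, hr, h⟩
    · exact nb_pos.2 ⟨r, hr, h⟩
  have q2 : ∀ v ∈ thick G x, 2 ≤ nb G (nbhd G x) v := fun v hv => (hG.mem_thick_iff.1 hv).2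
  have fQ : ∀ v ∈ thick G x,
      (0 : ℤ) ≤ 2 * nb G (nbhd G x) v + nb G (thick G x) v - 5 := by
    intro v hv
    have := qQ v hv
    have := q2 v hv
    omega
  -- the neighbours of `x₃`
  have far3 : ∀ v, v ∈ far G x ∧ G.Adj s₃ v ↔ v ∈ thick G x ∧ G.Adj s₃ v := by
    intro v
    refine and_congr_left fun h3 => ⟨fun h => ?_, fun h => (mem_thick.1 h).1⟩
    rw [mem_thick]
    exact ⟨h, fun h1 => thin3 v (mem_thin.2 ⟨h, h1⟩) h3.symm⟩
  have hs3 : 2 ≤ nb G (thick G x) s₃ := by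
    have h1 := dg_of_adj x3
    have h2 := hmin s₃
    have h3 : nb G (thick G x) s₃ = nb G (far G x) s₃ := by
      unfold nb
      congr 1
      ext v
      simp only [Finset.mem_filter]
      exact (far3 v).symm
    omega
  -- common neighbours of `s₁` and `s₂` have a neighbour of the same kind
  have keyM : ∀ v ∈ thick G x, G.Adj v s₁ → G.Adj v s₂ → ¬ G.Adj v s₃ →
      ∃ r ∈ thick G x, G.Adj r s₁ ∧ G.Adj r s₂ ∧ G.Adj v r := by
    intro v hv v1 v2 v3
    rcases key v (mem_thick.1 hv).1 with ⟨r, hr, -, h1, h2, h3⟩ |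
      ⟨r, hr, a, b, hab, k1, k2, k3, k4, k5, k6, k7⟩
    · exact ⟨r, hr, h1, h2, h3⟩
    · rw [hS] at k1 k2
      refine ⟨r, hr, ?_⟩
      rcases k1 with rfl | rfl | rfl <;> rcases k2 with rfl | rfl | rfl <;>
        first
        | exact absurd rfl hab
        | exact absurd k3 v3
        | exact absurd k4 v3
        | exact ⟨k5, k6, k7⟩
        | exact ⟨k6, k5, k7⟩
  -- a neighbour of `s₃` of degree three has a neighbour among those vertices
  have key3 : ∀ a ∈ thick G x, G.Adj a s₃ → dg G a = 3 →
      ∃ b ∈ thick G x, G.Adj b s₁ ∧ G.Adj b s₂ ∧ ¬ G.Adj b s₃ ∧ G.Adj a b := by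
    intro a ha a3 hd
    rcases key a (mem_thick.1 ha).1 with ⟨r, hr, h0, h1, h2, h3⟩ |
      ⟨r, hr, p, q, hpq, k1, k2, k3, k4, k5, k6, k7⟩
    · refine ⟨r, hr, h1, h2, fun r3 => ?_, h3⟩
      rcases h0 with h0 | h0
      · exact hP a s₁ r s₃ hd h0 h3 a3 h13 h1 r3
      · exact hP a s₂ r s₃ hd h0 h3 a3 h23 h2 r3
    · exact absurd k6 (hP a p r q hd k3 k7 k4 hpq k5)
  suffices hmain : (3 : ℤ) ≤
      ∑ v ∈ thick G x, (2 * nb G (nbhd G x) v + nb G (thick G x) v - 5 : ℤ) +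
      ∑ v ∈ thin G x, (2 * nb G (thick G x) v + nb G (thin G x) v - 3 : ℤ) by
    have : (5 * Fintype.card V : ℤ) ≤ 2 * G.edgeSet.ncard + 9 := by omega
    exact_mod_cast this
  have hQ0 := Finset.sum_nonneg fQ
  have hT0 := Finset.sum_nonneg fT
  by_cases h123 : ∃ u ∈ thick G x, G.Adj u s₁ ∧ G.Adj u s₂ ∧ G.Adj u s₃
  · obtain ⟨u, hu, u1, u2, u3⟩ := h123
    have hu3 : 3 ≤ nb G (nbhd G x) u := by
      rw [hnbS]
      simp [u1, u2, u3]
    have huQ := qQ u hu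
    obtain ⟨a, ha, b, hb, hab, sa, sb⟩ := two_le_nb.1 hs3
    have : ∃ a ∈ thick G x, a ≠ u ∧ G.Adj s₃ a := by
      by_cases h : a = u
      · exact ⟨b, hb, fun e => hab (h.trans e.symm), sb⟩
      · exact ⟨a, ha, h, sa⟩
    clear hab sa sb ha hb
    obtain ⟨a, ha, hau, sa⟩ := this
    -- The term of `u` is at least 6 + 1 - 5 = 2, so one more unit at another vertex is enough.
    have hpos : ∀ c ∈ thick G x, c ≠ u →
        (1 : ℤ) ≤ 2 * nb G (nbhd G x) c + nb G (thick G x) c - 5 →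
        (3 : ℤ) ≤ ∑ v ∈ thick G x, (2 * nb G (nbhd G x) v + nb G (thick G x) v - 5 : ℤ) +
      ∑ v ∈ thin G x, (2 * nb G (thick G x) v + nb G (thin G x) v - 3 : ℤ) := by
      intro c hc hcu hc1
      have := sum_ge_of_pair fQ hu hc hcu.symm
      omega
    by_cases ha1 : (1 : ℤ) ≤ 2 * nb G (nbhd G x) a + nb G (thick G x) a - 5
    · exact hpos a ha hau ha1
    have ha2 := q2 a ha
    have haQ := qQ a ha
    -- When `a` itself yields nothing, the unit is found at a thin neighbour of `a`, which then has
    -- two thick neighbours, or, if `a` has degree 3, at the vertex `b` given by `key3`.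
    by_cases haT : 1 ≤ nb G (thin G x) a
    · obtain ⟨v, hv, hav⟩ := nb_pos.1 haT
      obtain ⟨r, hr, r1, r2, hvr⟩ := keyT v hv
      have hra : a ≠ r := by
        rintro rfl
        have : 3 ≤ nb G (nbhd G x) a := by
          rw [hnbS]
          simp [r1, r2, sa.symm]
        omega
      have hv2 : 2 ≤ nb G (thick G x) v := two_le_nb.2 ⟨a, ha, r, hr, hra, hav.symm, hvr⟩
      have h1 := sum_ge_of_mem fT hv
      have h2 := sum_ge_of_mem fQ hu
      omega
    · have hd := dg_of_mem_thick ha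
      obtain ⟨b, hb, b1, b2, b3, hab⟩ := key3 a ha sa.symm (by omega)
      obtain ⟨r, hr, r1, r2, hbr⟩ := keyM b hb b1 b2 b3
      have hra : a ≠ r := by
        rintro rfl
        have : 3 ≤ nb G (nbhd G x) a := by
          rw [hnbS]
          simp [r1, r2, sa.symm]
        omega
      have hb2 : 2 ≤ nb G (thick G x) b := two_le_nb.2 ⟨a, ha, r, hr, hra, hab.symm, hbr⟩
      have := q2 b hb
      exact hpos b hb (fun e => b3 (e ▸ u3)) (by omega)
  · push Not at h123
    -- split the thick vertices according to whether they are adjacent to `s₃`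
    set R := (thick G x).filter fun v => G.Adj s₃ v with hR
    set M := (thick G x).filter fun v => ¬ G.Adj s₃ v with hM
    have mR : ∀ v, v ∈ R ↔ v ∈ thick G x ∧ G.Adj s₃ v := fun v => by simp [hR]
    have mM : ∀ v, v ∈ M ↔ v ∈ thick G x ∧ ¬ G.Adj s₃ v := fun v => by simp [hM]
    have hdisj : Disjoint M R := (Finset.disjoint_filter_filter_not _ _ _).symm
    have hunion : M ∪ R = thick G x := by
      rw [Finset.union_comm]
      exact Finset.filter_union_filter_not_eq _ _
    have nbQ : ∀ v, nb G (thick G x) v = nb G M v + nb G R v := fun v => by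
      rw [← nb_union hdisj, hunion]
    have M12 : ∀ v ∈ M, G.Adj v s₁ ∧ G.Adj v s₂ := by
      intro v hv
      rw [mM] at hv
      have := q2 v hv.1
      have h3 : ¬ G.Adj v s₃ := fun h => hv.2 h.symm
      rw [hnbS, if_neg h3] at this
      split_ifs at this with h1 h2
      · exact ⟨h1, h2⟩
      all_goals omega
    have memM : ∀ v ∈ thick G x, G.Adj v s₁ → G.Adj v s₂ → v ∈ M := by
      intro v hv h1 h2
      rw [mM]
      exact ⟨hv, fun h => h123 v hv h1 h2 h.symm⟩
    have R2 : ∀ v ∈ R, nb G (nbhd G x) v = 2 := by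
      intro v hv
      rw [mR] at hv
      have h2 := q2 v hv.1
      rw [hnbS, if_pos hv.2.symm] at h2 ⊢
      split_ifs at h2 ⊢ with h4 h5
      · exact absurd hv.2.symm (h123 v hv.1 h4 h5)
      all_goals omega
    have hcR : R.card = nb G (thick G x) s₃ := by
      unfold nb
      rw [hR]
    -- the lower bound by a sum over `R`
    have hbound : ∑ a ∈ R, (nb G M a + dg G a - 3 : ℤ) ≤
        ∑ v ∈ thick G x, (2 * nb G (nbhd G x) v + nb G (thick G x) v - 5 : ℤ) +
        ∑ v ∈ thin G x, (2 * nb G (thick G x) v + nb G (thin G x) v - 3 : ℤ) := by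
      -- Vertices of `M` and thin vertices all have a neighbour in `M`; what is left of their terms
      -- covers their edges to `R`, and is credited to `R`.
      have b1 : ∑ v ∈ M, (nb G R v : ℤ) ≤
          ∑ v ∈ M, (2 * nb G (nbhd G x) v + nb G (thick G x) v - 5 : ℤ) := by
        refine Finset.sum_le_sum fun v hv => ?_
        have hv' := (mM v).1 hv
        obtain ⟨r, hr, r1, r2, hvr⟩ := keyM v hv'.1 (M12 v hv).1 (M12 v hv).2
          fun h => hv'.2 h.symm
        have : 1 ≤ nb G M v := nb_pos.2 ⟨r, memM r hr r1 r2, hvr⟩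
        have := nbQ v
        have := q2 v hv'.1
        omega
      have b2 : ∑ v ∈ thin G x, (nb G R v : ℤ) ≤
          ∑ v ∈ thin G x, (2 * nb G (thick G x) v + nb G (thin G x) v - 3 : ℤ) := by
        refine Finset.sum_le_sum fun v hv => ?_
        obtain ⟨r, hr, r1, r2, hvr⟩ := keyT v hv
        have : 1 ≤ nb G M v := nb_pos.2 ⟨r, memM r hr r1 r2, hvr⟩
        have := nbQ v
        have := fT v hv
        omega
      have b3 : ∑ a ∈ R, (nb G M a + dg G a - 3 : ℤ) =
          ∑ a ∈ R, (nb G M a : ℤ) + ∑ a ∈ R, (nb G (thin G x) a : ℤ) +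
          ∑ v ∈ R, (2 * nb G (nbhd G x) v + nb G (thick G x) v - 5 : ℤ) := by
        rw [← Finset.sum_add_distrib, ← Finset.sum_add_distrib]
        refine Finset.sum_congr rfl fun v hv => ?_
        rw [dg_of_mem_thick ((mR v).1 hv).1, R2 v hv]
        push_cast
        ring
      have b4 := sum_nb_comm (G := G) M R
      have b5 := sum_nb_comm (G := G) (thin G x) R
      zify at b4 b5
      rw [b3, ← b4, ← b5, ← hunion, Finset.sum_union hdisj, hunion]
      linarith
    have gain : ∀ a ∈ R, (1 : ℤ) ≤ nb G M a + dg G a - 3 := by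
      intro a ha
      have ha' := (mR a).1 ha
      have := hmin a
      by_cases hd : dg G a = 3
      · obtain ⟨b, hb, b1, b2, b3, hab⟩ := key3 a ha'.1 ha'.2.symm hd
        have : 1 ≤ nb G M a := nb_pos.2 ⟨b, memM b hb b1 b2, hab⟩
        omega
      · omega
    by_contra hlt
    have hge := Finset.sum_le_sum gain
    rw [Finset.sum_const, nsmul_eq_mul, mul_one] at hge
    -- Every vertex of `R` gains at least 1, so failure of the bound means two vertices of gain
    -- exactly 1.
    have hc2 : R.card = 2 := by omega
    have gain1 : ∀ a ∈ R, (nb G M a + dg G a - 3 : ℤ) = 1 := by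
      intro a ha
      have h0 := sum_ge_of_mem (f := fun a => (nb G M a + dg G a - 3 - 1 : ℤ))
        (fun v hv => by have := gain v hv; omega) ha
      rw [Finset.sum_sub_distrib, Finset.sum_const, hc2] at h0
      have := gain a ha
      simp only [nsmul_eq_mul] at h0
      push_cast at h0
      omega
    obtain ⟨a, b, hab, hRab⟩ := Finset.card_eq_two.1 hc2
    have haR : a ∈ R := by simp [hRab]
    have hbR : b ∈ R := by simp [hRab]
    have N3 : ∀ u, G.Adj s₃ u → u = x ∨ u = a ∨ u = b := by
      intro u hu
      by_cases hux : u = x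
      · exact Or.inl hux
      · have hxu : ¬ G.Adj x u := by
          intro h
          exact (nb_eq_zero.1 n3) u (by simpa) hu
        have : u ∈ R := (mR u).2 ((far3 u).1 ⟨mem_far.2 ⟨hux, hxu⟩, hu⟩)
        rw [hRab] at this
        exact Or.inr (by simpa using this)
    have hMne : ∃ q, q ∈ M := by
      by_contra hcon
      push Not at hcon
      have z : ∀ v, nb G M v = 0 := fun v => nb_eq_zero.2 fun u hu => absurd hu (hcon u)
      have h1 := gain1 a haR
      have h2 := dg_of_mem_thick ((mR a).1 haR).1
      have h3 := R2 a haR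
      have h4 := nbQ a
      have h5 := z a
      have h6 : nb G R a ≤ 1 := by
        by_contra h
        obtain ⟨p, hp, q, hq, hpq, ap, aq⟩ := two_le_nb.1 (by omega : 2 ≤ nb G R a)
        rw [hRab] at hp hq
        simp only [Finset.mem_insert, Finset.mem_singleton] at hp hq
        rcases hp with rfl | rfl
        · exact G.irrefl ap
        · rcases hq with rfl | rfl
          · exact G.irrefl aq
          · exact hpq rfl
      obtain ⟨v, hv, -⟩ := nb_pos.1 (by omega : 0 < nb G (thin G x) a)
      obtain ⟨r, hr, r1, r2, -⟩ := keyT v hv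
      exact hcon r (memM r hr r1 r2)
    -- A rim link from `s₃` to `q` would have its hub in `R`, with degree at least 4 and a neighbour
    -- in `M`, hence gain 2. A link with hub `s₃` does not fit into N(s₃) = {x, a, b}. The link with
    -- hub `q` makes `a` and `b` common neighbours.
    have both : ∀ q ∈ M, G.Adj a q := by
      intro q hq
      have hq' := (mM q).1 hq
      have hqx : ¬ G.Adj x q := (mem_far.1 (mem_thick.1 hq'.1).1).2
      have hne : s₃ ≠ q := fun h => hqx (h ▸ x3)
      have four : ∀ h ∈ R, G.Adj h q → 4 ≤ dg G h → False := by
        intro h hh hhq h4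
        have : 1 ≤ nb G M h := nb_pos.2 ⟨q, hq, hhq⟩
        have := gain1 h hh
        omega
      have xR : ∀ h ∈ R, ¬ G.Adj x h := fun h hh =>
        (mem_far.1 (mem_thick.1 ((mR h).1 hh).1).1).2
      rcases hG.link s₃ q hne hq'.2 with ⟨h, p, r, k1, k2, k3, k4, k5, k6, k7⟩ |
        ⟨c, d, r, hcd, k1, k2, k3, k4, k5, k6, k7⟩ | ⟨c, d, r, hcd, k1, k2, k3, k4, k5, k6, k7⟩
      · exfalso
        have hh : h ∈ R := by
          rcases N3 h k1.symm with rfl | rfl | rfl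
          · exact absurd k4 hqx
          · exact haR
          · exact hbR
        refine four h hh k4 ?_
        have hs : ({s₃, p, r, q} : Finset V).card = 4 := by
          have e1 : s₃ ≠ r := fun e => hq'.2 (e ▸ k7)
          have e2 : p ≠ q := fun e => hq'.2 (e ▸ k5)
          rw [Finset.card_insert_of_notMem, Finset.card_insert_of_notMem, Finset.card_pair k7.ne]
          · simp [k6.ne, e2]
          · simp [k5.ne, e1, hne]
        rw [← hs]
        apply le_dg_of_subset
        intro u hu
        simp only [Finset.mem_insert, Finset.mem_singleton] at hu
        rcases hu with rfl | rfl | rfl | rfl <;> assumption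
      · exfalso
        have hc : c ∈ R := by
          rcases N3 c k1 with rfl | rfl | rfl
          · exact absurd k4.symm hqx
          · exact haR
          · exact hbR
        have hd : d ∈ R := by
          rcases N3 d k2 with rfl | rfl | rfl
          · exact absurd k5.symm hqx
          · exact haR
          · exact hbR
        rcases N3 r k3 with rfl | rfl | rfl
        · exact xR c hc k6
        all_goals
          rw [hRab] at hc hd
          simp only [Finset.mem_insert, Finset.mem_singleton] at hc hd
          rcases hc with rfl | rfl <;> rcases hd with rfl | rfl <;>
            first
            | exact hcd rfl
            | exact G.irrefl k6
            | exact G.irrefl k7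
      · rcases N3 c k4 with rfl | rfl | rfl
        · exact absurd k1.symm hqx
        · exact k1.symm
        · rcases N3 d k5 with rfl | rfl | rfl
          · exact absurd k2.symm hqx
          · exact k2.symm
          · exact absurd rfl hcd
    obtain ⟨q, hq⟩ := hMne
    have hq' := (mM q).1 hq
    obtain ⟨r, hr, r1, r2, hqr⟩ := keyM q hq'.1 (M12 q hq).1 (M12 q hq).2 fun h => hq'.2 h.symm
    have hrM := memM r hr r1 r2
    have h2 : 2 ≤ nb G M a := two_le_nb.2 ⟨q, hq, r, hrM, hqr.ne, both q hq, both r hrM⟩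
    have := gain1 a haR
    have := hmin a
    omega

end MinDegreeThree

/-! ### Degree three: triangular neighbourhoods, by discharging in half units. -/

section Triangle

variable {V : Type u} [Fintype V] {G : SimpleGraph V}

/-- No vertex of degree three has a neighbourhood inducing a path. -/
def NoInducedPathInNbhd (G : SimpleGraph V) : Prop :=
  ∀ y a b c, dg G y = 3 → G.Adj y a → G.Adj y b → G.Adj y c → a ≠ c → G.Adj b a → G.Adj b c →
    G.Adj a c

/-- The payment, in half units, of a thin vertex to each of its neighbours. -/
noncomputable def pay (G : SimpleGraph V) (x v : V) : ℕ :=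
  if nb G (thick G x) v = 1 ∧ nb G (thin G x) v = 1 then 0
  else if nb G (thick G x) v = 2 ∧ nb G (thin G x) v = 0 then 1 else 2

open Classical in
/-- The total payment received by `q`. -/
noncomputable def income (G : SimpleGraph V) (x q : V) : ℕ :=
  ∑ v ∈ thin G x, if G.Adj v q then pay G x v else 0

/-- The thick vertices without thick neighbours. -/
noncomputable def lonely (G : SimpleGraph V) (x : V) : Finset V :=
  (thick G x).filter fun v => nb G (thick G x) v = 0

/-- The lonely vertices that do not receive a full unit. -/
noncomputable def needy (G : SimpleGraph V) (x : V) : Finset V :=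
  (lonely G x).filter fun v => income G x v ≤ 1

theorem mem_lonely {x q : V} : q ∈ lonely G x ↔ q ∈ thick G x ∧ nb G (thick G x) q = 0 := by
  simp only [lonely, Finset.mem_filter]

theorem mem_needy {x q : V} : q ∈ needy G x ↔ q ∈ lonely G x ∧ income G x q ≤ 1 := by
  simp only [needy, Finset.mem_filter]

theorem pay_le_income {x v q : V} (hv : v ∈ thin G x) (h : G.Adj v q) :
    pay G x v ≤ income G x q := by
  classical
  have := Finset.single_le_sum (f := fun v => if G.Adj v q then pay G x v else 0)
    (fun _ _ => Nat.zero_le _) hv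
  simp only [h, if_true] at this
  exact this

theorem pay_eq_zero {x v : V} :
    pay G x v = 0 ↔ nb G (thick G x) v = 1 ∧ nb G (thin G x) v = 1 := by
  unfold pay
  split_ifs <;> simp_all

theorem pay_eq_one {x v : V} :
    pay G x v = 1 ↔ nb G (thick G x) v = 2 ∧ nb G (thin G x) v = 0 := by
  unfold pay
  split_ifs <;> simp_all

/-- A closed description of a thin vertex that pays nothing. -/
theorem Sat.thin_of_pay_eq_zero (hG : Sat G) {x v q : V} (hv : v ∈ thin G x) (h0 : pay G x v = 0)
    (hq : q ∈ thick G x) (hvq : G.Adj v q) :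
    ∃ w v', G.Adj x w ∧ v' ∈ thin G x ∧ G.Adj w q ∧ G.Adj v w ∧ G.Adj v v' ∧ dg G v = 3 ∧
      ∀ u, G.Adj v u ↔ u = w ∨ u = q ∨ u = v' := by
  rw [pay_eq_zero] at h0
  have hd := dg_of_mem_thin hv
  obtain ⟨w, p, q', hw, hp, hwp, hvw, hq', hqw, hqp, hqv, h2, -⟩ :=
    hG.parent (mem_thin.1 hv).1 (mem_thin.1 hv).2
  obtain ⟨q₀, -, -, huq⟩ := nb_eq_one.1 h0.1
  have e : q' = q := (huq q' (hG.mem_thick_iff.2 ⟨hq', h2⟩) hqv.symm).trans (huq q hq hvq).symm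
  subst e
  obtain ⟨v', hv', hvv', -⟩ := nb_eq_one.1 h0.2
  have hwv' : w ≠ v' := by
    rintro rfl
    exact (mem_far.1 (mem_thin.1 hv').1).2 hw
  have hqv' : q' ≠ v' := by
    rintro rfl
    exact (mem_thick.1 hq).2 (mem_thin.1 hv').2
  have hd3 : dg G v = 3 := by omega
  exact ⟨w, v', hw, hv', hqw.symm, hvw, hvv', hd3,
    adj_iff_of_dg_three hd3 hvw hvq hvv' hqw.ne.symm hwv' hqv'⟩

theorem mem_parts {x v : V} : v = x ∨ G.Adj x v ∨ v ∈ thick G x ∨ v ∈ thin G x := by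
  rw [mem_thick, mem_thin, mem_far]
  tauto

variable {x : V}

/-- The neighbours of a lonely vertex. -/
theorem adj_lonely {q u : V} (hq : q ∈ lonely G x) (h : G.Adj q u) :
    G.Adj x u ∨ u ∈ thin G x := by
  rw [mem_lonely] at hq
  rcases mem_parts (G := G) (x := x) (v := u) with rfl | hu | hu | hu
  · exact absurd h.symm (mem_far.1 (mem_thick.1 hq.1).1).2
  · exact Or.inl hu
  · exact absurd h (nb_eq_zero.1 hq.2 u hu)
  · exact Or.inr hu

theorem thin_unique {v s t : V} (hv : v ∈ thin G x) (hs : G.Adj x s) (ht : G.Adj x t)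
    (hvs : G.Adj v s) (hvt : G.Adj v t) : s = t := by
  obtain ⟨w, -, -, h⟩ := nb_eq_one.1 (mem_thin.1 hv).2
  exact (h s (by simpa) hvs).trans (h t (by simpa) hvt).symm

theorem needy_pay {q v : V} (hq : q ∈ needy G x) (hv : v ∈ thin G x) (h : G.Adj v q) :
    pay G x v ≤ 1 := (pay_le_income hv h).trans (mem_needy.1 hq).2

/-- A payment of 1 requires having no thin neighbour, and a payment of 2 would end the need. -/
theorem needy_pay_zero {q v v' : V} (hq : q ∈ needy G x) (hv : v ∈ thin G x) (h : G.Adj v q)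
    (hv' : v' ∈ thin G x) (hvv' : G.Adj v v') : pay G x v = 0 := by
  have h1 := needy_pay hq hv h
  have h2 : nb G (thin G x) v ≠ 0 := fun h0 => nb_eq_zero.1 h0 v' hv' hvv'
  have h3 : pay G x v ≠ 1 := fun h3 => h2 (pay_eq_one.1 h3).2
  omega

theorem thick_unique {v p q : V} (h0 : pay G x v = 0) (hp : p ∈ thick G x) (hq : q ∈ thick G x)
    (hvp : G.Adj v p) (hvq : G.Adj v q) : p = q := by
  obtain ⟨w, -, -, h⟩ := nb_eq_one.1 (pay_eq_zero.1 h0).1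
  exact (h p hp hvp).trans (h q hq hvq).symm

theorem needy_thick {q : V} (hq : q ∈ needy G x) : q ∈ thick G x :=
  (mem_lonely.1 (mem_needy.1 hq).1).1

theorem needy_not_adj {p q : V} (hp : p ∈ needy G x) (hq : q ∈ needy G x) : ¬ G.Adj p q :=
  nb_eq_zero.1 (mem_lonely.1 (mem_needy.1 hp).1).2 q (needy_thick hq)

/-- Two needy vertices do not have the same two neighbours next to `x`. -/
theorem Sat.needy_eq (hG : Sat G) (hN : NoInducedPathInNbhd G)
    (hle : ∀ v ∈ far G x, nb G (nbhd G x) v ≤ 2) {p q s t : V} (hp : p ∈ needy G x)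
    (hq : q ∈ needy G x) (hs : G.Adj x s) (ht : G.Adj x t) (hst : s ≠ t) (ps : G.Adj p s)
    (pt : G.Adj p t) (qs : G.Adj q s) (qt : G.Adj q t) : p = q := by
  by_contra hpq
  have hnpq := needy_not_adj hp hq
  have only : ∀ y ∈ needy G x, G.Adj y s → G.Adj y t → ∀ u, G.Adj y u →
      u = s ∨ u = t ∨ u ∈ thin G x := by
    intro y hy ys yt u hu
    rcases adj_lonely (mem_needy.1 hy).1 hu with h | h
    · by_contra hcon
      push Not at hcon
      have := three_le_nb (G := G) (mem_nbhd.2 h) (mem_nbhd.2 hs) (mem_nbhd.2 ht) hcon.1 hcon.2.1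
        hst hu ys yt
      have := hle y (mem_thick.1 (needy_thick hy)).1
      omega
    · exact Or.inr (Or.inr h)
  have onlyp := only p hp ps pt
  have onlyq := only q hq qs qt
  -- no common thin neighbour
  have hcommon : ∀ h ∈ thin G x, G.Adj h p → ¬ G.Adj h q := by
    intro h hh hhp hhq
    have h1 := needy_pay hp hh hhp
    have h0 : pay G x h ≠ 0 := fun h0 =>
      hpq (thick_unique h0 (needy_thick hp) (needy_thick hq) hhp hhq)
    have h2 := pay_eq_one.1 (by omega : pay G x h = 1)
    obtain ⟨w, r, q', hw, hr, hwr, hhw, hq', hqw, hqr, hqh, h3, -⟩ :=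
      hG.parent (mem_thin.1 hh).1 (mem_thin.1 hh).2
    obtain ⟨a, -, b, -, -, -, -, hab⟩ := nb_eq_two.1 h2.1
    have hw' : w = s ∨ w = t := by
      have k0 := hab q' (hG.mem_thick_iff.2 ⟨hq', h3⟩) hqh.symm
      have k1 := hab p (needy_thick hp) hhp
      have k2 := hab q (needy_thick hq) hhq
      have k3 : q' = p ∨ q' = q := by
        rcases k0 with rfl | rfl <;> rcases k1 with rfl | rfl <;> rcases k2 with rfl | rfl <;> tauto
      have hwT : w ∉ thin G x := fun h => (mem_far.1 (mem_thin.1 h).1).2 hw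
      rcases k3 with rfl | rfl
      · have := onlyp w hqw
        tauto
      · have := onlyq w hqw
        tauto
    have hpw : G.Adj p w ∧ G.Adj q w := by
      rcases hw' with rfl | rfl
      · exact ⟨ps, qs⟩
      · exact ⟨pt, qt⟩
    have hd := dg_of_mem_thin hh
    -- `h` has degree 3 and its neighbours contain the path p w q, which cannot be induced; but
    -- lonely vertices are not adjacent.
    exact hnpq (hN h p w q (by omega) hhp hhw hhq hpq hpw.1.symm hpw.2.symm)
  -- no thin edge between neighbours of `p` and `q`
  have hedge : ∀ a ∈ thin G x, ∀ b ∈ thin G x, ∀ w, G.Adj a p → G.Adj b q → G.Adj a b →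
      G.Adj w p → G.Adj a w → G.Adj b w → False := by
    intro a ha b hb w hap hbq hab hwp haw hbw
    have ha0 := needy_pay_zero hp ha hap hb hab
    have hb0 := needy_pay_zero hq hb hbq ha hab.symm
    obtain ⟨w', v', -, -, -, -, -, hd, -⟩ := hG.thin_of_pay_eq_zero ha ha0 (needy_thick hp) hap
    have hpb : p ≠ b := by
      rintro rfl
      exact (mem_thick.1 (needy_thick hp)).2 (mem_thin.1 hb).2
    -- The path p w b around `a` is not induced; so `b` gets the two thick neighbours `p` and `q`,
    -- while a vertex paying 0 has only one.
    have := hN a p w b hd hap haw hab hpb hwp hbw.symm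
    exact hpq (thick_unique hb0 (needy_thick hp) (needy_thick hq) this.symm hbq)
  -- The two common neighbours in a hub link must be `s` and `t`; the third vertex is then thin and
  -- adjacent to both, which is one too many.
  have hub : ∀ p q, (∀ u, G.Adj p u → u = s ∨ u = t ∨ u ∈ thin G x) →
      (∀ h ∈ thin G x, G.Adj h p → ¬ G.Adj h q) → ¬ HubLink G p q := by
    rintro p q onlyp hcommon ⟨a, b, r, hab, k1, k2, k3, k4, k5, k6, k7⟩
    have ha : a = s ∨ a = t := by
      have := onlyp a k1
      have := fun h => hcommon a h k1.symm k4.symm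
      tauto
    have hb : b = s ∨ b = t := by
      have := onlyp b k2
      have := fun h => hcommon b h k2.symm k5.symm
      tauto
    have hr : r ∈ thin G x := by
      rcases onlyp r k3 with rfl | rfl | h
      · exfalso
        rcases ha with rfl | rfl
        · exact G.irrefl k6
        · rcases hb with rfl | rfl
          · exact G.irrefl k7
          · exact hab rfl
      · exfalso
        rcases ha with rfl | rfl
        · rcases hb with rfl | rfl
          · exact hab rfl
          · exact G.irrefl k7
        · exact G.irrefl k6
      · exact h
    have hxa : G.Adj x a := by rcases ha with rfl | rfl <;> assumption
    have hxb : G.Adj x b := by rcases hb with rfl | rfl <;> assumption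
    exact hab (thin_unique hr hxa hxb k6 k7)
  -- In a rim link the hub is `s` or `t`. Two thin rim vertices fall under `hedge`, a single thin
  -- one would have two neighbours next to `x`, and with none the three vertices `h`, `a`, `b` would
  -- all lie in {s, t}.
  rcases hG.link p q hpq hnpq with ⟨h, a, b, k1, k2, k3, k4, k5, k6, k7⟩ | h | h
  · have hh : h = s ∨ h = t := by
      have := onlyp h k1.symm
      have := fun h' => hcommon h h' k1 k4
      tauto
    have hxh : G.Adj x h := by rcases hh with rfl | rfl <;> assumption
    have ha := onlyp a k5
    have hb := onlyq b k7.symm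
    by_cases haT : a ∈ thin G x
    · by_cases hbT : b ∈ thin G x
      · exact hedge a haT b hbT h k5.symm k7 k6 k1 k2.symm k3.symm
      · have hxb : G.Adj x b := by rcases hb with rfl | rfl | h <;> [exact hs; exact ht; contradiction]
        exact k3.ne (thin_unique haT hxh hxb k2.symm k6)
    · have hxa : G.Adj x a := by rcases ha with rfl | rfl | h <;> [exact hs; exact ht; contradiction]
      by_cases hbT : b ∈ thin G x
      · exact k2.ne (thin_unique hbT hxh hxa k3.symm k6.symm)
      · have e1 := k2.ne
        have e2 := k3.ne
        have e3 := k6.ne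
        rcases hh with rfl | rfl <;> rcases ha with rfl | rfl | h1 <;>
          rcases hb with rfl | rfl | h2 <;> simp_all
  · exact hub p q onlyp hcommon h
  · exact hub q p onlyq (fun h hh h1 h2 => hcommon h hh h2 h1) h

/-- A needy vertex without income is the only needy vertex. -/
theorem Sat.needy_of_income_eq_zero (hG : Sat G) (hN : NoInducedPathInNbhd G)
    (hmin : ∀ v, 3 ≤ dg G v)
    (hle : ∀ v ∈ far G x, nb G (nbhd G x) v ≤ 2) {p q : V} (hp : p ∈ needy G x)
    (hq : q ∈ needy G x) (h0 : income G x p = 0) : p = q := by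
  by_contra hpq
  have hnpq := needy_not_adj hp hq
  have hpt := needy_thick hp
  have hqt := needy_thick hq
  have same : ∀ s t, G.Adj x s → G.Adj x t → s ≠ t → G.Adj p s → G.Adj p t → G.Adj q s →
      ¬ G.Adj q t := fun s t hs ht hst ps pt qs qt =>
    hpq (hG.needy_eq hN hle hp hq hs ht hst ps pt qs qt)
  have hpay : ∀ v ∈ thin G x, G.Adj v p → pay G x v = 0 := by
    intro v hv hvp
    have := pay_le_income hv hvp
    omega
  -- `p` has degree at least 3, at most two neighbours next to `x` and no thick neighbour.
  obtain ⟨v, hv, hpv⟩ : ∃ v ∈ thin G x, G.Adj p v := by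
    have h1 := dg_of_mem_thick hpt
    have h2 := (mem_lonely.1 (mem_needy.1 hp).1).2
    have h3 := hle p (mem_thick.1 hpt).1
    have h4 := hmin p
    exact nb_pos.1 (by omega)
  have hv0 := hpay v hv hpv.symm
  obtain ⟨w, v', hw, hv', hwp, hvw, hvv', hd, hNv⟩ := hG.thin_of_pay_eq_zero hv hv0 hpt hpv.symm
  have hvq : ¬ G.Adj v q := fun h => hpq (thick_unique hv0 hpt hqt hpv.symm h)
  have hvqne : v ≠ q := by
    rintro rfl
    exact (mem_thick.1 hqt).2 (mem_thin.1 hv).2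
  have hv'p : v' ≠ p := by
    rintro rfl
    exact (mem_thick.1 hpt).2 (mem_thin.1 hv').2
  have pcommon : ∀ r, G.Adj p r → G.Adj r q → r ∉ thin G x := fun r hpr hrq hr =>
    hpq (thick_unique (hpay r hr hpr.symm) hpt hqt hpr.symm hrq)
  -- if `v'` is adjacent to `w` then it is adjacent to `p`
  have hclosed : G.Adj v' w → G.Adj v' p := fun h =>
    hN v v' w p hd hvv' hvw hpv.symm hv'p h.symm hwp
  by_cases hv'q : G.Adj v' q
  · have hv'0 := needy_pay_zero hq hv' hv'q hv hvv'.symm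
    obtain ⟨w', v'', hw', hv'', hw'q, hvw2, hvv2, hd', hNv'⟩ :=
      hG.thin_of_pay_eq_zero hv' hv'0 hqt hv'q
    have e : v = v'' := by
      obtain ⟨y, -, -, h⟩ := nb_eq_one.1 (pay_eq_zero.1 hv'0).2
      exact (h v hv hvv'.symm).trans (h v'' hv'' hvv2).symm
    subst e
    have hv'np : ¬ G.Adj v' p := fun h => hpq (thick_unique hv'0 hpt hqt h hv'q)
    have hww' : w ≠ w' := by
      rintro rfl
      exact hv'np (hclosed hvw2)
    -- The possible common neighbours of `p` and `v'` are `w'`, `q` and `v`; `q` is excluded, and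
    -- `v` alone carries no link.
    have hpw' : G.Adj p w' := by
      rcases hG.link p v' hv'p.symm (fun h => hv'np h.symm) with
        ⟨h, a, b, k1, k2, k3, k4, k5, k6, k7⟩ | ⟨a, b, r, hab, k1, k2, k3, k4, k5, k6, k7⟩ |
        ⟨a, b, r, hab, k1, k2, k3, k4, k5, k6, k7⟩
      · rcases (hNv' h).1 k4.symm with rfl | rfl | rfl
        · exact k1.symm
        · exact absurd k1.symm hnpq
        · exfalso
          have ea := (hNv a).1 k2
          have eb := (hNv b).1 k3
          have n1 := k5.ne
          have n2 := k6.ne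
          have n3 := k7.ne
          have n4 : a ≠ v' := fun e => hv'np (e ▸ k5).symm
          have n5 : b ≠ p := fun e => hv'np (e ▸ k7).symm
          rcases ea with rfl | rfl | rfl
          · rcases eb with rfl | rfl | rfl <;> contradiction
          · contradiction
          · contradiction
      · rcases (hNv' a).1 k4 with rfl | rfl | rfl
        · exact k1
        · exact absurd k1 hnpq
        · rcases (hNv' b).1 k5 with rfl | rfl | rfl
          · exact k2
          · exact absurd k2 hnpq
          · exact absurd rfl hab
      · rcases (hNv' a).1 k1 with rfl | rfl | rfl
        · exact k4
        · exact absurd k4 hnpq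
        · rcases (hNv' b).1 k2 with rfl | rfl | rfl
          · exact k5
          · exact absurd k5 hnpq
          · exact absurd rfl hab
    have hqw : ¬ G.Adj q w := fun h => same w w' hw hw' hww' hwp.symm hpw' h hw'q.symm
    have hcom : ∀ h, G.Adj v h → G.Adj h q → h = v' := by
      intro h h1 h2
      rcases (hNv h).1 h1 with rfl | rfl | rfl
      · exact absurd h2.symm hqw
      · exact absurd h2 hnpq
      · rfl
    -- `v'` is the only common neighbour of `v` and `q`, so it would be the hub of a rim link, but
    -- it has only three neighbours.
    rcases hG.link v q hvqne hvq with
        ⟨h, a, b, k1, k2, k3, k4, k5, k6, k7⟩ | ⟨a, b, r, hab, k1, k2, k3, k4, k5, k6, k7⟩ |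
        ⟨a, b, r, hab, k1, k2, k3, k4, k5, k6, k7⟩
    · have e := hcom h k1.symm k4
      subst e
      rcases (hNv' a).1 k2 with rfl | rfl | rfl
      · rcases (hNv a).1 k5 with e | rfl | rfl
        · exact hww' e.symm
        · exact hv'np hvw2
        · exact G.irrefl hvw2
      · exact hvq k5
      · exact G.irrefl k5
    · exact hab ((hcom a k1 k4.symm).trans (hcom b k2 k5.symm).symm)
    · exact hab ((hcom a k4 k1.symm).trans (hcom b k5 k2.symm).symm)
  -- Now `w` must be the hub of a rim link between `v` and `q`. Its path starts with `p`, giving `p`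
  -- and `q` a forbidden common neighbour, or with `v'`, which is then adjacent to `p` and has no
  -- way to continue.
  · have hcom : ∀ h, G.Adj v h → G.Adj h q → h = w := by
      intro h h1 h2
      rcases (hNv h).1 h1 with rfl | rfl | rfl
      · rfl
      · exact absurd h2 hnpq
      · exact absurd h2 hv'q
    rcases hG.link v q hvqne hvq with
        ⟨h, a, b, k1, k2, k3, k4, k5, k6, k7⟩ | ⟨a, b, r, hab, k1, k2, k3, k4, k5, k6, k7⟩ |
        ⟨a, b, r, hab, k1, k2, k3, k4, k5, k6, k7⟩
    · have e := hcom h k1.symm k4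
      subst e
      rcases (hNv a).1 k5 with rfl | rfl | rfl
      · exact G.irrefl k2
      · -- `b` is a common neighbour of `p` and `q`
        rcases adj_lonely (mem_needy.1 hp).1 k6 with hb | hb
        · exact same h b hw hb k3.ne hwp.symm k6 k4.symm k7.symm
        · exact pcommon b k6 k7 hb
      · have hap := hclosed k2.symm
        obtain ⟨w', v'', -, -, -, -, -, hd', -⟩ :=
          hG.thin_of_pay_eq_zero hv' (hpay a hv' hap) hpt hap
        have hvp : p ≠ v := by
          rintro rfl
          exact (mem_thick.1 hpt).2 (mem_thin.1 hv).2
        have := adj_iff_of_dg_three hd' k2.symm hap hvv'.symm hwp.ne hvw.ne.symm hvp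
        rcases (this b).1 k6 with rfl | rfl | rfl
        · exact G.irrefl k3
        · exact hnpq k7
        · exact hvq k7
    · exact hab ((hcom a k1 k4.symm).trans (hcom b k2 k5.symm).symm)
    · exact hab ((hcom a k4 k1.symm).trans (hcom b k5 k2.symm).symm)

/-- As τ ≥ 6, the remaining terms may sum to -1. Only lonely vertices have a negative term, namely
-1. Thin vertices hand out their terms in half units (`pay`), and a lonely vertex receiving two is
settled. The needy ones lack at most three half units together: one without income is the only needy
vertex, and otherwise each lacks one and there is at most one per pair of neighbours of `x`. By
integrality the sum is at least -1. -/
theorem three_of_triangle (hG : Sat G) {s₁ s₂ s₃ : V} (hx : dg G x = 3) (hmin : ∀ v, 3 ≤ dg G v)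
    (hN : NoInducedPathInNbhd G)
    (hS : ∀ u, G.Adj x u ↔ u = s₁ ∨ u = s₂ ∨ u = s₃)
    (h12 : s₁ ≠ s₂) (h13 : s₁ ≠ s₃) (h23 : s₂ ≠ s₃) (a12 : G.Adj s₁ s₂) (a13 : G.Adj s₁ s₃)
    (a23 : G.Adj s₂ s₃) :
    5 * Fintype.card V ≤ 2 * G.edgeSet.ncard + 9 := by
  classical
  have hid := edges_of_dg_three hx
  rw [sum_nbhd_three hS h12 h13 h23] at hid
  have x1 : G.Adj x s₁ := by simp [hS]
  have x2 : G.Adj x s₂ := by simp [hS]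
  have x3 : G.Adj x s₃ := by simp [hS]
  have n1 : 2 ≤ nb G (nbhd G x) s₁ := two_le_nb.2 ⟨s₂, by simpa, s₃, by simpa, h23, a12, a13⟩
  have n2 : 2 ≤ nb G (nbhd G x) s₂ := two_le_nb.2 ⟨s₁, by simpa, s₃, by simpa, h13, a12.symm, a23⟩
  have n3 : 2 ≤ nb G (nbhd G x) s₃ :=
    two_le_nb.2 ⟨s₁, by simpa, s₂, by simpa, h12, a13.symm, a23.symm⟩
  have hnbS := nb_nbhd_three (G := G) hS h12 h13 h23
  have hle : ∀ v ∈ far G x, nb G (nbhd G x) v ≤ 2 := by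
    intro v hv
    rw [mem_far] at hv
    by_contra h
    rw [hnbS] at h
    split_ifs at h with v1 v2 v3
    -- A vertex adjacent to the whole triangle completes a wheel with hub `s₁` and rim v s₂ x s₃.
    · exact hG.free ⟨s₁, v, s₂, x, s₃, hv.1, h23, v1.symm, a12, x1.symm, a13, v2, x2.symm, x3,
        v3.symm⟩
    all_goals omega
  have q2 : ∀ v ∈ thick G x, nb G (nbhd G x) v = 2 := by
    intro v hv
    have := hle v (mem_thick.1 hv).1
    have := (hG.mem_thick_iff.1 hv).2
    omega
  -- the number of needy vertices, weighted by their need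
  have hneed : ∑ q ∈ needy G x, (2 - income G x q) ≤ 3 := by
    by_cases h0 : ∃ p ∈ needy G x, income G x p = 0
    · obtain ⟨p, hp, hp0⟩ := h0
      have : needy G x ⊆ {p} := by
        intro q hq
        rw [Finset.mem_singleton]
        exact (hG.needy_of_income_eq_zero hN hmin hle hp hq hp0).symm
      calc ∑ q ∈ needy G x, (2 - income G x q) ≤ ∑ q ∈ {p}, (2 - income G x q) :=
            Finset.sum_le_sum_of_subset this
        _ ≤ 3 := by
          rw [Finset.sum_singleton]
          omega
    · push Not at h0
      have hcard : (needy G x).card ≤ 3 := by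
        have one : ∀ s t, G.Adj x s → G.Adj x t → s ≠ t →
            ((needy G x).filter fun q => G.Adj q s ∧ G.Adj q t).card ≤ 1 := by
          intro s t hs ht hst
          rw [Finset.card_le_one]
          intro p hp q hq
          simp only [Finset.mem_filter] at hp hq
          exact hG.needy_eq hN hle hp.1 hq.1 hs ht hst hp.2.1 hp.2.2 hq.2.1 hq.2.2
        have hsub : needy G x ⊆ ((needy G x).filter fun q => G.Adj q s₁ ∧ G.Adj q s₂) ∪
            ((needy G x).filter fun q => G.Adj q s₁ ∧ G.Adj q s₃) ∪
            ((needy G x).filter fun q => G.Adj q s₂ ∧ G.Adj q s₃) := by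
          intro q hq
          have := q2 q (needy_thick hq)
          rw [hnbS] at this
          simp only [Finset.mem_union, Finset.mem_filter, hq, true_and]
          split_ifs at this <;> first | omega | tauto
        have h1 := Finset.card_le_card hsub
        have h2 := Finset.card_union_le
          (((needy G x).filter fun q => G.Adj q s₁ ∧ G.Adj q s₂) ∪
            ((needy G x).filter fun q => G.Adj q s₁ ∧ G.Adj q s₃))
            ((needy G x).filter fun q => G.Adj q s₂ ∧ G.Adj q s₃)
        have h3 := Finset.card_union_le
          ((needy G x).filter fun q => G.Adj q s₁ ∧ G.Adj q s₂)
            ((needy G x).filter fun q => G.Adj q s₁ ∧ G.Adj q s₃)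
        have := one s₁ s₂ x1 x2 h12
        have := one s₁ s₃ x1 x3 h13
        have := one s₂ s₃ x2 x3 h23
        omega
      calc ∑ q ∈ needy G x, (2 - income G x q) ≤ ∑ q ∈ needy G x, 1 := by
            refine Finset.sum_le_sum fun q hq => ?_
            have := h0 q hq
            omega
        _ ≤ 3 := by simpa using hcard
  -- the payments are covered
  have hpay : ∑ q ∈ lonely G x, (income G x q : ℤ) ≤
      2 * ∑ v ∈ thin G x, (2 * nb G (thick G x) v + nb G (thin G x) v - 3 : ℤ) := by
    have e1 : ∑ q ∈ lonely G x, (income G x q : ℤ) =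
        ∑ v ∈ thin G x, (nb G (lonely G x) v * pay G x v : ℤ) := by
      simp only [income]
      push_cast
      rw [Finset.sum_comm]
      refine Finset.sum_congr rfl fun v _ => ?_
      rw [nb_eq_sum]
      push_cast
      rw [Finset.sum_mul]
      exact Finset.sum_congr rfl fun q _ => by split_ifs <;> simp
    rw [e1, Finset.mul_sum]
    refine Finset.sum_le_sum fun v hv => ?_
    have l1 : nb G (lonely G x) v ≤ nb G (thick G x) v := nb_mono (Finset.filter_subset _ _) v
    have l2 := dg_of_mem_thin hv
    have l3 := hmin v
    obtain ⟨w, p, q, -, -, -, -, hq, -, -, hqv, hq2, -⟩ :=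
      hG.parent (mem_thin.1 hv).1 (mem_thin.1 hv).2
    have l4 : 1 ≤ nb G (thick G x) v := nb_pos.2 ⟨q, hG.mem_thick_iff.2 ⟨hq, hq2⟩, hqv.symm⟩
    -- With three far neighbours a thin vertex can afford two half units for each lonely neighbour;
    -- the two possibilities with only two far neighbours are the exceptions in `pay`.
    unfold pay
    split_ifs with h1 h2
    · rw [h1.1, h1.2]
      norm_num
    · rw [h2.1, h2.2]
      rw [h2.1] at l1
      push_cast
      omega
    · push_cast
      omega
  have hthick : ∑ v ∈ thick G x, (2 * nb G (nbhd G x) v + nb G (thick G x) v - 5 : ℤ) ≥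
      - ((lonely G x).card : ℤ) := by
    have : - ((lonely G x).card : ℤ) =
        ∑ v ∈ thick G x, (if nb G (thick G x) v = 0 then (-1 : ℤ) else 0) := by
      rw [← Finset.sum_filter, Finset.sum_const]
      simp [lonely]
    rw [this, ge_iff_le]
    refine Finset.sum_le_sum fun v hv => ?_
    rw [q2 v hv]
    split_ifs with h
    · rw [h]
      norm_num
    · push_cast
      omega
  have hlow : 2 * ((lonely G x).card : ℤ) ≤ ∑ q ∈ lonely G x, (income G x q : ℤ) + 3 := by
    have e1 : ∑ q ∈ lonely G x, (2 - income G x q) = ∑ q ∈ needy G x, (2 - income G x q) := by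
      unfold needy
      rw [Finset.sum_filter]
      refine Finset.sum_congr rfl fun q _ => ?_
      split_ifs <;> omega
    have e2 : ∑ q ∈ lonely G x, 2 ≤ ∑ q ∈ lonely G x, ((2 - income G x q) + income G x q) :=
      Finset.sum_le_sum fun q _ => by omega
    rw [Finset.sum_add_distrib, e1, Finset.sum_const, smul_eq_mul] at e2
    rw [← Nat.cast_sum]
    omega
  have : (5 * Fintype.card V : ℤ) ≤ 2 * G.edgeSet.ncard + 9 := by
    zify at n1 n2 n3
    omega
  exact_mod_cast this

end Triangle

/-! ### Graphs with a universal vertex, and links through a unique common neighbour. -/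

section Universal

variable {V : Type u} {G : SimpleGraph V}

/-- If `w` is adjacent to all other vertices, non-adjacent vertices are joined by a path of length
three avoiding `w`. -/
theorem Sat.path_of_universal (hG : Sat G) {w : V} (hw : ∀ v, v ≠ w → G.Adj w v) {s t : V}
    (hs : s ≠ w) (ht : t ≠ w) (hst : s ≠ t) (hn : ¬ G.Adj s t) :
    ∃ p r, p ≠ w ∧ r ≠ w ∧ G.Adj s p ∧ G.Adj p r ∧ G.Adj r t := by
  have hub : ∀ s t, s ≠ w → t ≠ w → s ≠ t → ¬ G.Adj s t → HubLink G s t →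
      ∃ p r, p ≠ w ∧ r ≠ w ∧ G.Adj s p ∧ G.Adj p r ∧ G.Adj r t := by
    rintro s t hs ht hst hn ⟨a, b, r, hab, k1, k2, k3, k4, k5, k6, k7⟩
    -- If `r` is the universal vertex, it is already the hub of a wheel with rim s a t b.
    by_cases hr : r = w
    · subst hr
      exact absurd ⟨r, s, a, t, b, hst, hab, hw s hs, k6, hw t ht, k7, k1, k4.symm, k5, k2.symm⟩
        hG.free
    · by_cases ha : a = w
      · subst ha
        exact ⟨r, b, hr, hab.symm, k3, k7, k5.symm⟩
      · exact ⟨r, a, hr, ha, k3, k6, k4.symm⟩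
  rcases hG.link s t hst hn with ⟨h, p, r, k1, k2, k3, k4, k5, k6, k7⟩ | h | h
  · by_cases hp : p = w
    · subst hp
      exact ⟨h, r, k2.ne, k6.ne.symm, k1.symm, k3, k7⟩
    · by_cases hr : r = w
      · subst hr
        exact ⟨p, h, hp, k3.ne, k5, k2.symm, k4⟩
      · exact ⟨p, r, hp, hr, k5, k6, k7⟩
  · exact hub s t hs ht hst hn h
  · obtain ⟨p, r, hp, hr, k1, k2, k3⟩ := hub t s ht hs hst.symm (fun h => hn h.symm) h
    exact ⟨r, p, hr, hp, k3.symm, k2.symm, k1.symm⟩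

theorem neighborSet_induce_eq {w : V} {v : V} (hv : v ≠ w) {S : Set V}
    (h : ∀ u, u ≠ w → (G.Adj v u ↔ u ∈ S)) :
    (G.induce ({w}ᶜ : Set V)).neighborSet ⟨v, hv⟩ = Subtype.val ⁻¹' S := by
  ext ⟨u, hu⟩
  simpa using h u hu

theorem pairsJoinedTo_induce {w c : V} (hc : c ≠ w) {A : Set V} (hA : w ∉ A)
    (h : ∀ v ∈ A, ∃ v' ∈ A, ∀ u, u ≠ w → (G.Adj v u ↔ u = c ∨ u = v')) :
    PairsJoinedTo (G.induce ({w}ᶜ : Set V)) (Subtype.val ⁻¹' A) {⟨c, hc⟩} := by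
  rintro ⟨v, hv⟩ hvA
  obtain ⟨v', hv', hN⟩ := h v hvA
  refine ⟨⟨v', fun e => hA (e ▸ hv')⟩, hv', ?_⟩
  rw [neighborSet_induce_eq (S := {c, v'}) hv (by simpa using hN)]
  ext ⟨u, hu⟩
  simp [Subtype.ext_iff, or_comm]

/-- Translates neighbourhoods in `G` with the universal vertex `w` ignored into the structure of `G`
without `w`. -/
theorem isF3_induce {w c₁ c₂ c₃ c₄ c₅ : V} {P Q : Set V}
    (hnodup : [w, c₁, c₂, c₃, c₄, c₅].Nodup)
    (hPQ : Disjoint P Q) (hP : ∀ v ∈ P, v ∉ [w, c₁, c₂, c₃, c₄, c₅])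
    (hQ : ∀ v ∈ Q, v ∉ [w, c₁, c₂, c₃, c₄, c₅])
    (hcover : ∀ v, v ∈ [w, c₁, c₂, c₃, c₄, c₅] ∨ v ∈ P ∨ v ∈ Q)
    (h12 : G.Adj c₁ c₂) (h3 : ∀ u, u ≠ w → (G.Adj c₃ u ↔ u = c₂ ∨ u = c₄))
    (h4 : ∀ u, u ≠ w → (G.Adj c₄ u ↔ u = c₃ ∨ u = c₅))
    (h5 : ∀ u, u ≠ w → (G.Adj c₅ u ↔ u = c₄ ∨ u = c₁))
    (pP : ∀ v ∈ P, ∃ v' ∈ P, ∀ u, u ≠ w → (G.Adj v u ↔ u = c₁ ∨ u = v'))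
    (pQ : ∀ v ∈ Q, ∃ v' ∈ Q, ∀ u, u ≠ w → (G.Adj v u ↔ u = c₂ ∨ u = v')) :
    IsF3 (G.induce ({w}ᶜ : Set V)) := by
  simp only [List.nodup_cons, List.mem_cons, List.not_mem_nil, or_false, not_or, List.nodup_nil,
    not_false_eq_true, and_true] at hnodup hP hQ hcover
  obtain ⟨⟨e1, e2, e3, e4, e5⟩, f1, f2, f3, f4⟩ := hnodup
  have wP : w ∉ P := fun h => (hP w h).1 rfl
  have wQ : w ∉ Q := fun h => (hQ w h).1 rfl
  refine ⟨⟨c₁, Ne.symm e1⟩, ⟨c₂, Ne.symm e2⟩, ⟨c₃, Ne.symm e3⟩, ⟨c₄, Ne.symm e4⟩, ⟨c₅, Ne.symm e5⟩,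
    Subtype.val ⁻¹' P, Subtype.val ⁻¹' Q, ?_, ?_, ?_, ?_, ?_, ?_, ?_,
    pairsJoinedTo_induce _ wP pP, pairsJoinedTo_induce _ wQ pQ⟩
  · simpa [Subtype.ext_iff] using ⟨f1, f2, f3, f4⟩
  · simp only [List.pairwise_cons, List.mem_cons, List.not_mem_nil, or_false, forall_eq_or_imp,
      forall_eq, List.Pairwise.nil, and_true, IsEmpty.forall_iff, implies_true]
    refine ⟨⟨?_, ?_⟩, hPQ.preimage _⟩
    · rw [Set.disjoint_right]
      rintro ⟨v, hv⟩ hvP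
      have := hP v hvP
      simpa [Subtype.ext_iff] using this.2
    · rw [Set.disjoint_right]
      rintro ⟨v, hv⟩ hvQ
      have := hQ v hvQ
      simpa [Subtype.ext_iff] using this.2
  · rw [Set.eq_univ_iff_forall]
    rintro ⟨v, hv⟩
    have hv' : v ≠ w := hv
    have := hcover v
    simp only [Set.mem_union, Set.mem_insert_iff, Subtype.ext_iff, Set.mem_singleton_iff,
      Set.mem_preimage]
    tauto
  · simpa using h12
  all_goals
    first
    | rw [neighborSet_induce_eq (S := {c₂, c₄}) _ (by simpa using h3)]
    | rw [neighborSet_induce_eq (S := {c₃, c₅}) _ (by simpa using h4)]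
    | rw [neighborSet_induce_eq (S := {c₄, c₁}) _ (by simpa using h5)]
    ext ⟨u, hu⟩
    simp [Subtype.ext_iff]

/-- Non-adjacent vertices with only one common neighbour are linked along the rim. -/
theorem Sat.link_of_unique (hG : Sat G) {s t h₀ : V} (hst : s ≠ t) (hn : ¬ G.Adj s t)
    (hu : ∀ h, G.Adj s h → G.Adj t h → h = h₀) :
    ∃ p r, G.Adj h₀ s ∧ G.Adj h₀ p ∧ G.Adj h₀ r ∧ G.Adj h₀ t ∧ G.Adj s p ∧ G.Adj p r ∧
      G.Adj r t := by
  rcases hG.link s t hst hn with ⟨h, p, r, k1, k2, k3, k4, k5, k6, k7⟩ |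
    ⟨a, b, r, hab, k1, k2, k3, k4, k5, -⟩ | ⟨a, b, r, hab, k1, k2, k3, k4, k5, -⟩
  · have := hu h k1.symm k4.symm
    subst this
    exact ⟨p, r, k1, k2, k3, k4, k5, k6, k7⟩
  · exact absurd ((hu a k1 k4).trans (hu b k2 k5).symm) hab
  · exact absurd ((hu a k4 k1).trans (hu b k5 k2).symm) hab

theorem Sat.exists_common (hG : Sat G) {s t : V} (hst : s ≠ t) (hn : ¬ G.Adj s t) :
    ∃ h, G.Adj s h ∧ G.Adj t h := by
  rcases hG.link s t hst hn with ⟨h, p, r, k1, k2, k3, k4, k5, k6, k7⟩ |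
    ⟨a, b, r, hab, k1, k2, k3, k4, k5, -⟩ | ⟨a, b, r, hab, k1, k2, k3, k4, k5, -⟩
  · exact ⟨h, k1.symm, k4.symm⟩
  · exact ⟨a, k1, k4⟩
  · exact ⟨a, k4, k1⟩

variable [Fintype V]

/-- The hub of a link along the rim has degree at least four. -/
theorem four_le_dg {h s p r t : V} (hst : s ≠ t) (hn : ¬ G.Adj s t) (k1 : G.Adj h s)
    (k2 : G.Adj h p) (k3 : G.Adj h r) (k4 : G.Adj h t) (k5 : G.Adj s p) (k6 : G.Adj p r)
    (k7 : G.Adj r t) : 4 ≤ dg G h := by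
  classical
  have hs : ({s, p, r, t} : Finset V).card = 4 := by
    have e1 : s ≠ r := fun e => hn (e ▸ k7)
    have e2 : p ≠ t := fun e => hn (e ▸ k5)
    rw [Finset.card_insert_of_notMem, Finset.card_insert_of_notMem, Finset.card_pair k7.ne]
    · simp [k6.ne, e2]
    · simp [k5.ne, e1, hst]
  rw [← hs]
  apply le_dg_of_subset
  intro u hu
  simp only [Finset.mem_insert, Finset.mem_singleton] at hu
  rcases hu with rfl | rfl | rfl | rfl <;> assumption

/-- A unique common neighbour excludes hub links, so it is the hub of a rim link, and such a hub has
four neighbours. -/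
theorem Sat.false_of_unique (hG : Sat G) {s t h₀ : V} (hst : s ≠ t) (hn : ¬ G.Adj s t)
    (hu : ∀ h, G.Adj s h → G.Adj t h → h = h₀) (hd : dg G h₀ ≤ 3) : False := by
  obtain ⟨p, r, k1, k2, k3, k4, k5, k6, k7⟩ := hG.link_of_unique hst hn hu
  have := four_le_dg hst hn k1 k2 k3 k4 k5 k6 k7
  omega

end Universal

/-! ### Degree three: neighbourhoods inducing a path, and the tight case. -/

section Path

variable {V : Type u} [Fintype V] {G : SimpleGraph V} {x s₁ s₂ s₃ : V}

/-- The neighbours `s₁`, `s₂`, `s₃` of `x` induce a path and all estimates are sharp. -/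
structure TightPath (G : SimpleGraph V) (x s₁ s₂ s₃ : V) : Prop where
  sat : Sat G
  nbr : ∀ u, G.Adj x u ↔ u = s₁ ∨ u = s₂ ∨ u = s₃
  ne₁₂ : s₁ ≠ s₂
  ne₁₃ : s₁ ≠ s₃
  ne₂₃ : s₂ ≠ s₃
  adj₁₂ : G.Adj s₁ s₂
  adj₂₃ : G.Adj s₂ s₃
  not_adj : ¬ G.Adj s₁ s₃
  not_all : ∀ v ∈ far G x, G.Adj v s₁ → G.Adj v s₂ → ¬ G.Adj v s₃
  mate : ∀ v ∈ thick G x, G.Adj v s₂ → ∃ r ∈ thick G x, G.Adj r s₂ ∧ G.Adj r v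
  thick_tight : ∀ v ∈ thick G x, nb G (thick G x) v = 1 ∨
    (nb G (thick G x) v = 0 ∧ nb G (thin G x) v = 1)
  thin_tight : ∀ v ∈ thin G x, dg G v = 3 ∧ nb G (lonely G x) v + 1 = nb G (thick G x) v

theorem TightPath.symm (h : TightPath G x s₁ s₂ s₃) : TightPath G x s₃ s₂ s₁ where
  sat := h.sat
  nbr u := by rw [h.nbr]; tauto
  ne₁₂ := h.ne₂₃.symm
  ne₁₃ := h.ne₁₃.symm
  ne₂₃ := h.ne₁₂.symm
  adj₁₂ := h.adj₂₃.symm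
  adj₂₃ := h.adj₁₂.symm
  not_adj := fun e => h.not_adj e.symm
  not_all := fun v hv h3 h2 h1 => h.not_all v hv h1 h2 h3
  mate := h.mate
  thick_tight := h.thick_tight
  thin_tight := h.thin_tight

/-- Around a vertex whose neighbourhood induces a path, there are enough edges or all estimates
are sharp. -/
theorem three_of_path (hG : Sat G) (hx : dg G x = 3) (hmin : ∀ v, 3 ≤ dg G v)
    (hS : ∀ u, G.Adj x u ↔ u = s₁ ∨ u = s₂ ∨ u = s₃)
    (h12 : s₁ ≠ s₂) (h13 : s₁ ≠ s₃) (h23 : s₂ ≠ s₃) (a12 : G.Adj s₁ s₂) (a23 : G.Adj s₂ s₃)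
    (n13 : ¬ G.Adj s₁ s₃) :
    5 * Fintype.card V ≤ 2 * G.edgeSet.ncard + 9 ∨
      (5 * Fintype.card V ≤ 2 * G.edgeSet.ncard + 10 ∧ TightPath G x s₁ s₂ s₃) := by
  classical
  have hid := edges_of_dg_three hx
  rw [sum_nbhd_three hS h12 h13 h23] at hid
  have x1 : G.Adj x s₁ := by simp [hS]
  have x2 : G.Adj x s₂ := by simp [hS]
  have x3 : G.Adj x s₃ := by simp [hS]
  have t1 : 1 ≤ nb G (nbhd G x) s₁ := nb_pos.2 ⟨s₂, by simpa, a12⟩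
  have t2 : 2 ≤ nb G (nbhd G x) s₂ := two_le_nb.2 ⟨s₁, by simpa, s₃, by simpa, h13, a12.symm, a23⟩
  have t3 : 1 ≤ nb G (nbhd G x) s₃ := nb_pos.2 ⟨s₂, by simpa, a23.symm⟩
  have hnbS := nb_nbhd_three (G := G) hS h12 h13 h23
  -- Otherwise there is a wheel with hub `s₂` and rim v s₁ x s₃.
  have hall : ∀ v ∈ far G x, G.Adj v s₁ → G.Adj v s₂ → ¬ G.Adj v s₃ := by
    intro v hv v1 v2 v3
    rw [mem_far] at hv
    exact hG.free ⟨s₂, v, s₁, x, s₃, hv.1, h13, v2.symm, a12.symm, x2.symm, a23, v1, x1.symm, x3,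
      v3.symm⟩
  have hq2 : ∀ v ∈ thick G x, nb G (nbhd G x) v = 2 := by
    intro v hv
    have h1 := (hG.mem_thick_iff.1 hv).2
    have h2 := hall v (mem_thick.1 hv).1
    rw [hnbS] at h1 ⊢
    split_ifs at h1 ⊢ <;> first | omega | tauto
  -- adjacent neighbours of `x`
  have edge : ∀ w p, G.Adj x w → G.Adj x p → G.Adj w p → (w = s₂ ∧ p ≠ s₂) ∨ (p = s₂ ∧ w ≠ s₂) := by
    intro w p hw hp hwp
    rcases (hS w).1 hw with rfl | rfl | rfl <;> rcases (hS p).1 hp with rfl | rfl | rfl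
    · exact absurd rfl hwp.ne
    · exact Or.inr ⟨rfl, h12⟩
    · exact absurd hwp n13
    · exact Or.inl ⟨rfl, h12⟩
    · exact absurd rfl hwp.ne
    · exact Or.inl ⟨rfl, h23.symm⟩
    · exact absurd hwp.symm n13
    · exact Or.inr ⟨rfl, h23.symm⟩
    · exact absurd rfl hwp.ne
  -- Edges inside `nbhd G x` all contain `s₂`, so they form no triangle.
  have notri : ∀ w p r, G.Adj x w → G.Adj x p → G.Adj w p → G.Adj r w → G.Adj r p →
      ¬ G.Adj x r := by
    intro w p r hw hp hwp hrw hrp hr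
    have k1 := edge w p hw hp hwp
    have k2 := edge r w hr hw hrw
    have k3 := edge r p hr hp hrp
    tauto
  have farof : ∀ v ∈ far G x, ∀ r, G.Adj r v → ¬ G.Adj x r → r ∈ far G x := by
    intro v hv r hrv hxr
    rw [mem_far]
    refine ⟨?_, hxr⟩
    rintro rfl
    exact (mem_far.1 hv).2 hrv
  have hmate : ∀ v ∈ thick G x, G.Adj v s₂ → ∃ r ∈ thick G x, G.Adj r s₂ ∧ G.Adj r v := by
    intro v hv v2
    have hvf := (mem_thick.1 hv).1
    have mk : ∀ w p r, G.Adj x w → G.Adj x p → G.Adj w p → G.Adj r w → G.Adj r p → G.Adj r v →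
        ∃ r ∈ thick G x, G.Adj r s₂ ∧ G.Adj r v := by
      intro w p r hw hp hwp hrw hrp hrv
      refine ⟨r, hG.mem_thick_iff.2 ⟨farof v hvf r hrv (notri w p r hw hp hwp hrw hrp),
        two_le_nb.2 ⟨w, by simpa, p, by simpa, hwp.ne, hrw, hrp⟩⟩, ?_, hrv⟩
      rcases edge w p hw hp hwp with ⟨rfl, -⟩ | ⟨rfl, -⟩ <;> assumption
    have two : ∀ a b, G.Adj x a → G.Adj x b → a ≠ b → G.Adj v a → G.Adj v b → G.Adj a b := by
      intro a b ha hb hab va vb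
      have := hall v hvf
      rcases (hS a).1 ha with rfl | rfl | rfl <;> rcases (hS b).1 hb with rfl | rfl | rfl <;>
        first | contradiction | assumption | (exact G.symm ‹_›) | tauto
    rcases hG.far_cases hvf with ⟨w, p, r, k1, k2, k3, k4, k5, k6, k7⟩ |
      ⟨a, b, r, hab, k1, k2, k3, k4, k5, k6, k7⟩ | ⟨a, b, r, hab, k1, k2, k3, k4, k5, k6, k7⟩
    · exact mk w p r k1 k2 k3 k5 k6 k7
    · exact absurd k3 (notri a b r k1 k2 (two a b k1 k2 hab k4 k5) k6 k7)
    · exact mk a b r k1 k2 (two a b k1 k2 hab k3 k4) k5 k6 k7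
  -- The parent of a thin vertex is adjacent to `s₂`, hence has a mate and is not lonely.
  have hlon : ∀ v ∈ thin G x, nb G (lonely G x) v + 1 ≤ nb G (thick G x) v := by
    intro v hv
    obtain ⟨w, p, q, hw, hp, hwp, -, hq, qw, qp, hqv, hq2, -⟩ :=
      hG.parent (mem_thin.1 hv).1 (mem_thin.1 hv).2
    have hqt : q ∈ thick G x := hG.mem_thick_iff.2 ⟨hq, hq2⟩
    have q2 : G.Adj q s₂ := by
      rcases edge w p hw hp hwp with ⟨rfl, -⟩ | ⟨rfl, -⟩ <;> assumption
    obtain ⟨r, hr, -, hrq⟩ := hmate q hqt q2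
    have hql : q ∉ lonely G x := fun h => nb_eq_zero.1 (mem_lonely.1 h).2 r hr hrq.symm
    have hsub : insert q (lonely G x) ⊆ thick G x := by
      intro a ha
      rcases Finset.mem_insert.1 ha with rfl | ha
      · exact hqt
      · exact (mem_lonely.1 ha).1
    have := nb_mono (G := G) hsub v
    rw [nb_insert hql, if_pos hqv.symm] at this
    omega
  -- The term of a lonely vertex is -1. Each edge from a thin to a lonely vertex carries one unit to
  -- the lonely end, after which no term is negative.
  have hsum : ∑ v ∈ thick G x, (2 * nb G (nbhd G x) v + nb G (thick G x) v - 5 : ℤ) +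
      ∑ v ∈ thin G x, (2 * nb G (thick G x) v + nb G (thin G x) v - 3 : ℤ) =
      ∑ v ∈ thick G x, ((nb G (thick G x) v : ℤ) - 1 +
        (if nb G (thick G x) v = 0 then (nb G (thin G x) v : ℤ) else 0)) +
      ∑ v ∈ thin G x, (2 * nb G (thick G x) v + nb G (thin G x) v - 3 - nb G (lonely G x) v : ℤ) := by
    have e1 : ∑ v ∈ thick G x, (2 * nb G (nbhd G x) v + nb G (thick G x) v - 5 : ℤ) =
        ∑ v ∈ thick G x, ((nb G (thick G x) v : ℤ) - 1) := by
      refine Finset.sum_congr rfl fun v hv => ?_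
      rw [hq2 v hv]
      push_cast
      ring
    have e2 : ∑ v ∈ thick G x, (if nb G (thick G x) v = 0 then (nb G (thin G x) v : ℤ) else 0) =
        ∑ v ∈ thin G x, (nb G (lonely G x) v : ℤ) := by
      rw [← Finset.sum_filter]
      exact_mod_cast sum_nb_comm (G := G) (lonely G x) (thin G x)
    rw [e1, Finset.sum_add_distrib, e2, Finset.sum_sub_distrib _ (fun v => (nb G (lonely G x) v : ℤ))]
    ring
  have p1 : ∀ v ∈ thick G x, (0 : ℤ) ≤ (nb G (thick G x) v : ℤ) - 1 +
        (if nb G (thick G x) v = 0 then (nb G (thin G x) v : ℤ) else 0) := by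
    intro v hv
    have h1 := dg_of_mem_thick hv
    have h2 := hmin v
    rw [hq2 v hv] at h1
    split_ifs <;> omega
  have p2 : ∀ v ∈ thin G x, (0 : ℤ) ≤
      2 * nb G (thick G x) v + nb G (thin G x) v - 3 - nb G (lonely G x) v := by
    intro v hv
    have h1 := dg_of_mem_thin hv
    have h2 := hmin v
    have h3 := hlon v hv
    omega
  rw [hsum] at hid
  have q1 := Finset.sum_nonneg p1
  have q2 := Finset.sum_nonneg p2
  -- τ ≥ 4 gives 2e ≥ 5n - 10; if the better bound fails, all redistributed terms vanish.
  by_cases hcase : 5 * Fintype.card V ≤ 2 * G.edgeSet.ncard + 9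
  · exact Or.inl hcase
  · right
    zify at t1 t2 t3 hcase
    refine ⟨by zify; linarith, hG, hS, h12, h13, h23, a12, a23, n13, hall, hmate, ?_, ?_⟩
    · have z := (Finset.sum_eq_zero_iff_of_nonneg p1).1 (by linarith)
      intro v hv
      have := z v hv
      split_ifs at this <;> omega
    · have z := (Finset.sum_eq_zero_iff_of_nonneg p2).1 (by linarith)
      intro v hv
      have h0 := z v hv
      have h1 := dg_of_mem_thin hv
      have h2 := hmin v
      have h3 := hlon v hv
      omega

namespace TightPath

theorem adj_x (h : TightPath G x s₁ s₂ s₃) : G.Adj x s₁ ∧ G.Adj x s₂ ∧ G.Adj x s₃ := by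
  simp [h.nbr]

theorem edge (h : TightPath G x s₁ s₂ s₃) {w p : V} (hw : G.Adj x w) (hp : G.Adj x p)
    (hwp : G.Adj w p) : w = s₂ ∨ p = s₂ := by
  have n13 := h.not_adj
  rcases (h.nbr w).1 hw with rfl | rfl | rfl <;> rcases (h.nbr p).1 hp with rfl | rfl | rfl
  · exact absurd rfl hwp.ne
  · exact Or.inr rfl
  · exact absurd hwp n13
  · exact Or.inl rfl
  · exact Or.inl rfl
  · exact Or.inl rfl
  · exact absurd hwp.symm n13
  · exact Or.inr rfl
  · exact absurd rfl hwp.ne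

theorem thin_parent (h : TightPath G x s₁ s₂ s₃) {v : V} (hv : v ∈ thin G x) :
    ∃ w q, G.Adj x w ∧ G.Adj v w ∧ q ∈ thick G x ∧ G.Adj q s₂ ∧ G.Adj q w ∧ G.Adj q v := by
  obtain ⟨w, p, q, hw, hp, hwp, hvw, hq, qw, qp, hqv, hq2, -⟩ :=
    h.sat.parent (mem_thin.1 hv).1 (mem_thin.1 hv).2
  refine ⟨w, q, hw, hvw, h.sat.mem_thick_iff.2 ⟨hq, hq2⟩, ?_, qw, hqv⟩
  rcases h.edge hw hp hwp with rfl | rfl <;> assumption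

theorem two_of_thick (h : TightPath G x s₁ s₂ s₃) {v : V} (hv : v ∈ thick G x) :
    (G.Adj v s₁ ∧ G.Adj v s₂ ∧ ¬ G.Adj v s₃) ∨ (G.Adj v s₂ ∧ G.Adj v s₃ ∧ ¬ G.Adj v s₁) ∨
      (G.Adj v s₁ ∧ G.Adj v s₃ ∧ ¬ G.Adj v s₂) := by
  classical
  have h1 := (h.sat.mem_thick_iff.1 hv).2
  have h2 := h.not_all v (mem_thick.1 hv).1
  rw [nb_nbhd_three h.nbr h.ne₁₂ h.ne₁₃ h.ne₂₃] at h1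
  split_ifs at h1 <;> first | omega | tauto

theorem mem_thick_of_adj (h : TightPath G x s₁ s₂ s₃) {u r a b : V} (hu : u ∈ far G x)
    (hru : G.Adj r u) (ha : G.Adj x a) (hb : G.Adj x b) (hab : G.Adj a b) (ra : G.Adj r a)
    (rb : G.Adj r b) : r ∈ thick G x := by
  have hr : ¬ G.Adj x r := by
    intro hr
    have e1 := h.edge ha hb hab
    have e2 := h.edge hr ha ra
    have e3 := h.edge hr hb rb
    have := ra.ne
    have := rb.ne
    have := hab.ne
    grind
  refine h.sat.mem_thick_iff.2 ⟨mem_far.2 ⟨?_, hr⟩,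
    two_le_nb.2 ⟨a, by simpa, b, by simpa, hab.ne, ra, rb⟩⟩
  rintro rfl
  exact (mem_far.1 hu).2 hru

theorem thick_ne_thin {v u : V} (hv : v ∈ thick G x) (hu : u ∈ thin G x) : v ≠ u := by
  rintro rfl
  exact (mem_thick.1 hv).2 (mem_thin.1 hu).2

theorem nbr_ne_thin {v u : V} (hv : G.Adj x v) (hu : u ∈ thin G x) : v ≠ u := by
  rintro rfl
  exact (mem_far.1 (mem_thin.1 hu).1).2 hv

theorem nbr_ne_thick {v u : V} (hv : G.Adj x v) (hu : u ∈ thick G x) : v ≠ u := by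
  rintro rfl
  exact (mem_far.1 (mem_thick.1 hu).1).2 hv

/-- A lonely vertex cannot have a thin neighbour attached to a vertex next to `s₁`. -/
theorem not_lonely_aux (h : TightPath G x s₁ s₂ s₃) {u v q w : V} (hu : u ∈ lonely G x)
    (hv : v ∈ thin G x) (hw : G.Adj x w) (vw : G.Adj v w) (hq : q ∈ thick G x)
    (q1 : G.Adj q s₁) (q2 : G.Adj q s₂) (qw : G.Adj q w) (vq : G.Adj v q)
    (hNu : ∀ a, G.Adj u a ↔ a = s₁ ∨ a = s₃ ∨ a = v)
    (hNv : ∀ a, G.Adj v a ↔ a = w ∨ a = u ∨ a = q) (dgv : dg G v = 3) (dgu : dg G u = 3) :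
    False := by
  obtain ⟨x1, x2, x3⟩ := h.adj_x
  have hG := h.sat
  have n13 := h.not_adj
  have e12 := h.ne₁₂
  have hut := (mem_lonely.1 hu).1
  have huthick : ∀ r ∈ thick G x, ¬ G.Adj u r := nb_eq_zero.1 (mem_lonely.1 hu).2
  have q3 : ¬ G.Adj q s₃ := h.not_all q (mem_thick.1 hq).1 q1 q2
  have u1 : G.Adj u s₁ := by simp [hNu]
  have u2 : ¬ G.Adj u s₂ := by
    rw [hNu]
    have := nbr_ne_thin x2 hv
    have := h.ne₂₃
    tauto
  have huq : u ≠ q := by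
    rintro rfl
    exact u2 q2
  have nuq := huthick q hq
  have hw' : w = s₁ ∨ w = s₂ := by
    rcases (h.nbr w).1 hw with rfl | rfl | rfl
    · exact Or.inl rfl
    · exact Or.inr rfl
    · exact absurd qw q3
  rcases hw' with rfl | rfl
  · -- `u` against `q`
    have com : ∀ a, G.Adj u a → G.Adj q a → a = w ∨ a = v := by
      intro a ha hqa
      rcases (hNu a).1 ha with rfl | rfl | rfl
      · exact Or.inl rfl
      · exact absurd hqa q3
      · exact Or.inr rfl
    rcases hG.link u q huq nuq with ⟨c, p, r, k1, k2, k3, k4, k5, k6, k7⟩ |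
      ⟨a, b, r, hab, k1, k2, k3, k4, k5, k6, k7⟩ | ⟨a, b, r, hab, k1, k2, k3, k4, k5, k6, k7⟩
    · rcases com c k1.symm k4.symm with rfl | rfl
      · rcases (hNu p).1 k5 with rfl | rfl | rfl
        · exact G.irrefl k2
        · exact n13 k2
        · rcases (hNv r).1 k6 with rfl | rfl | rfl
          · exact G.irrefl k3
          · exact nuq k7
          · exact G.irrefl k7
      · have := four_le_dg huq nuq k1 k2 k3 k4 k5 k6 k7
        omega
    · have : G.Adj r w := by
        rcases com a k1 k4 with rfl | rfl
        · exact k6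
        · rcases com b k2 k5 with rfl | rfl
          · exact k7
          · exact absurd rfl hab
      have r' : G.Adj r v := by
        rcases com a k1 k4 with rfl | rfl
        · rcases com b k2 k5 with rfl | rfl
          · exact absurd rfl hab
          · exact k7
        · exact k6
      rcases (hNu r).1 k3 with rfl | rfl | rfl
      · exact G.irrefl this
      · exact n13 this.symm
      · exact G.irrefl r'
    · have : G.Adj r w := by
        rcases com a k4 k1 with rfl | rfl
        · exact k6
        · rcases com b k5 k2 with rfl | rfl
          · exact k7
          · exact absurd rfl hab
      have r' : G.Adj r v := by
        rcases com a k4 k1 with rfl | rfl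
        · rcases com b k5 k2 with rfl | rfl
          · exact absurd rfl hab
          · exact k7
        · exact k6
      rcases (hNv r).1 r'.symm with rfl | rfl | rfl
      · exact G.irrefl this
      · exact nuq k3.symm
      · exact G.irrefl k3
  · -- `v` against `s₁`
    have v1 : ¬ G.Adj v s₁ := fun hv1 => e12 (thin_unique hv x1 hw hv1 vw)
    -- Every link between `v` and `s₁` that is compatible with N(v) = {w, u, q} contains a common
    -- neighbour of `s₁`, `w` and `q`.
    obtain ⟨r, r1, r2, rq⟩ : ∃ r, G.Adj r s₁ ∧ G.Adj r w ∧ G.Adj r q := by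
      rcases hG.link v s₁ (nbr_ne_thin x1 hv).symm v1 with ⟨c, p, r, k1, k2, k3, k4, k5, k6, k7⟩ |
        ⟨a, b, r, hab, k1, k2, k3, k4, k5, k6, k7⟩ | ⟨a, b, r, hab, k1, k2, k3, k4, k5, k6, k7⟩
      · rcases (hNv c).1 k1.symm with rfl | rfl | rfl
        · rcases (hNv p).1 k5 with rfl | rfl | rfl
          · exact absurd k2 G.irrefl
          · exact absurd k2.symm u2
          · exact ⟨r, k7, k3.symm, k6.symm⟩
        · have := four_le_dg (nbr_ne_thin x1 hv).symm v1 k1 k2 k3 k4 k5 k6 k7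
          omega
        · rcases (hNv p).1 k5 with rfl | rfl | rfl
          · exact ⟨r, k7, k6.symm, k3.symm⟩
          · exact absurd k2.symm nuq
          · exact absurd k2 G.irrefl
      · exfalso
        rcases (hNv r).1 k3 with rfl | rfl | rfl
        · have one : ∀ a, G.Adj v a → G.Adj r a → a = q := by
            intro a ha hra
            rcases (hNv a).1 ha with rfl | rfl | rfl
            · exact absurd hra G.irrefl
            · exact absurd hra.symm u2
            · rfl
          exact hab ((one a k1 k6).trans (one b k2 k7).symm)
        · rcases (hNv a).1 k1 with rfl | rfl | rfl
          · exact u2 k6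
          · exact G.irrefl k6
          · exact nuq k6
        · have one : ∀ a, G.Adj v a → G.Adj r a → a = w := by
            intro a ha hra
            rcases (hNv a).1 ha with rfl | rfl | rfl
            · rfl
            · exact absurd hra.symm nuq
            · exact absurd hra G.irrefl
          exact hab ((one a k1 k6).trans (one b k2 k7).symm)
      · have hr : ¬ G.Adj r u := by
          intro hru
          rcases (hNu r).1 hru.symm with rfl | rfl | rfl
          · exact G.irrefl k3
          · exact n13 k3
          · exact v1 k3.symm
        have hau : a ≠ u := by
          rintro rfl
          exact hr k6
        have hbu : b ≠ u := by
          rintro rfl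
          exact hr k7
        rcases (hNv a).1 k4 with rfl | rfl | rfl
        · rcases (hNv b).1 k5 with rfl | rfl | rfl
          · exact absurd rfl hab
          · exact absurd rfl hbu
          · exact ⟨r, k3.symm, k6, k7⟩
        · exact absurd rfl hau
        · rcases (hNv b).1 k5 with rfl | rfl | rfl
          · exact ⟨r, k3.symm, k7, k6⟩
          · exact absurd rfl hbu
          · exact absurd rfl hab
    -- `r` is thick and `s₁` is its only common neighbour with `u`, so `s₁` would be the hub of a
    -- rim link; but no neighbour of `u` is adjacent to `s₁`.
    have hr := h.mem_thick_of_adj (mem_thick.1 hq).1 rq x1 hw h.adj₁₂ r1 r2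
    have nur := huthick r hr
    have hur : u ≠ r := by
      rintro rfl
      exact nuq rq
    have r3 := h.not_all r (mem_thick.1 hr).1 r1 r2
    obtain ⟨p, y, k1, k2, k3, k4, k5, k6, k7⟩ := hG.link_of_unique (h₀ := s₁) hur nur (by
      intro a ha hra
      rcases (hNu a).1 ha with rfl | rfl | rfl
      · rfl
      · exact absurd hra r3
      · rcases (hNv r).1 hra.symm with rfl | rfl | rfl
        · exact absurd r2 G.irrefl
        · exact absurd rfl hur
        · exact absurd rq G.irrefl)
    rcases (hNu p).1 k5 with rfl | rfl | rfl
    · exact G.irrefl k2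
    · exact n13 k2
    · exact v1 k2.symm

/-- A lonely vertex misses `s₂`, because thick vertices adjacent to `s₂` have mates. Tightness
leaves it the neighbours `s₁`, `s₃` and one thin vertex, whose parent is adjacent to `s₂` and to one
of `s₁`, `s₃`; the two cases are symmetric. -/
theorem not_lonely (h : TightPath G x s₁ s₂ s₃) {u : V} (hu : u ∈ lonely G x) : False := by
  obtain ⟨x1, x2, x3⟩ := h.adj_x
  have hut := (mem_lonely.1 hu).1
  have h0 := (mem_lonely.1 hu).2
  obtain ⟨u1, u3, u2⟩ : G.Adj u s₁ ∧ G.Adj u s₃ ∧ ¬ G.Adj u s₂ := by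
    have no : ¬ G.Adj u s₂ := by
      intro u2
      obtain ⟨r, hr, -, hru⟩ := h.mate u hut u2
      exact nb_eq_zero.1 h0 r hr hru.symm
    have := h.two_of_thick hut
    tauto
  have h1 : nb G (thin G x) u = 1 := by
    have := h.thick_tight u hut
    omega
  obtain ⟨v, hv, huv, -⟩ := nb_eq_one.1 h1
  have dgu : dg G u = 3 := by
    classical
    have h2 := dg_of_mem_thick hut
    rw [nb_nbhd_three h.nbr h.ne₁₂ h.ne₁₃ h.ne₂₃, if_pos u1, if_neg u2, if_pos u3] at h2
    omega
  have hNu := adj_iff_of_dg_three dgu u1 u3 huv h.ne₁₃ (nbr_ne_thin x1 hv) (nbr_ne_thin x3 hv)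
  obtain ⟨w, q, hw, vw, hq, q2, qw, qv⟩ := h.thin_parent hv
  have huq : u ≠ q := by
    rintro rfl
    exact u2 q2
  have dgv := (h.thin_tight v hv).1
  have hNv := adj_iff_of_dg_three dgv vw huv.symm qv.symm (nbr_ne_thick hw hut)
    (nbr_ne_thick hw hq) huq
  rcases h.two_of_thick hq with ⟨q1, -, -⟩ | ⟨-, q3, -⟩ | ⟨-, -, q2'⟩
  · exact h.not_lonely_aux hu hv hw vw hq q1 q2 qw qv.symm hNu hNv dgv dgu
  · exact h.symm.not_lonely_aux hu hv hw vw hq q3 q2 qw qv.symm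
      (fun a => by rw [hNu]; tauto) hNv dgv dgu
  · exact q2' q2

theorem nb_thick_of_thick (h : TightPath G x s₁ s₂ s₃) {v : V} (hv : v ∈ thick G x) :
    nb G (thick G x) v = 1 := by
  rcases h.thick_tight v hv with h1 | ⟨h1, -⟩
  · exact h1
  · exact (h.not_lonely (mem_lonely.2 ⟨hv, h1⟩)).elim

theorem thick_mate_unique (h : TightPath G x s₁ s₂ s₃) {v a b : V} (hv : v ∈ thick G x)
    (ha : a ∈ thick G x) (hb : b ∈ thick G x) (va : G.Adj v a) (vb : G.Adj v b) : a = b := by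
  obtain ⟨m, -, -, hm⟩ := nb_eq_one.1 (h.nb_thick_of_thick hv)
  exact (hm a ha va).trans (hm b hb vb).symm

theorem nb_of_thin (h : TightPath G x s₁ s₂ s₃) {v : V} (hv : v ∈ thin G x) :
    nb G (thick G x) v = 1 ∧ nb G (thin G x) v = 1 := by
  obtain ⟨h1, h2⟩ := h.thin_tight v hv
  have h3 : nb G (lonely G x) v = 0 := nb_eq_zero.2 fun u hu _ => (h.not_lonely hu).elim
  have h4 := dg_of_mem_thin hv
  omega

theorem thin_nbrs (h : TightPath G x s₁ s₂ s₃) {v : V} (hv : v ∈ thin G x) :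
    ∃ w q v', G.Adj x w ∧ q ∈ thick G x ∧ v' ∈ thin G x ∧ G.Adj q s₂ ∧ G.Adj q w ∧
      dg G v = 3 ∧ ∀ u, G.Adj v u ↔ u = w ∨ u = q ∨ u = v' := by
  obtain ⟨w, q, hw, vw, hq, q2, qw, qv⟩ := h.thin_parent hv
  obtain ⟨v', hv', vv', -⟩ := nb_eq_one.1 (h.nb_of_thin hv).2
  have hd := (h.thin_tight v hv).1
  exact ⟨w, q, v', hw, hq, hv', q2, qw, hd, adj_iff_of_dg_three hd vw qv.symm vv'
    (nbr_ne_thick hw hq) (nbr_ne_thin hw hv') (thick_ne_thin hq hv')⟩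

theorem thin_parent_unique (h : TightPath G x s₁ s₂ s₃) {v a b : V} (hv : v ∈ thin G x)
    (ha : a ∈ thick G x) (hb : b ∈ thick G x) (va : G.Adj v a) (vb : G.Adj v b) : a = b := by
  obtain ⟨m, -, -, hm⟩ := nb_eq_one.1 (h.nb_of_thin hv).1
  exact (hm a ha va).trans (hm b hb vb).symm

end TightPath

end Path

/-! ### The tight case: the middle of the path is universal. -/

section PathUniversal

variable {V : Type u} [Fintype V] {G : SimpleGraph V} {x s₁ s₂ s₃ : V}

namespace TightPath

/-- The neighbours of a thick vertex that is not adjacent to `s₂`. -/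
theorem nbrs_of_not_adj (h : TightPath G x s₁ s₂ s₃) {u : V} (hu : u ∈ thick G x)
    (u2 : ¬ G.Adj u s₂) : ∃ u' ∈ thick G x, ¬ G.Adj u' s₂ ∧ dg G u = 3 ∧
      ∀ a, G.Adj u a ↔ a = s₁ ∨ a = s₃ ∨ a = u' := by
  classical
  obtain ⟨x1, x2, x3⟩ := h.adj_x
  obtain ⟨u1, u3⟩ : G.Adj u s₁ ∧ G.Adj u s₃ := by
    have := h.two_of_thick hu
    tauto
  obtain ⟨u', hu', uu', -⟩ := nb_eq_one.1 (h.nb_thick_of_thick hu)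
  have h0 : nb G (thin G x) u = 0 := by
    refine nb_eq_zero.2 fun v hv huv => ?_
    obtain ⟨w, q, hw, vw, hq, q2, qw, qv⟩ := h.thin_parent hv
    have := h.thin_parent_unique hv hu hq huv.symm qv.symm
    subst this
    exact u2 q2
  have hd := dg_of_mem_thick hu
  rw [nb_nbhd_three h.nbr h.ne₁₂ h.ne₁₃ h.ne₂₃, if_pos u1, if_neg u2, if_pos u3,
    h.nb_thick_of_thick hu, h0] at hd
  refine ⟨u', hu', ?_, by omega, adj_iff_of_dg_three (by omega) u1 u3 uu' h.ne₁₃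
    (nbr_ne_thick x1 hu') (nbr_ne_thick x3 hu')⟩
  intro u'2
  obtain ⟨r, hr, r2, hru⟩ := h.mate u' hu' u'2
  have := h.thick_mate_unique hu' hr hu hru.symm uu'.symm
  subst this
  exact u2 r2

/-- `u` and its mate `u'` have no neighbours but each other, `s₁` and `s₃`. So `s₁` is the only
common neighbour of `u` and `q` and would be the hub of a rim link, but the rim path from `u` cannot
get beyond `u'`. -/
theorem not_adj_aux (h : TightPath G x s₁ s₂ s₃) {u q : V} (hu : u ∈ thick G x)
    (u2 : ¬ G.Adj u s₂) (hq : q ∈ thick G x) (q2 : G.Adj q s₂) (q1 : G.Adj q s₁) : False := by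
  obtain ⟨x1, x2, x3⟩ := h.adj_x
  obtain ⟨u', hu', u'2, -, hNu⟩ := h.nbrs_of_not_adj hu u2
  obtain ⟨u'', hu'', u''2, -, hNu'⟩ := h.nbrs_of_not_adj hu' u'2
  have uu' : G.Adj u u' := by simp [hNu]
  have e := h.thick_mate_unique hu' hu hu'' uu'.symm (by simp [hNu'])
  subst e
  have huq : u ≠ q := by
    rintro rfl
    exact u2 q2
  have hu'q : u' ≠ q := by
    rintro rfl
    exact u'2 q2
  have nuq : ¬ G.Adj u q := fun e => hu'q (h.thick_mate_unique hu hu' hq uu' e)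
  have q3 := h.not_all q (mem_thick.1 hq).1 q1 q2
  obtain ⟨p, y, k1, k2, k3, k4, k5, k6, k7⟩ := h.sat.link_of_unique (h₀ := s₁) huq nuq (by
    intro a ha hqa
    rcases (hNu a).1 ha with rfl | rfl | rfl
    · rfl
    · exact absurd hqa q3
    · exact absurd (h.thick_mate_unique hu' hu hq uu'.symm hqa.symm) huq)
  rcases (hNu p).1 k5 with rfl | rfl | rfl
  · exact G.irrefl k2
  · exact h.not_adj k2
  · rcases (hNu' y).1 k6 with rfl | rfl | rfl
    · exact G.irrefl k3
    · exact h.not_adj k3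
    · exact nuq k7

/-- By `not_adj_aux` one thick vertex missing `s₂` makes all of them miss it. Then no thin vertex
exists, since parents are adjacent to `s₂`, and N(s₂) = {x, s₁, s₃}. Neighbours of `s₁` or `s₃` now
have at most one neighbour besides these two, which leaves no link between `s₁` and `s₃`. -/
theorem thick_adj (h : TightPath G x s₁ s₂ s₃) {u : V} (hu : u ∈ thick G x) : G.Adj u s₂ := by
  by_contra u2
  obtain ⟨x1, x2, x3⟩ := h.adj_x
  have hall : ∀ q ∈ thick G x, ¬ G.Adj q s₂ := by
    intro q hq q2
    rcases h.two_of_thick hq with ⟨q1, -, -⟩ | ⟨-, q3, -⟩ | ⟨-, -, q2'⟩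
    · exact h.not_adj_aux hu u2 hq q2 q1
    · exact h.symm.not_adj_aux hu u2 hq q2 q3
    · exact q2' q2
  have hthin : ∀ v, v ∉ thin G x := by
    intro v hv
    obtain ⟨w, q, hw, vw, hq, q2, qw, qv⟩ := h.thin_parent hv
    exact hall q hq q2
  have hN2 : ∀ a, G.Adj s₂ a ↔ a = x ∨ a = s₁ ∨ a = s₃ := by
    intro a
    constructor
    · intro ha
      rcases mem_parts (G := G) (x := x) (v := a) with rfl | ha' | ha' | ha'
      · exact Or.inl rfl
      · rcases (h.nbr a).1 ha' with rfl | rfl | rfl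
        · exact Or.inr (Or.inl rfl)
        · exact absurd ha G.irrefl
        · exact Or.inr (Or.inr rfl)
      · exact absurd ha.symm (hall a ha')
      · exact absurd ha' (hthin a)
    · rintro (rfl | rfl | rfl)
      exacts [x2.symm, h.adj₁₂.symm, h.adj₂₃]
  -- the neighbours of a neighbour of `s₁`
  have one : ∀ r a b, (G.Adj r s₁ ∨ G.Adj r s₃) → G.Adj r a → G.Adj r b → a ≠ s₁ → a ≠ s₃ →
      b ≠ s₁ → b ≠ s₃ → a = b := by
    intro r a b hr ra rb a1 a3 b1 b3
    rcases mem_parts (G := G) (x := x) (v := r) with rfl | hr' | hr' | hr'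
    · have := (h.nbr a).1 ra
      have := (h.nbr b).1 rb
      grind
    · rcases (h.nbr r).1 hr' with rfl | rfl | rfl
      · exact absurd hr (not_or.2 ⟨G.irrefl, h.not_adj⟩)
      · have := (hN2 a).1 ra
        have := (hN2 b).1 rb
        grind
      · exact absurd hr (not_or.2 ⟨fun e => h.not_adj e.symm, G.irrefl⟩)
    · obtain ⟨u', -, -, -, hN⟩ := h.nbrs_of_not_adj hr' (hall r hr')
      have := (hN a).1 ra
      have := (hN b).1 rb
      grind
    · exact absurd hr' (hthin r)
  have ne1 : ∀ a, G.Adj a s₁ → a ≠ s₁ ∧ a ≠ s₃ := fun a ha => ⟨ha.ne, by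
    rintro rfl
    exact h.not_adj ha.symm⟩
  rcases h.sat.link s₁ s₃ h.ne₁₃ h.not_adj with ⟨c, p, r, k1, k2, k3, k4, k5, k6, k7⟩ |
      ⟨a, b, r, hab, k1, k2, k3, k4, k5, k6, k7⟩ | ⟨a, b, r, hab, k1, k2, k3, k4, k5, k6, k7⟩
  · have := one c p r (Or.inl k1) k2 k3 k5.ne.symm (ne1 p k5.symm).2
      (fun e => h.not_adj (e ▸ k7)) k7.ne
    exact k6.ne this
  · exact hab (one r a b (Or.inl k3.symm) k6 k7 k1.ne.symm k4.ne.symm k2.ne.symm k5.ne.symm)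
  · exact hab (one r a b (Or.inr k3.symm) k6 k7 k4.ne.symm k1.ne.symm k5.ne.symm k2.ne.symm)

/-- Otherwise `v` and `s₃` could only be linked through the thin neighbour of `v`, whose degree 3 is
too small for a hub. -/
theorem not_thin_adj (h : TightPath G x s₁ s₂ s₃) {v : V} (hv : v ∈ thin G x) :
    ¬ G.Adj v s₁ := by
  intro v1
  obtain ⟨x1, x2, x3⟩ := h.adj_x
  obtain ⟨w, q, v', hw, hq, hv', q2, qw, -, hN⟩ := h.thin_nbrs hv
  have := thin_unique hv x1 hw v1 (by simp [hN])
  subst this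
  have q3 := h.not_all q (mem_thick.1 hq).1 qw q2
  have v3 : ¬ G.Adj v s₃ := fun e => h.ne₁₃ (thin_unique hv x1 x3 v1 e)
  obtain ⟨-, -, -, -, -, -, -, -, hd, -⟩ := h.thin_nbrs hv'
  refine h.sat.false_of_unique (h₀ := v') (nbr_ne_thin x3 hv).symm v3 ?_ hd.le
  intro a ha hs
  rcases (hN a).1 ha with rfl | rfl | rfl
  · exact absurd hs.symm h.not_adj
  · exact absurd hs.symm q3
  · rfl

theorem universal (h : TightPath G x s₁ s₂ s₃) {v : V} (hv : v ≠ s₂) : G.Adj s₂ v := by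
  obtain ⟨x1, x2, x3⟩ := h.adj_x
  rcases mem_parts (G := G) (x := x) (v := v) with rfl | hr' | hr' | hr'
  · exact x2.symm
  · rcases (h.nbr v).1 hr' with rfl | rfl | rfl
    · exact h.adj₁₂.symm
    · exact absurd rfl hv
    · exact h.adj₂₃
  · exact (h.thick_adj hr').symm
  · obtain ⟨w, q, v', hw, hq, hv', q2, qw, -, hN⟩ := h.thin_nbrs hr'
    have vw : G.Adj v w := by simp [hN]
    rcases (h.nbr w).1 hw with rfl | rfl | rfl
    · exact absurd vw (h.not_thin_adj hr')
    · exact vw.symm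
    · exact absurd vw (h.symm.not_thin_adj hr')

end TightPath

end PathUniversal

/-! ### The graph left after deleting the universal vertex. -/

section ConePath

variable {V : Type u} {G : SimpleGraph V} {w x s t : V}

/-- `v` is adjacent to an end of the path `s x t`. -/
def Mid (G : SimpleGraph V) (w x s t v : V) : Prop := v ≠ w ∧ v ≠ x ∧ (G.Adj v s ∨ G.Adj v t)

/-- `v` is not on the path `s x t` and not adjacent to its ends. -/
def Leaf (G : SimpleGraph V) (w x s t v : V) : Prop :=
  v ≠ w ∧ v ≠ x ∧ v ≠ s ∧ v ≠ t ∧ ¬ G.Adj v s ∧ ¬ G.Adj v t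

/-- The graph has a universal vertex `w`; outside `w` there is a path `s x t` and all other
vertices come in adjacent pairs at distance one and two from its ends. -/
structure ConePath (G : SimpleGraph V) (w x s t : V) : Prop where
  sat : Sat G
  univ : ∀ v, v ≠ w → G.Adj w v
  nbr : ∀ u, u ≠ w → (G.Adj x u ↔ u = s ∨ u = t)
  x_ne : x ≠ w
  s_ne : s ≠ w
  t_ne : t ≠ w
  ne : s ≠ t
  not_adj : ¬ G.Adj s t
  not_both : ∀ v, v ≠ w → v ≠ x → G.Adj v s → ¬ G.Adj v t
  mate : ∀ v, Mid G w x s t v → ∃ m, Mid G w x s t m ∧ G.Adj v m ∧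
    ∀ m', Mid G w x s t m' → G.Adj v m' → m' = m
  leaf : ∀ v, Leaf G w x s t v → ∃ q v', Mid G w x s t q ∧ Leaf G w x s t v' ∧
    ∀ u, u ≠ w → (G.Adj v u ↔ u = q ∨ u = v')

/-- The vertices in `Mid` are the thick ones, those in `Leaf` the thin ones. -/
theorem TightPath.conePath [Fintype V] {s₁ s₂ s₃ : V} (h : TightPath G x s₁ s₂ s₃) :
    ConePath G s₂ x s₁ s₃ := by
  obtain ⟨x1, x2, x3⟩ := h.adj_x
  have mid : ∀ v, Mid G s₂ x s₁ s₃ v ↔ v ∈ thick G x := by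
    intro v
    constructor
    · rintro ⟨hw, hx, hv⟩
      have hnx : ¬ G.Adj x v := by
        intro hxv
        rcases (h.nbr v).1 hxv with rfl | rfl | rfl
        · exact hv.elim G.irrefl h.not_adj
        · exact hw rfl
        · exact hv.elim (fun e => h.not_adj e.symm) G.irrefl
      have hv2 := (h.universal hw).symm
      refine h.sat.mem_thick_iff.2 ⟨mem_far.2 ⟨hx, hnx⟩, two_le_nb.2 ?_⟩
      rcases hv with hv | hv
      · exact ⟨s₁, by simpa, s₂, by simpa, h.ne₁₂, hv, hv2⟩
      · exact ⟨s₃, by simpa, s₂, by simpa, h.ne₂₃.symm, hv, hv2⟩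
    · intro hv
      refine ⟨(nbr_ne_thick x2 hv).symm, (mem_far.1 (mem_thick.1 hv).1).1, ?_⟩
      have := h.two_of_thick hv
      tauto
  have leaf : ∀ v, Leaf G s₂ x s₁ s₃ v ↔ v ∈ thin G x := by
    intro v
    constructor
    · rintro ⟨h1, h2, h3, h4, h5, h6⟩
      rcases mem_parts (G := G) (x := x) (v := v) with rfl | hr' | hr' | hr'
      · exact absurd rfl h2
      · rcases (h.nbr v).1 hr' with rfl | rfl | rfl <;> contradiction
      · have := h.two_of_thick hr'
        tauto
      · exact hr'
    · intro hv
      exact ⟨(TightPath.nbr_ne_thin x2 hv).symm, (mem_far.1 (mem_thin.1 hv).1).1,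
        (TightPath.nbr_ne_thin x1 hv).symm, (TightPath.nbr_ne_thin x3 hv).symm,
        h.not_thin_adj hv, h.symm.not_thin_adj hv⟩
  refine ⟨h.sat, fun v => h.universal, ?_, x2.ne, h.ne₁₂, h.ne₂₃.symm, h.ne₁₃, h.not_adj, ?_, ?_,
    ?_⟩
  · intro u hu
    rw [h.nbr]
    tauto
  · intro v hw hx h1 h3
    have hv : v ∈ far G x := (mem_thick.1 ((mid v).1 ⟨hw, hx, Or.inl h1⟩)).1
    exact h.not_all v hv h1 (h.universal hw).symm h3
  · intro v hv
    rw [mid] at hv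
    obtain ⟨m, hm, vm, hu⟩ := nb_eq_one.1 (h.nb_thick_of_thick hv)
    exact ⟨m, (mid m).2 hm, vm, fun m' hm' => hu m' ((mid m').1 hm')⟩
  · intro v hv
    rw [leaf] at hv
    obtain ⟨a, q, v', ha, hq, hv', q2, qw, -, hN⟩ := h.thin_nbrs hv
    refine ⟨q, v', (mid q).2 hq, (leaf v').2 hv', fun u hu => ?_⟩
    have : a = s₂ := thin_unique hv ha x2 (by simp [hN])
      (h.universal (TightPath.nbr_ne_thin x2 hv).symm).symm
    subst this
    rw [hN]
    tauto

namespace ConePath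

theorem symm (h : ConePath G w x s t) : ConePath G w x t s := by
  have mid : ∀ v, Mid G w x s t v ↔ Mid G w x t s v := fun v => by simp only [Mid]; tauto
  have leaf : ∀ v, Leaf G w x s t v ↔ Leaf G w x t s v := fun v => by simp only [Leaf]; tauto
  refine ⟨h.sat, h.univ, fun u hu => (h.nbr u hu).trans or_comm, h.x_ne, h.t_ne, h.s_ne, h.ne.symm,
    fun e => h.not_adj e.symm, fun v h1 h2 h3 h4 => h.not_both v h1 h2 h4 h3, ?_, ?_⟩
  · simpa only [mid] using h.mate
  · simpa only [mid, leaf] using h.leaf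

theorem path (h : ConePath G w x s t) {a b : V} (ha : a ≠ w) (hb : b ≠ w) (hab : a ≠ b)
    (hn : ¬ G.Adj a b) : ∃ p r, p ≠ w ∧ r ≠ w ∧ G.Adj a p ∧ G.Adj p r ∧ G.Adj r b :=
  h.sat.path_of_universal h.univ ha hb hab hn

theorem mate_unique (h : ConePath G w x s t) {v a b : V} (hv : Mid G w x s t v)
    (ha : Mid G w x s t a) (hb : Mid G w x s t b) (va : G.Adj v a) (vb : G.Adj v b) : a = b := by
  obtain ⟨m, -, -, hm⟩ := h.mate v hv
  exact (hm a ha va).trans (hm b hb vb).symm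

theorem parts (G : SimpleGraph V) (w x s t v : V) :
    v = w ∨ v = x ∨ v = s ∨ v = t ∨ Mid G w x s t v ∨ Leaf G w x s t v := by
  simp only [Mid, Leaf]
  tauto

theorem leaf_not_mid {v : V} (hv : Leaf G w x s t v) : ¬ Mid G w x s t v := by
  rintro ⟨-, -, h1⟩
  exact h1.elim hv.2.2.2.2.1 hv.2.2.2.2.2

theorem s_not_mid (h : ConePath G w x s t) : ¬ Mid G w x s t s :=
  fun ⟨_, _, h1⟩ => h1.elim G.irrefl h.not_adj

theorem parent_unique (h : ConePath G w x s t) {v a b : V} (hv : Leaf G w x s t v)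
    (ha : Mid G w x s t a) (hb : Mid G w x s t b) (va : G.Adj v a) (vb : G.Adj v b) : a = b := by
  obtain ⟨q, v', hq, hv', hN⟩ := h.leaf v hv
  have e : ∀ c, Mid G w x s t c → G.Adj v c → c = q := by
    intro c hc vc
    rcases (hN c hc.1).1 vc with rfl | rfl
    · rfl
    · exact absurd hc (leaf_not_mid hv')
  exact (e a ha va).trans (e b hb vb).symm

theorem not_adj_x (h : ConePath G w x s t) {v : V} (hv : Mid G w x s t v) : ¬ G.Adj v x := by
  intro e
  rcases (h.nbr v hv.1).1 e.symm with rfl | rfl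
  · exact h.s_not_mid hv
  · exact hv.2.2.elim (fun e => h.not_adj e.symm) G.irrefl

/-- There are adjacent vertices next to the two ends. -/
theorem exists_cross (h : ConePath G w x s t) :
    ∃ u u', Mid G w x s t u ∧ Mid G w x s t u' ∧ G.Adj u s ∧ G.Adj u' t ∧ G.Adj u u' := by
  -- The path of length three from `s` to `t` avoids `x`, whose only neighbours besides `w` are `s`
  -- and `t`.
  obtain ⟨p, r, hp, hr, k1, k2, k3⟩ := h.path h.s_ne h.t_ne h.ne h.not_adj
  have hpx : p ≠ x := by
    rintro rfl
    rcases (h.nbr r hr).1 k2 with rfl | rfl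
    · exact h.not_adj k3
    · exact G.irrefl k3
  have hrx : r ≠ x := by
    rintro rfl
    rcases (h.nbr p hp).1 k2.symm with rfl | rfl
    · exact G.irrefl k1
    · exact h.not_adj k1
  exact ⟨p, r, ⟨hp, hpx, Or.inl k1.symm⟩, ⟨hr, hrx, Or.inr k3⟩, k1.symm, k3, k2⟩

/-- Neighbours of a vertex next to `s`. -/
theorem nbr_mid (h : ConePath G w x s t) {q m a : V} (hq : Mid G w x s t q) (qs : G.Adj q s)
    (hm : Mid G w x s t m) (qm : G.Adj q m) (ha : a ≠ w) (qa : G.Adj q a) :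
    a = s ∨ a = m ∨ Leaf G w x s t a := by
  rcases parts G w x s t a with rfl | rfl | rfl | rfl | ha' | ha'
  · exact absurd rfl ha
  · exact absurd qa (h.not_adj_x hq)
  · exact Or.inl rfl
  · exact absurd qa (h.not_both q hq.1 hq.2.1 qs)
  · exact Or.inr (Or.inl (h.mate_unique hq ha' hm qa qm))
  · exact Or.inr (Or.inr ha')

/-- A leaf attached to a vertex `q` next to `s`: its mate is also attached to `q`, whose mate is next
to `t`. -/
theorem leaf_parent (h : ConePath G w x s t) {v v' q : V} (hv : Leaf G w x s t v)
    (hv' : Leaf G w x s t v') (hq : Mid G w x s t q) (vv' : G.Adj v v') (vq : G.Adj v q)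
    (qs : G.Adj q s) : G.Adj v' q ∧ ∃ m, Mid G w x s t m ∧ G.Adj q m ∧ G.Adj m t := by
  obtain ⟨a, b, ha, hb, hN⟩ := h.leaf v hv
  have eq : q = a := h.parent_unique hv hq ha vq ((hN a ha.1).2 (Or.inl rfl))
  subst eq
  have eb : v' = b := by
    rcases (hN v' hv'.1).1 vv' with rfl | rfl
    · exact absurd hq (leaf_not_mid hv')
    · rfl
  subst eb
  obtain ⟨q', c, hq', hc, hN'⟩ := h.leaf v' hv'
  have ec : v = c := by
    rcases (hN' v hv.1).1 vv'.symm with rfl | rfl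
    · exact absurd hq' (leaf_not_mid hv)
    · rfl
  subst ec
  have vq2 : G.Adj v' q' := (hN' q' hq'.1).2 (Or.inl rfl)
  obtain ⟨m, hm, qm, hmu⟩ := h.mate q hq
  have qt := h.not_both q hq.1 hq.2.1 qs
  have child : ∀ r, G.Adj q r → Leaf G w x s t r → ∀ z, Mid G w x s t z → G.Adj r z → z = q :=
    fun r hqr hr z hz hrz => h.parent_unique hr hz hq hrz hqr.symm
  -- the path from `v` to `t`
  have mt : q' = q ∨ G.Adj q' t ∨ G.Adj m t := by
    obtain ⟨p, r, hp, hr, k1, k2, k3⟩ := h.path hv.1 h.t_ne hv.2.2.2.1 hv.2.2.2.2.2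
    rcases (hN p hp).1 k1 with rfl | rfl
    · rcases h.nbr_mid hq qs hm qm hr k2 with rfl | rfl | hr'
      · exact absurd k3 h.not_adj
      · exact Or.inr (Or.inr k3)
      · exact absurd k3 hr'.2.2.2.2.2
    · rcases (hN' r hr).1 k2 with rfl | rfl
      · exact Or.inr (Or.inl k3)
      · exact absurd k3 hv.2.2.2.2.2
  -- If `v'` hangs on another vertex `q'`, there is no path of length three from `v` to `q'` when
  -- `q'` is next to `t`, nor from `v` to `m` when `m` is next to `t`.
  have hqq' : q' = q := by
    by_contra hne
    have vnq' : ¬ G.Adj v q' := fun e => hne (h.parent_unique hv hq' hq e vq)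
    have vq'ne : v ≠ q' := by
      rintro rfl
      exact leaf_not_mid hv hq'
    by_cases q't : G.Adj q' t
    · obtain ⟨p, r, hp, hr, k1, k2, k3⟩ := h.path hv.1 hq'.1 vq'ne vnq'
      rcases (hN p hp).1 k1 with rfl | rfl
      · rcases h.nbr_mid hq qs hm qm hr k2 with rfl | rfl | hr'
        · exact h.not_both q' hq'.1 hq'.2.1 k3.symm q't
        · exact hne (h.mate_unique hm hq' hq k3 qm.symm)
        · exact hne (child r k2 hr' q' hq' k3)
      · rcases (hN' r hr).1 k2 with rfl | rfl
        · exact G.irrefl k3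
        · exact vnq' k3
    · have mt' : G.Adj m t := by tauto
      have ms : ¬ G.Adj m s := fun e => h.not_both m hm.1 hm.2.1 e mt'
      have vnm : ¬ G.Adj v m := fun e => qm.ne (h.parent_unique hv hq hm vq e)
      have vmne : v ≠ m := by
        rintro rfl
        exact leaf_not_mid hv hm
      obtain ⟨p, r, hp, hr, k1, k2, k3⟩ := h.path hv.1 hm.1 vmne vnm
      rcases (hN p hp).1 k1 with rfl | rfl
      · rcases h.nbr_mid hq qs hm qm hr k2 with rfl | rfl | hr'
        · exact ms k3.symm
        · exact G.irrefl k3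
        · exact qm.ne (child r k2 hr' m hm k3).symm
      · rcases (hN' r hr).1 k2 with rfl | rfl
        · exact hne (h.mate_unique hm hq' hq k3.symm qm.symm)
        · exact vnm k3
  subst hqq'
  refine ⟨vq2, m, hm, qm, ?_⟩
  -- the path from `v` to `t` again
  obtain ⟨p, r, hp, hr, k1, k2, k3⟩ := h.path hv.1 h.t_ne hv.2.2.2.1 hv.2.2.2.2.2
  rcases (hN p hp).1 k1 with rfl | rfl
  · rcases h.nbr_mid hq qs hm qm hr k2 with rfl | rfl | hr'
    · exact absurd k3 h.not_adj
    · exact k3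
    · exact absurd k3 hr'.2.2.2.2.2
  · rcases (hN' r hr).1 k2 with rfl | rfl
    · exact absurd k3 qt
    · exact absurd k3 hv.2.2.2.2.2

/-- There is only one pair of adjacent vertices next to the two ends. -/
theorem cross_unique (h : ConePath G w x s t) {u u' q q' : V} (hu : Mid G w x s t u)
    (hu' : Mid G w x s t u') (us : G.Adj u s) (u't : G.Adj u' t) (uu' : G.Adj u u')
    (hq : Mid G w x s t q) (hq' : Mid G w x s t q') (qs : G.Adj q s) (q't : G.Adj q' t)
    (qq' : G.Adj q q') : q = u := by
  by_contra hne
  have ns : ∀ a, Mid G w x s t a → G.Adj a t → ¬ G.Adj a s := fun a ha h1 h2 =>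
    h.not_both a ha.1 ha.2.1 h2 h1
  have nqu : ¬ G.Adj q u := by
    intro e
    have := h.mate_unique hq hu hq' e qq'
    subst this
    exact ns u hu q't us
  -- Each inner vertex of the path is `s`, a mate, or a leaf at its end; all nine combinations fail.
  obtain ⟨p, r, hp, hr, k1, k2, k3⟩ := h.path hq.1 hu.1 hne nqu
  have child : ∀ z r y, Mid G w x s t z → Mid G w x s t y → G.Adj z r → Leaf G w x s t r →
      G.Adj r y → y = z := fun z r y hz hy hzr hr hry => h.parent_unique hr hy hz hry hzr.symm
  rcases h.nbr_mid hq qs hq' qq' hp k1 with rfl | rfl | hp'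
  · rcases h.nbr_mid hu us hu' uu' hr k3.symm with rfl | rfl | hr'
    · exact G.irrefl k2
    · exact ns _ hu' u't k2.symm
    · exact hr'.2.2.2.2.1 k2.symm
  · rcases h.nbr_mid hu us hu' uu' hr k3.symm with rfl | rfl | hr'
    · exact ns _ hq' q't k2
    · have e := h.mate_unique hu' hq' hu k2.symm uu'.symm
      exact ns _ hq' q't (e ▸ us)
    · exact ns _ hq' q't (child u r p hu hq' k3.symm hr' k2.symm ▸ us)
  · rcases h.nbr_mid hu us hu' uu' hr k3.symm with rfl | rfl | hr'
    · exact hp'.2.2.2.2.1 k2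
    · have e := child q p r hq hu' k1 hp' k2
      subst e
      exact ns _ hu' u't qs
    · have := (h.leaf_parent hp' hr' hq k2 k1.symm qs).1
      exact hne (child u r q hu hq k3.symm hr' this)

/-- Vertices next to `s` outside the cross pair form pairs at `s`. -/
theorem pairs_end (h : ConePath G w x s t) {u u' : V} (hu : Mid G w x s t u)
    (hu' : Mid G w x s t u') (us : G.Adj u s) (u't : G.Adj u' t) (uu' : G.Adj u u') {v : V}
    (hv : Mid G w x s t v) (vs : G.Adj v s) (hvu : v ≠ u) :
    ∃ m, (Mid G w x s t m ∧ G.Adj m s ∧ m ≠ u) ∧ ∀ a, a ≠ w → (G.Adj v a ↔ a = s ∨ a = m) := by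
  obtain ⟨m, hm, vm, -⟩ := h.mate v hv
  have mt : ¬ G.Adj m t := fun mt => hvu (h.cross_unique hu hu' us u't uu' hv hm vs mt vm)
  have ms : G.Adj m s := hm.2.2.resolve_right mt
  refine ⟨m, ⟨hm, ms, ?_⟩, fun a ha => ⟨fun va => ?_, ?_⟩⟩
  · rintro rfl
    have := h.mate_unique hm hv hu' vm.symm uu'
    subst this
    exact h.not_both v hv.1 hv.2.1 vs u't
  · rcases h.nbr_mid hv vs hm vm ha va with rfl | rfl | ha'
    · exact Or.inl rfl
    · exact Or.inr rfl
    · obtain ⟨q, b, hq, hb, hN⟩ := h.leaf a ha'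
      obtain ⟨-, m', hm', vm', m't⟩ :=
        h.leaf_parent ha' hb hv ((hN b hb.1).2 (Or.inr rfl)) va.symm vs
      have := h.mate_unique hv hm hm' vm vm'
      subst this
      exact absurd m't mt
  · rintro (rfl | rfl) <;> assumption

/-- The leaves attached to a vertex next to `s` form pairs. -/
theorem pairs_leaf (h : ConePath G w x s t) {u : V} (hu : Mid G w x s t u) (us : G.Adj u s) {v : V}
    (hv : Leaf G w x s t v) (vu : G.Adj v u) :
    ∃ m, (Leaf G w x s t m ∧ G.Adj m u) ∧ ∀ a, a ≠ w → (G.Adj v a ↔ a = u ∨ a = m) := by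
  obtain ⟨q, b, hq, hb, hN⟩ := h.leaf v hv
  have vb : G.Adj v b := (hN b hb.1).2 (Or.inr rfl)
  have e := h.parent_unique hv hu hq vu ((hN q hq.1).2 (Or.inl rfl))
  subst e
  exact ⟨b, ⟨hb, (h.leaf_parent hv hb hu vb vu us).1⟩, hN⟩

/-- Pairs with different roots can only exist if the roots are adjacent. -/
theorem roots_adj (h : ConePath G w x s t) {c d : V} {A B : Set V} (hAB : Disjoint A B)
    (hcd : c ≠ d) (hcw : c ≠ w) (hdw : d ≠ w) (hwA : w ∉ A) (hwB : w ∉ B) (hcA : c ∉ A) (hcB : c ∉ B)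
    (hdA : d ∉ A) (hdB : d ∉ B)
    (hA : ∀ v ∈ A, ∃ m ∈ A, ∀ a, a ≠ w → (G.Adj v a ↔ a = c ∨ a = m))
    (hB : ∀ v ∈ B, ∃ m ∈ B, ∀ a, a ≠ w → (G.Adj v a ↔ a = d ∨ a = m)) {v y : V}
    (hv : v ∈ A) (hy : y ∈ B) : G.Adj c d := by
  rw [Set.disjoint_left] at hAB
  obtain ⟨v', hv', hNv⟩ := hA v hv
  obtain ⟨v₂, hv₂, hNv'⟩ := hA v' hv'
  obtain ⟨y', hy', hNy⟩ := hB y hy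
  obtain ⟨y₂, hy₂, hNy'⟩ := hB y' hy'
  have nw : ∀ {a}, a ∈ A → a ≠ w := fun ha e => hwA (e ▸ ha)
  have nw' : ∀ {a}, a ∈ B → a ≠ w := fun ha e => hwB (e ▸ ha)
  have hn : ¬ G.Adj v y := by
    intro e
    rcases (hNv y (nw' hy)).1 e with rfl | rfl
    · exact hcB hy
    · exact hAB hv' hy
  -- Outside `w`, the pairs meet the rest of the graph only in their roots, so the path has to be v
  -- c d y.
  obtain ⟨p, r, hp, hr, k1, k2, k3⟩ := h.path (nw hv) (nw' hy) (fun e => hAB hv (e ▸ hy)) hn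
  rcases (hNv p hp).1 k1 with rfl | rfl <;> rcases (hNy r hr).1 k3.symm with rfl | rfl
  · exact k2
  · rcases (hNy' p hcw).1 k2.symm with rfl | rfl <;> contradiction
  · rcases (hNv' r hdw).1 k2 with rfl | rfl <;> contradiction
  · rcases (hNy' p hp).1 k2.symm with rfl | rfl
    · exact absurd hv' hdA
    · exact absurd hy₂ (hAB hv')

variable {u u' : V}

theorem nbr_end (h : ConePath G w x s t) (hu : Mid G w x s t u) (us : G.Adj u s)
    (hA : ∀ v, Mid G w x s t v → G.Adj v s → v = u) (a : V) (ha : a ≠ w) :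
    G.Adj s a ↔ a = u ∨ a = x := by
  constructor
  · intro hsa
    rcases parts G w x s t a with rfl | rfl | rfl | rfl | ha' | ha'
    · exact absurd rfl ha
    · exact Or.inr rfl
    · exact absurd hsa G.irrefl
    · exact absurd hsa h.not_adj
    · exact Or.inl (hA a ha' hsa.symm)
    · exact absurd hsa.symm ha'.2.2.2.2.1
  · rintro (rfl | rfl)
    · exact us.symm
    · exact ((h.nbr s h.s_ne).2 (Or.inl rfl)).symm

/-- By `leaf_parent` the mate of the vertex carrying a leaf lies next to the opposite end; by
`cross_unique` there is only one such pair. -/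
theorem leaf_root (h : ConePath G w x s t) (hu : Mid G w x s t u)
    (hu' : Mid G w x s t u') (us : G.Adj u s) (u't : G.Adj u' t) (uu' : G.Adj u u') {v : V}
    (hv : Leaf G w x s t v) : G.Adj v u ∨ G.Adj v u' := by
  have mid : ∀ v, Mid G w x s t v → Mid G w x t s v := fun v => by simp only [Mid]; tauto
  have leaf : ∀ v, Leaf G w x s t v → Leaf G w x t s v := fun v => by simp only [Leaf]; tauto
  obtain ⟨q, b, hq, hb, hN⟩ := h.leaf v hv
  have vq := (hN q hq.1).2 (Or.inl rfl)
  have vb := (hN b hb.1).2 (Or.inr rfl)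
  rcases hq.2.2 with qs | qt
  · obtain ⟨-, m, hm, qm, mt⟩ := h.leaf_parent hv hb hq vb vq qs
    have := h.cross_unique hu hu' us u't uu' hq hm qs mt qm
    subst this
    exact Or.inl vq
  · obtain ⟨-, m, hm, qm, mt⟩ := h.symm.leaf_parent (leaf v hv) (leaf b hb) (mid q hq) vb vq qt
    have := h.symm.cross_unique (mid _ hu') (mid _ hu) u't us uu'.symm (mid q hq) hm qt mt qm
    subst this
    exact Or.inr vq

/-- The 5-cycle is s u u' t x. Pairs at `s` exclude pairs at `t` and at `u'` by `roots_adj`, so the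
only other root is `u`, adjacent to `s`. -/
theorem isF3_of_end (h : ConePath G w x s t) (hu : Mid G w x s t u)
    (hu' : Mid G w x s t u') (us : G.Adj u s) (u't : G.Adj u' t) (uu' : G.Adj u u') {v : V}
    (hv : Mid G w x s t v) (vs : G.Adj v s) (hvu : v ≠ u) :
    IsF3 (G.induce ({w}ᶜ : Set V)) := by
  have mid : ∀ v, Mid G w x s t v ↔ Mid G w x t s v := fun v => by simp only [Mid]; tauto
  have leaf : ∀ v, Leaf G w x s t v ↔ Leaf G w x t s v := fun v => by simp only [Leaf]; tauto
  have xs := (h.nbr s h.s_ne).2 (Or.inl rfl)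
  have xt := (h.nbr t h.t_ne).2 (Or.inr rfl)
  have ut := h.not_both u hu.1 hu.2.1 us
  have u's : ¬ G.Adj u' s := fun e => h.not_both u' hu'.1 hu'.2.1 e u't
  have tm : ¬ Mid G w x s t t := fun e => h.symm.s_not_mid ((mid t).1 e)
  have sm := h.s_not_mid
  have hA := fun y => h.pairs_end hu hu' us u't uu' (v := y)
  have hA' := fun y => h.symm.pairs_end ((mid _).1 hu') ((mid _).1 hu) u't us uu'.symm (v := y)
  have hL := fun y => h.pairs_leaf hu us (v := y)
  have hL' := fun y => h.symm.pairs_leaf ((mid _).1 hu') u't (v := y)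
  simp only [← mid, ← leaf] at hA' hL'
  have hpA : ∀ y ∈ {y | Mid G w x s t y ∧ G.Adj y s ∧ y ≠ u},
      ∃ m ∈ {y | Mid G w x s t y ∧ G.Adj y s ∧ y ≠ u}, ∀ a, a ≠ w → (G.Adj y a ↔ a = s ∨ a = m) :=
    fun y hy => hA y hy.1 hy.2.1 hy.2.2
  have hpL : ∀ y ∈ {y | Leaf G w x s t y ∧ G.Adj y u},
      ∃ m ∈ {y | Leaf G w x s t y ∧ G.Adj y u}, ∀ a, a ≠ w → (G.Adj y a ↔ a = u ∨ a = m) :=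
    fun y hy => hL y hy.1 hy.2
  -- no pairs at `t`
  have eA' : ∀ y, Mid G w x s t y → G.Adj y t → y = u' := by
    intro y hy yt
    by_contra hne
    refine h.not_adj (h.roots_adj (c := s) (d := t)
      (A := {y | Mid G w x s t y ∧ G.Adj y s ∧ y ≠ u})
      (B := {y | Mid G w x s t y ∧ G.Adj y t ∧ y ≠ u'}) ?_ h.ne h.s_ne h.t_ne
      (fun e => e.1.1 rfl) (fun e => e.1.1 rfl) (fun e => sm e.1) (fun e => sm e.1)
      (fun e => tm e.1) (fun e => tm e.1) hpA
      (fun y hy => hA' y hy.1 hy.2.1 hy.2.2) ⟨hv, vs, hvu⟩ ⟨hy, yt, hne⟩)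
    rw [Set.disjoint_left]
    rintro a ⟨ha, h1, -⟩ ⟨-, h2, -⟩
    exact h.not_both a ha.1 ha.2.1 h1 h2
  -- no pairs at `u'`
  have eL' : ∀ y, Leaf G w x s t y → ¬ G.Adj y u' := by
    intro y hy yu'
    refine u's (h.roots_adj (c := s) (d := u')
      (A := {y | Mid G w x s t y ∧ G.Adj y s ∧ y ≠ u})
      (B := {y | Leaf G w x s t y ∧ G.Adj y u'}) ?_ (fun e => sm (e ▸ hu')) h.s_ne hu'.1
      (fun e => e.1.1 rfl) (fun e => e.1.1 rfl) (fun e => sm e.1) (fun e => e.1.2.2.1 rfl)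
      (fun e => u's e.2.1) (fun e => leaf_not_mid e.1 hu') hpA
      (fun y hy => hL' y hy.1 hy.2) ⟨hv, vs, hvu⟩ ⟨hy, yu'⟩).symm
    rw [Set.disjoint_left]
    rintro a ⟨ha, -⟩ ⟨h2, -⟩
    exact leaf_not_mid h2 ha
  have eu's : u' ≠ s := fun e => sm (e ▸ hu')
  have eu't : u' ≠ t := fun e => tm (e ▸ hu')
  have eus : u ≠ s := fun e => sm (e ▸ hu)
  have eut : u ≠ t := fun e => tm (e ▸ hu)
  refine isF3_induce (c₁ := s) (c₂ := u) (c₃ := u') (c₄ := t) (c₅ := x)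
    (P := {y | Mid G w x s t y ∧ G.Adj y s ∧ y ≠ u}) (Q := {y | Leaf G w x s t y ∧ G.Adj y u})
    ?_ ?_ ?_ ?_ ?_ us.symm ?_ ?_ ?_ hpA hpL
  · simp [h.s_ne.symm, hu.1.symm, hu'.1.symm, h.t_ne.symm, h.x_ne.symm, eus.symm, eu's.symm, h.ne,
      xs.ne.symm, uu'.ne, eut, hu.2.1, eu't, hu'.2.1, xt.ne.symm]
  · rw [Set.disjoint_left]
    rintro a ⟨ha, -⟩ ⟨h2, -⟩
    exact leaf_not_mid h2 ha
  · rintro a ⟨ha, as, hau⟩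
    have : a ≠ u' := fun e => u's (e ▸ as)
    have : a ≠ t := fun e => tm (e ▸ ha)
    simp [ha.1, ha.2.1, as.ne, *]
  · rintro a ⟨ha, au⟩
    have : a ≠ u' := fun e => leaf_not_mid ha (e ▸ hu')
    simp [ha.1, ha.2.1, ha.2.2.1, ha.2.2.2.1, au.ne, this]
  · intro a
    simp only [List.mem_cons, List.not_mem_nil, or_false, Set.mem_ofPred_eq]
    rcases parts G w x s t a with ha | ha | ha | ha | ha | ha
    · tauto
    · tauto
    · tauto
    · tauto
    · have := eA' a ha
      have := ha.2.2
      tauto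
    · have := eL' a ha
      have := h.leaf_root hu hu' us u't uu' ha
      tauto
  · intro a ha
    constructor
    · intro e
      rcases h.symm.nbr_mid ((mid _).1 hu') u't ((mid _).1 hu) uu'.symm ha e with rfl | rfl | hl
      · exact Or.inr rfl
      · exact Or.inl rfl
      · exact absurd e.symm (eL' a ((leaf a).2 hl))
    · rintro (rfl | rfl)
      exacts [uu'.symm, u't]
  · exact h.symm.nbr_end ((mid _).1 hu') u't fun y hy => eA' y ((mid y).2 hy)
  · intro a ha
    rw [h.nbr a ha, or_comm]

/-- If neither end carries pairs, all leaves hang on the adjacent vertices `u` and `u'`, and the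
5-cycle is read from there. -/
theorem isF3 (h : ConePath G w x s t) : IsF3 (G.induce ({w}ᶜ : Set V)) := by
  have mid : ∀ v, Mid G w x s t v ↔ Mid G w x t s v := fun v => by simp only [Mid]; tauto
  have leaf : ∀ v, Leaf G w x s t v ↔ Leaf G w x t s v := fun v => by simp only [Leaf]; tauto
  obtain ⟨u, u', hu, hu', us, u't, uu'⟩ := h.exists_cross
  by_cases h1 : ∀ v, Mid G w x s t v → G.Adj v s → v = u
  swap
  · push Not at h1
    obtain ⟨v, hv, vs, hvu⟩ := h1
    exact h.isF3_of_end hu hu' us u't uu' hv vs hvu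
  by_cases h2 : ∀ v, Mid G w x s t v → G.Adj v t → v = u'
  swap
  · push Not at h2
    obtain ⟨v, hv, vs, hvu⟩ := h2
    exact h.symm.isF3_of_end ((mid _).1 hu') ((mid _).1 hu) u't us uu'.symm ((mid _).1 hv) vs hvu
  have xs := (h.nbr s h.s_ne).2 (Or.inl rfl)
  have xt := (h.nbr t h.t_ne).2 (Or.inr rfl)
  have tm : ¬ Mid G w x s t t := fun e => h.symm.s_not_mid ((mid t).1 e)
  have sm := h.s_not_mid
  have hL := fun y => h.pairs_leaf hu us (v := y)
  have hL' := fun y => h.symm.pairs_leaf ((mid _).1 hu') u't (v := y)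
  simp only [← leaf] at hL'
  have eu's : u' ≠ s := fun e => sm (e ▸ hu')
  have eu't : u' ≠ t := fun e => tm (e ▸ hu')
  have eus : u ≠ s := fun e => sm (e ▸ hu)
  have eut : u ≠ t := fun e => tm (e ▸ hu)
  refine isF3_induce (c₁ := u) (c₂ := u') (c₃ := t) (c₄ := x) (c₅ := s)
    (P := {y | Leaf G w x s t y ∧ G.Adj y u}) (Q := {y | Leaf G w x s t y ∧ G.Adj y u'})
    ?_ ?_ ?_ ?_ ?_ uu' ?_ ?_ ?_ (fun y hy => hL y hy.1 hy.2) (fun y hy => hL' y hy.1 hy.2)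
  · simp [h.s_ne.symm, hu.1.symm, hu'.1.symm, h.t_ne.symm, h.x_ne.symm, eus, eu's, h.ne.symm,
      xs.ne, uu'.ne, eut, hu.2.1, eu't, hu'.2.1, xt.ne.symm]
  · rw [Set.disjoint_left]
    rintro a ⟨ha, h3⟩ ⟨-, h4⟩
    exact uu'.ne (h.parent_unique ha hu hu' h3 h4)
  · rintro a ⟨ha, au⟩
    have : a ≠ u' := fun e => leaf_not_mid ha (e ▸ hu')
    simp [ha.1, ha.2.1, ha.2.2.1, ha.2.2.2.1, au.ne, this]
  · rintro a ⟨ha, au⟩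
    have : a ≠ u := fun e => leaf_not_mid ha (e ▸ hu)
    simp [ha.1, ha.2.1, ha.2.2.1, ha.2.2.2.1, au.ne, this]
  · intro a
    simp only [List.mem_cons, List.not_mem_nil, or_false, Set.mem_ofPred_eq]
    rcases parts G w x s t a with ha | ha | ha | ha | ha | ha
    · tauto
    · tauto
    · tauto
    · tauto
    · have := h1 a ha
      have := h2 a ha
      have := ha.2.2
      tauto
    · have := h.leaf_root hu hu' us u't uu' ha
      tauto
  · exact h.symm.nbr_end ((mid _).1 hu') u't fun y hy => h2 y ((mid y).2 hy)
  · intro a ha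
    rw [h.nbr a ha, or_comm]
  · intro a ha
    rw [h.nbr_end hu us h1 a ha, or_comm]

end ConePath

end ConePath

/-! ### Minimum degree at least three: conclusion. -/

section MinDegreeThree

variable {V : Type u} [Fintype V] {G : SimpleGraph V}

/-- A saturated graph with minimum degree at least three has more than the extremal number of edges
or is the join of a single vertex and a graph of the third type. -/
theorem edges_of_three_le (hG : Sat G) (hn : 6 ≤ Fintype.card V) (hmin : ∀ v, 3 ≤ dg G v) :
    5 * Fintype.card V ≤ 2 * G.edgeSet.ncard + 9 ∨
      (5 * Fintype.card V ≤ 2 * G.edgeSet.ncard + 10 ∧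
        ∃ w, (∀ v, v ≠ w → G.Adj w v) ∧ IsF3 (G.induce ({w}ᶜ : Set V))) := by
  by_cases h3 : ∃ x, dg G x = 3
  swap
  · left
    push Not at h3
    have h4 : ∀ v, 4 ≤ dg G v := fun v => by
      have := hmin v
      have := h3 v
      omega
    by_cases h4' : ∃ x, dg G x = 4
    · obtain ⟨x, hx⟩ := h4'
      exact edges_of_minDegree_four hG hx h4
    · push Not at h4'
      rw [← sum_dg]
      have : ∑ v : V, 5 ≤ ∑ v, dg G v := Finset.sum_le_sum fun v _ => by
        have := h4 v
        have := h4' v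
        omega
      simp at this
      omega
  by_cases hN : NoInducedPathInNbhd G
  swap
  · simp only [NoInducedPathInNbhd] at hN
    push Not at hN
    obtain ⟨x, a, b, c, hx, xa, xb, xc, hac, ba, bc, nac⟩ := hN
    rcases three_of_path hG hx hmin (adj_iff_of_dg_three hx xa xb xc ba.ne.symm hac bc.ne)
      ba.ne.symm hac bc.ne ba.symm bc nac with h | ⟨h, ht⟩
    · exact Or.inl h
    · exact Or.inr ⟨h, b, ht.conePath.univ, ht.conePath.isF3⟩
  left
  by_cases hT : ∃ x a b c, dg G x = 3 ∧ G.Adj x a ∧ G.Adj x b ∧ G.Adj x c ∧ G.Adj a b ∧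
      G.Adj a c ∧ G.Adj b c
  · obtain ⟨x, a, b, c, hx, xa, xb, xc, ab, ac, bc⟩ := hT
    exact three_of_triangle hG hx hmin hN (adj_iff_of_dg_three hx xa xb xc ab.ne ac.ne bc.ne)
      ab.ne ac.ne bc.ne ab ac bc
  -- A path in such a neighbourhood would be induced or close up to a triangle; both are excluded by
  -- now.
  have hP : NoPathInNbhd G 3 := by
    intro y a b c hy ya yb yc hac ba bc
    exact hT ⟨y, a, b, c, hy, ya, yb, yc, ba.symm, hN y a b c hy ya yb yc hac ba bc, bc⟩
  by_cases hE : ∃ x a b, dg G x = 3 ∧ G.Adj x a ∧ G.Adj x b ∧ G.Adj a b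
  · obtain ⟨x, a, b, hx, xa, xb, ab⟩ := hE
    obtain ⟨c, hac, hbc, hS⟩ := exists_third_of_dg_three hx xa xb ab.ne
    exact three_of_edge hG hx hmin hP hS ab.ne hac hbc ab
  · push Not at hE
    obtain ⟨x, hx⟩ := h3
    exact three_of_independent hG hx hmin hn hE

end MinDegreeThree

/-! ### A vertex of degree two: edge count and isolated thin vertices. -/

section TwoBase

variable {V : Type u} {G : SimpleGraph V} {x a b : V}

/-- `x` has exactly two neighbours `a` and `b`, and these are adjacent. -/
structure TwoBase (G : SimpleGraph V) (x a b : V) : Prop where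
  sat : Sat G
  nbr : ∀ u, G.Adj x u ↔ u = a ∨ u = b
  adj : G.Adj a b

namespace TwoBase

theorem symm (h : TwoBase G x a b) : TwoBase G x b a :=
  ⟨h.sat, fun u => (h.nbr u).trans or_comm, h.adj.symm⟩

theorem adj_left (h : TwoBase G x a b) : G.Adj x a := by simp [h.nbr]

theorem adj_right (h : TwoBase G x a b) : G.Adj x b := by simp [h.nbr]

/-- In a rim link the hub and the rim vertex next to `x` are `a` and `b`, and the other rim vertex
is `c`; in a link with hub `v` the third vertex is `c`. A hub at `x` would need a third neighbour.
-/
theorem link (h : TwoBase G x a b) {v : V} (hx : v ≠ x) (ha : v ≠ a) (hb : v ≠ b) :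
    (G.Adj v a ∨ G.Adj v b) ∧ ∃ c, c ≠ x ∧ G.Adj c a ∧ G.Adj c b ∧ G.Adj v c := by
  have hn : ¬ G.Adj x v := fun e => ((h.nbr v).1 e).elim ha hb
  rcases h.sat.link x v hx.symm hn with ⟨c, p, r, k1, k2, k3, k4, k5, k6, k7⟩ |
    ⟨c, d, r, hcd, k1, k2, k3, k4, k5, k6, k7⟩ | ⟨c, d, r, hcd, k1, k2, k3, k4, k5, k6, k7⟩
  · have hr : r ≠ x := by
      rintro rfl
      exact hn k7
    have e1 := (h.nbr c).1 k1.symm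
    have e2 := (h.nbr p).1 k5
    rcases e1 with rfl | rfl <;> rcases e2 with rfl | rfl
    · exact absurd k2 G.irrefl
    · exact ⟨Or.inl k4.symm, r, hr, k3.symm, k6.symm, k7.symm⟩
    · exact ⟨Or.inr k4.symm, r, hr, k6.symm, k3.symm, k7.symm⟩
    · exact absurd k2 G.irrefl
  · exfalso
    rcases (h.nbr r).1 k3 with rfl | rfl <;> rcases (h.nbr c).1 k1 with rfl | rfl <;>
      rcases (h.nbr d).1 k2 with rfl | rfl <;>
      first | exact hcd rfl | exact G.irrefl k6 | exact G.irrefl k7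
  · have hr : r ≠ x := by
      rintro rfl
      exact hn k3.symm
    rcases (h.nbr c).1 k4 with rfl | rfl <;> rcases (h.nbr d).1 k5 with rfl | rfl
    · exact absurd rfl hcd
    · exact ⟨Or.inl k1, r, hr, k6, k7, k3⟩
    · exact ⟨Or.inl k2, r, hr, k7, k6, k3⟩
    · exact absurd rfl hcd

theorem near (h : TwoBase G x a b) {v : V} (hx : v ≠ x) (ha : v ≠ a) (hb : v ≠ b) :
    G.Adj v a ∨ G.Adj v b := (h.link hx ha hb).1

/-- If `v` is adjacent to `a`, then `a` would be the hub of a wheel with rim v c b d; likewise for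
`b`. -/
theorem common_unique (h : TwoBase G x a b) {v c d : V} (hx : v ≠ x) (ha : v ≠ a) (hb : v ≠ b)
    (ca : G.Adj c a) (cb : G.Adj c b) (da : G.Adj d a) (db : G.Adj d b) (vc : G.Adj v c)
    (vd : G.Adj v d) : c = d := by
  by_contra hcd
  rcases h.near hx ha hb with va | vb
  · exact h.sat.free ⟨a, v, c, b, d, hb, hcd, va.symm, ca.symm, h.adj, da.symm, vc, cb, db.symm,
      vd.symm⟩
  · exact h.sat.free ⟨b, v, c, a, d, ha, hcd, vb.symm, cb.symm, h.adj.symm, db.symm, vc, ca,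
      da.symm, vd.symm⟩

/-- Two vertices of degree two have different neighbourhoods. -/
theorem ne_of_ne {y : V} (hx : TwoBase G x a b) (hy : TwoBase G y a b) : x = y := by
  by_contra hne
  obtain ⟨-, c, -, ca, cb, yc⟩ := hx.link (Ne.symm hne) hy.adj_left.ne hy.adj_right.ne
  rcases (hy.nbr c).1 yc with rfl | rfl
  · exact G.irrefl ca
  · exact G.irrefl cb

/-- The two possibilities for a second isolated vertex. -/
theorem second_isolated (h : TwoBase G x a b) {y z q q' : V} (hy : TwoBase G y a q)
    (hyz : y ≠ z) (hq'a : G.Adj q' a) (hq'b : G.Adj q' b) (qb : G.Adj q b)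
    (hz : TwoBase G z a q' ∨ TwoBase G z b q') (hyb : ¬ G.Adj y z) :
    (TwoBase G z a q' ∧ G.Adj q' q) ∨ TwoBase G z b q := by
  have zq : z ≠ q := by
    rintro rfl
    exact hyb hy.adj_right
  have za : z ≠ a := by
    rintro rfl
    exact hyb hy.adj_left
  -- The vertex through which `z` is linked to `y` is adjacent to `a` and `q`, and it must be one of
  -- the two neighbours of `z`.
  obtain ⟨h1, c, -, ca, cq, zc⟩ := hy.link hyz.symm za zq
  rcases hz with hz | hz
  · rcases (hz.nbr c).1 zc with rfl | rfl
    · exact absurd ca G.irrefl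
    · exact Or.inl ⟨hz, cq⟩
  · rcases h1 with e | e
    · rcases (hz.nbr a).1 e with e' | rfl
      · exact absurd e' h.adj.ne
      · exact absurd hq'a G.irrefl
    · rcases (hz.nbr q).1 e with e' | rfl
      · exact absurd e' qb.ne
      · exact Or.inr hz

end TwoBase

/-- In a saturated graph the two neighbours of a vertex of degree two are adjacent. -/
theorem Sat.twoBase (hG : Sat G) (hab : a ≠ b) (hx : ∀ u, G.Adj x u ↔ u = a ∨ u = b) :
    TwoBase G x a b := by
  refine ⟨hG, hx, ?_⟩
  by_contra hn
  have xa : G.Adj x a := by simp [hx]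
  have xb : G.Adj x b := by simp [hx]
  -- If `a` and `b` are not adjacent, rim links at `x` are impossible, and either hub link makes `v`
  -- adjacent to both.
  have far : ∀ v, v ≠ x → v ≠ a → v ≠ b → G.Adj v a ∧ G.Adj v b := by
    intro v h1 h2 h3
    have hnv : ¬ G.Adj x v := fun e => ((hx v).1 e).elim h2 h3
    rcases hG.link x v h1.symm hnv with ⟨c, p, r, k1, k2, k3, k4, k5, k6, k7⟩ |
      ⟨c, d, r, hcd, k1, k2, k3, k4, k5, k6, k7⟩ | ⟨c, d, r, hcd, k1, k2, k3, k4, k5, k6, k7⟩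
    · exfalso
      rcases (hx c).1 k1.symm with rfl | rfl <;> rcases (hx p).1 k5 with rfl | rfl <;>
        first | exact G.irrefl k2 | exact hn k2 | exact hn k2.symm
    · rcases (hx c).1 k1 with rfl | rfl <;> rcases (hx d).1 k2 with rfl | rfl <;>
        first | exact absurd rfl hcd | exact ⟨k4, k5⟩ | exact ⟨k5, k4⟩
    · rcases (hx c).1 k4 with rfl | rfl <;> rcases (hx d).1 k5 with rfl | rfl <;>
        first | exact absurd rfl hcd | exact ⟨k1, k2⟩ | exact ⟨k2, k1⟩
  -- every neighbour of `a` has at most one neighbour besides `a` and `b`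
  have one : ∀ r c d, r ≠ a → r ≠ b → G.Adj r c → G.Adj r d → c ≠ a → c ≠ b → d ≠ a → d ≠ b →
      c = d := by
    intro r c d ra rb rc rd ca cb da db
    by_contra hcd
    by_cases hr : r = x
    · subst hr
      exact ((hx c).1 rc).elim ca cb
    · have hc : c ≠ x := by
        rintro rfl
        exact ((hx r).1 rc.symm).elim ra rb
      have hd : d ≠ x := by
        rintro rfl
        exact ((hx r).1 rd.symm).elim ra rb
      obtain ⟨r1, r2⟩ := far r hr ra rb
      obtain ⟨c1, c2⟩ := far c hc ca cb
      obtain ⟨d1, d2⟩ := far d hd da db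
      exact hG.free ⟨r, a, c, b, d, hab, hcd, r1, rc, r2, rd, c1.symm, c2, d2.symm, d1⟩
  have ne : ∀ c, G.Adj a c → c ≠ b := fun c hc e => hn (e ▸ hc)
  have ne' : ∀ c, G.Adj b c → c ≠ a := fun c hc e => hn (e ▸ hc).symm
  -- Any link between `a` and `b` contains a vertex with two neighbours besides `a` and `b`.
  rcases hG.link a b hab hn with ⟨c, p, r, k1, k2, k3, k4, k5, k6, k7⟩ |
    ⟨c, d, r, hcd, k1, k2, k3, k4, k5, k6, k7⟩ | ⟨c, d, r, hcd, k1, k2, k3, k4, k5, k6, k7⟩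
  · exact k6.ne (one c p r k1.ne k4.ne k2 k3 k5.ne.symm (ne p k5) (ne' r k7.symm) k7.ne)
  · exact hcd (one r c d k3.ne.symm (ne r k3) k6 k7 k1.ne.symm (ne c k1) k2.ne.symm (ne d k2))
  · exact hcd (one r c d (ne' r k3) k3.ne.symm k6 k7 (ne' c k1) k1.ne.symm (ne' d k2) k2.ne.symm)

variable [Fintype V]

theorem Sat.two_le_dg (hG : Sat G) (hn : 3 ≤ Fintype.card V) (v : V) : 2 ≤ dg G v := by
  classical
  by_cases hv : far G v = ∅
  · have := card_eq_nbhd_far (G := G) v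
    rw [hv, Finset.card_empty] at this
    omega
  · obtain ⟨u, hu⟩ := Finset.nonempty_iff_ne_empty.2 hv
    unfold dg
    rw [two_le_nb]
    rcases hG.far_cases hu with ⟨w, p, r, k1, k2, k3, -⟩ | ⟨c, d, r, hcd, k1, k2, -⟩ |
      ⟨c, d, r, hcd, k1, k2, -⟩
    · exact ⟨w, by simp, p, by simp, k3.ne, k1, k2⟩
    · exact ⟨c, by simp, d, by simp, hcd, k1, k2⟩
    · exact ⟨c, by simp, d, by simp, hcd, k1, k2⟩

namespace TwoBase

theorem nb_nbhd (h : TwoBase G x a b) [DecidableRel G.Adj] (v : V) :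
    nb G (nbhd G x) v = (if G.Adj v a then 1 else 0) + (if G.Adj v b then 1 else 0) := by
  classical
  have : nbhd G x = {a, b} := by
    ext u
    simp [h.nbr]
  rw [this, nb_insert (by simpa using h.adj.ne), nb_singleton]

theorem mem_thick (h : TwoBase G x a b) {v : V} :
    v ∈ thick G x ↔ v ≠ x ∧ G.Adj v a ∧ G.Adj v b := by
  classical
  rw [h.sat.mem_thick_iff, mem_far, h.nbr, h.nb_nbhd]
  constructor
  · rintro ⟨⟨h1, h2⟩, h3⟩
    split_ifs at h3 with c1 c2 <;> first | omega | exact ⟨h1, c1, c2⟩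
  · rintro ⟨h1, h2, h3⟩
    rw [if_pos h2, if_pos h3]
    exact ⟨⟨h1, fun e => e.elim h2.ne h3.ne⟩, le_refl _⟩

theorem mem_thin (h : TwoBase G x a b) {v : V} :
    v ∈ thin G x ↔ v ≠ x ∧ v ≠ a ∧ v ≠ b ∧ ¬ (G.Adj v a ∧ G.Adj v b) := by
  have h1 := h.mem_thick (v := v)
  rw [W4Sat.mem_thick, mem_far, h.nbr] at h1
  rw [W4Sat.mem_thin, mem_far, h.nbr]
  tauto

/-- Existence is `link`, uniqueness is `common_unique`. This makes the edge count around a vertex of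
degree two an identity. -/
theorem nb_thick (h : TwoBase G x a b) {v : V} (hv : v ∈ far G x) : nb G (thick G x) v = 1 := by
  rw [mem_far, h.nbr, not_or] at hv
  obtain ⟨-, c, cx, ca, cb, vc⟩ := h.link hv.1 hv.2.1 hv.2.2
  refine nb_eq_one.2 ⟨c, h.mem_thick.2 ⟨cx, ca, cb⟩, vc, fun d hd vd => ?_⟩
  obtain ⟨-, da, db⟩ := h.mem_thick.1 hd
  exact h.common_unique hv.1 hv.2.1 hv.2.2 da db ca cb vd vc

/-- The edge count around a vertex of degree two. -/
theorem edges (h : TwoBase G x a b) : (2 * G.edgeSet.ncard + 9 : ℤ) =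
    5 * Fintype.card V + ∑ v ∈ thin G x, (nb G (thin G x) v - 1 : ℤ) := by
  classical
  have hS : nbhd G x = {a, b} := by
    ext u
    simp [h.nbr]
  have hd : dg G x = 2 := by
    rw [← card_nbhd, hS, Finset.card_pair h.adj.ne]
  have h1 := two_mul_edges (G := G) x
  have h2 := card_eq_nbhd_far (G := G) x
  have hc : (far G x).card = (thick G x).card + (thin G x).card := by
    have := sum_far (G := G) x (fun _ => 1)
    simpa using this
  have hs : ∑ s ∈ nbhd G x, nb G (nbhd G x) s = 2 := by
    rw [show ∑ s ∈ nbhd G x, nb G (nbhd G x) s = ∑ s ∈ {a, b}, nb G (nbhd G x) s by rw [hS],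
      Finset.sum_pair h.adj.ne, h.nb_nbhd, h.nb_nbhd, if_neg G.irrefl, if_pos h.adj,
      if_pos h.adj.symm, if_neg G.irrefl]
  have t1 : ∑ v ∈ thick G x, (dg G v + nb G (nbhd G x) v) =
      5 * (thick G x).card + (thin G x).card := by
    have e : ∀ v ∈ thick G x, dg G v + nb G (nbhd G x) v = 5 + nb G (thin G x) v := by
      intro v hv
      have e1 := dg_of_mem_thick hv
      rw [h.nb_thick (W4Sat.mem_thick.1 hv).1] at e1
      obtain ⟨-, va, vb⟩ := h.mem_thick.1 hv
      have e2 := h.nb_nbhd v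
      rw [if_pos va, if_pos vb] at e2
      omega
    -- Every thin vertex has one thick neighbour, so there are as many edges between thick and thin
    -- vertices as thin vertices.
    rw [Finset.sum_congr rfl e, Finset.sum_add_distrib, sum_nb_comm,
      Finset.sum_congr rfl fun v hv => h.nb_thick (W4Sat.mem_thin.1 hv).1]
    simp [mul_comm]
  have t2 : ∑ v ∈ thin G x, (dg G v + nb G (nbhd G x) v) =
      3 * (thin G x).card + ∑ v ∈ thin G x, nb G (thin G x) v := by
    have e : ∀ v ∈ thin G x, dg G v + nb G (nbhd G x) v = 3 + nb G (thin G x) v := by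
      intro v hv
      have e1 := dg_of_mem_thin hv
      rw [h.nb_thick (W4Sat.mem_thin.1 hv).1] at e1
      have e2 := (W4Sat.mem_thin.1 hv).2
      omega
    rw [Finset.sum_congr rfl e, Finset.sum_add_distrib]
    simp [mul_comm]
  rw [sum_far, t1, t2, hs, hd] at h1
  rw [hd] at h2
  rw [Finset.sum_sub_distrib, Finset.sum_const]
  zify at h1 h2 hc
  simp only [nsmul_eq_mul, mul_one]
  linarith

/-- The neighbours of a vertex that is isolated among the vertices with one neighbour in `{a, b}`. -/
theorem twoBase_of_isolated (h : TwoBase G x a b) {y : V} (hy : y ∈ thin G x)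
    (h0 : nb G (thin G x) y = 0) :
    ∃ q, q ≠ x ∧ G.Adj q a ∧ G.Adj q b ∧ (TwoBase G y a q ∨ TwoBase G y b q) := by
  have hf := (W4Sat.mem_thin.1 hy).1
  obtain ⟨q, hq, yq, -⟩ := nb_eq_one.1 (h.nb_thick hf)
  obtain ⟨hqx, qa, qb⟩ := h.mem_thick.1 hq
  have hd : dg G y = 2 := by
    rw [dg_of_mem_thin hy, h.nb_thick hf, h0]
  obtain ⟨hx, ha, hb, -⟩ := h.mem_thin.1 hy
  refine ⟨q, hqx, qa, qb, ?_⟩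
  rcases h.near hx ha hb with ya | yb
  · exact Or.inl ⟨h.sat, adj_iff_of_dg_two hd ya yq qa.ne.symm, qa.symm⟩
  · exact Or.inr ⟨h.sat, adj_iff_of_dg_two hd yb yq qb.ne.symm, qb.symm⟩

/-- The neighbours of a vertex with one neighbour in `{a, b}` and one neighbour of the same kind. -/
theorem nbrs_of_matched (h : TwoBase G x a b) {v : V} (hv : v ∈ thin G x)
    (h1 : nb G (thin G x) v = 1) :
    ∃ s p v', (s = a ∨ s = b) ∧ p ≠ x ∧ G.Adj p a ∧ G.Adj p b ∧ v' ∈ thin G x ∧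
      ∀ u, G.Adj v u ↔ u = s ∨ u = p ∨ u = v' := by
  have hf := (W4Sat.mem_thin.1 hv).1
  obtain ⟨p, hp, vp, -⟩ := nb_eq_one.1 (h.nb_thick hf)
  obtain ⟨v', hv', vv', -⟩ := nb_eq_one.1 h1
  obtain ⟨hpx, pa, pb⟩ := h.mem_thick.1 hp
  have hd : dg G v = 3 := by
    rw [dg_of_mem_thin hv, h.nb_thick hf, h1]
  obtain ⟨hx, ha, hb, -⟩ := h.mem_thin.1 hv
  obtain ⟨-, ha', hb', -⟩ := h.mem_thin.1 hv'
  have hpv' := TightPath.thick_ne_thin hp hv'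
  rcases h.near hx ha hb with ya | yb
  · exact ⟨a, p, v', Or.inl rfl, hpx, pa, pb, hv',
      adj_iff_of_dg_three hd ya vp vv' pa.ne.symm ha'.symm hpv'⟩
  · exact ⟨b, p, v', Or.inr rfl, hpx, pa, pb, hv',
      adj_iff_of_dg_three hd yb vp vv' pb.ne.symm hb'.symm hpv'⟩

/-- By `second_isolated`, next to `y` over a q every further isolated vertex is over b q or over a
r, with r the mate of `q`. Two of the same kind coincide by `ne_of_ne`, and the two kinds exclude
each other. -/
theorem three_isolated_aux (h : TwoBase G x a b) {y z t q : V} (hy : TwoBase G y a q)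
    (hqx : q ≠ x) (qb : G.Adj q b) (hyt : y ∈ thin G x) (hzt : z ∈ thin G x) (htt : t ∈ thin G x)
    (z0 : nb G (thin G x) z = 0) (t0 : nb G (thin G x) t = 0) (hyz : y ≠ z) (hyt' : y ≠ t)
    (hzt' : z ≠ t) : False := by
  obtain ⟨q₁, h1x, h1a, h1b, hz⟩ := h.twoBase_of_isolated hzt z0
  obtain ⟨q₂, h2x, h2a, h2b, ht⟩ := h.twoBase_of_isolated htt t0
  have nyz : ¬ G.Adj y z := fun e => nb_eq_zero.1 z0 y hyt e.symm
  have nyt : ¬ G.Adj y t := fun e => nb_eq_zero.1 t0 y hyt e.symm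
  have qa := hy.adj.symm
  have mixed : ∀ z t q₁, TwoBase G z a q₁ → G.Adj q₁ q → z ∈ thin G x → TwoBase G t b q →
      z ≠ t → False := by
    intro z t q₁ hz h1 hzt ht hne
    obtain ⟨-, -, zb, hab⟩ := h.mem_thin.1 hzt
    have zq : z ≠ q := by
      rintro rfl
      exact hab ⟨qa, qb⟩
    rcases ht.near hne zb zq with e | e
    · exact hab ⟨hz.adj_left, e⟩
    · rcases (hz.nbr q).1 e with rfl | rfl
      · exact G.irrefl qa
      · exact G.irrefl h1
  rcases h.second_isolated hy hyz h1a h1b qb hz nyz with ⟨kz, z1⟩ | kz <;>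
    rcases h.second_isolated hy hyt' h2a h2b qb ht nyt with ⟨kt, t1⟩ | kt
  · have := h.common_unique hqx qa.ne qb.ne h1a h1b h2a h2b z1.symm t1.symm
    subst this
    exact hzt' (kz.ne_of_ne kt)
  · exact mixed z t q₁ kz z1 hzt kt hzt'
  · exact mixed t z q₂ kt t1 htt kz hzt'.symm
  · exact hzt' (kz.ne_of_ne kt)

theorem card_isolated (h : TwoBase G x a b) :
    ((thin G x).filter fun v => nb G (thin G x) v = 0).card ≤ 2 := by
  by_contra hc
  push Not at hc
  obtain ⟨y, z, t, hy, hz, ht, hyz, hyt, hzt⟩ := Finset.two_lt_card_iff.1 hc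
  rw [Finset.mem_filter] at hy hz ht
  obtain ⟨q, hqx, qa, qb, k | k⟩ := h.twoBase_of_isolated hy.1 hy.2
  · exact h.three_isolated_aux k hqx qb hy.1 hz.1 ht.1 hz.2 ht.2 hyz hyt hzt
  · exact h.symm.three_isolated_aux k hqx qa hy.1 hz.1 ht.1 hz.2 ht.2 hyz hyt hzt

/-- The truncated `nb G (thin G x) v - 1` is 0 instead of -1 at isolated vertices; the difference is
the cardinality on the left. -/
theorem edges_split (h : TwoBase G x a b) : (2 * G.edgeSet.ncard + 9 : ℤ) +
    ((thin G x).filter fun v => nb G (thin G x) v = 0).card =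
    5 * Fintype.card V + ∑ v ∈ thin G x, ((nb G (thin G x) v - 1 : ℕ) : ℤ) := by
  rw [h.edges, add_assoc, Finset.card_filter, Nat.cast_sum, ← Finset.sum_add_distrib]
  congr 1
  refine Finset.sum_congr rfl fun v _ => ?_
  split_ifs with h0
  · rw [h0]
    simp
  · push_cast
    omega

theorem le_edges (h : TwoBase G x a b) : 5 * Fintype.card V ≤ 2 * G.edgeSet.ncard + 11 := by
  have h1 := h.edges_split
  have h2 := h.card_isolated
  have h3 : (0 : ℤ) ≤ ∑ v ∈ thin G x, ((nb G (thin G x) v - 1 : ℕ) : ℤ) :=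
    Finset.sum_nonneg fun _ _ => Int.natCast_nonneg _
  omega

/-- The extremal configuration with an odd number of vertices. -/
theorem isolated_of_eq (h : TwoBase G x a b)
    (he : 5 * Fintype.card V = 2 * G.edgeSet.ncard + 11) :
    ∃ y z, y ≠ z ∧ y ∈ thin G x ∧ z ∈ thin G x ∧ nb G (thin G x) y = 0 ∧ nb G (thin G x) z = 0 ∧
      ∀ v ∈ thin G x, v ≠ y → v ≠ z → nb G (thin G x) v = 1 := by
  classical
  have h1 := h.edges_split
  have h2 := h.card_isolated
  rw [← Nat.cast_sum] at h1
  -- 2e = 5n - 11 requires both of the at most two isolated vertices and no surplus elsewhere.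
  have h3 : ∑ v ∈ thin G x, (nb G (thin G x) v - 1) = 0 := by omega
  have h4 : ((thin G x).filter fun v => nb G (thin G x) v = 0).card = 2 := by omega
  rw [Finset.sum_eq_zero_iff] at h3
  obtain ⟨y, z, hyz, hI⟩ := Finset.card_eq_two.1 h4
  have mem : ∀ v, (v ∈ thin G x ∧ nb G (thin G x) v = 0) ↔ v = y ∨ v = z := by
    intro v
    simpa using Finset.ext_iff.1 hI v
  have hy := (mem y).2 (Or.inl rfl)
  have hz := (mem z).2 (Or.inr rfl)
  refine ⟨y, z, hyz, hy.1, hz.1, hy.2, hz.2, fun v hv vy vz => ?_⟩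
  have := h3 v hv
  have : nb G (thin G x) v ≠ 0 := fun e => ((mem v).1 ⟨hv, e⟩).elim vy vz
  omega

/-- The two candidates for extremal configurations with an even number of vertices. -/
theorem isolated_of_eq_succ (h : TwoBase G x a b)
    (he : 5 * Fintype.card V = 2 * G.edgeSet.ncard + 10) :
    (∃ y ∈ thin G x, nb G (thin G x) y = 0 ∧ ∀ v ∈ thin G x, v ≠ y → nb G (thin G x) v = 1) ∨
    ∃ y z c, y ≠ z ∧ y ∈ thin G x ∧ z ∈ thin G x ∧ nb G (thin G x) y = 0 ∧
      nb G (thin G x) z = 0 ∧ c ∈ thin G x ∧ nb G (thin G x) c = 2 ∧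
      ∀ v ∈ thin G x, v ≠ y → v ≠ z → v ≠ c → nb G (thin G x) v = 1 := by
  classical
  have h1 := h.edges_split
  have h2 := h.card_isolated
  rw [← Nat.cast_sum] at h1
  -- Now the number of isolated vertices exceeds the surplus by one and is at most two.
  have h3 : ((thin G x).filter fun v => nb G (thin G x) v = 0).card = 1 ∨
    ((thin G x).filter fun v => nb G (thin G x) v = 0).card = 2 := by omega
  rcases h3 with h4 | h4
  · left
    have h3 : ∑ v ∈ thin G x, (nb G (thin G x) v - 1) = 0 := by omega
    rw [Finset.sum_eq_zero_iff] at h3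
    obtain ⟨y, hI⟩ := Finset.card_eq_one.1 h4
    have mem : ∀ v, (v ∈ thin G x ∧ nb G (thin G x) v = 0) ↔ v = y := by
      intro v
      simpa using Finset.ext_iff.1 hI v
    have hy := (mem y).2 rfl
    refine ⟨y, hy.1, hy.2, fun v hv vy => ?_⟩
    have := h3 v hv
    have : nb G (thin G x) v ≠ 0 := fun e => vy ((mem v).1 ⟨hv, e⟩)
    omega
  · right
    have h3 : ∑ v ∈ thin G x, (nb G (thin G x) v - 1) = 1 := by omega
    obtain ⟨y, z, hyz, hI⟩ := Finset.card_eq_two.1 h4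
    have mem : ∀ v, (v ∈ thin G x ∧ nb G (thin G x) v = 0) ↔ v = y ∨ v = z := by
      intro v
      simpa using Finset.ext_iff.1 hI v
    have hy := (mem y).2 (Or.inl rfl)
    have hz := (mem z).2 (Or.inr rfl)
    obtain ⟨c, hc, hc0⟩ := Finset.exists_ne_zero_of_sum_ne_zero (by omega :
      ∑ v ∈ thin G x, (nb G (thin G x) v - 1) ≠ 0)
    have hc1 := Finset.single_le_sum (f := fun v => nb G (thin G x) v - 1)
      (fun _ _ => Nat.zero_le _) hc
    refine ⟨y, z, c, hyz, hy.1, hz.1, hy.2, hz.2, hc, by omega, fun v hv vy vz vc => ?_⟩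
    have : nb G (thin G x) v ≠ 0 := fun e => ((mem v).1 ⟨hv, e⟩).elim vy vz
    have := Finset.add_le_sum (f := fun v => nb G (thin G x) v - 1)
      (fun _ _ => Nat.zero_le _) hv hc vc
    omega

end TwoBase

end TwoBase

/-! ### Labelled forms of the families for even order, and passage to induced subgraphs. -/

section Labelled

variable {V : Type u}

/-- `G` is obtained from a graph of the first type by deleting the vertex of degree one attached
to `c`. -/
def IsF2 (G : SimpleGraph V) : Prop :=
  ∃ (a b c a' b' : V) (A B C : Set V),
    [a, b, c, a', b'].Nodup ∧
    [{a, b, c, a', b'}, A, B, C].Pairwise Disjoint ∧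
    {a, b, c, a', b'} ∪ A ∪ B ∪ C = Set.univ ∧
    G.IsClique {a, b, c} ∧
    G.neighborSet a' = {a} ∧ G.neighborSet b' = {b} ∧
    PairsJoinedTo G A {a} ∧ PairsJoinedTo G B {b} ∧ PairsJoinedTo G C {c}

/-- The labelled description of the graphs in the second family of type `𝓑`. -/
structure B2Labelled (G : SimpleGraph V) (x y x₁ x₂ u₁ u₂ : V) (U11 U12 U2 : Set V) : Prop where
  nodup : [x, y, x₁, x₂, u₁, u₂].Nodup
  disjoint : [{x, y, x₁, x₂, u₁, u₂}, U11, U12, U2].Pairwise Disjoint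
  cover : {x, y, x₁, x₂, u₁, u₂} ∪ U11 ∪ U12 ∪ U2 = Set.univ
  clique : G.IsClique {x₁, x₂, u₁, u₂}
  nbr_u₂ : G.neighborSet u₂ = {x₁, x₂, u₁}
  nbr_x : G.neighborSet x = {x₁, x₂}
  nbr_y : G.neighborSet y = {x₁, u₁}
  pairs_U11 : PairsJoinedTo G U11 {x₁, u₁}
  pairs_U12 : PairsJoinedTo G U12 {x₂, u₁}
  pairs_U2 : PairsJoinedTo G U2 {x₁, x₂}

variable {G : SimpleGraph V}

theorem disjoint_list_preimage {w : V} {l : List V} {A : Set V} (h : ∀ v ∈ A, v ∉ l)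
    {s : Set ({w}ᶜ : Set V)} (hs : ∀ v ∈ s, (v : V) ∈ l) : Disjoint s (Subtype.val ⁻¹' A) := by
  rw [Set.disjoint_left]
  exact fun v hv hA => h v hA (hs v hv)

theorem isF1_induce {w a b c a' b' c' : V} {A B C : Set V}
    (hnodup : [w, a, b, c, a', b', c'].Nodup)
    (hAB : Disjoint A B) (hAC : Disjoint A C) (hBC : Disjoint B C)
    (hA : ∀ v ∈ A, v ∉ [w, a, b, c, a', b', c']) (hB : ∀ v ∈ B, v ∉ [w, a, b, c, a', b', c'])
    (hC : ∀ v ∈ C, v ∉ [w, a, b, c, a', b', c'])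
    (hcover : ∀ v, v ∈ [w, a, b, c, a', b', c'] ∨ v ∈ A ∨ v ∈ B ∨ v ∈ C)
    (ab : G.Adj a b) (ac : G.Adj a c) (bc : G.Adj b c)
    (ha' : ∀ u, u ≠ w → (G.Adj a' u ↔ u = a)) (hb' : ∀ u, u ≠ w → (G.Adj b' u ↔ u = b))
    (hc' : ∀ u, u ≠ w → (G.Adj c' u ↔ u = c))
    (pA : ∀ v ∈ A, ∃ v' ∈ A, ∀ u, u ≠ w → (G.Adj v u ↔ u = a ∨ u = v'))
    (pB : ∀ v ∈ B, ∃ v' ∈ B, ∀ u, u ≠ w → (G.Adj v u ↔ u = b ∨ u = v'))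
    (pC : ∀ v ∈ C, ∃ v' ∈ C, ∀ u, u ≠ w → (G.Adj v u ↔ u = c ∨ u = v')) :
    IsF1 (G.induce ({w}ᶜ : Set V)) := by
  have wA : w ∉ A := fun h => hA w h (by simp)
  have wB : w ∉ B := fun h => hB w h (by simp)
  have wC : w ∉ C := fun h => hC w h (by simp)
  simp only [List.nodup_cons, List.mem_cons, List.not_mem_nil, or_false, not_or, List.nodup_nil,
    not_false_eq_true, and_true] at hnodup hcover
  obtain ⟨⟨e1, e2, e3, e4, e5, e6⟩, f⟩ := hnodup
  refine ⟨⟨a, Ne.symm e1⟩, ⟨b, Ne.symm e2⟩, ⟨c, Ne.symm e3⟩, ⟨a', Ne.symm e4⟩, ⟨b', Ne.symm e5⟩,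
    ⟨c', Ne.symm e6⟩, Subtype.val ⁻¹' A, Subtype.val ⁻¹' B, Subtype.val ⁻¹' C, ?_, ?_, ?_, ?_, ?_,
    ?_, ?_, pairsJoinedTo_induce _ wA pA, pairsJoinedTo_induce _ wB pB,
    pairsJoinedTo_induce _ wC pC⟩
  · simpa [Subtype.ext_iff] using f
  · simp only [List.pairwise_cons, List.mem_cons, List.not_mem_nil, or_false, forall_eq_or_imp,
      forall_eq, List.Pairwise.nil, and_true, IsEmpty.forall_iff, implies_true]
    refine ⟨⟨disjoint_list_preimage hA ?_, disjoint_list_preimage hB ?_,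
      disjoint_list_preimage hC ?_⟩, ⟨hAB.preimage _, hAC.preimage _⟩, hBC.preimage _⟩ <;>
    · rintro v (rfl | rfl | rfl | rfl | rfl | rfl) <;> simp
  · rw [Set.eq_univ_iff_forall]
    rintro ⟨v, hv⟩
    have hv' : v ≠ w := hv
    have := hcover v
    simp only [Set.mem_union, Set.mem_insert_iff, Subtype.ext_iff, Set.mem_singleton_iff,
      Set.mem_preimage]
    tauto
  · simp [SimpleGraph.isClique_iff, Set.pairwise_insert, ab, ac, bc, ab.symm, ac.symm, bc.symm]
  · rw [neighborSet_induce_eq (S := {a}) _ (by simpa using ha')]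
    ext ⟨u, hu⟩
    simp [Subtype.ext_iff]
  · rw [neighborSet_induce_eq (S := {b}) _ (by simpa using hb')]
    ext ⟨u, hu⟩
    simp [Subtype.ext_iff]
  · rw [neighborSet_induce_eq (S := {c}) _ (by simpa using hc')]
    ext ⟨u, hu⟩
    simp [Subtype.ext_iff]

theorem isF2_induce {w a b c a' b' : V} {A B C : Set V}
    (hnodup : [w, a, b, c, a', b'].Nodup)
    (hAB : Disjoint A B) (hAC : Disjoint A C) (hBC : Disjoint B C)
    (hA : ∀ v ∈ A, v ∉ [w, a, b, c, a', b']) (hB : ∀ v ∈ B, v ∉ [w, a, b, c, a', b'])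
    (hC : ∀ v ∈ C, v ∉ [w, a, b, c, a', b'])
    (hcover : ∀ v, v ∈ [w, a, b, c, a', b'] ∨ v ∈ A ∨ v ∈ B ∨ v ∈ C)
    (ab : G.Adj a b) (ac : G.Adj a c) (bc : G.Adj b c)
    (ha' : ∀ u, u ≠ w → (G.Adj a' u ↔ u = a)) (hb' : ∀ u, u ≠ w → (G.Adj b' u ↔ u = b))
    (pA : ∀ v ∈ A, ∃ v' ∈ A, ∀ u, u ≠ w → (G.Adj v u ↔ u = a ∨ u = v'))
    (pB : ∀ v ∈ B, ∃ v' ∈ B, ∀ u, u ≠ w → (G.Adj v u ↔ u = b ∨ u = v'))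
    (pC : ∀ v ∈ C, ∃ v' ∈ C, ∀ u, u ≠ w → (G.Adj v u ↔ u = c ∨ u = v')) :
    IsF2 (G.induce ({w}ᶜ : Set V)) := by
  have wA : w ∉ A := fun h => hA w h (by simp)
  have wB : w ∉ B := fun h => hB w h (by simp)
  have wC : w ∉ C := fun h => hC w h (by simp)
  simp only [List.nodup_cons, List.mem_cons, List.not_mem_nil, or_false, not_or, List.nodup_nil,
    not_false_eq_true, and_true] at hnodup hcover
  obtain ⟨⟨e1, e2, e3, e4, e5⟩, f⟩ := hnodup
  refine ⟨⟨a, Ne.symm e1⟩, ⟨b, Ne.symm e2⟩, ⟨c, Ne.symm e3⟩, ⟨a', Ne.symm e4⟩, ⟨b', Ne.symm e5⟩,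
    Subtype.val ⁻¹' A, Subtype.val ⁻¹' B, Subtype.val ⁻¹' C, ?_, ?_, ?_, ?_, ?_,
    ?_, pairsJoinedTo_induce _ wA pA, pairsJoinedTo_induce _ wB pB,
    pairsJoinedTo_induce _ wC pC⟩
  · simpa [Subtype.ext_iff] using f
  · simp only [List.pairwise_cons, List.mem_cons, List.not_mem_nil, or_false, forall_eq_or_imp,
      forall_eq, List.Pairwise.nil, and_true, IsEmpty.forall_iff, implies_true]
    refine ⟨⟨disjoint_list_preimage hA ?_, disjoint_list_preimage hB ?_,
      disjoint_list_preimage hC ?_⟩, ⟨hAB.preimage _, hAC.preimage _⟩, hBC.preimage _⟩ <;>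
    · rintro v (rfl | rfl | rfl | rfl | rfl) <;> simp
  · rw [Set.eq_univ_iff_forall]
    rintro ⟨v, hv⟩
    have hv' : v ≠ w := hv
    have := hcover v
    simp only [Set.mem_union, Set.mem_insert_iff, Subtype.ext_iff, Set.mem_singleton_iff,
      Set.mem_preimage]
    tauto
  · simp [SimpleGraph.isClique_iff, Set.pairwise_insert, ab, ac, bc, ab.symm, ac.symm, bc.symm]
  · rw [neighborSet_induce_eq (S := {a}) _ (by simpa using ha')]
    ext ⟨u, hu⟩
    simp [Subtype.ext_iff]
  · rw [neighborSet_induce_eq (S := {b}) _ (by simpa using hb')]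
    ext ⟨u, hu⟩
    simp [Subtype.ext_iff]

theorem pairsJoinedTo_of_iff {U : Set V} {p q : V}
    (h : ∀ v ∈ U, ∃ v' ∈ U, ∀ u, G.Adj v u ↔ u = p ∨ u = q ∨ u = v') :
    PairsJoinedTo G U {p, q} := by
  intro v hv
  obtain ⟨v', hv', hN⟩ := h v hv
  refine ⟨v', hv', ?_⟩
  ext u
  simp only [SimpleGraph.mem_neighborSet, hN, Set.union_singleton, Set.mem_insert_iff,
    Set.mem_singleton_iff]
  tauto

end Labelled

/-! ### Two vertices of degree two with a common neighbour. -/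

section TwoPair

variable {V : Type u} [Fintype V] {G : SimpleGraph V} {x y a b q r : V}

/-- Two vertices `x`, `y` of degree two with the common neighbour `a`, together with the mate `r` of
the other neighbour of `y`. -/
structure TwoPair (G : SimpleGraph V) (x y a b q r : V) : Prop where
  base : TwoBase G x a b
  second : TwoBase G y a q
  q_ne : q ≠ x
  q_adj : G.Adj q b
  r_ne : r ≠ x
  ra : G.Adj r a
  rb : G.Adj r b
  rq : G.Adj r q
  y_mem : y ∈ thin G x
  y_zero : nb G (thin G x) y = 0

/-- The common neighbours of `a` and `b` besides `x`, `q`, `r`. -/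
def otherCore (G : SimpleGraph V) (x a b q r : V) : Set V :=
  {v | v ≠ x ∧ G.Adj v a ∧ G.Adj v b ∧ v ≠ q ∧ v ≠ r}

theorem TwoBase.exists_twoPair (h : TwoBase G x a b) (hy : TwoBase G y a q) (hqx : q ≠ x)
    (qb : G.Adj q b) (hyt : y ∈ thin G x) (h0 : nb G (thin G x) y = 0) :
    ∃ r, TwoPair G x y a b q r := by
  obtain ⟨-, r, hr, ra, rb, qr⟩ := h.link hqx hy.adj.ne.symm qb.ne
  exact ⟨r, h, hy, hqx, qb, hr, ra, rb, qr.symm, hyt, h0⟩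

namespace TwoPair

theorem qa (h : TwoPair G x y a b q r) : G.Adj q a := h.second.adj.symm

theorem parts (h : TwoPair G x y a b q r) (v : V) :
    v = x ∨ v = a ∨ v = b ∨ v = q ∨ v = r ∨ v ∈ otherCore G x a b q r ∨ v ∈ thin G x := by
  rw [h.base.mem_thin]
  simp only [otherCore, Set.mem_ofPred_eq]
  tauto

theorem thin_ne (h : TwoPair G x y a b q r) {v : V} (hv : v ∈ thin G x) :
    v ≠ x ∧ v ≠ a ∧ v ≠ b ∧ v ≠ q ∧ v ≠ r := by
  obtain ⟨h1, h2, h3, h4⟩ := h.base.mem_thin.1 hv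
  refine ⟨h1, h2, h3, ?_, ?_⟩
  · rintro rfl
    exact h4 ⟨h.qa, h.q_adj⟩
  · rintro rfl
    exact h4 ⟨h.ra, h.rb⟩

theorem thin_not_core (h : TwoPair G x y a b q r) {v : V} (hv : v ∈ thin G x) :
    v ∉ otherCore G x a b q r := fun e => (h.base.mem_thin.1 hv).2.2.2 ⟨e.2.1, e.2.2.1⟩

theorem thin_near (h : TwoPair G x y a b q r) {v : V} (hv : v ∈ thin G x) :
    G.Adj v a ∨ G.Adj v b := by
  obtain ⟨h1, h2, h3, -⟩ := h.thin_ne hv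
  exact h.base.near h1 h2 h3

theorem thin_not_both (h : TwoPair G x y a b q r) {v : V} (hv : v ∈ thin G x) (va : G.Adj v a) :
    ¬ G.Adj v b := fun vb => (h.base.mem_thin.1 hv).2.2.2 ⟨va, vb⟩

/-- A vertex not adjacent to `a` is adjacent to `q`. -/
theorem thin_adj_q (h : TwoPair G x y a b q r) {v : V} (hv : v ∈ thin G x) (vb : G.Adj v b) :
    G.Adj v q := by
  have va : ¬ G.Adj v a := fun va => h.thin_not_both hv va vb
  obtain ⟨h1, h2, h3, h4, h5⟩ := h.thin_ne hv
  have hvy : v ≠ y := by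
    rintro rfl
    exact va h.second.adj_left
  exact (h.second.near hvy h2 h4).resolve_left va

theorem parent_unique (h : TwoPair G x y a b q r) {v c d : V} (hv : v ∈ thin G x)
    (ca : G.Adj c a) (cb : G.Adj c b) (da : G.Adj d a) (db : G.Adj d b) (vc : G.Adj v c)
    (vd : G.Adj v d) : c = d := by
  obtain ⟨h1, h2, h3, -⟩ := h.thin_ne hv
  exact h.base.common_unique h1 h2 h3 ca cb da db vc vd

theorem not_q_r (h : TwoPair G x y a b q r) {v : V} (hv : v ∈ thin G x) (vq : G.Adj v q) :
    ¬ G.Adj v r := fun vr =>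
  h.rq.ne (h.parent_unique hv h.ra h.rb h.qa h.q_adj vr vq)

theorem mate_q (h : TwoPair G x y a b q r) {c : V} (ca : G.Adj c a) (cb : G.Adj c b)
    (cq : G.Adj c q) : c = r :=
  h.base.common_unique h.q_ne h.qa.ne h.q_adj.ne ca cb h.ra h.rb cq.symm h.rq.symm

theorem mate_r (h : TwoPair G x y a b q r) {c : V} (ca : G.Adj c a) (cb : G.Adj c b)
    (cr : G.Adj c r) : c = q :=
  h.base.common_unique h.r_ne h.ra.ne h.rb.ne ca cb h.qa h.q_adj cr.symm h.rq

/-- Edges between vertices attached to different ends cannot form a triangle with `q`. -/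
theorem no_cross (h : TwoPair G x y a b q r) {d d' : V} (hd : d ∈ thin G x) (hd' : d' ∈ thin G x)
    (da : G.Adj d a) (d'b : G.Adj d' b) (dd' : G.Adj d d') (dq : G.Adj d q) (d'q : G.Adj d' q) :
    False :=
  h.base.sat.free ⟨q, d, d', b, a, (h.thin_ne hd).2.2.1, (h.thin_ne hd').2.1, dq.symm, d'q.symm,
    h.q_adj, h.qa, dd', d'b, h.base.adj.symm, da.symm⟩

/-- The neighbours of a matched vertex. -/
theorem matched (h : TwoPair G x y a b q r) {v : V} (hv : v ∈ thin G x)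
    (h1 : nb G (thin G x) v = 1) :
    ∃ s p v', (s = a ∨ s = b) ∧ G.Adj p a ∧ G.Adj p b ∧ v' ∈ thin G x ∧ v' ≠ y ∧
      ∀ u, G.Adj v u ↔ u = s ∨ u = p ∨ u = v' := by
  obtain ⟨s, p, v', hs, -, pa, pb, hv', hN⟩ := h.base.nbrs_of_matched hv h1
  refine ⟨s, p, v', hs, pa, pb, hv', ?_, hN⟩
  rintro rfl
  exact nb_eq_zero.1 h.y_zero v hv (((hN _).2 (Or.inr (Or.inr rfl))).symm)

/-- A matched vertex next to `a` whose mate is also next to `a`. -/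
theorem matched_left (h : TwoPair G x y a b q r) {v : V} (hv : v ∈ thin G x)
    (h1 : nb G (thin G x) v = 1)
    (hmate : ∀ v' ∈ thin G x, G.Adj v v' → nb G (thin G x) v' = 1 ∧ G.Adj v' a)
    (va : G.Adj v a) :
    ∃ p v', (p = q ∨ p = r) ∧ v' ∈ thin G x ∧ v' ≠ y ∧ G.Adj v' a ∧ G.Adj v' p ∧
      ∀ u, G.Adj v u ↔ u = a ∨ u = p ∨ u = v' := by
  have vb := h.thin_not_both hv va
  obtain ⟨s, p, v', hs, pa, pb, hv', hv'y, hN⟩ := h.matched hv h1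
  have hsa : s = a := by
    rcases hs with rfl | rfl
    · rfl
    · exact absurd ((hN s).2 (Or.inl rfl)) vb
  subst hsa
  have vv' : G.Adj v v' := (hN v').2 (Or.inr (Or.inr rfl))
  obtain ⟨h1', v'a⟩ := hmate v' hv' vv'
  have v'b := h.thin_not_both hv' v'a
  obtain ⟨s', p', v₂, hs', pa', pb', hv₂, -, hN'⟩ := h.matched hv' h1'
  have hsa' : s' = s := by
    rcases hs' with rfl | rfl
    · rfl
    · exact absurd ((hN' s').2 (Or.inl rfl)) v'b
  subst hsa'
  have e : v = v₂ := by
    rcases (hN' v).1 vv'.symm with rfl | rfl | rfl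
    · exact absurd rfl (h.thin_ne hv).2.1
    · exact absurd pb' vb
    · rfl
  subst e
  have hvy : v ≠ y := by
    rintro rfl
    exact nb_eq_zero.1 h.y_zero v' hv' vv'
  -- The vertex linking `v` to `y` is adjacent to the common neighbour of `x`, `y` and to `q`. It is
  -- `p`, and then `p = r`, or it is `v'`, and then `p' = q`. Applied in both directions this gives
  -- p = p'.
  have key : ∀ v v' p p', v ∈ thin G x → v ≠ y → G.Adj p s' → G.Adj p b → G.Adj p' s' →
      G.Adj p' b → v' ∈ thin G x → (∀ u, G.Adj v u ↔ u = s' ∨ u = p ∨ u = v') →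
      (∀ u, G.Adj v' u ↔ u = s' ∨ u = p' ∨ u = v) → p = r ∨ p' = q := by
    intro v v' p p' hv hvy pa pb pa' pb' hv' hN hN'
    obtain ⟨-, h2, -, h4, -⟩ := h.thin_ne hv
    obtain ⟨-, c, -, ca, cq, vc⟩ := h.second.link hvy h2 h4
    rcases (hN c).1 vc with rfl | rfl | rfl
    · exact absurd ca G.irrefl
    · exact Or.inl (h.mate_q pa pb cq)
    · right
      exact h.parent_unique hv' pa' pb' h.qa h.q_adj ((hN' p').2 (Or.inr (Or.inl rfl))) cq
  have k1 := key v v' p p' hv hvy pa pb pa' pb' hv' hN hN'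
  have k2 := key v' v p' p hv' hv'y pa' pb' pa pb hv hN' hN
  have hqr := h.rq.ne
  have hpp : p = p' ∧ (p = q ∨ p = r) := by
    rcases k1 with rfl | rfl <;> rcases k2 with rfl | rfl
    · exact ⟨rfl, Or.inr rfl⟩
    · exact absurd rfl hqr
    · exact absurd rfl hqr
    · exact ⟨rfl, Or.inl rfl⟩
  obtain ⟨rfl, hp⟩ := hpp
  exact ⟨p, v', hp, hv', hv'y, v'a, (hN' p).2 (Or.inr (Or.inl rfl)), hN⟩

/-- The remaining common neighbours of `a` and `b` form pairs. -/
theorem core_pairs (h : TwoPair G x y a b q r)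
    (hch : ∀ v ∈ thin G x, ∀ c ∈ otherCore G x a b q r, ¬ G.Adj v c) :
    ∀ v ∈ otherCore G x a b q r, ∃ v' ∈ otherCore G x a b q r,
      ∀ u, G.Adj v u ↔ u = a ∨ u = b ∨ u = v' := by
  intro v hv
  obtain ⟨hvx, va, vb, vq, vr⟩ := hv
  obtain ⟨-, c, cx, ca, cb, vc⟩ := h.base.link hvx va.ne vb.ne
  have cq : c ≠ q := by
    rintro rfl
    exact vr (h.mate_q va vb vc)
  have cr : c ≠ r := by
    rintro rfl
    exact vq (h.mate_r va vb vc)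
  refine ⟨c, ⟨cx, ca, cb, cq, cr⟩, fun u => ⟨fun hu => ?_, ?_⟩⟩
  · rcases h.parts u with rfl | rfl | rfl | rfl | rfl | hu' | hu'
    · rcases (h.base.nbr v).1 hu.symm with rfl | rfl
      · exact absurd va G.irrefl
      · exact absurd vb G.irrefl
    · exact Or.inl rfl
    · exact Or.inr (Or.inl rfl)
    · exact absurd (h.mate_q va vb hu) vr
    · exact absurd (h.mate_r va vb hu) vq
    · exact Or.inr (Or.inr (h.base.common_unique hvx va.ne vb.ne hu'.2.1 hu'.2.2.1 ca cb hu vc))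
    · exact absurd hu.symm (hch u hu' v ⟨hvx, va, vb, vq, vr⟩)
  · rintro (rfl | rfl | rfl) <;> assumption

theorem universal (h : TwoPair G x y a b q r) (hall : ∀ v ∈ thin G x, G.Adj v a) (v : V)
    (hv : v ≠ a) : G.Adj a v := by
  rcases h.parts v with rfl | rfl | rfl | rfl | rfl | hu' | hu'
  · exact h.base.adj_left.symm
  · exact absurd rfl hv
  · exact h.base.adj
  · exact h.qa.symm
  · exact h.ra.symm
  · exact hu'.2.1.symm
  · exact (hall v hu').symm

end TwoPair

end TwoPair

/-! ### Cones, and the exclusion of thin vertices with two thin neighbours. -/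

section MinDegreeTwo

variable {V : Type u} [Fintype V] {G : SimpleGraph V} {x y z a b q r : V}

namespace TwoPair

theorem y_nbr (h : TwoPair G x y a b q r) {v : V} : G.Adj y v ↔ v = a ∨ v = q := h.second.nbr v

theorem y_not_r (h : TwoPair G x y a b q r) : ¬ G.Adj y r := by
  rw [h.y_nbr]
  exact fun e => e.elim h.ra.ne h.rq.ne

theorem nodup (h : TwoPair G x y a b q r) : [a, b, q, r, x, y].Nodup := by
  obtain ⟨h1, h2, h3, h4, h5⟩ := h.thin_ne h.y_mem
  simp [h.base.adj.ne, h.qa.ne.symm, h.ra.ne.symm, h.base.adj_left.ne.symm, h2.symm,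
    h.q_adj.ne.symm, h.rb.ne.symm, h.base.adj_right.ne.symm, h3.symm, h.rq.ne.symm, h.q_ne, h4.symm,
    h.r_ne, h5.symm, h1.symm]

theorem core_not_mem (h : TwoPair G x y a b q r) {v : V} (hv : v ∈ otherCore G x a b q r) :
    v ∉ [a, b, q, r, x, y] := by
  have hvy : v ≠ y := by
    rintro rfl
    exact h.thin_not_core h.y_mem hv
  obtain ⟨h1, h2, h3, h4, h5⟩ := hv
  simp [h1, h2.ne, h3.ne, h4, h5, hvy]

theorem thin_not_mem (h : TwoPair G x y a b q r) {v : V} (hv : v ∈ thin G x) (hvy : v ≠ y) :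
    v ∉ [a, b, q, r, x, y] := by
  obtain ⟨h1, h2, h3, h4, h5⟩ := h.thin_ne hv
  simp [h1, h2, h3, h4, h5, hvy]

theorem core_disjoint (h : TwoPair G x y a b q r) {A : Set V} (hA : ∀ v ∈ A, v ∈ thin G x) :
    Disjoint (otherCore G x a b q r) A := by
  rw [Set.disjoint_left]
  exact fun v hv hvA => h.thin_not_core (hA v hvA) hv

/-- If all vertices are adjacent to `a`, the matched vertices form pairs at `q` and `r`. -/
theorem star_pairs (h : TwoPair G x y a b q r) (hall : ∀ v ∈ thin G x, G.Adj v a)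
    (hle : ∀ v ∈ thin G x, nb G (thin G x) v ≤ 1) {v : V} (hv : v ∈ thin G x)
    (h1 : nb G (thin G x) v = 1) :
    ∃ p v', (p = q ∨ p = r) ∧ v' ∈ thin G x ∧ v' ≠ y ∧ G.Adj v' p ∧
      ∀ u, G.Adj v u ↔ u = a ∨ u = p ∨ u = v' := by
  obtain ⟨p, v', hp, hv', hv'y, -, v'p, hN⟩ := h.matched_left hv h1 (fun v' hv' vv' => by
    have h2 := hle v' hv'
    have h3 : 0 < nb G (thin G x) v' := nb_pos.2 ⟨v, hv, vv'.symm⟩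
    exact ⟨by omega, hall v' hv'⟩) (hall v hv)
  exact ⟨p, v', hp, hv', hv'y, v'p, hN⟩

theorem star_core (h : TwoPair G x y a b q r) (hall : ∀ v ∈ thin G x, G.Adj v a)
    (hch : ∀ v ∈ thin G x, v = y ∨ G.Adj v r ∨ G.Adj v q) :
    ∀ v ∈ otherCore G x a b q r, ∃ v' ∈ otherCore G x a b q r,
      ∀ u, u ≠ a → (G.Adj v u ↔ u = b ∨ u = v') := by
  have key := h.core_pairs fun v hv c hc vc => by
    rcases hch v hv with rfl | e | e
    · rcases h.y_nbr.1 vc with rfl | rfl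
      · exact G.irrefl hc.2.1
      · exact hc.2.2.2.1 rfl
    · exact hc.2.2.2.2 (h.parent_unique hv hc.2.1 hc.2.2.1 h.ra h.rb vc e)
    · exact hc.2.2.2.1 (h.parent_unique hv hc.2.1 hc.2.2.1 h.qa h.q_adj vc e)
  intro v hv
  obtain ⟨v', hv', hN⟩ := key v hv
  refine ⟨v', hv', fun u hu => ?_⟩
  rw [hN]
  tauto

theorem star_pairs_q (h : TwoPair G x y a b q r) (hall : ∀ v ∈ thin G x, G.Adj v a)
    (hle : ∀ v ∈ thin G x, nb G (thin G x) v ≤ 1)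
    (hm : ∀ v ∈ thin G x, v ≠ y → G.Adj v q → nb G (thin G x) v = 1) :
    ∀ v ∈ {v | v ∈ thin G x ∧ G.Adj v q ∧ v ≠ y}, ∃ v' ∈ {v | v ∈ thin G x ∧ G.Adj v q ∧ v ≠ y},
      ∀ u, u ≠ a → (G.Adj v u ↔ u = q ∨ u = v') := by
  rintro v ⟨hv, vq, hvy⟩
  obtain ⟨p, v', rfl | rfl, hv', hv'y, v'p, hN⟩ := h.star_pairs hall hle hv (hm v hv hvy vq)
  · refine ⟨v', ⟨hv', v'p, hv'y⟩, fun u hu => ?_⟩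
    rw [hN]
    tauto
  · exact absurd ((hN p).2 (by simp)) (h.not_q_r hv vq)

theorem star_pairs_r (h : TwoPair G x y a b q r) (hall : ∀ v ∈ thin G x, G.Adj v a)
    (hle : ∀ v ∈ thin G x, nb G (thin G x) v ≤ 1) {v : V} (hv : v ∈ thin G x) (vr : G.Adj v r)
    (h1 : nb G (thin G x) v = 1) : ∃ v' ∈ thin G x, G.Adj v' r ∧
      ∀ u, u ≠ a → (G.Adj v u ↔ u = r ∨ u = v') := by
  obtain ⟨p, v', rfl | rfl, hv', hv'y, v'p, hN⟩ := h.star_pairs hall hle hv h1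
  · exact absurd vr (h.not_q_r hv ((hN p).2 (by simp)))
  · refine ⟨v', hv', v'p, fun u hu => ?_⟩
    rw [hN]
    tauto

theorem disjoint_q_r (h : TwoPair G x y a b q r) {A B : Set V}
    (hA : ∀ v ∈ A, v ∈ thin G x ∧ G.Adj v q) (hB : ∀ v ∈ B, G.Adj v r) : Disjoint A B := by
  rw [Set.disjoint_left]
  exact fun v hv hvB => h.not_q_r (hA v hv).1 (hA v hv).2 (hB v hvB)

/-- Two isolated vertices next to `a`. -/
theorem star_all (h : TwoPair G x y a b q r) (hz : TwoBase G z a r) :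
    ∀ v ∈ thin G x, G.Adj v a := by
  intro v hv
  obtain ⟨h1, h2, h3, h4, h5⟩ := h.thin_ne hv
  by_contra va
  have hvy : v ≠ y := fun e => va (e ▸ h.second.adj_left)
  have hvz : v ≠ z := fun e => va (e ▸ hz.adj_left)
  exact h.not_q_r hv ((h.second.near hvy h2 h4).resolve_left va)
    ((hz.near hvz h2 h5).resolve_left va)

/-- Deleting the universal vertex `a` leaves the triangle b q r with the pendant vertices `x`, `y`,
`z`; the pairs at `b` are the other common neighbours of `a` and `b`, those at `q` and `r` are thin.
-/
theorem isF1_of_star (h : TwoPair G x y a b q r) (hz : TwoBase G z a r) (hzt : z ∈ thin G x)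
    (z0 : nb G (thin G x) z = 0)
    (hm : ∀ v ∈ thin G x, v ≠ y → v ≠ z → nb G (thin G x) v = 1) :
    IsF1 (G.induce ({a}ᶜ : Set V)) := by
  have hall := h.star_all hz
  have hle : ∀ v ∈ thin G x, nb G (thin G x) v ≤ 1 := by
    intro v hv
    by_cases hvy : v = y
    · rw [hvy, h.y_zero]
      omega
    · by_cases hvz : v = z
      · rw [hvz, z0]
        omega
      · exact (hm v hv hvy hvz).le
  have zq : ¬ G.Adj z q := by
    rw [hz.nbr]
    exact fun e => e.elim h.qa.ne h.rq.ne.symm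
  have hzy : z ≠ y := by
    rintro rfl
    exact zq h.second.adj_right
  have hroot : ∀ v ∈ thin G x, v = y ∨ v = z ∨ G.Adj v r ∨ G.Adj v q := by
    intro v hv
    by_cases hvy : v = y
    · exact Or.inl hvy
    by_cases hvz : v = z
    · exact Or.inr (Or.inl hvz)
    obtain ⟨p, v', rfl | rfl, -, -, -, hN⟩ := h.star_pairs hall hle hv (hm v hv hvy hvz)
    · exact Or.inr (Or.inr (Or.inr ((hN p).2 (by simp))))
    · exact Or.inr (Or.inr (Or.inl ((hN p).2 (by simp))))
  have hnd := h.nodup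
  have hzl := h.thin_not_mem hzt hzy
  have nd : [a, b, q, r, x, y, z].Nodup := by
    rw [show [a, b, q, r, x, y, z] = [a, b, q, r, x, y] ++ [z] from rfl, List.nodup_append]
    refine ⟨hnd, by simp, ?_⟩
    rintro u hu v hv rfl
    rw [List.mem_singleton] at hv
    exact hzl (hv ▸ hu)
  have out : ∀ v, v ∉ [a, b, q, r, x, y] → v ≠ z → v ∉ [a, b, q, r, x, y, z] := by
    intro v h1 h2
    rw [show [a, b, q, r, x, y, z] = [a, b, q, r, x, y] ++ [z] from rfl, List.mem_append,
      List.mem_singleton, not_or]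
    exact ⟨h1, h2⟩
  refine isF1_induce (w := a) (a := b) (b := q) (c := r) (a' := x) (b' := y) (c' := z)
    (A := otherCore G x a b q r) (B := {v | v ∈ thin G x ∧ G.Adj v q ∧ v ≠ y})
    (C := {v | v ∈ thin G x ∧ G.Adj v r ∧ v ≠ z}) nd
    (h.core_disjoint fun v hv => hv.1) (h.core_disjoint fun v hv => hv.1)
    (h.disjoint_q_r (fun v hv => ⟨hv.1, hv.2.1⟩) fun v hv => hv.2.1) ?_ ?_ ?_ ?_ h.q_adj.symm
    h.rb.symm h.rq.symm ?_ ?_ ?_ ?_ ?_ ?_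
  · intro v hv
    refine out v (h.core_not_mem hv) ?_
    rintro rfl
    exact h.thin_not_core hzt hv
  · rintro v ⟨hv, vq, hvy⟩
    refine out v (h.thin_not_mem hv hvy) ?_
    rintro rfl
    exact zq vq
  · rintro v ⟨hv, vr, hvz⟩
    refine out v (h.thin_not_mem hv ?_) hvz
    rintro rfl
    exact h.y_not_r vr
  · intro v
    rcases h.parts v with e | e | e | e | e | e | e
    iterate 5 exact Or.inl (by simp [e])
    · exact Or.inr (Or.inl e)
    · by_cases hvy : v = y
      · exact Or.inl (by simp [hvy])
      by_cases hvz : v = z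
      · exact Or.inl (by simp [hvz])
      rcases hroot v e with k | k | k | k
      · exact absurd k hvy
      · exact absurd k hvz
      · exact Or.inr (Or.inr (Or.inr ⟨e, k, hvz⟩))
      · exact Or.inr (Or.inr (Or.inl ⟨e, k, hvy⟩))
  · intro u hu
    rw [h.base.nbr]
    tauto
  · intro u hu
    rw [h.y_nbr]
    tauto
  · intro u hu
    rw [hz.nbr]
    tauto
  · refine h.star_core hall fun v hv => ?_
    rcases hroot v hv with e | rfl | e | e
    · exact Or.inl e
    · exact Or.inr (Or.inl hz.adj_right)
    · exact Or.inr (Or.inl e)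
    · exact Or.inr (Or.inr e)
  · refine h.star_pairs_q hall hle fun v hv hvy vq => hm v hv hvy ?_
    rintro rfl
    exact zq vq
  · rintro v ⟨hv, vr, hvz⟩
    have hvy : v ≠ y := by
      rintro rfl
      exact h.y_not_r vr
    obtain ⟨v', hv', hvr, hN⟩ := h.star_pairs_r hall hle hv vr (hm v hv hvy hvz)
    refine ⟨v', ⟨hv', hvr, ?_⟩, hN⟩
    rintro rfl
    exact nb_eq_zero.1 z0 v hv ((hN v' (h.thin_ne hv').2.1).2 (by simp)).symm

/-- As in `isF1_of_star`, except that `r` carries no pendant vertex. -/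
theorem isF2_of_star (h : TwoPair G x y a b q r) (hall : ∀ v ∈ thin G x, G.Adj v a)
    (hm : ∀ v ∈ thin G x, v ≠ y → nb G (thin G x) v = 1) :
    IsF2 (G.induce ({a}ᶜ : Set V)) := by
  have hle : ∀ v ∈ thin G x, nb G (thin G x) v ≤ 1 := by
    intro v hv
    by_cases hvy : v = y
    · rw [hvy, h.y_zero]
      omega
    · exact (hm v hv hvy).le
  have hroot : ∀ v ∈ thin G x, v = y ∨ G.Adj v r ∨ G.Adj v q := by
    intro v hv
    by_cases hvy : v = y
    · exact Or.inl hvy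
    obtain ⟨p, v', rfl | rfl, -, -, -, hN⟩ := h.star_pairs hall hle hv (hm v hv hvy)
    · exact Or.inr (Or.inr ((hN p).2 (by simp)))
    · exact Or.inr (Or.inl ((hN p).2 (by simp)))
  have hry : ∀ v, G.Adj v r → v ≠ y := by
    rintro v vr rfl
    exact h.y_not_r vr
  refine isF2_induce (w := a) (a := b) (b := q) (c := r) (a' := x) (b' := y)
    (A := otherCore G x a b q r) (B := {v | v ∈ thin G x ∧ G.Adj v q ∧ v ≠ y})
    (C := {v | v ∈ thin G x ∧ G.Adj v r}) h.nodup
    (h.core_disjoint fun v hv => hv.1) (h.core_disjoint fun v hv => hv.1)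
    (h.disjoint_q_r (fun v hv => ⟨hv.1, hv.2.1⟩) fun v hv => hv.2) (fun v => h.core_not_mem)
    (fun v hv => h.thin_not_mem hv.1 hv.2.2) (fun v hv => h.thin_not_mem hv.1 (hry v hv.2)) ?_
    h.q_adj.symm h.rb.symm h.rq.symm ?_ ?_ (h.star_core hall hroot) ?_ ?_
  · intro v
    rcases h.parts v with e | e | e | e | e | e | e
    iterate 5 exact Or.inl (by simp [e])
    · exact Or.inr (Or.inl e)
    · by_cases hvy : v = y
      · exact Or.inl (by simp [hvy])
      rcases hroot v e with k | k | k
      · exact absurd k hvy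
      · exact Or.inr (Or.inr (Or.inr ⟨e, k⟩))
      · exact Or.inr (Or.inr (Or.inl ⟨e, k, hvy⟩))
  · intro u hu
    rw [h.base.nbr]
    tauto
  · intro u hu
    rw [h.y_nbr]
    tauto
  · exact h.star_pairs_q hall hle fun v hv hvy _ => hm v hv hvy
  · rintro v ⟨hv, vr⟩
    obtain ⟨v', hv', hvr, hN⟩ := h.star_pairs_r hall hle hv vr (hm v hv (hry v vr))
    exact ⟨v', ⟨hv', hvr⟩, hN⟩

/-- Two isolated vertices next to `a` exclude a vertex with two neighbours of the same kind. -/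
theorem star_no_path (h : TwoPair G x y a b q r) (hz : TwoBase G z a r)
    (z0 : nb G (thin G x) z = 0) {c : V} (hc : c ∈ thin G x) (hc2 : nb G (thin G x) c = 2)
    (hm : ∀ v ∈ thin G x, v ≠ y → v ≠ z → v ≠ c → nb G (thin G x) v = 1) : False := by
  have hall := h.star_all hz
  obtain ⟨d, hd, e, he, hde, cd, ce, -⟩ := nb_eq_two.1 hc2
  -- The links of `d` to `y` and to `z` force `d` and `c` to share their neighbour among `q` and
  -- `r`.
  have key : ∀ d ∈ thin G x, G.Adj c d → ∃ p, (p = q ∨ p = r) ∧ G.Adj d p ∧ G.Adj c p := by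
    intro d hd cd
    have dy : d ≠ y := by
      rintro rfl
      exact nb_eq_zero.1 h.y_zero c hc cd.symm
    have dz : d ≠ z := by
      rintro rfl
      exact nb_eq_zero.1 z0 c hc cd.symm
    have d1 := hm d hd dy dz cd.ne.symm
    obtain ⟨s, p, d', hs, pa, pb, hd', -, hN⟩ := h.matched hd d1
    have ed : d' = c := by
      rcases (hN c).1 cd.symm with rfl | rfl | rfl
      · obtain ⟨-, h2, h3, -⟩ := h.thin_ne hc
        rcases hs with rfl | rfl <;> contradiction
      · exact absurd pb (h.thin_not_both hc (hall _ hc))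
      · rfl
    subst ed
    have hsa : s = a := by
      rcases hs with rfl | rfl
      · rfl
      · exact absurd ((hN s).2 (Or.inl rfl)) (h.thin_not_both hd (hall d hd))
    subst hsa
    have dp : G.Adj d p := (hN p).2 (by simp)
    obtain ⟨-, h2, -, h4, h5⟩ := h.thin_ne hd
    have k1 : p = r ∨ G.Adj d' q := by
      obtain ⟨-, k, -, ka, kq, dk⟩ := h.second.link dy h2 h4
      rcases (hN k).1 dk with rfl | rfl | rfl
      · exact absurd ka G.irrefl
      · exact Or.inl (h.mate_q pa pb kq)
      · exact Or.inr kq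
    have k2 : p = q ∨ G.Adj d' r := by
      obtain ⟨-, k, -, ka, kr, dk⟩ := hz.link dz h2 h5
      rcases (hN k).1 dk with rfl | rfl | rfl
      · exact absurd ka G.irrefl
      · exact Or.inl (h.mate_r pa pb kr)
      · exact Or.inr kr
    have hqr := h.rq.ne
    rcases k1 with rfl | k1 <;> rcases k2 with rfl | k2
    · exact absurd rfl hqr
    · exact ⟨p, Or.inr rfl, dp, k2⟩
    · exact ⟨p, Or.inl rfl, dp, k1⟩
    · exact absurd k2 (h.not_q_r hc k1)
  obtain ⟨p, hp, dp, cp⟩ := key d hd cd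
  obtain ⟨p', hp', ep, cp'⟩ := key e he ce
  have pp : p = p' := by
    rcases hp with rfl | rfl <;> rcases hp' with rfl | rfl
    · rfl
    · exact absurd cp' (h.not_q_r hc cp)
    · exact absurd cp (h.not_q_r hc cp')
    · rfl
  subst pp
  have pa : G.Adj a p := by
    rcases hp with rfl | rfl
    · exact h.qa.symm
    · exact h.ra.symm
  -- Both neighbours of `c` have the same root `p`, which closes the rim d c e p around `a`.
  exact h.base.sat.free ⟨a, d, c, e, p, hde, cp.ne, (hall d hd).symm, (hall c hc).symm,
    (hall e he).symm, pa, cd.symm, ce, ep, dp.symm⟩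

/-- Isolated vertices next to `a` and `b`. -/
theorem triangle_all (h : TwoPair G x y a b q r) (hz : TwoBase G z b q) :
    ∀ v ∈ thin G x, G.Adj v q := by
  intro v hv
  obtain ⟨h1, h2, h3, h4, h5⟩ := h.thin_ne hv
  rcases h.thin_near hv with va | vb
  · by_contra vq
    have hvz : v ≠ z := fun e => vq (e ▸ hz.adj_right)
    exact h.thin_not_both hv va ((hz.near hvz h3 h4).resolve_right vq)
  · exact h.thin_adj_q hv vb

/-- All thin vertices are adjacent to `q`. By `no_cross` the two thin neighbours d, e of `c` lie on
the same side s ∈ {a, b} as `c`, so s is the hub of a wheel with rim d c e q. -/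
theorem triangle_no_path (h : TwoPair G x y a b q r) (hz : TwoBase G z b q) {c : V}
    (hc : c ∈ thin G x) (hc2 : nb G (thin G x) c = 2) : False := by
  have hall := h.triangle_all hz
  obtain ⟨d, hd, e, he, hde, cd, ce, -⟩ := nb_eq_two.1 hc2
  have key : ∀ s t, G.Adj q s → G.Adj c s →
      (∀ d ∈ thin G x, G.Adj c d → ¬ G.Adj d t) → (∀ v ∈ thin G x, G.Adj v s ∨ G.Adj v t) →
      False := by
    intro s t qs cs hno hst
    have ds := (hst d hd).resolve_right (hno d hd cd)
    have es := (hst e he).resolve_right (hno e he ce)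
    exact h.base.sat.free ⟨s, d, c, e, q, hde, (hall c hc).ne, ds.symm, cs.symm, es.symm, qs.symm,
      cd.symm, ce, hall e he, (hall d hd).symm⟩
  rcases h.thin_near hc with ca | cb
  · exact key a b h.qa ca (fun d hd cd db => h.no_cross hc hd ca db cd (hall c hc) (hall d hd))
      fun v => h.thin_near
  · exact key b a h.q_adj cb
      (fun d hd cd da => h.no_cross hd hc da cb cd.symm (hall d hd) (hall c hc))
      fun v hv => (h.thin_near hv).symm

/-- Pairs over `{a, q}`. -/
theorem pairs_left (h : TwoPair G x y a b q r) {v : V} (hv : v ∈ thin G x)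
    (h1 : nb G (thin G x) v = 1) (va : G.Adj v a) (vq : G.Adj v q) :
    ∃ v' ∈ thin G x, v' ≠ y ∧ ∀ u, G.Adj v u ↔ u = a ∨ u = q ∨ u = v' := by
  obtain ⟨s, p, v', hs, pa, pb, hv', hv'y, hN⟩ := h.matched hv h1
  have es : s = a := by
    rcases hs with rfl | rfl
    · rfl
    · exact absurd ((hN s).2 (by simp)) (h.thin_not_both hv va)
  have ep : p = q := h.parent_unique hv pa pb h.qa h.q_adj ((hN p).2 (by simp)) vq
  subst es ep
  exact ⟨v', hv', hv'y, hN⟩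

/-- Pairs over `{b, q}`. -/
theorem pairs_right (h : TwoPair G x y a b q r) {v : V} (hv : v ∈ thin G x)
    (h1 : nb G (thin G x) v = 1) (vb : G.Adj v b) :
    ∃ v' ∈ thin G x, v' ≠ y ∧ ∀ u, G.Adj v u ↔ u = b ∨ u = q ∨ u = v' := by
  obtain ⟨s, p, v', hs, pa, pb, hv', hv'y, hN⟩ := h.matched hv h1
  have es : s = b := by
    rcases hs with rfl | rfl
    · exact absurd vb (h.thin_not_both hv ((hN s).2 (by simp)))
    · rfl
  have ep : p = q := h.parent_unique hv pa pb h.qa h.q_adj ((hN p).2 (by simp))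
    (h.thin_adj_q hv vb)
  subst es ep
  exact ⟨v', hv', hv'y, hN⟩

theorem clique (h : TwoPair G x y a b q r) : G.IsClique {a, b, q, r} := by
  have h1 := h.base.adj
  have h2 := h.qa
  have h3 := h.q_adj
  have h4 := h.ra
  have h5 := h.rb
  have h6 := h.rq
  simp [SimpleGraph.isClique_iff, Set.pairwise_insert, h1, h2, h3, h4, h5, h6, h1.symm, h2.symm,
    h3.symm, h4.symm, h5.symm, h6.symm]

theorem nbr_r (h : TwoPair G x y a b q r) {u : V} (hu : G.Adj r u) :
    u = a ∨ u = b ∨ u = q ∨ u ∈ thin G x := by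
  rcases h.parts u with rfl | rfl | rfl | rfl | rfl | hu' | hu'
  · exact absurd ((h.base.nbr r).1 hu.symm) (not_or.2 ⟨h.ra.ne, h.rb.ne⟩)
  · exact Or.inl rfl
  · exact Or.inr (Or.inl rfl)
  · exact Or.inr (Or.inr (Or.inl rfl))
  · exact absurd hu G.irrefl
  · exact absurd (h.mate_r hu'.2.1 hu'.2.2.1 hu.symm) hu'.2.2.2.1
  · exact Or.inr (Or.inr (Or.inr hu'))

theorem not_core_of_adj (h : TwoPair G x y a b q r) {v c : V} (hv : v ∈ thin G x)
    (hc : c ∈ otherCore G x a b q r) (hqr : G.Adj v q ∨ G.Adj v r) : ¬ G.Adj v c := by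
  intro vc
  rcases hqr with e | e
  · exact hc.2.2.2.1 (h.parent_unique hv hc.2.1 hc.2.2.1 h.qa h.q_adj vc e)
  · exact hc.2.2.2.2 (h.parent_unique hv hc.2.1 hc.2.2.1 h.ra h.rb vc e)

theorem neighborSet_x (h : TwoPair G x y a b q r) : G.neighborSet x = {a, b} := by
  ext u
  simp [h.base.nbr]

theorem neighborSet_y (h : TwoPair G x y a b q r) : G.neighborSet y = {a, q} := by
  ext u
  simp [h.second.nbr]

end TwoPair

end MinDegreeTwo

/-! ### The families without a universal vertex, and the classification in degree two. -/

section MinDegreeTwoB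

variable {V : Type u} [Fintype V] {G : SimpleGraph V} {x y z a b q r : V}

namespace TwoPair

theorem disjoint_left_right (h : TwoPair G x y a b q r) {A B : Set V}
    (hA : ∀ v ∈ A, v ∈ thin G x ∧ G.Adj v a) (hB : ∀ v ∈ B, G.Adj v b) : Disjoint A B := by
  rw [Set.disjoint_left]
  exact fun v hv hvB => h.thin_not_both (hA v hv).1 (hA v hv).2 (hB v hvB)

theorem neighborSet_r (h : TwoPair G x y a b q r) (hr : ∀ v ∈ thin G x, ¬ G.Adj v r) :
    G.neighborSet r = {a, b, q} := by
  ext u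
  simp only [SimpleGraph.mem_neighborSet, Set.mem_insert_iff, Set.mem_singleton_iff]
  constructor
  · intro hu
    rcases h.nbr_r hu with e | e | e | e
    · exact Or.inl e
    · exact Or.inr (Or.inl e)
    · exact Or.inr (Or.inr e)
    · exact absurd hu.symm (hr u e)
  · rintro (rfl | rfl | rfl)
    exacts [h.ra, h.rb, h.rq]

/-- `x`, `y`, `z` sit over the three sides of the triangle a b q, and `r` completes a K₄. All thin
vertices are adjacent to `q`, and by `no_cross` matched ones lie on the same side. -/
theorem b1Labelled (h : TwoPair G x y a b q r) (hz : TwoBase G z b q) (hzt : z ∈ thin G x)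
    (z0 : nb G (thin G x) z = 0)
    (hm : ∀ v ∈ thin G x, v ≠ y → v ≠ z → nb G (thin G x) v = 1) :
    B1Labelled G x y z a b q r {v | v ∈ thin G x ∧ G.Adj v a ∧ v ≠ y}
      {v | v ∈ thin G x ∧ G.Adj v b ∧ v ≠ z} (otherCore G x a b q r) := by
  have hall := h.triangle_all hz
  obtain ⟨y1, y2, y3, y4, y5⟩ := h.thin_ne h.y_mem
  obtain ⟨z1, z2, z3, z4, z5⟩ := h.thin_ne hzt
  have za : ¬ G.Adj z a := fun e => h.thin_not_both hzt e hz.adj_left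
  have yb := h.thin_not_both h.y_mem h.second.adj_left
  have hyz : y ≠ z := by
    rintro rfl
    exact za h.second.adj_left
  have nothin : ∀ v, v ∈ thin G x → v ≠ y → v ≠ z → v ∉ ({x, y, z, a, b, q, r} : Set V) := by
    intro v hv hy hz
    obtain ⟨h1, h2, h3, h4, h5⟩ := h.thin_ne hv
    simp [*]
  refine ⟨?_, ?_, ?_, h.clique, h.neighborSet_r fun v hv => h.not_q_r hv (hall v hv),
    h.neighborSet_x, h.neighborSet_y, ?_, pairsJoinedTo_of_iff ?_, pairsJoinedTo_of_iff ?_,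
    pairsJoinedTo_of_iff
      (h.core_pairs fun v hv c hc => h.not_core_of_adj hv hc (Or.inl (hall v hv)))⟩
  · simp [y1.symm, z1.symm, h.base.adj_left.ne, h.base.adj_right.ne, h.q_ne.symm, h.r_ne.symm,
      hyz, y2, y3, y4, y5, z2, z3, z4, z5, h.base.adj.ne, h.qa.ne.symm, h.ra.ne.symm,
      h.q_adj.ne.symm, h.rb.ne.symm, h.rq.ne.symm]
  · simp only [List.pairwise_cons, List.mem_cons, List.not_mem_nil, or_false, forall_eq_or_imp,
      forall_eq, List.Pairwise.nil, and_true, IsEmpty.forall_iff, implies_true]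
    refine ⟨⟨?_, ?_, ?_⟩, ⟨h.disjoint_left_right (fun v hv => ⟨hv.1, hv.2.1⟩) fun v hv => hv.2.1,
      (h.core_disjoint fun v hv => hv.1).symm⟩, (h.core_disjoint fun v hv => hv.1).symm⟩
    · rw [Set.disjoint_right]
      rintro v ⟨hv, va, hvy⟩
      exact nothin v hv hvy fun e => za (e ▸ va)
    · rw [Set.disjoint_right]
      rintro v ⟨hv, vb, hvz⟩
      exact nothin v hv (fun e => yb (e ▸ vb)) hvz
    · rw [Set.disjoint_right]
      intro v hv
      have hvy : v ≠ y := fun e => h.thin_not_core h.y_mem (e ▸ hv)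
      have hvz : v ≠ z := fun e => h.thin_not_core hzt (e ▸ hv)
      simp [hvy, hvz, hv.1, hv.2.1.ne, hv.2.2.1.ne, hv.2.2.2.1, hv.2.2.2.2]
  · rw [Set.eq_univ_iff_forall]
    intro v
    rcases h.parts v with e | e | e | e | e | e | e
    iterate 5 exact Or.inl (Or.inl (Or.inl (by simp [e])))
    · exact Or.inr e
    · by_cases hvy : v = y
      · exact Or.inl (Or.inl (Or.inl (by simp [hvy])))
      by_cases hvz : v = z
      · exact Or.inl (Or.inl (Or.inl (by simp [hvz])))
      rcases h.thin_near e with k | k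
      · exact Or.inl (Or.inl (Or.inr ⟨e, k, hvy⟩))
      · exact Or.inl (Or.inr ⟨e, k, hvz⟩)
  · ext u
    simp [hz.nbr]
  · rintro v ⟨hv, va, hvy⟩
    have hvz : v ≠ z := fun e => za (e ▸ va)
    obtain ⟨v', hv', hv'y, hN⟩ := h.pairs_left hv (hm v hv hvy hvz) va (hall v hv)
    have vv' : G.Adj v v' := (hN v').2 (by simp)
    refine ⟨v', ⟨hv', ?_, hv'y⟩, hN⟩
    refine (h.thin_near hv').resolve_right fun v'b => ?_
    exact h.no_cross hv hv' va v'b vv' (hall v hv) (hall v' hv')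
  · rintro v ⟨hv, vb, hvz⟩
    have hvy : v ≠ y := fun e => yb (e ▸ vb)
    obtain ⟨v', hv', hv'y, hN⟩ := h.pairs_right hv (hm v hv hvy hvz) vb
    have vv' : G.Adj v v' := (hN v').2 (by simp)
    refine ⟨v', ⟨hv', ?_, ?_⟩, hN⟩
    · refine (h.thin_near hv').resolve_left fun v'a => ?_
      exact h.no_cross hv' hv v'a vb vv'.symm (hall v' hv') (hall v hv)
    · rintro rfl
      exact nb_eq_zero.1 z0 v hv vv'.symm

/-- The neighbours of a matched vertex next to `a` when some vertex is not adjacent to `a`. -/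
theorem left_cases (h : TwoPair G x y a b q r)
    (hm : ∀ v ∈ thin G x, v ≠ y → nb G (thin G x) v = 1) {e : V} (he : e ∈ thin G x)
    (eb : G.Adj e b) {v : V} (hv : v ∈ thin G x) (hvy : v ≠ y) (va : G.Adj v a) :
    ∃ v' ∈ thin G x, v' ≠ y ∧
      ((G.Adj v' a ∧ ∀ u, G.Adj v u ↔ u = a ∨ u = q ∨ u = v') ∨
        (G.Adj v' b ∧ ∀ u, G.Adj v u ↔ u = a ∨ u = r ∨ u = v')) := by
  have yb := h.thin_not_both h.y_mem h.second.adj_left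
  obtain ⟨s, p, v', hs, pa, pb, hv', hv'y, hN⟩ := h.matched hv (hm v hv hvy)
  have vb := h.thin_not_both hv va
  have hsa : s = a := by
    rcases hs with rfl | rfl
    · rfl
    · exact absurd ((hN s).2 (Or.inl rfl)) vb
  subst hsa
  have vv' : G.Adj v v' := (hN v').2 (by simp)
  have vp : G.Adj v p := (hN p).2 (by simp)
  refine ⟨v', hv', hv'y, ?_⟩
  rcases h.thin_near hv' with v'a | v'b
  · left
    refine ⟨v'a, ?_⟩
    have hmate : ∀ t ∈ thin G x, G.Adj v t → t = v' := by
      intro t ht vt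
      rcases (hN t).1 vt with rfl | rfl | rfl
      · exact absurd rfl (h.thin_ne ht).2.1
      · exact absurd pb (h.thin_not_both ht pa)
      · rfl
    obtain ⟨p', v₂, hp', hv₂, -, -, v₂p, hN₂⟩ := h.matched_left hv (hm v hv hvy)
      (fun t ht vt => hmate t ht vt ▸ ⟨hm v' hv' hv'y, v'a⟩) va
    have e2 := hmate v₂ hv₂ ((hN₂ v₂).2 (by simp))
    subst e2
    rcases hp' with rfl | rfl
    · exact hN₂
    -- With root `r` for the pair v v', the vertices `e` and `v` would have no common neighbour.
    · exfalso
      have ey : e ≠ y := fun k => yb (k ▸ eb)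
      obtain ⟨e', he', e'y, hNe⟩ := h.pairs_right he (hm e he ey) eb
      have ev : e ≠ v := by
        rintro rfl
        exact vb eb
      have nev : ¬ G.Adj e v := by
        intro k
        have := hmate e he k.symm
        subst this
        exact h.thin_not_both he v'a eb
      obtain ⟨c, ec, vc⟩ := h.base.sat.exists_common ev nev
      rcases (hNe c).1 ec with rfl | rfl | rfl
      · exact vb vc
      · exact h.not_q_r hv vc ((hN₂ p').2 (by simp))
      · have := hmate c he' vc
        subst this
        obtain ⟨s', p₁, v₃, hs', pa', pb', hv₃, -, hN₃⟩ := h.matched hv' (hm c hv' hv'y)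
        have k1 : v₃ = v := by
          rcases (hN₃ v).1 vv'.symm with rfl | rfl | rfl
          · rcases hs' with rfl | rfl
            · exact absurd rfl (h.thin_ne hv).2.1
            · exact absurd rfl (h.thin_ne hv).2.2.1
          · exact absurd pb' vb
          · rfl
        rcases (hN₃ e).1 ec.symm with rfl | rfl | rfl
        · rcases hs' with rfl | rfl
          · exact absurd rfl (h.thin_ne he).2.1
          · exact absurd rfl (h.thin_ne he).2.2.1
        · exact h.thin_not_both he pa' eb
        · exact ev k1
  · right
    refine ⟨v'b, ?_⟩
    obtain ⟨-, h2, -, h4, -⟩ := h.thin_ne hv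
    -- The vertex linking `v` to `y` is adjacent to `a` and `q`; among the neighbours of `v` only
    -- `p` qualifies, so `p` is the mate `r` of `q`.
    obtain ⟨-, k, -, ka, kq, vk⟩ := h.second.link hvy h2 h4
    have : p = r := by
      rcases (hN k).1 vk with rfl | rfl | rfl
      · exact absurd ka G.irrefl
      · exact h.mate_q pa pb kq
      · exact absurd v'b (h.thin_not_both hv' ka)
    subst this
    exact hN

theorem b2Labelled (h : TwoPair G x y a b q r)
    (hL : ∀ v ∈ thin G x, v ≠ y → G.Adj v a → ∃ v' ∈ thin G x, v' ≠ y ∧ G.Adj v' a ∧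
      ∀ u, G.Adj v u ↔ u = a ∨ u = q ∨ u = v')
    (hm : ∀ v ∈ thin G x, v ≠ y → nb G (thin G x) v = 1) :
    B2Labelled G x y a b q r {v | v ∈ thin G x ∧ G.Adj v a ∧ v ≠ y}
      {v | v ∈ thin G x ∧ G.Adj v b} (otherCore G x a b q r) := by
  obtain ⟨y1, y2, y3, y4, y5⟩ := h.thin_ne h.y_mem
  have yb := h.thin_not_both h.y_mem h.second.adj_left
  have hall : ∀ v ∈ thin G x, G.Adj v q := by
    intro v hv
    by_cases hvy : v = y
    · subst hvy
      exact h.second.adj_right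
    rcases h.thin_near hv with va | vb
    · obtain ⟨v', -, -, -, hN⟩ := hL v hv hvy va
      exact (hN q).2 (by simp)
    · exact h.thin_adj_q hv vb
  have nothin : ∀ v, v ∈ thin G x → v ≠ y → v ∉ ({x, y, a, b, q, r} : Set V) := by
    intro v hv hy
    obtain ⟨h1, h2, h3, h4, h5⟩ := h.thin_ne hv
    simp [*]
  refine ⟨?_, ?_, ?_, h.clique, h.neighborSet_r fun v hv => h.not_q_r hv (hall v hv),
    h.neighborSet_x, h.neighborSet_y, pairsJoinedTo_of_iff ?_, pairsJoinedTo_of_iff ?_,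
    pairsJoinedTo_of_iff
      (h.core_pairs fun v hv c hc => h.not_core_of_adj hv hc (Or.inl (hall v hv)))⟩
  · simp [y1.symm, h.base.adj_left.ne, h.base.adj_right.ne, h.q_ne.symm, h.r_ne.symm,
      y2, y3, y4, y5, h.base.adj.ne, h.qa.ne.symm, h.ra.ne.symm,
      h.q_adj.ne.symm, h.rb.ne.symm, h.rq.ne.symm]
  · simp only [List.pairwise_cons, List.mem_cons, List.not_mem_nil, or_false, forall_eq_or_imp,
      forall_eq, List.Pairwise.nil, and_true, IsEmpty.forall_iff, implies_true]
    refine ⟨⟨?_, ?_, ?_⟩, ⟨h.disjoint_left_right (fun v hv => ⟨hv.1, hv.2.1⟩) fun v hv => hv.2,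
      (h.core_disjoint fun v hv => hv.1).symm⟩, (h.core_disjoint fun v hv => hv.1).symm⟩
    · rw [Set.disjoint_right]
      rintro v ⟨hv, va, hvy⟩
      exact nothin v hv hvy
    · rw [Set.disjoint_right]
      rintro v ⟨hv, vb⟩
      exact nothin v hv (fun e => yb (e ▸ vb))
    · rw [Set.disjoint_right]
      intro v hv
      have hvy : v ≠ y := fun e => h.thin_not_core h.y_mem (e ▸ hv)
      simp [hvy, hv.1, hv.2.1.ne, hv.2.2.1.ne, hv.2.2.2.1, hv.2.2.2.2]
  · rw [Set.eq_univ_iff_forall]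
    intro v
    rcases h.parts v with e | e | e | e | e | e | e
    iterate 5 exact Or.inl (Or.inl (Or.inl (by simp [e])))
    · exact Or.inr e
    · by_cases hvy : v = y
      · exact Or.inl (Or.inl (Or.inl (by simp [hvy])))
      rcases h.thin_near e with k | k
      · exact Or.inl (Or.inl (Or.inr ⟨e, k, hvy⟩))
      · exact Or.inl (Or.inr ⟨e, k⟩)
  · rintro v ⟨hv, va, hvy⟩
    obtain ⟨v', hv', hv'y, v'a, hN⟩ := hL v hv hvy va
    exact ⟨v', ⟨hv', v'a, hv'y⟩, hN⟩
  · rintro v ⟨hv, vb⟩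
    have hvy : v ≠ y := fun e => yb (e ▸ vb)
    obtain ⟨v', hv', hv'y, hN⟩ := h.pairs_right hv (hm v hv hvy) vb
    have vv' : G.Adj v v' := (hN v').2 (by simp)
    refine ⟨v', ⟨hv', ?_⟩, hN⟩
    refine (h.thin_near hv').resolve_left fun v'a => ?_
    exact h.no_cross hv' hv v'a vb vv'.symm (hall v' hv') (hall v hv)

/-- The crossed pair d d' plays the role of v₁ v₂. Any other thin vertex next to `b` would have no
common neighbour with `d`, so this pair is unique and the remaining pairs next to `a` are joined to
`a` and `q`. -/
theorem b3Labelled (h : TwoPair G x y a b q r)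
    (hm : ∀ v ∈ thin G x, v ≠ y → nb G (thin G x) v = 1) {d d' : V} (hd : d ∈ thin G x)
    (hdy : d ≠ y) (da : G.Adj d a) (hd' : d' ∈ thin G x) (d'b : G.Adj d' b)
    (hN : ∀ u, G.Adj d u ↔ u = a ∨ u = r ∨ u = d') :
    B3Labelled G x y a b d d' q r {v | v ∈ thin G x ∧ G.Adj v a ∧ v ≠ y ∧ v ≠ d}
      (otherCore G x a b q r) := by
  obtain ⟨y1, y2, y3, y4, y5⟩ := h.thin_ne h.y_mem
  obtain ⟨d1, d2, d3, d4, d5⟩ := h.thin_ne hd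
  obtain ⟨e1, e2, e3, e4, e5⟩ := h.thin_ne hd'
  have yb := h.thin_not_both h.y_mem h.second.adj_left
  have db := h.thin_not_both hd da
  have dr : G.Adj d r := (hN r).2 (by simp)
  have dd' : G.Adj d d' := (hN d').2 (by simp)
  have d'y : d' ≠ y := fun e => yb (e ▸ d'b)
  have hN' : ∀ u, G.Adj d' u ↔ u = b ∨ u = q ∨ u = d := by
    obtain ⟨t, ht, -, hN'⟩ := h.pairs_right hd' (hm d' hd' d'y) d'b
    have : t = d := by
      rcases (hN' d).1 dd'.symm with rfl | rfl | rfl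
      · exact absurd rfl d3
      · exact absurd rfl d4
      · rfl
    rwa [this] at hN'
  -- `d'` is the only vertex that is not adjacent to `a`
  have huniq : ∀ e ∈ thin G x, G.Adj e b → e = d' := by
    intro e he eb
    by_contra hne
    have ey : e ≠ y := fun k => yb (k ▸ eb)
    have ed : e ≠ d := fun k => db (k ▸ eb)
    obtain ⟨e', he', -, hNe⟩ := h.pairs_right he (hm e he ey) eb
    have ned : ¬ G.Adj e d := by
      intro k
      rcases (hN e).1 k.symm with rfl | rfl | rfl
      · exact (h.thin_ne he).2.1 rfl
      · exact (h.thin_ne he).2.2.2.2 rfl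
      · exact hne rfl
    obtain ⟨c, ec, dc⟩ := h.base.sat.exists_common ed ned
    rcases (hNe c).1 ec with rfl | rfl | rfl
    · exact db dc
    · exact h.not_q_r hd dc dr
    · rcases (hN c).1 dc with rfl | rfl | rfl
      · exact (h.thin_ne he').2.1 rfl
      · exact (h.thin_ne he').2.2.2.2 rfl
      · rcases (hN' e).1 ec.symm with rfl | rfl | rfl
        · exact (h.thin_ne he).2.2.1 rfl
        · exact (h.thin_ne he).2.2.2.1 rfl
        · exact ed rfl
  have hL : ∀ v ∈ thin G x, G.Adj v a → v ≠ y → v ≠ d → ∃ v' ∈ thin G x, v' ≠ y ∧ G.Adj v' a ∧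
      v' ≠ d ∧ ∀ u, G.Adj v u ↔ u = a ∨ u = q ∨ u = v' := by
    intro v hv va hvy hvd
    obtain ⟨v', hv', hv'y, ⟨v'a, hNv⟩ | ⟨v'b, hNv⟩⟩ := h.left_cases hm hd' d'b hv hvy va
    · refine ⟨v', hv', hv'y, v'a, ?_, hNv⟩
      rintro rfl
      rcases (hN v).1 ((hNv v').2 (by simp)).symm with rfl | rfl | rfl
      · exact (h.thin_ne hv).2.1 rfl
      · exact (h.thin_ne hv).2.2.2.2 rfl
      · exact h.thin_not_both hv va d'b
    · have := huniq v' hv' v'b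
      subst this
      rcases (hN' v).1 ((hNv v').2 (by simp)).symm with rfl | rfl | rfl
      · exact absurd rfl (h.thin_ne hv).2.2.1
      · exact absurd rfl (h.thin_ne hv).2.2.2.1
      · exact absurd rfl hvd
  have hroot : ∀ v ∈ thin G x, v ≠ d → G.Adj v q := by
    intro v hv hvd
    by_cases hvy : v = y
    · subst hvy
      exact h.second.adj_right
    rcases h.thin_near hv with va | vb
    · obtain ⟨v', -, -, -, -, hNv⟩ := hL v hv va hvy hvd
      exact (hNv q).2 (by simp)
    · exact h.thin_adj_q hv vb
  refine ⟨?_, ?_, ?_, h.clique, ?_, h.neighborSet_x, h.neighborSet_y, ?_, ?_,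
    pairsJoinedTo_of_iff ?_, pairsJoinedTo_of_iff (h.core_pairs fun v hv c hc =>
      h.not_core_of_adj hv hc ?_)⟩
  · simp [y1.symm, h.base.adj_left.ne, h.base.adj_right.ne, h.q_ne.symm, h.r_ne.symm,
      y2, y3, y4, y5, h.base.adj.ne, h.qa.ne.symm, h.ra.ne.symm, d1.symm, e1.symm, hdy.symm,
      d'y.symm, d2.symm, e2.symm, d3.symm, e3.symm, dd'.ne, d4, d5, e4, e5,
      h.q_adj.ne.symm, h.rb.ne.symm, h.rq.ne.symm]
  · simp only [List.pairwise_cons, List.mem_cons, List.not_mem_nil, or_false, forall_eq_or_imp,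
      forall_eq, List.Pairwise.nil, and_true, IsEmpty.forall_iff, implies_true]
    refine ⟨⟨?_, ?_⟩, (h.core_disjoint fun v hv => hv.1).symm⟩
    · rw [Set.disjoint_right]
      rintro v ⟨hv, va, hvy, hvd⟩
      have hvd' : v ≠ d' := fun e => h.thin_not_both hv va (e ▸ d'b)
      obtain ⟨h1, h2, h3, h4, h5⟩ := h.thin_ne hv
      simp [h1, h2, h3, h4, h5, hvy, hvd, hvd']
    · rw [Set.disjoint_right]
      intro v hv
      have hvy : v ≠ y := fun e => h.thin_not_core h.y_mem (e ▸ hv)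
      have hvd : v ≠ d := fun e => h.thin_not_core hd (e ▸ hv)
      have hvd' : v ≠ d' := fun e => h.thin_not_core hd' (e ▸ hv)
      simp [hvy, hvd, hvd', hv.1, hv.2.1.ne, hv.2.2.1.ne, hv.2.2.2.1, hv.2.2.2.2]
  · rw [Set.eq_univ_iff_forall]
    intro v
    rcases h.parts v with e | e | e | e | e | e | e
    iterate 5 exact Or.inl (Or.inl (by simp [e]))
    · exact Or.inr e
    · by_cases hvy : v = y
      · exact Or.inl (Or.inl (by simp [hvy]))
      by_cases hvd : v = d
      · exact Or.inl (Or.inl (by simp [hvd]))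
      rcases h.thin_near e with k | k
      · exact Or.inl (Or.inr ⟨e, k, hvy, hvd⟩)
      · exact Or.inl (Or.inl (by simp [huniq v e k]))
  · ext u
    simp only [SimpleGraph.mem_neighborSet, Set.mem_insert_iff, Set.mem_singleton_iff]
    constructor
    · intro hu
      rcases h.nbr_r hu with e | e | e | e
      · exact Or.inl e
      · exact Or.inr (Or.inl e)
      · exact Or.inr (Or.inr (Or.inl e))
      · by_cases hud : u = d
        · exact Or.inr (Or.inr (Or.inr hud))
        · exact absurd hu.symm (h.not_q_r e (hroot u e hud))
    · rintro (rfl | rfl | rfl | rfl)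
      exacts [h.ra, h.rb, h.rq, dr.symm]
  · ext u
    simp only [SimpleGraph.mem_neighborSet, Set.mem_insert_iff, Set.mem_singleton_iff, hN]
    tauto
  · ext u
    simp only [SimpleGraph.mem_neighborSet, Set.mem_insert_iff, Set.mem_singleton_iff, hN']
    tauto
  · rintro v ⟨hv, va, hvy, hvd⟩
    obtain ⟨v', hv', hv'y, v'a, hv'd, hNv⟩ := hL v hv va hvy hvd
    exact ⟨v', ⟨hv', v'a, hv'y, hv'd⟩, hNv⟩
  · by_cases hvd : v = d
    · subst hvd
      exact Or.inr dr
    · exact Or.inl (hroot v hv hvd)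

end TwoPair

/-- The extremal graphs with an odd number of vertices and a vertex of degree two. -/
theorem TwoBase.classify_odd (h : TwoBase G x a b)
    (he : 5 * Fintype.card V = 2 * G.edgeSet.ncard + 11) :
    (∃ w, (∀ v, v ≠ w → G.Adj w v) ∧ IsF1 (G.induce ({w}ᶜ : Set V))) ∨
      ∃ (x y z x₁ x₂ u₁ u₂ : V) (U11 U12 U2 : Set V),
        B1Labelled G x y z x₁ x₂ u₁ u₂ U11 U12 U2 := by
  obtain ⟨y, z, hyz, hy, hz, y0, z0, hm⟩ := h.isolated_of_eq he
  obtain ⟨q, hqx, qa, qb, hyb⟩ := h.twoBase_of_isolated hy y0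
  obtain ⟨q', -, q'a, q'b, hzb⟩ := h.twoBase_of_isolated hz z0
  have nyz : ¬ G.Adj y z := nb_eq_zero.1 y0 z hz
  -- By symmetry between `a` and `b`, `y` may be assumed adjacent to `a`.
  have main : ∀ a b, TwoBase G x a b → TwoBase G y a q → G.Adj q a → G.Adj q b → G.Adj q' a →
      G.Adj q' b → (TwoBase G z a q' ∨ TwoBase G z b q') →
      (∃ w, (∀ v, v ≠ w → G.Adj w v) ∧ IsF1 (G.induce ({w}ᶜ : Set V))) ∨
      ∃ (x y z x₁ x₂ u₁ u₂ : V) (U11 U12 U2 : Set V),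
        B1Labelled G x y z x₁ x₂ u₁ u₂ U11 U12 U2 := by
    intro a b h hyb qa qb q'a q'b hzb
    obtain ⟨r, hp⟩ := h.exists_twoPair hyb hqx qb hy y0
    rcases h.second_isolated hyb hyz q'a q'b qb hzb nyz with ⟨k, hqq⟩ | k
    · have := hp.mate_q q'a q'b hqq
      subst this
      exact Or.inl ⟨a, hp.universal (hp.star_all k), hp.isF1_of_star k hz z0 hm⟩
    · exact Or.inr ⟨_, _, _, _, _, _, _, _, _, _, hp.b1Labelled k hz z0 hm⟩
  rcases hyb with hyb | hyb
  · exact main a b h hyb qa qb q'a q'b hzb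
  · exact main b a h.symm hyb qb qa q'b q'a hzb.symm

/-- The extremal graphs with an even number of vertices and a vertex of degree two. -/
theorem TwoBase.classify_even (h : TwoBase G x a b)
    (he : 5 * Fintype.card V = 2 * G.edgeSet.ncard + 10) :
    (∃ w, (∀ v, v ≠ w → G.Adj w v) ∧ IsF2 (G.induce ({w}ᶜ : Set V))) ∨
      (∃ (x y x₁ x₂ u₁ u₂ : V) (U11 U12 U2 : Set V),
        B2Labelled G x y x₁ x₂ u₁ u₂ U11 U12 U2 ∧ U12.Nonempty) ∨
      ∃ (x y x₁ x₂ v₁ v₂ u₁ u₂ : V) (U1 U2 : Set V),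
        B3Labelled G x y x₁ x₂ v₁ v₂ u₁ u₂ U1 U2 := by
  rcases h.isolated_of_eq_succ he with ⟨y, hy, y0, hm⟩ |
    ⟨y, z, c, hyz, hy, hz, y0, z0, hc, hc2, hm⟩
  · obtain ⟨q, hqx, qa, qb, hyb⟩ := h.twoBase_of_isolated hy y0
    have main : ∀ a b, TwoBase G x a b → TwoBase G y a q → G.Adj q b →
        (∃ w, (∀ v, v ≠ w → G.Adj w v) ∧ IsF2 (G.induce ({w}ᶜ : Set V))) ∨
        (∃ (x y x₁ x₂ u₁ u₂ : V) (U11 U12 U2 : Set V),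
          B2Labelled G x y x₁ x₂ u₁ u₂ U11 U12 U2 ∧ U12.Nonempty) ∨
        ∃ (x y x₁ x₂ v₁ v₂ u₁ u₂ : V) (U1 U2 : Set V),
          B3Labelled G x y x₁ x₂ v₁ v₂ u₁ u₂ U1 U2 := by
      intro a b h hyb qb
      obtain ⟨r, hp⟩ := h.exists_twoPair hyb hqx qb hy y0
      by_cases hall : ∀ v ∈ thin G x, G.Adj v a
      · exact Or.inl ⟨a, hp.universal hall, hp.isF2_of_star hall hm⟩
      push Not at hall
      obtain ⟨e, he, ea⟩ := hall
      have eb := (hp.thin_near he).resolve_left ea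
      right
      -- The third family arises from a pair with ends on different sides; without one, the second
      -- arises, and `e` shows that its pairs over {b, q} exist.
      by_cases hcross : ∃ d ∈ thin G x, d ≠ y ∧ G.Adj d a ∧ ∃ d' ∈ thin G x, G.Adj d' b ∧
          ∀ u, G.Adj d u ↔ u = a ∨ u = r ∨ u = d'
      · obtain ⟨d, hd, hdy, da, d', hd', d'b, hN⟩ := hcross
        exact Or.inr ⟨_, _, _, _, _, _, _, _, _, _, hp.b3Labelled hm hd hdy da hd' d'b hN⟩
      · refine Or.inl ⟨_, _, _, _, _, _, _, _, _, hp.b2Labelled ?_ hm, e, he, eb⟩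
        intro v hv hvy va
        obtain ⟨v', hv', hv'y, ⟨v'a, hNv⟩ | ⟨v'b, hNv⟩⟩ := hp.left_cases hm he eb hv hvy va
        · exact ⟨v', hv', hv'y, v'a, hNv⟩
        · exact absurd ⟨v, hv, hvy, va, v', hv', v'b, hNv⟩ hcross
    rcases hyb with hyb | hyb
    · exact main a b h hyb qb
    · exact main b a h.symm hyb qa
  · exfalso
    obtain ⟨q, hqx, qa, qb, hyb⟩ := h.twoBase_of_isolated hy y0
    obtain ⟨q', -, q'a, q'b, hzb⟩ := h.twoBase_of_isolated hz z0
    have nyz : ¬ G.Adj y z := nb_eq_zero.1 y0 z hz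
    have main : ∀ a b, TwoBase G x a b → TwoBase G y a q → G.Adj q b → G.Adj q' a →
        G.Adj q' b → (TwoBase G z a q' ∨ TwoBase G z b q') → False := by
      intro a b h hyb qb q'a q'b hzb
      obtain ⟨r, hp⟩ := h.exists_twoPair hyb hqx qb hy y0
      rcases h.second_isolated hyb hyz q'a q'b qb hzb nyz with ⟨k, hqq⟩ | k
      · have := hp.mate_q q'a q'b hqq
        subst this
        exact hp.star_no_path k z0 hc hc2 hm
      · exact hp.triangle_no_path k hc hc2
    rcases hyb with hyb | hyb
    · exact main a b h hyb qb q'a q'b hzb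
    · exact main b a h.symm hyb qa q'b q'a hzb.symm

end MinDegreeTwoB

/-! ### Saturated graphs built on a small core. -/

section Based

variable {V : Type u} {G : SimpleGraph V}

/-- The neighbours of `v` are `p` and `q`. -/
def Pend (G : SimpleGraph V) (p q v : V) : Prop := ∀ u, G.Adj v u ↔ u = p ∨ u = q

/-- The neighbours of `v` are `p`, `q` and `w`. -/
def Pair (G : SimpleGraph V) (p q v w : V) : Prop := ∀ u, G.Adj v u ↔ u = p ∨ u = q ∨ u = w

/-- A graph consisting of a core `K`, vertices of degree two (those in `P`) and adjacent pairs of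
vertices of degree three, all of them attached to edges `p q` of the core with `B p q`. -/
structure Based (G : SimpleGraph V) (K P : Finset V) (B : V → V → Prop) : Prop where
  base : ∀ p q, B p q → p ∈ K ∧ q ∈ K ∧ G.Adj p q
  disj : ∀ v ∈ P, v ∉ K
  pend : ∀ v ∈ P, ∃ p q, B p q ∧ Pend G p q v
  pend_unique : ∀ u ∈ P, ∀ v ∈ P, ∀ p q, Pend G p q u → Pend G p q v → u = v
  pair : ∀ v, v ∉ K → v ∉ P →
    ∃ p q w, B p q ∧ w ∉ K ∧ w ∉ P ∧ Pair G p q v w ∧ Pair G p q w v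

/-- The conditions on the core that make the graph saturated. -/
structure SatCore (G : SimpleGraph V) (K P : Finset V) (B : V → V → Prop) : Prop where
  meet : ∀ p q p' q', B p q → B p' q' → (p = p' ∧ (q = q' ∨ G.Adj q q')) ∨
    (p = q' ∧ (q = p' ∨ G.Adj q p')) ∨ (q = p' ∧ (p = q' ∨ G.Adj p q')) ∨
    (q = q' ∧ (p = p' ∨ G.Adj p p'))
  core_link : ∀ p q c, B p q → c ∈ K → c ≠ p → c ≠ q →
    (∃ r, G.Adj p r ∧ G.Adj q r ∧ G.Adj r c ∧ (G.Adj p c ∨ G.Adj q c)) ∨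
    (G.Adj p c ∧ G.Adj q c ∧ P = ∅)
  core_core : ∀ s ∈ K, ∀ t ∈ K, s ≠ t → ¬ G.Adj s t →
    RimLink G s t ∨ HubLink G s t ∨ HubLink G t s
  core_free : ∀ h ∈ K, ∀ a ∈ K, ∀ b ∈ K, ∀ c ∈ K, ∀ d ∈ K, a ≠ c → b ≠ d → G.Adj h a →
    G.Adj h b → G.Adj h c → G.Adj h d → G.Adj a b → G.Adj b c → G.Adj c d → ¬ G.Adj d a

theorem RimLink.symm {s t : V} (h : RimLink G s t) : RimLink G t s := by
  obtain ⟨h, p, r, k1, k2, k3, k4, k5, k6, k7⟩ := h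
  exact ⟨h, r, p, k4, k3, k2, k1, k7.symm, k6.symm, k5.symm⟩

theorem Pend.symm {p q v : V} (h : Pend G p q v) : Pend G q p v := fun u => (h u).trans or_comm

theorem Pair.symm {p q v v' : V} (h : Pair G p q v v') : Pair G q p v v' := fun u => by
  rw [h u]
  tauto

/-- A wheel has at least four rim vertices. -/
theorem rim_not_three {h a b c d p q s : V} (hac : a ≠ c) (hbd : b ≠ d) (ha : G.Adj h a)
    (hb : G.Adj h b) (hc : G.Adj h c) (hd : G.Adj h d) (hab : G.Adj a b) (hbc : G.Adj b c)
    (hcd : G.Adj c d) (hda : G.Adj d a)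
    (hN : ∀ u, u = a ∨ u = b ∨ u = c ∨ u = d → G.Adj h u → u = p ∨ u = q ∨ u = s) : False := by
  classical
  have h4 : ({a, b, c, d} : Finset V).card = 4 := by
    rw [Finset.card_insert_of_notMem, Finset.card_insert_of_notMem, Finset.card_pair hcd.ne]
    · simp [hbc.ne, hbd]
    · simp [hab.ne, hac, hda.ne.symm]
  have h3 : ({p, q, s} : Finset V).card ≤ 3 := Finset.card_le_three
  have : ({a, b, c, d} : Finset V) ⊆ {p, q, s} := by
    intro u hu
    simp only [Finset.mem_insert, Finset.mem_singleton] at hu ⊢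
    refine hN u hu ?_
    rcases hu with rfl | rfl | rfl | rfl <;> assumption
  have := Finset.card_le_card this
  omega

namespace Based

variable {K P : Finset V} {B : V → V → Prop}

/-- The vertices outside the core do not lie on a wheel. -/
theorem not_rim (h : Based G K P B) {v : V} (hv : v ∉ K) {c a b d : V} (hbd : b ≠ d)
    (hva : v ≠ a) (hc : ¬ ∃ p q s, Pair G p q c s) (cv : G.Adj c v) (ca : G.Adj c a)
    (vb : G.Adj v b) (vd : G.Adj v d) (cb : G.Adj c b) (cd : G.Adj c d) (ba : G.Adj b a)
    (da : G.Adj d a) : False := by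
  by_cases hP : v ∈ P
  · obtain ⟨p, q, -, hN⟩ := h.pend v hP
    have e1 := (hN c).1 cv.symm
    have e2 := (hN b).1 vb
    have e3 := (hN d).1 vd
    have n1 := cb.ne
    have n2 := cd.ne
    rcases e1 with rfl | rfl <;> rcases e2 with rfl | rfl <;> rcases e3 with rfl | rfl <;>
      contradiction
  · obtain ⟨p, q, v', -, -, -, hN, hN'⟩ := h.pair v hv hP
    have n1 := cb.ne
    have n2 := cd.ne
    have cv' : c ≠ v' := by
      rintro rfl
      exact hc ⟨p, q, v, hN'⟩
    have hca := ca.ne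
    have hba := ba.ne
    have hda := da.ne
    rcases (hN b).1 vb with e2 | e2 | e2
    · rcases (hN d).1 vd with e3 | e3 | e3
      · exact hbd (e2.trans e3.symm)
      · rcases (hN c).1 cv.symm with e1 | e1 | e1
        · exact n1 (e1.trans e2.symm)
        · exact n2 (e1.trans e3.symm)
        · exact cv' e1
      · subst e3
        rcases (hN c).1 cv.symm with e1 | e1 | e1
        · exact n1 (e1.trans e2.symm)
        · rcases (hN' a).1 da with e4 | e4 | e4
          · exact hba (e2.trans e4.symm)
          · exact hca (e1.trans e4.symm)
          · exact hva e4.symm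
        · exact cv' e1
    · rcases (hN d).1 vd with e3 | e3 | e3
      · rcases (hN c).1 cv.symm with e1 | e1 | e1
        · exact n2 (e1.trans e3.symm)
        · exact n1 (e1.trans e2.symm)
        · exact cv' e1
      · exact hbd (e2.trans e3.symm)
      · subst e3
        rcases (hN c).1 cv.symm with e1 | e1 | e1
        · rcases (hN' a).1 da with e4 | e4 | e4
          · exact hca (e1.trans e4.symm)
          · exact hba (e2.trans e4.symm)
          · exact hva e4.symm
        · exact n1 (e1.trans e2.symm)
        · exact cv' e1
    · subst e2
      rcases (hN d).1 vd with e3 | e3 | e3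
      · rcases (hN c).1 cv.symm with e1 | e1 | e1
        · exact n2 (e1.trans e3.symm)
        · rcases (hN' a).1 ba with e4 | e4 | e4
          · exact hda (e3.trans e4.symm)
          · exact hca (e1.trans e4.symm)
          · exact hva e4.symm
        · exact cv' e1
      · rcases (hN c).1 cv.symm with e1 | e1 | e1
        · rcases (hN' a).1 ba with e4 | e4 | e4
          · exact hca (e1.trans e4.symm)
          · exact hda (e3.trans e4.symm)
          · exact hva e4.symm
        · exact n2 (e1.trans e3.symm)
        · exact cv' e1
      · exact hbd e3.symm

theorem attached (h : Based G K P B) {v : V} (hv : v ∉ K) : ∃ p q, B p q ∧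
    (Pend G p q v ∧ v ∈ P ∨ ∃ v', v' ∉ K ∧ Pair G p q v v' ∧ Pair G p q v' v) := by
  by_cases hP : v ∈ P
  · obtain ⟨p, q, hB, hN⟩ := h.pend v hP
    exact ⟨p, q, hB, Or.inl ⟨hN, hP⟩⟩
  · obtain ⟨p, q, v', hB, hv', -, hN, hN'⟩ := h.pair v hv hP
    exact ⟨p, q, hB, Or.inr ⟨v', hv', hN, hN'⟩⟩

/-- A hub has four neighbours, vertices outside the core have at most three. -/
theorem hub_mem (h : Based G K P B) {c a b d e : V} (hbd : b ≠ e) (had : a ≠ d)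
    (ca : G.Adj c a) (cb : G.Adj c b) (cd : G.Adj c d) (ce : G.Adj c e) (ab : G.Adj a b)
    (bd : G.Adj b d) (de : G.Adj d e) (ea : G.Adj e a) :
    c ∈ K ∧ ¬ ∃ p q s, Pair G p q c s := by
  have key : ¬ ∃ p q s, Pair G p q c s := by
    rintro ⟨p, q, s, hN⟩
    exact rim_not_three had hbd ca cb cd ce ab bd de ea fun u _ hu => (hN u).1 hu
  refine ⟨?_, key⟩
  by_contra hc
  obtain ⟨p, q, -, ⟨hN, -⟩ | ⟨v', -, hN, -⟩⟩ := h.attached hc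
  · exact rim_not_three (p := p) (q := q) (s := q) had hbd ca cb cd ce ab bd de ea fun u _ hu => by
      have := (hN u).1 hu
      tauto
  · exact key ⟨p, q, v', hN⟩

/-- A wheel would lie inside the core, by `hub_mem` and `not_rim`. Missing edges with an end outside
the core become rim edges: two attached vertices use that their attachment edges meet, an attached
vertex and a core vertex use `core_link`. -/
theorem sat (h : Based G K P B) (hK : SatCore G K P B) : Sat G := by
  constructor
  · rintro ⟨c, a, b, d, e, had, hbe, ca, cb, cd, ce, ab, bd, de, ea⟩
    obtain ⟨hc, hc'⟩ := h.hub_mem hbe had ca cb cd ce ab bd de ea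
    have ha : a ∈ K := by
      by_contra hn
      exact h.not_rim hn hbe had hc' ca cd ab ea.symm cb ce bd de.symm
    have hb : b ∈ K := by
      by_contra hn
      exact h.not_rim hn had hbe hc' cb ce ab.symm bd ca cd ea.symm de
    have hd : d ∈ K := by
      by_contra hn
      exact h.not_rim hn hbe had.symm hc' cd ca bd.symm de cb ce ab.symm ea
    have he : e ∈ K := by
      by_contra hn
      exact h.not_rim hn had hbe.symm hc' ce cb ea de.symm ca cd ab bd.symm
    exact hK.core_free c hc a ha b hb d hd e he had hbe ca cb cd ce ab bd de ea
  · -- links between two vertices outside the core, attached to `p q` and `p q'`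
    have two : ∀ u v p q q', G.Adj p q → G.Adj p q' → G.Adj u p → G.Adj u q → G.Adj v p →
        G.Adj v q' → G.Adj q q' → RimLink G u v := by
      intro u v p q q' pq pq' up uq vp vq' qq'
      exact ⟨p, q, q', up.symm, pq, pq', vp.symm, uq, qq', vq'.symm⟩
    -- The hub is `p` and the rim is u u' q v.
    have same : ∀ u v u' p q, G.Adj p q → Pair G p q u u' → Pair G p q u' u → G.Adj v p →
        G.Adj v q → RimLink G u v := by
      intro u v u' p q pq hN hN' vp vq
      have up : G.Adj u p := (hN p).2 (by simp)
      have uu' : G.Adj u u' := (hN u').2 (by simp)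
      have u'p : G.Adj u' p := (hN' p).2 (by simp)
      have u'q : G.Adj u' q := (hN' q).2 (by simp)
      exact ⟨p, u', q, up.symm, u'p.symm, pq, vp.symm, uu', u'q, vq.symm⟩
    have nn : ∀ u v, u ∉ K → v ∉ K → u ≠ v → RimLink G u v := by
      intro u v hu hv huv
      obtain ⟨p, q, hB, hN⟩ := h.attached hu
      obtain ⟨p', q', hB', hN'⟩ := h.attached hv
      have pq := (h.base p q hB).2.2
      have pq' := (h.base p' q' hB').2.2
      have up : G.Adj u p := by
        rcases hN with ⟨hN, -⟩ | ⟨w, -, hN, -⟩ <;> exact (hN p).2 (by simp)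
      have uq : G.Adj u q := by
        rcases hN with ⟨hN, -⟩ | ⟨w, -, hN, -⟩ <;> exact (hN q).2 (by simp)
      have vp : G.Adj v p' := by
        rcases hN' with ⟨hN, -⟩ | ⟨w, -, hN, -⟩ <;> exact (hN p').2 (by simp)
      have vq : G.Adj v q' := by
        rcases hN' with ⟨hN, -⟩ | ⟨w, -, hN, -⟩ <;> exact (hN q').2 (by simp)
      have eq : (p = p' ∧ q = q') ∨ (p = q' ∧ q = p') → RimLink G u v := by
        intro e
        rcases hN with ⟨hN, hP⟩ | ⟨w, -, hN, hNw⟩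
        · rcases hN' with ⟨hN', hP'⟩ | ⟨w, -, hN', hNw⟩
          · exfalso
            rcases e with ⟨rfl, rfl⟩ | ⟨rfl, rfl⟩
            · exact huv (h.pend_unique u hP v hP' _ _ hN hN')
            · exact huv (h.pend_unique u hP v hP' _ _ hN hN'.symm)
          · rcases e with ⟨rfl, rfl⟩ | ⟨rfl, rfl⟩
            · exact (same v u w p q pq hN' hNw up uq).symm
            · exact (same v u w p q pq hN'.symm hNw.symm up uq).symm
        · rcases e with ⟨rfl, rfl⟩ | ⟨rfl, rfl⟩
          · exact same u v w p q pq hN hNw vp vq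
          · exact same u v w p q pq hN hNw vq vp
      rcases hK.meet p q p' q' hB hB' with ⟨e1, e2 | e2⟩ | ⟨e1, e2 | e2⟩ | ⟨e1, e2 | e2⟩ |
        ⟨e1, e2 | e2⟩
      · exact eq (Or.inl ⟨e1, e2⟩)
      · subst e1
        exact two u v p q q' pq pq' up uq vp vq e2
      · exact eq (Or.inr ⟨e1, e2⟩)
      · subst e1
        exact two u v p q p' pq pq'.symm up uq vq vp e2
      · exact eq (Or.inr ⟨e2, e1⟩)
      · subst e1
        exact two u v q p q' pq.symm pq' uq up vp vq e2
      · exact eq (Or.inl ⟨e2, e1⟩)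
      · subst e1
        exact two u v q p p' pq.symm pq'.symm uq up vq vp e2
    have nc : ∀ v c, v ∉ K → c ∈ K → ¬ G.Adj v c → RimLink G v c := by
      intro v c hv hc hn
      obtain ⟨p, q, hB, hN⟩ := h.attached hv
      have pq := (h.base p q hB).2.2
      have vp : G.Adj v p := by
        rcases hN with ⟨hN, -⟩ | ⟨w, -, hN, -⟩ <;> exact (hN p).2 (by simp)
      have vq : G.Adj v q := by
        rcases hN with ⟨hN, -⟩ | ⟨w, -, hN, -⟩ <;> exact (hN q).2 (by simp)
      rcases hK.core_link p q c hB hc (fun e => hn (e ▸ vp)) (fun e => hn (e ▸ vq)) with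
        ⟨r, pr, qr, rc, pc | qc⟩ | ⟨pc, qc, hP⟩
      · exact ⟨p, q, r, vp.symm, pq, pr, pc, vq, qr, rc⟩
      · exact ⟨q, p, r, vq.symm, pq.symm, qr, qc, vp, pr, rc⟩
      · rcases hN with ⟨-, hP'⟩ | ⟨w, -, hN, hNw⟩
        · rw [hP] at hP'
          simp at hP'
        · exact same v c w p q pq hN hNw pc.symm qc.symm
    intro s t hst hn
    by_cases hs : s ∈ K
    · by_cases ht : t ∈ K
      · exact hK.core_core s hs t ht hst hn
      · exact Or.inl (nc t s ht hs fun e => hn e.symm).symm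
    · by_cases ht : t ∈ K
      · exact Or.inl (nc s t hs ht hn)
      · exact Or.inl (nn s t hs ht hst)

/-- Outside the core a vertex has two core neighbours and degree 3, or 2 if it lies in `P`; so it
adds 2 + 3 to the degree sum, less 1 on `P`. -/
theorem edges [Fintype V] (h : Based G K P B) :
    2 * G.edgeSet.ncard + 5 * K.card + P.card = ∑ k ∈ K, nb G K k + 5 * Fintype.card V := by
  classical
  have hdisj : Disjoint K P := by
    rw [Finset.disjoint_right]
    exact h.disj
  have hnbK : ∀ v, v ∉ K → nb G K v = 2 := by
    intro v hv
    obtain ⟨p, q, hB, hN⟩ := h.attached hv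
    obtain ⟨hp, hq, pq⟩ := h.base p q hB
    rcases hN with ⟨hN, -⟩ | ⟨w, hw, hN, -⟩
    · exact nb_eq_two.2 ⟨p, hp, q, hq, pq.ne, (hN p).2 (by simp), (hN q).2 (by simp),
        fun u _ hu => (hN u).1 hu⟩
    · refine nb_eq_two.2 ⟨p, hp, q, hq, pq.ne, (hN p).2 (by simp), (hN q).2 (by simp),
        fun u hu' hu => ?_⟩
      rcases (hN u).1 hu with e | e | e
      · exact Or.inl e
      · exact Or.inr e
      · exact absurd (e ▸ hu') hw
  have hdP : ∀ v ∈ P, dg G v = 2 := by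
    intro v hv
    obtain ⟨p, q, hB, hN⟩ := h.pend v hv
    have pq := (h.base p q hB).2.2
    exact nb_eq_two.2 ⟨p, by simp, q, by simp, pq.ne, (hN p).2 (by simp), (hN q).2 (by simp),
      fun u _ hu => (hN u).1 hu⟩
  have hdR : ∀ v, v ∉ K → v ∉ P → dg G v = 3 := by
    intro v hv hP
    obtain ⟨p, q, w, hB, hw, -, hN, -⟩ := h.pair v hv hP
    obtain ⟨hp, hq, pq⟩ := h.base p q hB
    have : nbhd G v = {p, q, w} := by
      ext u
      simp [hN u]
    rw [← card_nbhd, this, Finset.card_eq_three]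
    exact ⟨p, q, w, pq.ne, fun e => hw (e ▸ hp), fun e => hw (e ▸ hq), rfl⟩
  have s1 : ∑ k ∈ K, dg G k = ∑ k ∈ K, nb G K k + 2 * (Kᶜ).card := by
    have e : ∀ k ∈ K, dg G k = nb G K k + nb G Kᶜ k := by
      intro k _
      rw [← nb_union disjoint_compl_right, Finset.union_compl]
      rfl
    rw [Finset.sum_congr rfl e, Finset.sum_add_distrib, sum_nb_comm K Kᶜ,
      Finset.sum_congr rfl fun v hv => hnbK v (Finset.mem_compl.1 hv)]
    simp [mul_comm]
  have s2 : ∑ k ∈ Kᶜ, dg G k + P.card = 3 * (Kᶜ).card := by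
    have hsub : P ⊆ Kᶜ := fun v hv => Finset.mem_compl.2 (h.disj v hv)
    rw [← Finset.sum_sdiff hsub, Finset.sum_congr rfl hdP,
      Finset.sum_congr rfl fun v hv => hdR v (Finset.mem_compl.1 (Finset.mem_sdiff.1 hv).1)
        (Finset.mem_sdiff.1 hv).2]
    have := Finset.card_sdiff_add_card_eq_card hsub
    simp only [Finset.sum_const, smul_eq_mul]
    omega
  have s3 := sum_dg G
  rw [← Finset.sum_add_sum_compl K] at s3
  have s4 := Finset.card_add_card_compl K
  omega

end Based

/-- The core conditions for a complete graph on four vertices. -/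
theorem satCore_of_clique {K P : Finset V} {B : V → V → Prop} (hcard : K.card = 4)
    (hK : ∀ p ∈ K, ∀ q ∈ K, p ≠ q → G.Adj p q) (hB : ∀ p q, B p q → p ∈ K ∧ q ∈ K ∧ p ≠ q)
    (hmeet : ∀ p q p' q', B p q → B p' q' → p = p' ∨ p = q' ∨ q = p' ∨ q = q') :
    SatCore G K P B := by
  classical
  have ad : ∀ p ∈ K, ∀ q ∈ K, p = q ∨ G.Adj p q := by
    intro p hp q hq
    by_cases e : p = q
    · exact Or.inl e
    · exact Or.inr (hK p hp q hq e)
  constructor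
  · intro p q p' q' h h'
    obtain ⟨hp, hq, -⟩ := hB p q h
    obtain ⟨hp', hq', -⟩ := hB p' q' h'
    rcases hmeet p q p' q' h h' with e | e | e | e
    · exact Or.inl ⟨e, ad q hq q' hq'⟩
    · exact Or.inr (Or.inl ⟨e, ad q hq p' hp'⟩)
    · exact Or.inr (Or.inr (Or.inl ⟨e, ad p hp q' hq'⟩))
    · exact Or.inr (Or.inr (Or.inr ⟨e, ad p hp p' hp'⟩))
  · intro p q c h hc hcp hcq
    obtain ⟨hp, hq, hpq⟩ := hB p q h
    left
    -- The fourth core vertex serves as `r`.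
    have h3 : ({p, q, c} : Finset V).card ≤ 3 := Finset.card_le_three
    obtain ⟨r, hr, hr'⟩ := Finset.exists_mem_notMem_of_card_lt_card (s := {p, q, c}) (t := K)
      (by omega)
    simp only [Finset.mem_insert, Finset.mem_singleton, not_or] at hr'
    exact ⟨r, hK p hp r hr (Ne.symm hr'.1), hK q hq r hr (Ne.symm hr'.2.1), hK r hr c hc hr'.2.2,
      Or.inl (hK p hp c hc hcp.symm)⟩
  · intro s hs t ht hst hn
    exact absurd (hK s hs t ht hst) hn
  · intro h hh a ha b hb c hc d hd hac hbd k1 k2 k3 k4 k5 k6 k7 k8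
    have h5 : ({h, a, b, c, d} : Finset V).card = 5 := by
      rw [Finset.card_insert_of_notMem, Finset.card_insert_of_notMem,
        Finset.card_insert_of_notMem, Finset.card_pair k7.ne]
      · simp [k6.ne, hbd]
      · simp [k5.ne, hac, k8.ne.symm]
      · simp [k1.ne, k2.ne, k3.ne, k4.ne]
    have : ({h, a, b, c, d} : Finset V) ⊆ K := by
      intro u hu
      simp only [Finset.mem_insert, Finset.mem_singleton] at hu
      rcases hu with rfl | rfl | rfl | rfl | rfl <;> assumption
    have := Finset.card_le_card this
    omega

theorem sum_nb_clique {K : Finset V} (hcard : K.card = 4)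
    (hK : ∀ p ∈ K, ∀ q ∈ K, p ≠ q → G.Adj p q) : ∑ k ∈ K, nb G K k = 12 := by
  classical
  have : ∀ k ∈ K, nb G K k = 3 := by
    intro k hk
    have : K.filter (G.Adj k) = K.erase k := by
      ext u
      simp only [Finset.mem_filter, Finset.mem_erase]
      constructor
      · rintro ⟨h1, h2⟩
        exact ⟨h2.ne.symm, h1⟩
      · rintro ⟨h1, h2⟩
        exact ⟨h2, hK k hk u h2 (Ne.symm h1)⟩
    unfold nb
    have h2 := Finset.card_erase_of_mem hk
    rw [← this, hcard] at h2
    convert h2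
  rw [Finset.sum_congr rfl this, Finset.sum_const, hcard]
  rfl

/-- A graph with a complete core on four vertices whose attachment edges pairwise intersect. -/
structure CliqueBased (G : SimpleGraph V) (K P : Finset V) (B : V → V → Prop) : Prop
    extends Based G K P B where
  card_core : K.card = 4
  adj_core : ∀ p ∈ K, ∀ q ∈ K, p ≠ q → G.Adj p q
  meet : ∀ p q p' q', B p q → B p' q' → p = p' ∨ p = q' ∨ q = p' ∨ q = q'

namespace CliqueBased

variable {K P : Finset V} {B : V → V → Prop}

theorem isSat (h : CliqueBased G K P B) : Sat G :=
  h.toBased.sat (satCore_of_clique h.card_core h.adj_core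
    (fun p q hB => ⟨(h.base p q hB).1, (h.base p q hB).2.1, (h.base p q hB).2.2.ne⟩) h.meet)

/-- 2e = 12 + 5(n - 4) - |P|; the extremal values correspond to |P| = 3 and |P| = 2. -/
theorem two_mul_edges [Fintype V] (h : CliqueBased G K P B) :
    2 * G.edgeSet.ncard + 8 + P.card = 5 * Fintype.card V := by
  have h1 := h.toBased.edges
  rw [sum_nb_clique h.card_core h.adj_core, h.card_core] at h1
  omega

/-- Deleting a vertex of degree two outside the core. -/
theorem delete [DecidableEq V] (h : CliqueBased G K P B) {z : V} (hz : z ∈ P) :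
    CliqueBased (G.induce ({z}ᶜ : Set V)) (K.subtype (· ∈ ({z}ᶜ : Set V)))
      (P.subtype (· ∈ ({z}ᶜ : Set V))) (fun p q => B p q) := by
  have hzK := h.disj z hz
  have neK : ∀ {v}, v ∈ K → v ≠ z := fun hv e => hzK (e ▸ hv)
  refine ⟨⟨?_, ?_, ?_, ?_, ?_⟩, ?_, ?_, ?_⟩
  · intro p q hB
    have := h.base p q hB
    simpa using this
  · intro v hv
    have := h.disj v (by simpa using hv)
    simpa using this
  · intro v hv
    obtain ⟨p, q, hB, hN⟩ := h.pend v (by simpa using hv)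
    obtain ⟨hp, hq, -⟩ := h.base p q hB
    refine ⟨⟨p, neK hp⟩, ⟨q, neK hq⟩, hB, fun u => ?_⟩
    simpa [Subtype.ext_iff] using hN u
  · rintro u hu v hv p q hN hN'
    -- Vertices of `P` have all their neighbours in the core, so deleting `z` does not change their
    -- neighbourhoods.
    have lift : ∀ v : ({z}ᶜ : Set V), (v : V) ∈ P → Pend (G.induce ({z}ᶜ : Set V)) p q v →
        Pend G p q v := by
      intro v hv hN
      obtain ⟨p', q', hB, hN'⟩ := h.pend v hv
      obtain ⟨hp, hq, -⟩ := h.base p' q' hB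
      intro w
      by_cases hw : w = z
      · have h1 : ¬ G.Adj v w := by
          rw [hN' w]
          rintro (e | e)
          · exact neK hp (e ▸ hw)
          · exact neK hq (e ▸ hw)
        have h2 : ¬ (w = (p : V) ∨ w = (q : V)) := by
          rintro (e | e)
          · exact p.2 (e ▸ hw)
          · exact q.2 (e ▸ hw)
        exact iff_of_false h1 h2
      · simpa [Subtype.ext_iff] using hN ⟨w, hw⟩
    have hu' : (u : V) ∈ P := by simpa using hu
    have hv' : (v : V) ∈ P := by simpa using hv
    exact Subtype.ext (h.pend_unique u hu' v hv' p q (lift u hu' hN) (lift v hv' hN'))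
  · intro v hv hv'
    obtain ⟨p, q, w, hB, hw, hw', hN, hN'⟩ := h.pair v (by simpa using hv) (by simpa using hv')
    obtain ⟨hp, hq, -⟩ := h.base p q hB
    have hwz : w ≠ z := fun e => hw' (e ▸ hz)
    refine ⟨⟨p, neK hp⟩, ⟨q, neK hq⟩, ⟨w, hwz⟩, hB, by simpa using hw, by simpa using hw',
      fun u => ?_, fun u => ?_⟩
    · simpa [Subtype.ext_iff] using hN u
    · simpa [Subtype.ext_iff] using hN' u
  · rw [Finset.card_subtype, Finset.filter_true_of_mem, h.card_core]
    exact fun v hv => neK hv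
  · intro p hp q hq hpq
    exact h.adj_core p (by simpa using hp) q (by simpa using hq) fun e => hpq (Subtype.ext e)
  · intro p q p' q' h1 h2
    simpa [Subtype.ext_iff] using h.meet p q p' q' h1 h2

/-- Both n and |P| drop by one: 8 + (|P| - 1) + 5 = 12 + |P|. -/
theorem two_mul_edges_delete [Fintype V] [DecidableEq V] (h : CliqueBased G K P B) {z : V}
    (hz : z ∈ P) : 2 * (G.induce ({z}ᶜ : Set V)).edgeSet.ncard + 12 + P.card =
      5 * Fintype.card V := by
  have h1 := (h.delete hz).two_mul_edges
  have h2 : (P.subtype (· ∈ ({z}ᶜ : Set V))).card + 1 = P.card := by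
    rw [Finset.card_subtype, ← Finset.card_erase_add_one hz]
    congr 2
    ext v
    simp [and_comm]
  have h3 : Fintype.card ({z}ᶜ : Set V) + 1 = Fintype.card V := by
    have := Fintype.card_pos_iff.2 ⟨z⟩
    rw [Fintype.card_compl_set]
    simp
    omega
  omega

end CliqueBased

end Based

/-! ### Families with a complete core. -/

section Families

variable {V : Type u} {G F : SimpleGraph V}

theorem join_adj_inl_inl {u v : V} : (join F K1).Adj (Sum.inl u) (Sum.inl v) ↔ F.Adj u v := by
  simp [join]

theorem join_adj_inl_inr {u : V} {i : Fin 1} : (join F K1).Adj (Sum.inl u) (Sum.inr i) := by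
  simp [join]

theorem join_adj_inr_inl {u : V} {i : Fin 1} : (join F K1).Adj (Sum.inr i) (Sum.inl u) := by
  simp [join]

theorem join_not_adj_inr_inr {i j : Fin 1} : ¬ (join F K1).Adj (Sum.inr i) (Sum.inr j) := by
  simp [join, K1, Subsingleton.elim i j]

/-- The neighbours in a cone of a vertex other than the apex. -/
theorem join_adj_inl {u : V} {t : V ⊕ Fin 1} : (join F K1).Adj (Sum.inl u) t ↔
    t = Sum.inr 0 ∨ ∃ v, F.Adj u v ∧ t = Sum.inl v := by
  rcases t with t | i
  · simp [join_adj_inl_inl]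
  · simp [join_adj_inl_inr, Subsingleton.elim i 0]

theorem mem_neighborSet_of_eq {v : V} {S : Set V} (h : G.neighborSet v = S) (u : V) :
    G.Adj v u ↔ u ∈ S := by
  rw [← h]
  rfl

theorem PairsJoinedTo.join {U : Set V} {p : V} (h : PairsJoinedTo F U {p}) :
    PairsJoinedTo (W4Sat.join F K1) (Sum.inl '' U) {Sum.inr 0, Sum.inl p} := by
  rintro _ ⟨v, hv, rfl⟩
  obtain ⟨v', hv', hN⟩ := h v hv
  refine ⟨Sum.inl v', ⟨v', hv', rfl⟩, ?_⟩
  ext t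
  rw [SimpleGraph.mem_neighborSet, join_adj_inl]
  simp only [mem_neighborSet_of_eq hN]
  constructor
  · rintro (rfl | ⟨v, hv | hv, rfl⟩)
    · simp
    · simp [Set.mem_singleton_iff.1 hv]
    · simp [Set.mem_singleton_iff.1 hv]
  · rintro ((rfl | rfl) | rfl)
    · simp
    · simp
    · simp

/-- The mate of the mate of `v` is `v`, because `v` is a neighbour of its mate and is not one of the
roots. -/
theorem PairsJoinedTo.pair {U : Set V} {p q : V} (h : PairsJoinedTo G U {p, q}) (hp : p ∉ U)
    (hq : q ∉ U) {v : V} (hv : v ∈ U) : ∃ v' ∈ U, Pair G p q v v' ∧ Pair G p q v' v := by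
  obtain ⟨v', hv', hN⟩ := h v hv
  obtain ⟨v'', hv'', hN'⟩ := h v' hv'
  have e : v ∈ ({p, q} ∪ {v''} : Set V) := by
    rw [← mem_neighborSet_of_eq hN']
    refine ((mem_neighborSet_of_eq hN v').2 ?_).symm
    simp
  have e' : v = v'' := by
    rcases e with (rfl | rfl) | e
    · exact absurd hv hp
    · exact absurd hv hq
    · exact e
  subst e'
  refine ⟨v', hv', fun u => ?_, fun u => ?_⟩
  · rw [mem_neighborSet_of_eq hN]
    simp [or_left_comm, or_comm]
  · rw [mem_neighborSet_of_eq hN']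
    simp [or_left_comm, or_comm]

theorem based_of_family {ι : Type*} {p q : ι → V} {U : ι → Set V} {K P : Finset V}
    (hbase : ∀ i, p i ∈ K ∧ q i ∈ K ∧ G.Adj (p i) (q i))
    (hP : ∀ v ∈ P, v ∉ K ∧ ∃ i, G.neighborSet v = {p i, q i})
    (hunique : ∀ u ∈ P, ∀ v ∈ P, (∀ t, G.Adj u t ↔ G.Adj v t) → u = v)
    (hU : ∀ i, ∀ v ∈ U i, v ∉ K ∧ v ∉ P) (hpair : ∀ i, PairsJoinedTo G (U i) {p i, q i})
    (hcover : ∀ v, v ∉ K → v ∉ P → ∃ i, v ∈ U i) :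
    Based G K P (fun a b => ∃ i, a = p i ∧ b = q i) := by
  constructor
  · rintro _ _ ⟨i, rfl, rfl⟩
    exact hbase i
  · exact fun v hv => (hP v hv).1
  · intro v hv
    obtain ⟨-, i, hi⟩ := hP v hv
    exact ⟨p i, q i, ⟨i, rfl, rfl⟩, fun u => mem_neighborSet_of_eq hi u⟩
  · intro u hu v hv a b h1 h2
    exact hunique u hu v hv fun t => (h1 t).trans (h2 t).symm
  · intro v hv hv'
    obtain ⟨i, hi⟩ := hcover v hv hv'
    obtain ⟨v', hv'U, h1, h2⟩ := (hpair i).pair (fun h => (hU i _ h).1 (hbase i).1)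
      (fun h => (hU i _ h).1 (hbase i).2.1) hi
    exact ⟨p i, q i, v', ⟨i, rfl, rfl⟩, (hU i _ hv'U).1, (hU i _ hv'U).2, h1, h2⟩

/-- The neighbourhood in a cone of a vertex of degree one in the base. -/
theorem neighborSet_join_of_singleton {v p : V} (h : F.neighborSet v = {p}) :
    (join F K1).neighborSet (Sum.inl v) = {Sum.inr 0, Sum.inl p} := by
  ext t
  rw [SimpleGraph.mem_neighborSet, join_adj_inl]
  simp [mem_neighborSet_of_eq h]

/-- The attachment edges are the sides of the triangle x₁ x₂ u₁, any two of which meet. -/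
theorem B1Labelled.cliqueBased [DecidableEq V] {x y z x₁ x₂ u₁ u₂ : V} {U11 U12 U2 : Set V}
    (h : B1Labelled G x y z x₁ x₂ u₁ u₂ U11 U12 U2) :
    ∃ B, CliqueBased G {x₁, x₂, u₁, u₂} {x, y, z} B := by
  have hnd := h.nodup
  simp only [List.nodup_cons, List.mem_cons, List.not_mem_nil, or_false, not_or, not_false_eq_true,
    List.nodup_nil, and_true] at hnd
  obtain ⟨⟨n1, n2, n3, n4, n5, n6⟩, ⟨n7, n8, n9, n10, n11⟩, ⟨n12, n13, n14, n15⟩,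
    ⟨n16, n17, n18⟩, ⟨n19, n20⟩, n21⟩ := hnd
  have hd := h.disjoint
  simp only [List.pairwise_cons, List.mem_cons, List.not_mem_nil, or_false, forall_eq_or_imp,
    forall_eq] at hd
  have hc : ∀ p ∈ ({x₁, x₂, u₁, u₂} : Finset V), ∀ q ∈ ({x₁, x₂, u₁, u₂} : Finset V), p ≠ q →
      G.Adj p q := fun p hp q hq hpq => h.clique (by simpa using hp) (by simpa using hq) hpq
  have hout : ∀ S : Set V, Disjoint ({x, y, z, x₁, x₂, u₁, u₂} : Set V) S → ∀ v ∈ S,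
      v ∉ ({x₁, x₂, u₁, u₂} : Finset V) ∧ v ∉ ({x, y, z} : Finset V) := by
    intro S hS v hv
    have := Set.disjoint_right.1 hS hv
    simp only [Set.mem_insert_iff, Set.mem_singleton_iff, not_or] at this
    simp [this]
  have hb := based_of_family (G := G) (p := ![x₁, x₁, x₂]) (q := ![x₂, u₁, u₁])
    (U := ![U2, U11, U12]) (K := {x₁, x₂, u₁, u₂}) (P := {x, y, z}) ?_ ?_ ?_ ?_ ?_ ?_
  · refine ⟨_, hb, ?_, hc, ?_⟩
    · rw [Finset.card_insert_of_notMem, Finset.card_insert_of_notMem, Finset.card_pair n21] <;>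
        simp [*]
    · rintro _ _ _ _ ⟨i, rfl, rfl⟩ ⟨j, rfl, rfl⟩
      fin_cases i <;> fin_cases j <;> simp
  · intro i
    fin_cases i
    · exact ⟨by simp, by simp, hc _ (by simp) _ (by simp) n16⟩
    · exact ⟨by simp, by simp, hc _ (by simp) _ (by simp) n17⟩
    · exact ⟨by simp, by simp, hc _ (by simp) _ (by simp) n19⟩
  · intro v hv
    simp only [Finset.mem_insert, Finset.mem_singleton] at hv
    rcases hv with rfl | rfl | rfl
    · exact ⟨by simp [*], 0, h.nbr_x⟩
    · exact ⟨by simp [*], 1, h.nbr_y⟩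
    · exact ⟨by simp [*], 2, h.nbr_z⟩
  · intro u hu v hv huv
    simp only [Finset.mem_insert, Finset.mem_singleton] at hu hv
    have hx := mem_neighborSet_of_eq h.nbr_x
    have hy := mem_neighborSet_of_eq h.nbr_y
    have hz := mem_neighborSet_of_eq h.nbr_z
    have h1 := huv x₁
    have h2 := huv x₂
    have h3 := huv u₁
    rcases hu with rfl | rfl | rfl <;> rcases hv with rfl | rfl | rfl <;> first
      | rfl
      | (exfalso; simp [hx, hy, hz, n16, n17, n19, Ne.symm n16]
          at h1 h2 h3)
  · intro i
    fin_cases i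
    · exact hout U2 hd.1.2.2
    · exact hout U11 hd.1.1
    · exact hout U12 hd.1.2.1
  · intro i
    fin_cases i
    · exact h.pairs_U2
    · exact h.pairs_U11
    · exact h.pairs_U12
  · intro v hv hv'
    have := Set.eq_univ_iff_forall.1 h.cover v
    simp only [Finset.mem_insert, Finset.mem_singleton, not_or] at hv hv'
    rcases this with ((this | this) | this) | this
    · simp [hv, hv'] at this
    · exact ⟨1, this⟩
    · exact ⟨2, this⟩
    · exact ⟨0, this⟩

theorem B1Labelled.card_pendant [DecidableEq V] {x y z x₁ x₂ u₁ u₂ : V} {U11 U12 U2 : Set V}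
    (h : B1Labelled G x y z x₁ x₂ u₁ u₂ U11 U12 U2) : ({x, y, z} : Finset V).card = 3 := by
  have hnd := h.nodup
  simp only [List.nodup_cons, List.mem_cons, not_or] at hnd
  exact Finset.card_eq_three.2 ⟨x, y, z, hnd.1.1, hnd.1.2.1, hnd.2.1.1, rfl⟩

/-- The core is the apex with the triangle, and the attachment edges all contain the apex. Vertices
of degree one in `F` have degree two in the cone; that they all lie in `P` is what allows deleting
any of them. -/
theorem IsF1.cliqueBased [DecidableEq V] (h : IsF1 F) :
    ∃ K P B, CliqueBased (join F K1) K P B ∧ P.card = 3 ∧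
      ∀ w, (F.neighborSet w).ncard = 1 → Sum.inl w ∈ P := by
  obtain ⟨a, b, c, a', b', c', A, B, C, hnd, hd, hcov, hcl, ha, hb, hc, hA, hB, hC⟩ := h
  simp only [List.nodup_cons, List.mem_cons, List.not_mem_nil, or_false, not_or, not_false_eq_true,
    List.nodup_nil, and_true] at hnd
  obtain ⟨⟨n1, n2, n3, n4, n5⟩, ⟨n7, n8, n9, n10⟩, ⟨n12, n13, n14⟩, ⟨n16, n17⟩, n19⟩ := hnd
  simp only [List.pairwise_cons, List.mem_cons, List.not_mem_nil, or_false, forall_eq_or_imp,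
    forall_eq] at hd
  have ab : F.Adj a b := hcl (by simp) (by simp) n1
  have ac : F.Adj a c := hcl (by simp) (by simp) n2
  have bc : F.Adj b c := hcl (by simp) (by simp) n7
  have hcl' : ∀ p ∈ ({Sum.inr 0, Sum.inl a, Sum.inl b, Sum.inl c} : Finset (V ⊕ Fin 1)),
      ∀ q ∈ ({Sum.inr 0, Sum.inl a, Sum.inl b, Sum.inl c} : Finset (V ⊕ Fin 1)), p ≠ q →
      (join F K1).Adj p q := by
    intro p hp q hq hpq
    simp only [Finset.mem_insert, Finset.mem_singleton] at hp hq
    rcases hp with rfl | rfl | rfl | rfl <;> rcases hq with rfl | rfl | rfl | rfl <;>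
      simp_all [join_adj_inl_inl, join_adj_inl_inr, join_adj_inr_inl, ab.symm, ac.symm, bc.symm]
  have hout : ∀ S : Set V, Disjoint ({a, b, c, a', b', c'} : Set V) S →
      ∀ v ∈ Sum.inl '' S,
      v ∉ ({Sum.inr 0, Sum.inl a, Sum.inl b, Sum.inl c} : Finset (V ⊕ Fin 1)) ∧
      v ∉ ({Sum.inl a', Sum.inl b', Sum.inl c'} : Finset (V ⊕ Fin 1)) := by
    rintro S hS _ ⟨v, hv, rfl⟩
    have := Set.disjoint_right.1 hS hv
    simp only [Set.mem_insert_iff, Set.mem_singleton_iff, not_or] at this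
    simp [this]
  have hcov' := Set.eq_univ_iff_forall.1 hcov
  have hbd := based_of_family (G := join F K1) (p := ![Sum.inr 0, Sum.inr 0, Sum.inr 0])
    (q := ![Sum.inl a, Sum.inl b, Sum.inl c])
    (U := ![Sum.inl '' A, Sum.inl '' B, Sum.inl '' C])
    (K := {Sum.inr 0, Sum.inl a, Sum.inl b, Sum.inl c})
    (P := {Sum.inl a', Sum.inl b', Sum.inl c'}) ?_ ?_ ?_ ?_ ?_ ?_
  · refine ⟨_, _, _, ⟨hbd, ?_, hcl', ?_⟩, ?_, ?_⟩
    · rw [Finset.card_insert_of_notMem, Finset.card_insert_of_notMem, Finset.card_pair] <;>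
        simp [*]
    · rintro _ _ _ _ ⟨i, rfl, rfl⟩ ⟨j, rfl, rfl⟩
      left
      fin_cases i <;> fin_cases j <;> rfl
    · rw [Finset.card_insert_of_notMem, Finset.card_pair] <;> simp [*]
    · intro w hw
      obtain ⟨s, hs⟩ := Set.ncard_eq_one.1 hw
      have uniq : ∀ p q, F.Adj w p → F.Adj w q → p = q := by
        intro p q hp hq
        rw [mem_neighborSet_of_eq hs] at hp hq
        exact hp.trans hq.symm
      have hpair : ∀ U p, PairsJoinedTo F U {p} → p ∉ U → w ∉ U := by
        intro U p hU hp hwU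
        obtain ⟨w', hw', hN⟩ := hU w hwU
        have := uniq p w' ((mem_neighborSet_of_eq hN p).2 (by simp))
          ((mem_neighborSet_of_eq hN w').2 (by simp))
        exact hp (this ▸ hw')
      rcases hcov' w with ((hw' | hw') | hw') | hw'
      · simp only [Set.mem_insert_iff, Set.mem_singleton_iff] at hw'
        rcases hw' with rfl | rfl | rfl | rfl | rfl | rfl
        · exact absurd (uniq _ _ ab ac) n7
        · exact absurd (uniq _ _ ab.symm bc) n2
        · exact absurd (uniq _ _ ac.symm bc.symm) n1
        · simp
        · simp
        · simp
      · exact absurd hw' (hpair A a hA (Set.disjoint_left.1 hd.1.1 (by simp)))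
      · exact absurd hw' (hpair B b hB (Set.disjoint_left.1 hd.1.2.1 (by simp)))
      · exact absurd hw' (hpair C c hC (Set.disjoint_left.1 hd.1.2.2 (by simp)))
  · intro i
    fin_cases i <;> exact ⟨by simp, by simp, join_adj_inr_inl⟩
  · intro v hv
    simp only [Finset.mem_insert, Finset.mem_singleton] at hv
    rcases hv with rfl | rfl | rfl
    · exact ⟨by simp [*, Ne.symm], 0, neighborSet_join_of_singleton ha⟩
    · exact ⟨by simp [*, Ne.symm], 1, neighborSet_join_of_singleton hb⟩
    · exact ⟨by simp [*, Ne.symm], 2, neighborSet_join_of_singleton hc⟩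
  · intro u hu v hv huv
    simp only [Finset.mem_insert, Finset.mem_singleton] at hu hv
    have hx := mem_neighborSet_of_eq ha
    have hy := mem_neighborSet_of_eq hb
    have hz := mem_neighborSet_of_eq hc
    have h1 := huv (Sum.inl a)
    have h2 := huv (Sum.inl b)
    have h3 := huv (Sum.inl c)
    rcases hu with rfl | rfl | rfl <;> rcases hv with rfl | rfl | rfl <;> first
      | rfl
      | (exfalso; simp [join_adj_inl_inl, hx, hy, hz, n1, n2, n7]
          at h1 h2 h3)
  · intro i
    fin_cases i
    · exact hout A hd.1.1
    · exact hout B hd.1.2.1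
    · exact hout C hd.1.2.2
  · intro i
    fin_cases i
    · exact hA.join
    · exact hB.join
    · exact hC.join
  · rintro (v | i) hv hv'
    · simp only [Finset.mem_insert, Finset.mem_singleton, not_or, Sum.inl.injEq] at hv hv'
      rcases hcov' v with ((this | this) | this) | this
      · simp [hv, hv'] at this
      · exact ⟨0, v, this, rfl⟩
      · exact ⟨1, v, this, rfl⟩
      · exact ⟨2, v, this, rfl⟩
    · simp [Subsingleton.elim i 0] at hv

end Families

/-! ### The two cores on six vertices. -/

section Table

variable {V : Type u} {G F : SimpleGraph V}

/-- Adjacency in the cone over a 5-cycle, with apex `0`. -/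
def wheelTable (i j : Fin 6) : Bool :=
  i ≠ j ∧ (i = 0 ∨ j = 0 ∨ i.val + 1 = j.val ∨ j.val + 1 = i.val ∨ (i = 1 ∧ j = 5) ∨
    (i = 5 ∧ j = 1))

/-- Adjacency in the graph on `x₁, x₂, u₁, u₂, v₁, v₂` in which the non-adjacent pairs are `v₁ x₂`,
`v₁ u₁`, `v₂ x₁` and `v₂ u₂`. -/
def crossedTable (i j : Fin 6) : Bool :=
  i ≠ j ∧ ¬ ((i = 4 ∧ (j = 1 ∨ j = 2)) ∨ (j = 4 ∧ (i = 1 ∨ i = 2)) ∨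
    (i = 5 ∧ (j = 0 ∨ j = 3)) ∨ (j = 5 ∧ (i = 0 ∨ i = 3)))

/-- The core conditions, checked on a table of adjacencies. -/
theorem satCore_of_table {k : Fin 6 → V} {T : Fin 6 → Fin 6 → Bool} {β γ : Fin 2 → Fin 6}
    {K P : Finset V} {e : Bool} (hK : ∀ v, v ∈ K ↔ ∃ i, v = k i)
    (hT : ∀ i j, G.Adj (k i) (k j) ↔ T i j = true) (he : e = true → P = ∅)
    (hmeet : ∀ i j, β i = β j ∧ (γ i = γ j ∨ T (γ i) (γ j) = true))
    (hlink : ∀ i c, c ≠ β i → c ≠ γ i →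
      (∃ r, T (β i) r = true ∧ T (γ i) r = true ∧ T r c = true ∧
        (T (β i) c = true ∨ T (γ i) c = true)) ∨
      (T (β i) c = true ∧ T (γ i) c = true ∧ e = true))
    (hrim : ∀ s t, s ≠ t → T s t = false → ∃ h, T h s = true ∧ T h t = true ∧
      ∃ p, T h p = true ∧ T s p = true ∧ ∃ r, T h r = true ∧ T p r = true ∧ T r t = true)
    (hfree : ∀ h a, T h a = true → ∀ b, T h b = true → T a b = true → ∀ c, T h c = true →
      T b c = true → a ≠ c → ∀ d, T h d = true → T c d = true → T d a = true → b = d) :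
    SatCore G K P (fun p q => ∃ i, p = k (β i) ∧ q = k (γ i)) := by
  constructor
  · rintro _ _ _ _ ⟨i, rfl, rfl⟩ ⟨j, rfl, rfl⟩
    obtain ⟨h1, h2⟩ := hmeet i j
    refine Or.inl ⟨congrArg k h1, ?_⟩
    rcases h2 with h2 | h2
    · exact Or.inl (congrArg k h2)
    · exact Or.inr ((hT _ _).2 h2)
  · rintro _ _ c ⟨i, rfl, rfl⟩ hc h1 h2
    obtain ⟨c, rfl⟩ := (hK c).1 hc
    rcases hlink i c (fun h => h1 (congrArg k h)) (fun h => h2 (congrArg k h)) with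
      ⟨r, r1, r2, r3, r4⟩ | ⟨r1, r2, r3⟩
    · refine Or.inl ⟨k r, (hT _ _).2 r1, (hT _ _).2 r2, (hT _ _).2 r3, ?_⟩
      rw [hT, hT]
      exact r4
    · exact Or.inr ⟨(hT _ _).2 r1, (hT _ _).2 r2, he r3⟩
  · intro s hs t ht hst hn
    obtain ⟨s, rfl⟩ := (hK s).1 hs
    obtain ⟨t, rfl⟩ := (hK t).1 ht
    rw [hT, Bool.not_eq_true] at hn
    obtain ⟨h, h1, h2, p, h3, h4, r, h5, h6, h7⟩ := hrim s t (fun h => hst (congrArg k h)) hn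
    exact Or.inl ⟨k h, k p, k r, (hT _ _).2 h1, (hT _ _).2 h3, (hT _ _).2 h5, (hT _ _).2 h2,
      (hT _ _).2 h4, (hT _ _).2 h6, (hT _ _).2 h7⟩
  · intro h hh a ha b hb c hc d hd hac hbd k1 k2 k3 k4 k5 k6 k7 k8
    obtain ⟨h, rfl⟩ := (hK h).1 hh
    obtain ⟨a, rfl⟩ := (hK a).1 ha
    obtain ⟨b, rfl⟩ := (hK b).1 hb
    obtain ⟨c, rfl⟩ := (hK c).1 hc
    obtain ⟨d, rfl⟩ := (hK d).1 hd
    rw [hT] at k1 k2 k3 k4 k5 k6 k7 k8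
    exact hbd (congrArg k (hfree h a k1 b k2 k5 c k3 k6 (fun h => hac (congrArg k h)) d k4 k7 k8))

theorem sum_nb_of_table {k : Fin 6 → V} {T : Fin 6 → Fin 6 → Bool} {K : Finset V}
    (hK : ∀ v, v ∈ K ↔ ∃ i, v = k i) (hk : Function.Injective k)
    (hT : ∀ i j, G.Adj (k i) (k j) ↔ T i j = true) :
    ∑ v ∈ K, nb G K v = ∑ i, (Finset.univ.filter fun j => T i j = true).card := by
  classical
  have hKm : K = Finset.univ.map ⟨k, hk⟩ := by
    ext v
    simp [hK, eq_comm]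
  rw [hKm, Finset.sum_map]
  refine Finset.sum_congr rfl fun i _ => ?_
  rw [← Finset.card_map ⟨k, hk⟩]
  unfold nb
  congr 1
  ext v
  simp only [Finset.mem_filter, Finset.mem_map, Finset.mem_univ, true_and,
    Function.Embedding.coeFn_mk]
  constructor
  · rintro ⟨⟨j, rfl⟩, h⟩
    exact ⟨j, (hT _ _).1 h, rfl⟩
  · rintro ⟨j, h, rfl⟩
    exact ⟨⟨j, rfl⟩, (hT _ _).2 h⟩

theorem card_of_table {k : Fin 6 → V} {K : Finset V} (hK : ∀ v, v ∈ K ↔ ∃ i, v = k i)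
    (hk : Function.Injective k) : K.card = 6 := by
  classical
  have hKm : K = Finset.univ.map ⟨k, hk⟩ := by
    ext v
    simp [hK, eq_comm]
  rw [hKm, Finset.card_map]
  rfl

-- The second alternative of `core_link` is needed: no common neighbour of vertices 0 and 1 is
-- adjacent to 5. It is available because no vertex of degree two is attached.
set_option synthInstance.maxHeartbeats 200000 in
set_option synthInstance.maxSize 1024 in
theorem satCore_wheelTable {k : Fin 6 → V} {K : Finset V} (hK : ∀ v, v ∈ K ↔ ∃ i, v = k i)
    (hT : ∀ i j, G.Adj (k i) (k j) ↔ wheelTable i j = true) :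
    SatCore G K ∅ (fun p q => ∃ i, p = k (![0, 0] i) ∧ q = k (![1, 2] i)) :=
  satCore_of_table (e := true) hK hT (fun _ => rfl) (by decide) (by decide) (by decide)
    (by decide)

-- Vertices of degree two are attached here, so only the first alternative of `core_link` may be
-- used.
set_option synthInstance.maxHeartbeats 200000 in
set_option synthInstance.maxSize 1024 in
theorem satCore_crossedTable {k : Fin 6 → V} {K P : Finset V} (hK : ∀ v, v ∈ K ↔ ∃ i, v = k i)
    (hT : ∀ i j, G.Adj (k i) (k j) ↔ crossedTable i j = true) :
    SatCore G K P (fun p q => ∃ i, p = k (![0, 0] i) ∧ q = k (![1, 2] i)) :=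
  satCore_of_table (e := false) hK hT (fun h => by simp at h) (by decide) (by decide)
    (by decide) (by decide)

theorem sum_wheelTable :
    ∑ i, (Finset.univ.filter fun j => wheelTable i j = true).card = 20 := by decide

theorem sum_crossedTable :
    ∑ i, (Finset.univ.filter fun j => crossedTable i j = true).card = 22 := by decide

/-- 2e = 20 + 5(n - 6) = 5n - 10. -/
theorem IsF3.sat_join [Fintype V] (h : IsF3 F) : Sat (join F K1) ∧
    2 * (join F K1).edgeSet.ncard + 10 = 5 * Fintype.card (V ⊕ Fin 1) := by
  classical
  obtain ⟨a, b, c, d, e, P, Q, hnd, hd, hcov, ab, hc, hd', he, hP, hQ⟩ := h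
  simp only [List.nodup_cons, List.mem_cons, List.not_mem_nil, or_false, not_or, not_false_eq_true,
    List.nodup_nil, and_true] at hnd
  obtain ⟨⟨n1, n2, n3, n4⟩, ⟨n5, n6, n7⟩, ⟨n8, n9⟩, n10⟩ := hnd
  simp only [List.pairwise_cons, List.mem_cons, List.not_mem_nil, or_false, forall_eq_or_imp,
    forall_eq] at hd
  have hcov' := Set.eq_univ_iff_forall.1 hcov
  have hc1 := mem_neighborSet_of_eq hc
  have hd1 := mem_neighborSet_of_eq hd'
  have he1 := mem_neighborSet_of_eq he
  simp only [Set.mem_insert_iff, Set.mem_singleton_iff] at hc1 hd1 he1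
  have hc2 : ∀ u, F.Adj u c ↔ u = b ∨ u = d := fun u => (F.adj_comm u c).trans (hc1 u)
  have hd2 : ∀ u, F.Adj u d ↔ u = c ∨ u = e := fun u => (F.adj_comm u d).trans (hd1 u)
  have he2 : ∀ u, F.Adj u e ↔ u = d ∨ u = a := fun u => (F.adj_comm u e).trans (he1 u)
  let k : Fin 6 → V ⊕ Fin 1 := ![Sum.inr 0, Sum.inl a, Sum.inl b, Sum.inl c, Sum.inl d, Sum.inl e]
  have hk : Function.Injective k := by
    rw [← List.nodup_ofFn]
    simp [k, *]
  have hT : ∀ i j, (join F K1).Adj (k i) (k j) ↔ wheelTable i j = true := by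
    have h1 := ab.symm
    intro i j
    fin_cases i <;> fin_cases j <;>
      simp [k, wheelTable, join_adj_inl_inl, join_adj_inl_inr, join_adj_inr_inl, *] <;> grind
  have hK : ∀ v, v ∈ Finset.univ.image k ↔ ∃ i, v = k i := by simp [eq_comm]
  have hout : ∀ S : Set V, Disjoint ({a, b, c, d, e} : Set V) S → ∀ v ∈ Sum.inl '' S,
      v ∉ Finset.univ.image k ∧ v ∉ (∅ : Finset (V ⊕ Fin 1)) := by
    rintro S hS _ ⟨v, hv, rfl⟩
    refine ⟨fun hv' => ?_, by simp⟩
    have := Set.disjoint_right.1 hS hv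
    simp only [Set.mem_insert_iff, Set.mem_singleton_iff, not_or] at this
    obtain ⟨i, hi⟩ := (hK _).1 hv'
    fin_cases i <;> simp [k, this] at hi
  have hb := based_of_family (G := join F K1) (p := fun i => k (![0, 0] i))
    (q := fun i => k (![1, 2] i)) (U := ![Sum.inl '' P, Sum.inl '' Q])
    (K := Finset.univ.image k) (P := ∅) ?_ ?_ ?_ ?_ ?_ ?_
  · refine ⟨hb.sat (satCore_wheelTable hK hT), ?_⟩
    have := hb.edges
    rw [sum_nb_of_table hK hk hT, card_of_table hK hk, sum_wheelTable] at this
    simp only [Finset.card_empty] at this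
    omega
  · intro i
    exact ⟨(hK _).2 ⟨_, rfl⟩, (hK _).2 ⟨_, rfl⟩, (hT _ _).2 (by fin_cases i <;> rfl)⟩
  · simp
  · simp
  · intro i
    fin_cases i
    · exact hout P hd.1.1
    · exact hout Q hd.1.2
  · intro i
    fin_cases i
    · exact hP.join
    · exact hQ.join
  · rintro (v | i) hv -
    · rcases hcov' v with (h | h) | h
      · simp only [Set.mem_insert_iff, Set.mem_singleton_iff] at h
        exfalso
        rw [hK] at hv
        rcases h with rfl | rfl | rfl | rfl | rfl
        · exact hv ⟨1, rfl⟩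
        · exact hv ⟨2, rfl⟩
        · exact hv ⟨3, rfl⟩
        · exact hv ⟨4, rfl⟩
        · exact hv ⟨5, rfl⟩
      · exact ⟨0, v, h, rfl⟩
      · exact ⟨1, v, h, rfl⟩
    · exact absurd ((hK _).2 ⟨0, by simp [k, Subsingleton.elim i 0]⟩) hv

/-- 2e = 22 + 5(n - 6) - 2 = 5n - 10. -/
theorem B3Labelled.sat [Fintype V] {x y x₁ x₂ v₁ v₂ u₁ u₂ : V} {U1 U2 : Set V}
    (h : B3Labelled G x y x₁ x₂ v₁ v₂ u₁ u₂ U1 U2) : Sat G ∧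
    2 * G.edgeSet.ncard + 10 = 5 * Fintype.card V := by
  classical
  have hnd := h.nodup
  simp only [List.nodup_cons, List.mem_cons, List.not_mem_nil, or_false, not_or, not_false_eq_true,
    List.nodup_nil, and_true] at hnd
  obtain ⟨⟨n1, n2, n3, n4, n5, n6, n7⟩, ⟨m2, m3, m4, m5, m6, m7⟩, ⟨p1, p2, p3, p4, p5⟩,
    ⟨q1, q2, q3, q4⟩, ⟨r1, r2, r3⟩, ⟨s1, s2⟩, t1⟩ := hnd
  have hd := h.disjoint
  simp only [List.pairwise_cons, List.mem_cons, List.not_mem_nil, or_false, forall_eq_or_imp,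
    forall_eq] at hd
  have hcov' := Set.eq_univ_iff_forall.1 h.cover
  have h1 : G.Adj x₁ x₂ := h.clique (by simp) (by simp) p1
  have h2 : G.Adj x₁ u₁ := h.clique (by simp) (by simp) p4
  have h3 : G.Adj x₂ u₁ := h.clique (by simp) (by simp) q3
  have hu := mem_neighborSet_of_eq h.nbr_u₂
  have hv₁ := mem_neighborSet_of_eq h.nbr_v₁
  have hv₂ := mem_neighborSet_of_eq h.nbr_v₂
  simp only [Set.mem_insert_iff, Set.mem_singleton_iff] at hu hv₁ hv₂
  have hu' := fun u => (G.adj_comm u u₂).trans (hu u)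
  have hv₁' := fun u => (G.adj_comm u v₁).trans (hv₁ u)
  have hv₂' := fun u => (G.adj_comm u v₂).trans (hv₂ u)
  let k : Fin 6 → V := ![x₁, x₂, u₁, u₂, v₁, v₂]
  have hk : Function.Injective k := by
    rw [← List.nodup_ofFn]
    simp [k, *, Ne.symm]
  have hT : ∀ i j, G.Adj (k i) (k j) ↔ crossedTable i j = true := by
    have h1' := h1.symm
    have h2' := h2.symm
    have h3' := h3.symm
    intro i j
    fin_cases i <;> fin_cases j <;>
      simp [k, crossedTable, *] <;> grind
  have hK : ∀ v, v ∈ Finset.univ.image k ↔ ∃ i, v = k i := by simp [eq_comm]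
  have hKP : ∀ v, v ≠ x₁ → v ≠ x₂ → v ≠ u₁ → v ≠ u₂ → v ≠ v₁ → v ≠ v₂ →
      v ∉ Finset.univ.image k := by
    intro v _ _ _ _ _ _ hv
    obtain ⟨i, hi⟩ := (hK v).1 hv
    fin_cases i <;> simp [k] at hi <;> contradiction
  have hout : ∀ S : Set V, Disjoint ({x, y, x₁, x₂, v₁, v₂, u₁, u₂} : Set V) S → ∀ v ∈ S,
      v ∉ Finset.univ.image k ∧ v ∉ ({x, y} : Finset V) := by
    intro S hS v hv
    have := Set.disjoint_right.1 hS hv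
    simp only [Set.mem_insert_iff, Set.mem_singleton_iff, not_or] at this
    obtain ⟨t1, t2, t3, t4, t5, t6, t7, t8⟩ := this
    exact ⟨hKP v t3 t4 t7 t8 t5 t6, by simp [t1, t2]⟩
  have hb := based_of_family (G := G) (p := fun i => k (![0, 0] i))
    (q := fun i => k (![1, 2] i)) (U := ![U2, U1])
    (K := Finset.univ.image k) (P := {x, y}) ?_ ?_ ?_ ?_ ?_ ?_
  · refine ⟨hb.sat (satCore_crossedTable hK hT), ?_⟩
    have := hb.edges
    rw [sum_nb_of_table hK hk hT, card_of_table hK hk, sum_crossedTable,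
      Finset.card_pair n1] at this
    omega
  · intro i
    exact ⟨(hK _).2 ⟨_, rfl⟩, (hK _).2 ⟨_, rfl⟩, (hT _ _).2 (by fin_cases i <;> rfl)⟩
  · intro v hv
    simp only [Finset.mem_insert, Finset.mem_singleton] at hv
    rcases hv with rfl | rfl
    · exact ⟨hKP v n2 n3 n6 n7 n4 n5, 0, h.nbr_x⟩
    · exact ⟨hKP v m2 m3 m6 m7 m4 m5, 1, h.nbr_y⟩
  · intro u hu v hv huv
    simp only [Finset.mem_insert, Finset.mem_singleton] at hu hv
    have hx := mem_neighborSet_of_eq h.nbr_x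
    have hy := mem_neighborSet_of_eq h.nbr_y
    have e := huv x₂
    rcases hu with rfl | rfl <;> rcases hv with rfl | rfl <;> first
      | rfl
      | (exfalso; simp [hx, hy, Ne.symm p1, q3] at e)
  · intro i
    fin_cases i
    · exact hout U2 hd.1.2
    · exact hout U1 hd.1.1
  · intro i
    fin_cases i
    · exact h.pairs_U2
    · exact h.pairs_U1
  · intro v hv hv'
    rcases hcov' v with (h | h) | h
    · simp only [Set.mem_insert_iff, Set.mem_singleton_iff] at h
      simp only [Finset.mem_insert, Finset.mem_singleton, not_or] at hv'
      exfalso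
      rw [hK] at hv
      rcases h with e | e | e | e | e | e | e | e
      · exact hv'.1 e
      · exact hv'.2 e
      · exact hv ⟨0, e⟩
      · exact hv ⟨1, e⟩
      · exact hv ⟨4, e⟩
      · exact hv ⟨5, e⟩
      · exact hv ⟨2, e⟩
      · exact hv ⟨3, e⟩
    · exact ⟨1, h⟩
    · exact ⟨0, h⟩

end Table

/-! ### Isomorphisms, reinsertion of deleted vertices, and examples of every order. -/

section Transport

variable {V : Type u} {W : Type v} {G : SimpleGraph V} {H : SimpleGraph W}

theorem neighborSet_iso (e : G ≃g H) (v : V) : H.neighborSet (e v) = e '' G.neighborSet v := by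
  ext u
  obtain ⟨u, rfl⟩ := e.surjective u
  simp [e.map_adj_iff]

theorem PairsJoinedTo.iso (e : G ≃g H) {U S : Set V} (h : PairsJoinedTo G U S) :
    PairsJoinedTo H (e '' U) (e '' S) := by
  rintro _ ⟨v, hv, rfl⟩
  obtain ⟨v', hv', hN⟩ := h v hv
  refine ⟨e v', ⟨v', hv', rfl⟩, ?_⟩
  rw [neighborSet_iso, hN, Set.image_union, Set.image_singleton]

theorem isClique_iso (e : G ≃g H) {S : Set V} (h : G.IsClique S) : H.IsClique (e '' S) := by
  rintro _ ⟨u, hu, rfl⟩ _ ⟨v, hv, rfl⟩ huv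
  exact e.map_adj_iff.2 (h hu hv fun h => huv (congrArg e h))

theorem pairwise_disjoint_image {f : V → W} (hf : Function.Injective f) {l : List (Set V)}
    (h : l.Pairwise Disjoint) : (l.map (f '' ·)).Pairwise Disjoint :=
  h.map _ fun _ _ hs => Set.disjoint_image_of_injective hf hs

theorem image_eq_univ (e : G ≃g H) {S : Set V} (h : S = Set.univ) : e '' S = Set.univ := by
  rw [h, Set.image_univ, Set.range_eq_univ]
  exact e.surjective

theorem IsF1.iso (e : G ≃g H) (h : IsF1 G) : IsF1 H := by
  obtain ⟨a, b, c, a', b', c', A, B, C, hnd, hd, hcov, hcl, ha, hb, hc, hA, hB, hC⟩ := h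
  refine ⟨e a, e b, e c, e a', e b', e c', e '' A, e '' B, e '' C, hnd.map e.injective, ?_, ?_,
    ?_, ?_, ?_, ?_, ?_, ?_, ?_⟩
  · simpa [Set.image_insert_eq] using pairwise_disjoint_image e.injective hd
  · simpa [Set.image_insert_eq, Set.image_union] using image_eq_univ e hcov
  · simpa [Set.image_insert_eq] using isClique_iso e hcl
  · rw [neighborSet_iso, ha, Set.image_singleton]
  · rw [neighborSet_iso, hb, Set.image_singleton]
  · rw [neighborSet_iso, hc, Set.image_singleton]
  · simpa using hA.iso e
  · simpa using hB.iso e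
  · simpa using hC.iso e

theorem IsF3.iso (e : G ≃g H) (h : IsF3 G) : IsF3 H := by
  obtain ⟨c₁, c₂, c₃, c₄, c₅, P, Q, hnd, hd, hcov, had, h3, h4, h5, hP, hQ⟩ := h
  refine ⟨e c₁, e c₂, e c₃, e c₄, e c₅, e '' P, e '' Q, hnd.map e.injective, ?_, ?_,
    e.map_adj_iff.2 had, ?_, ?_, ?_, ?_, ?_⟩
  · simpa [Set.image_insert_eq] using pairwise_disjoint_image e.injective hd
  · simpa [Set.image_insert_eq, Set.image_union] using image_eq_univ e hcov
  · rw [neighborSet_iso, h3, Set.image_pair]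
  · rw [neighborSet_iso, h4, Set.image_pair]
  · rw [neighborSet_iso, h5, Set.image_pair]
  · simpa using hP.iso e
  · simpa using hQ.iso e

theorem B1Labelled.iso (e : G ≃g H) {x y z x₁ x₂ u₁ u₂ : V} {U11 U12 U2 : Set V}
    (h : B1Labelled G x y z x₁ x₂ u₁ u₂ U11 U12 U2) :
    B1Labelled H (e x) (e y) (e z) (e x₁) (e x₂) (e u₁) (e u₂) (e '' U11) (e '' U12)
      (e '' U2) where
  nodup := h.nodup.map e.injective
  disjoint := by
    simpa [Set.image_insert_eq] using pairwise_disjoint_image e.injective h.disjoint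
  cover := by simpa [Set.image_insert_eq, Set.image_union] using image_eq_univ e h.cover
  clique := by simpa [Set.image_insert_eq] using isClique_iso e h.clique
  nbr_u₂ := by rw [neighborSet_iso, h.nbr_u₂, Set.image_insert_eq, Set.image_pair]
  nbr_x := by rw [neighborSet_iso, h.nbr_x, Set.image_pair]
  nbr_y := by rw [neighborSet_iso, h.nbr_y, Set.image_pair]
  nbr_z := by rw [neighborSet_iso, h.nbr_z, Set.image_pair]
  pairs_U11 := by simpa [Set.image_pair] using h.pairs_U11.iso e
  pairs_U12 := by simpa [Set.image_pair] using h.pairs_U12.iso e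
  pairs_U2 := by simpa [Set.image_pair] using h.pairs_U2.iso e

theorem ncard_edgeSet_iso (e : G ≃g H) : G.edgeSet.ncard = H.edgeSet.ncard :=
  Set.ncard_congr' e.mapEdgeSet

/-- Isomorphic graphs remain isomorphic when corresponding vertices are deleted. -/
def isoInduceCompl (e : G ≃g H) (v : V) :
    G.induce ({v}ᶜ : Set V) ≃g H.induce ({e v}ᶜ : Set W) where
  toEquiv := e.toEquiv.subtypeEquiv fun a => by
    simp only [Set.mem_compl_iff, Set.mem_singleton_iff, not_iff_not]
    exact e.injective.eq_iff.symm
  map_rel_iff' := by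
    rintro ⟨a, ha⟩ ⟨b, hb⟩
    exact e.map_adj_iff

/-- Isomorphic graphs have isomorphic cones. -/
def isoJoin (e : G ≃g H) : join G K1 ≃g join H K1 where
  toEquiv := Equiv.sumCongr e.toEquiv (Equiv.refl _)
  map_rel_iff' := by
    rintro (a | a) (b | b)
    · exact join_adj_inl_inl.trans (e.map_adj_iff.trans join_adj_inl_inl.symm)
    · exact iff_of_true join_adj_inl_inr join_adj_inl_inr
    · exact iff_of_true join_adj_inr_inl join_adj_inr_inl
    · exact iff_of_false join_not_adj_inr_inr join_not_adj_inr_inr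

/-- Deleting a vertex of the base of a cone. -/
def isoJoinInduce (F : SimpleGraph V) (w : V) :
    join (F.induce ({w}ᶜ : Set V)) K1 ≃g (join F K1).induce ({Sum.inl w}ᶜ : Set (V ⊕ Fin 1)) where
  toFun := Sum.elim (fun v => ⟨Sum.inl v.1, fun h => v.2 (Sum.inl_injective h)⟩)
    (fun i => ⟨Sum.inr i, by simp⟩)
  invFun t := match t with
    | ⟨Sum.inl v, h⟩ => Sum.inl ⟨v, fun e => h (congrArg Sum.inl e)⟩
    | ⟨Sum.inr i, _⟩ => Sum.inr i
  left_inv := by rintro (v | i) <;> rfl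
  right_inv := by rintro ⟨v | i, h⟩ <;> rfl
  map_rel_iff' := by
    rintro (a | a) (b | b)
    · exact join_adj_inl_inl.trans join_adj_inl_inl.symm
    · exact iff_of_true join_adj_inl_inr join_adj_inl_inr
    · exact iff_of_true join_adj_inr_inl join_adj_inr_inl
    · exact iff_of_false join_not_adj_inr_inr join_not_adj_inr_inr

open Classical in
/-- A graph with a universal vertex is a cone. -/
noncomputable def isoJoinOfUniversal {w : V} (hw : ∀ v, v ≠ w → G.Adj w v) :
    join (G.induce ({w}ᶜ : Set V)) K1 ≃g G where
  toFun := Sum.elim Subtype.val fun _ => w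
  invFun v := if h : v = w then Sum.inr 0 else Sum.inl ⟨v, h⟩
  left_inv := by
    rintro (⟨v, hv⟩ | i)
    · have hv' : ¬ v = w := hv
      simp [hv']
    · simp [Subsingleton.elim i 0]
  right_inv v := by
    by_cases h : v = w <;> simp [h]
  map_rel_iff' := by
    rintro (⟨a, ha⟩ | a) (⟨b, hb⟩ | b)
    · exact join_adj_inl_inl.symm
    · exact iff_of_true (hw a ha).symm join_adj_inl_inr
    · exact iff_of_true (hw b hb) join_adj_inr_inl
    · exact iff_of_false (G.loopless.irrefl w) join_not_adj_inr_inr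

/-- The graph obtained by adding a new vertex with neighbourhood `S`. -/
def addVertex (G : SimpleGraph V) (S : Set V) : SimpleGraph (Option V) where
  Adj s t := match s, t with
    | none, none => False
    | none, some v => v ∈ S
    | some v, none => v ∈ S
    | some u, some v => G.Adj u v
  symm.symm := by
    rintro (_ | u) (_ | v) h
    · exact h
    · exact h
    · exact h
    · exact SimpleGraph.Adj.symm h
  loopless.irrefl := by
    rintro (_ | u) h
    · exact h
    · exact G.loopless.irrefl u h

theorem neighborSet_addVertex_none (S : Set V) :
    (addVertex G S).neighborSet none = some '' S := by
  ext t
  rcases t with _ | t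
  · simp [addVertex]
  · simp [addVertex]

theorem neighborSet_addVertex_some {S : Set V} {v : V} (hv : v ∉ S) :
    (addVertex G S).neighborSet (some v) = some '' G.neighborSet v := by
  ext t
  rcases t with _ | t
  · simp [addVertex, hv]
  · simp [addVertex]

theorem PairsJoinedTo.addVertex {U S T : Set V} (h : PairsJoinedTo G U T) (hU : ∀ v ∈ U, v ∉ S) :
    PairsJoinedTo (addVertex G S) (some '' U) (some '' T) := by
  rintro _ ⟨v, hv, rfl⟩
  obtain ⟨v', hv', hN⟩ := h v hv
  refine ⟨some v', ⟨v', hv', rfl⟩, ?_⟩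
  rw [neighborSet_addVertex_some (hU v hv), hN, Set.image_union, Set.image_singleton]

theorem isClique_addVertex {S T : Set V} (h : G.IsClique T) :
    (addVertex G S).IsClique (some '' T) := by
  rintro _ ⟨u, hu, rfl⟩ _ ⟨v, hv, rfl⟩ huv
  exact h hu hv fun h => huv (congrArg some h)

/-- Deleting the added vertex recovers the graph. -/
def isoAddVertex (G : SimpleGraph V) (S : Set V) :
    G ≃g (addVertex G S).induce ({none}ᶜ : Set (Option V)) where
  toFun v := ⟨some v, by simp⟩
  invFun t := match t with
    | ⟨some v, _⟩ => v
    | ⟨none, h⟩ => absurd rfl h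
  left_inv _ := rfl
  right_inv := by
    rintro ⟨_ | v, h⟩
    · exact absurd rfl h
    · rfl
  map_rel_iff' := Iff.rfl

/-- The new vertex is the missing pendant vertex at `c`. -/
theorem IsF2.exists_isF1 (h : IsF2 G) : ∃ S : Set V, IsF1 (addVertex G S) ∧
    ((addVertex G S).neighborSet none).ncard = 1 := by
  obtain ⟨a, b, c, a', b', A, B, C, hnd, hd, hcov, hcl, ha, hb, hA, hB, hC⟩ := h
  have hnd' := hnd
  simp only [List.nodup_cons, List.mem_cons, List.not_mem_nil, or_false, not_or, not_false_eq_true,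
    List.nodup_nil, and_true] at hnd'
  have hd' := hd
  simp only [List.pairwise_cons, List.mem_cons, List.not_mem_nil, or_false, forall_eq_or_imp,
    forall_eq] at hd'
  have key : ∀ U : Set V, Disjoint ({a, b, c, a', b'} : Set V) U →
      Disjoint ({some a, some b, some c, some a', some b', none} : Set (Option V)) (some '' U) := by
    intro U hU
    rw [Set.disjoint_right] at hU ⊢
    rintro _ ⟨v, hv, rfl⟩
    simpa using hU hv
  have out : ∀ U : Set V, Disjoint ({a, b, c, a', b'} : Set V) U → ∀ v ∈ U,
      v ∉ ({c} : Set V) := by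
    rintro U hU v hv rfl
    exact Set.disjoint_left.1 hU (by simp) hv
  refine ⟨{c}, ⟨some a, some b, some c, some a', some b', none, some '' A, some '' B, some '' C,
    ?_, ?_, ?_, ?_, ?_, ?_, ?_, ?_, ?_, ?_⟩, ?_⟩
  · simpa using hnd
  · have hdi := pairwise_disjoint_image (Option.some_injective V) (List.pairwise_cons.1 hd).2
    refine List.pairwise_cons.2 ⟨?_, hdi⟩
    simp only [List.mem_cons, List.not_mem_nil, or_false, forall_eq_or_imp, forall_eq]
    exact ⟨key A hd'.1.1, key B hd'.1.2.1, key C hd'.1.2.2⟩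
  · rw [Set.eq_univ_iff_forall] at hcov ⊢
    rintro (_ | v)
    · simp
    · simpa using hcov v
  · simpa [Set.image_insert_eq] using isClique_addVertex (S := {c}) hcl
  · rw [neighborSet_addVertex_some (fun h => hnd'.2.2.1.1 h.symm), ha, Set.image_singleton]
  · rw [neighborSet_addVertex_some (fun h => hnd'.2.2.1.2 h.symm), hb, Set.image_singleton]
  · rw [neighborSet_addVertex_none, Set.image_singleton]
  · simpa using hA.addVertex (out A hd'.1.1)
  · simpa using hB.addVertex (out B hd'.1.2.1)
  · simpa using hC.addVertex (out C hd'.1.2.2)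
  · rw [neighborSet_addVertex_none, Set.image_singleton, Set.ncard_singleton]

/-- The new vertex is the deleted `z`, over the edge x₂ u₁. -/
theorem B2Labelled.addVertex {x y x₁ x₂ u₁ u₂ : V} {U11 U12 U2 : Set V}
    (h : B2Labelled G x y x₁ x₂ u₁ u₂ U11 U12 U2) :
    B1Labelled (addVertex G {x₂, u₁}) (some x) (some y) none (some x₁) (some x₂) (some u₁)
      (some u₂) (some '' U11) (some '' U12) (some '' U2) := by
  have hnd := h.nodup
  simp only [List.nodup_cons, List.mem_cons, List.not_mem_nil, or_false, not_or, not_false_eq_true,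
    List.nodup_nil, and_true] at hnd
  obtain ⟨⟨n1, n2, n3, n4, n5⟩, ⟨n6, n7, n8, n9⟩, ⟨n10, n11, n12⟩, ⟨n13, n14⟩, n15⟩ := hnd
  have hd := h.disjoint
  simp only [List.pairwise_cons, List.mem_cons, List.not_mem_nil, or_false, forall_eq_or_imp,
    forall_eq] at hd
  have key : ∀ U : Set V, Disjoint ({x, y, x₁, x₂, u₁, u₂} : Set V) U →
      Disjoint ({some x, some y, none, some x₁, some x₂, some u₁, some u₂} : Set (Option V))
        (some '' U) := by
    intro U hU
    rw [Set.disjoint_right] at hU ⊢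
    rintro _ ⟨v, hv, rfl⟩
    simpa using hU hv
  have out : ∀ U : Set V, Disjoint ({x, y, x₁, x₂, u₁, u₂} : Set V) U → ∀ v ∈ U,
      v ∉ ({x₂, u₁} : Set V) := by
    rintro U hU v hv (rfl | rfl)
    · exact Set.disjoint_left.1 hU (by simp) hv
    · exact Set.disjoint_left.1 hU (by simp) hv
  constructor
  · simpa using h.nodup
  · have hdi := pairwise_disjoint_image (Option.some_injective V)
      (List.pairwise_cons.1 h.disjoint).2
    refine List.pairwise_cons.2 ⟨?_, hdi⟩
    simp only [List.mem_cons, List.not_mem_nil, or_false, forall_eq_or_imp, forall_eq]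
    exact ⟨key U11 hd.1.1, key U12 hd.1.2.1, key U2 hd.1.2.2⟩
  · have hcov := h.cover
    rw [Set.eq_univ_iff_forall] at hcov ⊢
    rintro (_ | v)
    · simp
    · simpa using hcov v
  · simpa [Set.image_insert_eq] using isClique_addVertex (S := {x₂, u₁}) h.clique
  · rw [neighborSet_addVertex_some (by simp [Ne.symm n14, Ne.symm n15]), h.nbr_u₂,
      Set.image_insert_eq, Set.image_pair]
  · rw [neighborSet_addVertex_some (by simp [n3, n4]), h.nbr_x, Set.image_pair]
  · rw [neighborSet_addVertex_some (by simp [n7, n8]), h.nbr_y, Set.image_pair]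
  · rw [neighborSet_addVertex_none, Set.image_pair]
  · simpa [Set.image_pair] using h.pairs_U11.addVertex (out U11 hd.1.1)
  · simpa [Set.image_pair] using h.pairs_U12.addVertex (out U12 hd.1.2.1)
  · simpa [Set.image_pair] using h.pairs_U2.addVertex (out U2 hd.1.2.2)

/-- The disjoint union of `G` and `m` edges whose ends are joined to the vertex `a` of `G`. -/
def attachPairs (G : SimpleGraph V) (a : V) (m : ℕ) : SimpleGraph (V ⊕ (Fin m × Bool)) where
  Adj s t := match s, t with
    | Sum.inl u, Sum.inl v => G.Adj u v
    | Sum.inl u, Sum.inr _ => u = a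
    | Sum.inr _, Sum.inl u => u = a
    | Sum.inr (i, s), Sum.inr (j, t) => i = j ∧ t = !s
  symm.symm := by
    rintro (u | ⟨i, s⟩) (v | ⟨j, t⟩) h
    · exact SimpleGraph.Adj.symm h
    · exact h
    · exact h
    · obtain ⟨rfl, rfl⟩ := h
      exact ⟨rfl, by simp⟩
  loopless.irrefl := by
    rintro (u | ⟨i, s⟩) h
    · exact G.loopless.irrefl u h
    · simp at h

theorem neighborSet_attachPairs {a v : V} (h : v ≠ a) (m : ℕ) :
    (attachPairs G a m).neighborSet (Sum.inl v) = Sum.inl '' G.neighborSet v := by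
  ext (u | ⟨i, s⟩)
  · simp [attachPairs]
  · simp [attachPairs, h]

theorem pairsJoinedTo_attachPairs (G : SimpleGraph V) (a : V) (m : ℕ) :
    PairsJoinedTo (attachPairs G a m) (Set.range Sum.inr) {Sum.inl a} := by
  rintro _ ⟨⟨i, s⟩, rfl⟩
  refine ⟨Sum.inr (i, !s), ⟨_, rfl⟩, ?_⟩
  ext (u | ⟨j, t⟩)
  · simp [attachPairs]
  · simp [attachPairs, eq_comm]

/-- The triangle `0 1 2` with a vertex of degree one attached to each of its vertices. -/
def net : SimpleGraph (Fin 6) where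
  Adj i j := i ≠ j ∧ ((i < 3 ∧ j < 3) ∨ i.val + 3 = j.val ∨ j.val + 3 = i.val)
  symm.symm := by
    rintro i j ⟨h1, h2⟩
    exact ⟨h1.symm, by tauto⟩
  loopless.irrefl := fun i h => h.1 rfl

theorem isF1_attachPairs_net (m : ℕ) : IsF1 (attachPairs net 0 m) := by
  have hN : ∀ i j : Fin 6, (∀ k, (i ≠ k ∧ ((i < 3 ∧ k < 3) ∨ i.val + 3 = k.val ∨
      k.val + 3 = i.val)) ↔ k = j) → net.neighborSet i = {j} := by
    intro i j h
    ext k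
    exact h k
  refine ⟨Sum.inl 0, Sum.inl 1, Sum.inl 2, Sum.inl 3, Sum.inl 4, Sum.inl 5, Set.range Sum.inr,
    ∅, ∅, ?_, ?_, ?_, ?_, ?_, ?_, ?_, pairsJoinedTo_attachPairs _ _ _, ?_, ?_⟩
  · simp
  · simp
  · rw [Set.eq_univ_iff_forall]
    rintro (i | t)
    · fin_cases i <;> simp
    · simp
  · rintro _ (rfl | rfl | rfl) _ (rfl | rfl | rfl) h <;> first
      | exact absurd rfl h
      | simp [attachPairs, net]
  · rw [neighborSet_attachPairs (by decide), hN 3 0 (by decide), Set.image_singleton]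
  · rw [neighborSet_attachPairs (by decide), hN 4 1 (by decide), Set.image_singleton]
  · rw [neighborSet_attachPairs (by decide), hN 5 2 (by decide), Set.image_singleton]
  · rintro v ⟨⟩
  · rintro v ⟨⟩

end Transport

/-! ### The saturation number and the extremal graphs. -/

section Extremal

theorem Sat.exists_twoBase_or {V : Type u} [Fintype V] {G : SimpleGraph V} (hG : Sat G)
    (hn : 6 ≤ Fintype.card V) : (∃ x a b, TwoBase G x a b) ∨ ∀ v, 3 ≤ dg G v := by
  by_cases h : ∃ x, dg G x = 2
  · obtain ⟨x, hx⟩ := h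
    obtain ⟨a, b, hab, hN⟩ := exists_of_dg_two hx
    exact Or.inl ⟨x, a, b, hG.twoBase hab hN⟩
  · right
    intro v
    have h1 := hG.two_le_dg (by omega) v
    have h2 : dg G v ≠ 2 := fun e => h ⟨v, e⟩
    omega

theorem Sat.le_edges {V : Type u} [Fintype V] {G : SimpleGraph V} (hG : Sat G)
    (hn : 6 ≤ Fintype.card V) : 5 * Fintype.card V ≤ 2 * G.edgeSet.ncard + 11 := by
  rcases hG.exists_twoBase_or hn with ⟨x, a, b, h⟩ | h
  · exact h.le_edges
  · rcases edges_of_three_le hG hn h with h | ⟨h, -⟩ <;> omega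

variable {n : ℕ} {G : SimpleGraph (Fin n)}

theorem exists_iso_fin {V : Type u} [Fintype V] (F : SimpleGraph V) {m : ℕ}
    (h : Fintype.card V = m) : ∃ H : SimpleGraph (Fin m), Nonempty (F ≃g H) :=
  ⟨_, ⟨SimpleGraph.Iso.map (Fintype.equivFinOfCardEq h) F⟩⟩

theorem card_compl_singleton (w : Fin n) : Fintype.card ({w}ᶜ : Set (Fin n)) = n - 1 := by
  rw [Fintype.card_compl_set]
  simp

theorem mem_A1_of_universal {w : Fin n} (hw : ∀ v, v ≠ w → G.Adj w v)
    (h : IsF1 (G.induce ({w}ᶜ : Set (Fin n)))) : G ∈ A1 n := by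
  obtain ⟨F, ⟨e⟩⟩ := exists_iso_fin (G.induce ({w}ᶜ : Set (Fin n))) (card_compl_singleton w)
  exact ⟨F, h.iso e, ⟨(isoJoinOfUniversal hw).symm.trans (isoJoin e)⟩⟩

theorem mem_A3_of_universal {w : Fin n} (hw : ∀ v, v ≠ w → G.Adj w v)
    (h : IsF3 (G.induce ({w}ᶜ : Set (Fin n)))) : G ∈ A3 n := by
  obtain ⟨F, ⟨e⟩⟩ := exists_iso_fin (G.induce ({w}ᶜ : Set (Fin n))) (card_compl_singleton w)
  exact ⟨F, h.iso e, ⟨(isoJoinOfUniversal hw).symm.trans (isoJoin e)⟩⟩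

/-- `F2` is defined by deletion, so the missing pendant vertex is added first and the enlarged graph
is moved to `Fin (n - 1 + 1)`. -/
theorem mem_A2_of_universal {w : Fin n} (hw : ∀ v, v ≠ w → G.Adj w v)
    (h : IsF2 (G.induce ({w}ᶜ : Set (Fin n)))) : G ∈ A2 n := by
  obtain ⟨F, ⟨e⟩⟩ := exists_iso_fin (G.induce ({w}ᶜ : Set (Fin n))) (card_compl_singleton w)
  obtain ⟨S, hS, h1⟩ := h.exists_isF1
  obtain ⟨F', ⟨e'⟩⟩ := exists_iso_fin (addVertex (G.induce ({w}ᶜ : Set (Fin n))) S)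
    (m := n - 1 + 1) (by rw [Fintype.card_option, card_compl_singleton])
  refine ⟨F, ⟨F', hS.iso e', e' none, ?_, ⟨?_⟩⟩,
    ⟨(isoJoinOfUniversal hw).symm.trans (isoJoin e)⟩⟩
  · rw [neighborSet_iso, Set.ncard_image_of_injective _ e'.injective, h1]
  · exact e.symm.trans ((isoAddVertex _ S).trans (isoInduceCompl e' none))

theorem B2Labelled.mem_B2 {x y x₁ x₂ u₁ u₂ : Fin n} {U11 U12 U2 : Set (Fin n)}
    (h : B2Labelled G x y x₁ x₂ u₁ u₂ U11 U12 U2) (hU : U12.Nonempty) : G ∈ B2 n := by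
  obtain ⟨F, ⟨e⟩⟩ := exists_iso_fin (W4Sat.addVertex G {x₂, u₁}) (m := n + 1) (by simp)
  exact ⟨F, _, _, _, _, _, _, _, _, _, _, h.addVertex.iso e, (hU.image _).image _,
    ⟨(isoAddVertex G {x₂, u₁}).trans (isoInduceCompl e none)⟩⟩

theorem sat_of_mem_A1 (hn : 1 ≤ n) (h : G ∈ A1 n) :
    Sat G ∧ 2 * G.edgeSet.ncard + 11 = 5 * n := by
  obtain ⟨F, hF, ⟨e⟩⟩ := h
  obtain ⟨K, P, B, hB, hP, -⟩ := IsF1.cliqueBased hF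
  refine ⟨hB.isSat.iso e.symm, ?_⟩
  have := hB.two_mul_edges
  rw [ncard_edgeSet_iso e]
  simp only [Fintype.card_sum, Fintype.card_fin] at this
  omega

theorem sat_of_mem_A2 (hn : 1 ≤ n) (h : G ∈ A2 n) :
    Sat G ∧ 2 * G.edgeSet.ncard + 10 = 5 * n := by
  obtain ⟨F, ⟨F', hF', w, hw, ⟨e'⟩⟩, ⟨e⟩⟩ := h
  obtain ⟨K, P, B, hB, hP, hdeg⟩ := IsF1.cliqueBased hF'
  let e'' := e.trans ((isoJoin e').trans (isoJoinInduce F' w))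
  refine ⟨(hB.delete (hdeg w hw)).isSat.iso e''.symm, ?_⟩
  have := hB.two_mul_edges_delete (hdeg w hw)
  rw [ncard_edgeSet_iso e'']
  simp only [Fintype.card_sum, Fintype.card_fin] at this
  omega

theorem sat_of_mem_A3 (hn : 1 ≤ n) (h : G ∈ A3 n) :
    Sat G ∧ 2 * G.edgeSet.ncard + 10 = 5 * n := by
  obtain ⟨F, hF, ⟨e⟩⟩ := h
  obtain ⟨h1, h2⟩ := IsF3.sat_join hF
  refine ⟨h1.iso e.symm, ?_⟩
  rw [ncard_edgeSet_iso e]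
  simp only [Fintype.card_sum, Fintype.card_fin] at h2
  omega

theorem sat_of_mem_B1 (h : G ∈ B1 n) : Sat G ∧ 2 * G.edgeSet.ncard + 11 = 5 * n := by
  obtain ⟨x, y, z, x₁, x₂, u₁, u₂, U11, U12, U2, h⟩ := h
  obtain ⟨B, hB⟩ := h.cliqueBased
  have := hB.two_mul_edges
  rw [h.card_pendant, Fintype.card_fin] at this
  exact ⟨hB.isSat, by omega⟩

theorem sat_of_mem_B2 (h : G ∈ B2 n) : Sat G ∧ 2 * G.edgeSet.ncard + 10 = 5 * n := by
  obtain ⟨F, x, y, z, x₁, x₂, u₁, u₂, U11, U12, U2, h, -, ⟨e⟩⟩ := h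
  obtain ⟨B, hB⟩ := h.cliqueBased
  have := hB.two_mul_edges_delete (z := z) (by simp)
  rw [h.card_pendant, Fintype.card_fin] at this
  refine ⟨(hB.delete (z := z) (by simp)).isSat.iso e.symm, ?_⟩
  rw [ncard_edgeSet_iso e]
  omega

theorem sat_of_mem_B3 (h : G ∈ B3 n) : Sat G ∧ 2 * G.edgeSet.ncard + 10 = 5 * n := by
  obtain ⟨x, y, x₁, x₂, v₁, v₂, u₁, u₂, U1, U2, h⟩ := h
  simpa using h.sat

/-- Minimum degree three would give 2e ≥ 5n - 10, so there is a vertex of degree two. -/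
theorem mem_odd_families (hn : 6 ≤ n) (hG : Sat G) (he : 2 * G.edgeSet.ncard + 11 = 5 * n) :
    G ∈ A1 n ∪ B1 n := by
  rcases hG.exists_twoBase_or (by simpa using hn) with ⟨x, a, b, h⟩ | h
  · rcases h.classify_odd (by simpa using he.symm) with ⟨w, hw, h⟩ | h
    · exact Or.inl (mem_A1_of_universal hw h)
    · exact Or.inr h
  · rcases edges_of_three_le hG (by simpa using hn) h with h | ⟨h, -⟩ <;>
      rw [Fintype.card_fin] at h <;> omega

theorem mem_even_families (hn : 6 ≤ n) (hG : Sat G) (he : 2 * G.edgeSet.ncard + 10 = 5 * n) :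
    G ∈ A2 n ∪ A3 n ∪ B2 n ∪ B3 n := by
  rcases hG.exists_twoBase_or (by simpa using hn) with ⟨x, a, b, h⟩ | h
  · rcases h.classify_even (by simpa using he.symm) with ⟨w, hw, h⟩ |
      ⟨x, y, x₁, x₂, u₁, u₂, U11, U12, U2, h, hU⟩ | h
    · exact Or.inl (Or.inl (Or.inl (mem_A2_of_universal hw h)))
    · exact Or.inl (Or.inr (h.mem_B2 hU))
    · exact Or.inr h
  · rcases edges_of_three_le hG (by simpa using hn) h with h | ⟨-, w, hw, h⟩
    · rw [Fintype.card_fin] at h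
      omega
    · exact Or.inl (Or.inl (Or.inr (mem_A3_of_universal hw h)))

/-- The cone over the net with m further pairs has 6 + 2m + 1 vertices. -/
theorem exists_sat_odd (m : ℕ) :
    ∃ G : SimpleGraph (Fin (2 * m + 7)), Sat G ∧ 2 * G.edgeSet.ncard + 11 = 5 * (2 * m + 7) := by
  obtain ⟨K, P, B, hB, hP, -⟩ := (isF1_attachPairs_net m).cliqueBased
  obtain ⟨G, ⟨e⟩⟩ := exists_iso_fin (join (attachPairs net 0 m) K1) (m := 2 * m + 7) (by
    simp
    omega)
  refine ⟨G, hB.isSat.iso e, ?_⟩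
  have := hB.two_mul_edges
  rw [ncard_edgeSet_iso e, hP] at this
  simp at this
  omega

/-- The same cone with one vertex of degree two deleted. -/
theorem exists_sat_even (m : ℕ) :
    ∃ G : SimpleGraph (Fin (2 * m + 6)), Sat G ∧ 2 * G.edgeSet.ncard + 10 = 5 * (2 * m + 6) := by
  obtain ⟨K, P, B, hB, hP, -⟩ := (isF1_attachPairs_net m).cliqueBased
  obtain ⟨z, hz⟩ := Finset.card_pos.1 (by omega : 0 < P.card)
  obtain ⟨G, ⟨e⟩⟩ := exists_iso_fin
    ((join (attachPairs net 0 m) K1).induce ({z}ᶜ : Set _)) (m := 2 * m + 6) (by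
    rw [Fintype.card_compl_set]
    simp
    omega)
  refine ⟨G, (hB.delete hz).isSat.iso e, ?_⟩
  have := hB.two_mul_edges_delete hz
  rw [ncard_edgeSet_iso e, hP] at this
  simp at this
  omega

/-- The infimum of the empty set would be 0, so an example of each order is needed. In the other
direction 2e ≥ 5n - 11 is enough, since e is an integer. -/
theorem satNumber_W4 (hn : 6 ≤ n) : satNumber n W4 = (5 * n - 10) / 2 := by
  have hmem : ∃ G : SimpleGraph (Fin n), IsSaturated W4 G ∧
      G.edgeSet.ncard = (5 * n - 10) / 2 := by
    rcases Nat.even_or_odd' n with ⟨k, rfl | rfl⟩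
    · obtain ⟨m, rfl⟩ := Nat.exists_eq_add_of_le (by omega : 3 ≤ k)
      obtain ⟨G, hG, he⟩ := exists_sat_even m
      rw [show 2 * (3 + m) = 2 * m + 6 by ring]
      exact ⟨G, (isSaturated_W4_iff _).2 hG, by omega⟩
    · obtain ⟨m, rfl⟩ := Nat.exists_eq_add_of_le (by omega : 3 ≤ k)
      obtain ⟨G, hG, he⟩ := exists_sat_odd m
      rw [show 2 * (3 + m) + 1 = 2 * m + 7 by ring]
      exact ⟨G, (isSaturated_W4_iff _).2 hG, by omega⟩
  refine le_antisymm (Nat.sInf_le hmem) (le_csInf ⟨_, hmem⟩ ?_)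
  rintro _ ⟨G, hG, rfl⟩
  have := ((isSaturated_W4_iff G).1 hG).le_edges (by simpa using hn)
  rw [Fintype.card_fin] at this
  omega

theorem mem_extremalGraphs_W4 (hn : 6 ≤ n) :
    G ∈ extremalGraphs n W4 ↔ Sat G ∧ G.edgeSet.ncard = (5 * n - 10) / 2 := by
  rw [← isSaturated_W4_iff, ← satNumber_W4 hn]
  rfl

end Extremal

end W4Sat

theorem theorem1p2 (n : ℕ) (hn : 6 ≤ n) :
    W4Sat.satNumber n W4Sat.W4 = (5 * n - 10) / 2 ∧
    (Odd n → W4Sat.extremalGraphs n W4Sat.W4 = W4Sat.A1 n ∪ W4Sat.B1 n) ∧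
    (Even n → W4Sat.extremalGraphs n W4Sat.W4 =
      W4Sat.A2 n ∪ W4Sat.A3 n ∪ W4Sat.B2 n ∪ W4Sat.B3 n) := by
  refine ⟨W4Sat.satNumber_W4 hn, fun ho => ?_, fun he => ?_⟩
  · obtain ⟨k, rfl⟩ := ho
    ext G
    rw [W4Sat.mem_extremalGraphs_W4 hn]
    constructor
    · rintro ⟨hG, h⟩
      -- For odd n the rounding gives 2e = 5n - 11 exactly.
      exact W4Sat.mem_odd_families hn hG (by omega)
    · intro hG
      have h : W4Sat.Sat G ∧ 2 * G.edgeSet.ncard + 11 = 5 * (2 * k + 1) := by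
        rcases hG with h | h
        · exact W4Sat.sat_of_mem_A1 (by omega) h
        · exact W4Sat.sat_of_mem_B1 h
      exact ⟨h.1, by omega⟩
  · obtain ⟨k, rfl⟩ := he
    ext G
    rw [W4Sat.mem_extremalGraphs_W4 hn]
    constructor
    · rintro ⟨hG, h⟩
      exact W4Sat.mem_even_families hn hG (by omega)
    · intro hG
      have h : W4Sat.Sat G ∧ 2 * G.edgeSet.ncard + 10 = 5 * (k + k) := by
        rcases hG with ((h | h) | h) | h
        · exact W4Sat.sat_of_mem_A2 (by omega) h
        · exact W4Sat.sat_of_mem_A3 (by omega) h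
        · exact W4Sat.sat_of_mem_B2 h
        · exact W4Sat.sat_of_mem_B3 h
      exact ⟨h.1, by omega⟩
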